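/- **Setting.** A dynamic weighted graph is a graph on $n$ vertices with edge weights in $[1,W]$, $W\ge 2$, that starts as some $G_0$ and undergoes edge insertions and deletions (fully dynamic), only insertions (incremental) or only deletions (decremental); $G_i$ is the graph after $i$ updates. A matching $M$ of $G$ is a $(1-\delta)$-approximate maximum weight matching (MWM) if $w(M)\ge(1-\delta)\,w(N)$ for every matching $N$ of $G$; $\mu(G)$ is the maximum number of edges of a matching. A dynamic $(1-\varepsilon)$-approximate MWM algorithm $\mathcal A$ maintains, possibly only implicitly, a $(1-\varepsilon)$-approximate MWM of each $G_i$. It has vertex-match query time $T\ge 1$ if at any time it reports, in time $T$, the partner of a given vertex in the maintained matching $M$ (or that there is none), and lists all edges of $M$ in time $T\cdot(|M|+1)$. An algorithm maintains a matching explicitly if after initialization and after every update an array holds the partner of each vertex. Time is counted on a word RAM with words of $O(\log(n+W+1/\varepsilon))$ bits, with additional cells for real numbers (exact field operations and comparisons at unit cost, no rounding), and with unit-cost lookup of the weight of a pair of vertices in the current graph. **Theorem.** There are a fixed black-box transformation and an absolute constant $C$ such that the following holds for all $n$, $m$, $W\ge 2$, $0<\varepsilon<1$, in each of the fully dynamic,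 incremental and decremental models. Let $\mathcal A$ be a dynamic $(1-\varepsilon)$-approximate MWM algorithm for (any class of) update sequences of the model in which the graph has at most $m$ edges at all times, with initialization time $\mathcal I$, amortized update time $\mathcal U$ (every sequence of $k$ updates in the class takes total update time at most $k\,\mathcal U$) and vertex-match query time $T\ge1$ for these parameters. Then the transformation produces from $\mathcal A$ an algorithm for the same update sequences (in particular it is partially dynamic preserving) that explicitly maintains a $(1-C\varepsilon\log W)$-approximate MWM, and for every such sequence of $k\geq 0$ updates, with $K=\max\{1,k,\varepsilon\,\mu(G_0)\}$: 1. the initialization, including writing down the first matching, takes time at most $\mathcal I+C\,T\,(1+\mu(G_0))$; 2. the initialization and the $k$ updates together take time at most $$\mathcal I+k\,\mathcal U+C\,\frac{\log^2 W}{\varepsilon}\,T\,K;$$ 3. the maintained matchings $\widetilde M_0,\dots,\widetilde M_k$ satisfy $$\sum_{i=1}^{k}|\widetilde M_i\oplus\widetilde M_{i-1}|\le C\,\frac{\log^2W}{\varepsilon}\,K.$$ Thus, over every sequence of $k\ge\max\{1,\varepsilon\,\mu(G_0)\}$ updates (for instance every non-empty sequence that starts from the empty graph), the amortized update time is $\mathcal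 U+O(\log^2 W/\varepsilon)\cdot T$ on top of the initialization time $\mathcal I$, and the amortized recourse is $O(\log^2 W/\varepsilon)$. -/

import Mathlib

noncomputable section

/-! Weighted graphs and matchings -/

/-- A weighted graph on the vertex set `Fin n`; only the weights of its edges matter. -/
structure WGraph (n : ℕ) where
  graph : SimpleGraph (Fin n)
  weight : Sym2 (Fin n) → ℝ

namespace WGraph

/-- All edge weights lie in `[1, W]`. -/
def WeightsIn {n : ℕ} (G : WGraph n) (W : ℝ) : Prop :=
  ∀ e ∈ G.graph.edgeSet, 1 ≤ G.weight e ∧ G.weight e ≤ W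

/-- `M` is a set of pairwise vertex-disjoint edges of `G`. -/
def IsMatching {n : ℕ} (G : WGraph n) (M : Finset (Sym2 (Fin n))) : Prop :=
  (∀ e ∈ M, e ∈ G.graph.edgeSet) ∧
    ∀ e ∈ M, ∀ f ∈ M, ∀ v : Fin n, v ∈ e → v ∈ f → e = f

/-- `M` is a `(1 - δ)`-approximate maximum weight matching of `G`. -/
def IsApproxMWM {n : ℕ} (G : WGraph n) (δ : ℝ) (M : Finset (Sym2 (Fin n))) : Prop :=
  G.IsMatching M ∧
    ∀ N : Finset (Sym2 (Fin n)), G.IsMatching N →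
      (1 - δ) * ∑ e ∈ N, G.weight e ≤ ∑ e ∈ M, G.weight e

/-- The maximum number of edges of a matching of `G`. -/
def matchingNumber {n : ℕ} (G : WGraph n) : ℕ :=
  sSup {k : ℕ | ∃ M : Finset (Sym2 (Fin n)), G.IsMatching M ∧ M.card = k}

open Classical in
/-- The weight of the pair `u, v` if it is an edge of `G`, and `0` otherwise. -/
def lookup {n : ℕ} (G : WGraph n) (u v : ℕ) : ℝ :=
  if h : u < n ∧ v < n then
    (if G.graph.Adj ⟨u, h.1⟩ ⟨v, h.2⟩ then G.weight s(⟨u, h.1⟩, ⟨v, h.2⟩) else 0)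
  else 0

end WGraph

/-! Dynamic graphs -/

/-- An edge update: insertion of the edge `uv` with weight `x`, or deletion of the edge `uv`. -/
inductive Update (n : ℕ) where
  | ins (u v : Fin n) (x : ℝ)
  | del (u v : Fin n)

namespace Update

/-- The graph after the update. -/
def apply {n : ℕ} (G : WGraph n) : Update n → WGraph n
  | ins u v x => ⟨G.graph ⊔ SimpleGraph.edge u v, Function.update G.weight s(u, v) x⟩
  | del u v => ⟨G.graph.deleteEdges {s(u, v)}, G.weight⟩

/-- Only absent edges with weight in `[1, W]` are inserted, only present edges are deleted. -/
def Valid {n : ℕ} (G : WGraph n) (W : ℝ) : Update n → Prop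
  | ins u v x => u ≠ v ∧ ¬ G.graph.Adj u v ∧ 1 ≤ x ∧ x ≤ W
  | del u v => G.graph.Adj u v

end Update

/-- An initial graph together with a sequence of updates. -/
structure UpdateSeq (n : ℕ) where
  start : WGraph n
  updates : List (Update n)

namespace UpdateSeq

/-- The number of updates. -/
def length {n : ℕ} (S : UpdateSeq n) : ℕ := S.updates.length

/-- The graph `G_i` after the first `i` updates. -/
def graphAt {n : ℕ} (S : UpdateSeq n) (i : ℕ) : WGraph n :=
  (S.updates.take i).foldl Update.apply S.start

end UpdateSeq

/-- The fully dynamic model and the two partially dynamic ones. -/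
inductive UpdateModel where
  | fullyDynamic
  | incremental
  | decremental

namespace UpdateModel

/-- The kinds of updates that the model admits. -/
def Allows {n : ℕ} : UpdateModel → Update n → Prop
  | fullyDynamic, _ => True
  | incremental, .ins _ _ _ => True
  | incremental, .del _ _ => False
  | decremental, .ins _ _ _ => False
  | decremental, .del _ _ => True

/-- The update sequences of the model on `n`-vertex graphs that have at most `m` edges and edge
weights in `[1, W]` at all times. -/
def sequences (mdl : UpdateModel) (n m : ℕ) (W : ℝ) : Set (UpdateSeq n) :=
  {S | S.start.WeightsIn W ∧
    (∀ (i : ℕ) (h : i < S.updates.length),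
      (S.updates[i]).Valid (S.graphAt i) W ∧ mdl.Allows S.updates[i]) ∧
    ∀ i ≤ S.length, (S.graphAt i).graph.edgeSet.ncard ≤ m}

end UpdateModel

/-! Dynamic matching algorithms with vertex-match queries -/

/-- A dynamic matching algorithm on `n` vertices, as a black box: a data structure with its
procedures and the number of steps that each call takes. The matching is maintained implicitly: it
is a function of the internal state and is accessible only through the two queries, which leave the
maintained matching and the internal state as they are. -/
structure DynAlg (n : ℕ) where
  /-- internal states -/
  State : Type
  /-- initialization on the initial graph -/
  init : WGraph n → State
  /-- processing of one update -/
  update : State → Update n → State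
  /-- the maintained matching -/
  matching : State → Finset (Sym2 (Fin n))
  /-- the vertex-match query -/
  mate : State → Fin n → Option (Fin n)
  /-- the query for all edges of the maintained matching -/
  edges : State → List (Fin n × Fin n)
  initTime : WGraph n → ℕ
  updateTime : State → Update n → ℕ
  mateTime : State → Fin n → ℕ
  edgesTime : State → ℕ

namespace DynAlg

/-- The internal state after the first `i` updates of `S`. -/
def stateAt {n : ℕ} (A : DynAlg n) (S : UpdateSeq n) (i : ℕ) : A.State :=
  (S.updates.take i).foldl A.update (A.init S.start)

/-- The time that `A` spends on the `(i+1)`-st update of `S`. -/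
def stepTime {n : ℕ} (A : DynAlg n) (S : UpdateSeq n) (i : Fin S.updates.length) : ℕ :=
  A.updateTime (A.stateAt S i) (S.updates.get i)

/-- In the state `s`, the algorithm answers vertex-match queries correctly in time `T`, and lists
the maintained matching `M` correctly, each edge once, in time `T * (|M| + 1)`. -/
structure VertexMatch {n : ℕ} (A : DynAlg n) (s : A.State) (T : ℝ) : Prop where
  mate_iff : ∀ u v : Fin n, A.mate s u = some v ↔ s(u, v) ∈ A.matching s
  mate_time : ∀ v : Fin n, (A.mateTime s v : ℝ) ≤ T
  edges_nodup : ((A.edges s).map fun p => s(p.1, p.2)).Nodup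
  mem_edges : ∀ e, e ∈ (A.edges s).map (fun p => s(p.1, p.2)) ↔ e ∈ A.matching s
  edges_time : (A.edgesTime s : ℝ) ≤ T * ((A.matching s).card + 1)

/-- `A` is a dynamic `(1 - ε)`-approximate MWM algorithm for the update sequences in `𝒞`, with
initialization time `I`, amortized update time `U` and vertex-match query time `T`. -/
structure Solves {n : ℕ} (A : DynAlg n) (𝒞 : Set (UpdateSeq n)) (ε I U T : ℝ) : Prop where
  approx : ∀ S ∈ 𝒞, ∀ i ≤ S.length,
    (S.graphAt i).IsApproxMWM ε (A.matching (A.stateAt S i))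
  query : ∀ S ∈ 𝒞, ∀ i ≤ S.length, A.VertexMatch (A.stateAt S i) T
  init_time : ∀ S ∈ 𝒞, (A.initTime S.start : ℝ) ≤ I
  update_time : ∀ S ∈ 𝒞, ((∑ i, A.stepTime S i : ℕ) : ℝ) ≤ S.length * U

end DynAlg

/-! A random access machine with calls to a dynamic matching algorithm -/

/-- The memory: finitely many arrays are used by a program, each of them made of word cells or of
real cells. -/
structure Memory where
  word : ℕ → ℕ → ℕ
  real : ℕ → ℕ → ℝ

namespace Memory

/-- Write `x` into the cell `i` of the word array `a`. -/
def setWord (σ : Memory) (a i x : ℕ) : Memory :=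
  { σ with word := Function.update σ.word a (Function.update (σ.word a) i x) }

/-- Write `x` into the cell `i` of the real array `a`. -/
def setReal (σ : Memory) (a i : ℕ) (x : ℝ) : Memory :=
  { σ with real := Function.update σ.real a (Function.update (σ.real a) i x) }

/-- Write the list `l` into the word array `a`, from the cell `0` on. -/
def setList (σ : Memory) (a : ℕ) (l : List ℕ) : Memory :=
  { σ with word := Function.update σ.word a fun i => (l[i]?).getD (σ.word a i) }

end Memory

/-- Expressions for words (natural numbers; subtraction is truncated, division rounds down). -/
inductive WExp where
  | const (c : ℕ)
  | get (a : ℕ) (i : WExp)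
  | add (x y : WExp)
  | sub (x y : WExp)
  | mul (x y : WExp)
  | div (x y : WExp)

/-- The value of a word expression. -/
def WExp.eval (σ : Memory) : WExp → ℕ
  | const c => c
  | get a i => σ.word a (i.eval σ)
  | add x y => x.eval σ + y.eval σ
  | sub x y => x.eval σ - y.eval σ
  | mul x y => x.eval σ * y.eval σ
  | div x y => x.eval σ / y.eval σ

/-- Expressions for real cells. There is no rounding, and the only constants are those of words. -/
inductive RExp where
  | ofWord (x : WExp)
  | get (a : ℕ) (i : WExp)
  /-- the weight of the pair `u, v` in the current graph, `0` if it is not an edge -/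
  | weight (u v : WExp)
  | add (x y : RExp)
  | sub (x y : RExp)
  | mul (x y : RExp)
  | div (x y : RExp)

/-- The value of a real expression when `G` is the current graph. -/
def RExp.eval {n : ℕ} (G : WGraph n) (σ : Memory) : RExp → ℝ
  | ofWord x => (x.eval σ : ℝ)
  | get a i => σ.real a (i.eval σ)
  | weight u v => G.lookup (u.eval σ) (v.eval σ)
  | add x y => x.eval G σ + y.eval G σ
  | sub x y => x.eval G σ - y.eval G σ
  | mul x y => x.eval G σ * y.eval G σ
  | div x y => x.eval G σ / y.eval G σ

/-- Tests. -/
inductive Test where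
  | wordLe (x y : WExp)
  | realLe (x y : RExp)
  | neg (b : Test)
  | both (b c : Test)

/-- The truth value of a test. -/
def Test.Holds {n : ℕ} (G : WGraph n) (σ : Memory) : Test → Prop
  | wordLe x y => x.eval σ ≤ y.eval σ
  | realLe x y => x.eval G σ ≤ y.eval G σ
  | neg b => ¬ b.Holds G σ
  | both b c => b.Holds G σ ∧ c.Holds G σ

/-- Programs. -/
inductive Prog where
  | skip
  | setWord (a : ℕ) (i x : WExp)
  | setReal (a : ℕ) (i : WExp) (x : RExp)
  | seq (p q : Prog)
  | branch (b : Test) (p q : Prog)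
  | loop (b : Test) (p : Prog)
  /-- vertex-match query for the vertex `v`, the answer goes to the cell `i` of `a` -/
  | mate (a : ℕ) (i v : WExp)
  /-- list the maintained matching: its edges go to `a` and `b` (one endpoint each), their number
  goes to the cell `0` of `c` -/
  | edges (a b c : ℕ)

/-- A vertex or its absence as a word: `0` for none, `v + 1` for the vertex `v`. -/
def mateCode {n : ℕ} : Option (Fin n) → ℕ
  | none => 0
  | some v => v + 1

/-- `Exec G A s B p σ t τ`: when `G` is the current graph and the algorithm `A` is in the state `s`,
the program `p` takes the memory `σ` to the memory `τ` in `t` steps. Every assignment and every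
test takes one step, and a query takes one step more than the time that `A` spends on it. Words
and addresses that are written have to be smaller than `B`. -/
inductive Exec {n : ℕ} (G : WGraph n) (A : DynAlg n) (s : A.State) (B : ℕ) :
    Prog → Memory → ℕ → Memory → Prop where
  | skip (σ : Memory) : Exec G A s B .skip σ 0 σ
  | setWord (a : ℕ) (i x : WExp) (σ : Memory) (hi : i.eval σ < B) (hx : x.eval σ < B) :
      Exec G A s B (.setWord a i x) σ 1 (σ.setWord a (i.eval σ) (x.eval σ))
  | setReal (a : ℕ) (i : WExp) (x : RExp) (σ : Memory) (hi : i.eval σ < B) :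
      Exec G A s B (.setReal a i x) σ 1 (σ.setReal a (i.eval σ) (x.eval G σ))
  | seq (p q : Prog) (σ τ υ : Memory) (t t' : ℕ) (hp : Exec G A s B p σ t τ)
      (hq : Exec G A s B q τ t' υ) : Exec G A s B (.seq p q) σ (t + t') υ
  | branch_true (b : Test) (p q : Prog) (σ τ : Memory) (t : ℕ) (hb : b.Holds G σ)
      (hp : Exec G A s B p σ t τ) : Exec G A s B (.branch b p q) σ (t + 1) τ
  | branch_false (b : Test) (p q : Prog) (σ τ : Memory) (t : ℕ) (hb : ¬ b.Holds G σ)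
      (hq : Exec G A s B q σ t τ) : Exec G A s B (.branch b p q) σ (t + 1) τ
  | loop_true (b : Test) (p : Prog) (σ τ υ : Memory) (t t' : ℕ) (hb : b.Holds G σ)
      (hp : Exec G A s B p σ t τ) (hl : Exec G A s B (.loop b p) τ t' υ) :
      Exec G A s B (.loop b p) σ (t + t' + 1) υ
  | loop_false (b : Test) (p : Prog) (σ : Memory) (hb : ¬ b.Holds G σ) :
      Exec G A s B (.loop b p) σ 1 σ
  | mate (a : ℕ) (i v : WExp) (σ : Memory) (hi : i.eval σ < B) (hv : v.eval σ < n) :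
      Exec G A s B (.mate a i v) σ (A.mateTime s ⟨v.eval σ, hv⟩ + 1)
        (σ.setWord a (i.eval σ) (mateCode (A.mate s ⟨v.eval σ, hv⟩)))
  | edges (a b c : ℕ) (σ : Memory) :
      Exec G A s B (.edges a b c) σ (A.edgesTime s + 1)
        (((σ.setList a ((A.edges s).map fun p => (p.1 : ℕ))).setList b
          ((A.edges s).map fun p => (p.2 : ℕ))).setWord c 0 (A.edges s).length)

/-! Black-box transformations -/

/-- A black-box transformation: the program that is run after the given algorithm has been
initialized, and the program that is run after the given algorithm has processed an update. -/
structure Transformation where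
  init : Prog
  update : Prog

namespace Transformation

/-- The memory at the beginning: `n`, `W` and `ε` are given, all other cells are `0`. -/
def startMemory (n : ℕ) (W ε : ℝ) : Memory :=
  (({ word := fun _ _ => 0, real := fun _ _ => 0 } : Memory).setWord 0 0 n).setReal 0 0 W
    |>.setReal 0 1 ε

/-- Announce an update: its kind and endpoints go to the word array `1`, the weight of an inserted
edge goes to the real array `1`. -/
def announce {n : ℕ} (σ : Memory) : Update n → Memory
  | .ins u v x => (((σ.setWord 1 0 1).setWord 1 1 u).setWord 1 2 v).setReal 1 0 x
  | .del u v => ((σ.setWord 1 0 0).setWord 1 1 u).setWord 1 2 v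

/-- `σ i` and `t i` are the memory contents and the number of steps of the transformation's
programs when the algorithm obtained from `A` processes the initialization (`i = 0`) and the `i`-th
update of `S`. Words are smaller than `(n + ⌈W⌉ + ⌈1/ε⌉ + 2) ^ c`, that is, they
have `O(log (n + W + 1/ε))` bits. -/
def Runs {n : ℕ} (P : Transformation) (A : DynAlg n) (c : ℕ) (W ε : ℝ) (S : UpdateSeq n)
    (σ : ℕ → Memory) (t : ℕ → ℕ) : Prop :=
  Exec (S.graphAt 0) A (A.stateAt S 0) ((n + ⌈W⌉₊ + ⌈1 / ε⌉₊ + 2) ^ c) P.init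
      (startMemory n W ε) (t 0) (σ 0) ∧
    ∀ (i : ℕ) (h : i < S.updates.length),
      Exec (S.graphAt (i + 1)) A (A.stateAt S (i + 1)) ((n + ⌈W⌉₊ + ⌈1 / ε⌉₊ + 2) ^ c) P.update
        (announce (σ i) S.updates[i]) (t (i + 1)) (σ (i + 1))

end Transformation

/-- The matching `M` is stored explicitly: the cell `u` of the word array `2` holds `v + 1` if
`uv ∈ M`, and `0` if `u` is unmatched. -/
def Memory.Stores {n : ℕ} (σ : Memory) (M : Finset (Sym2 (Fin n))) : Prop :=
  ∀ u : Fin n, σ.word 2 u ≤ n ∧ ∀ v : Fin n, σ.word 2 u = v + 1 ↔ s(u, v) ∈ M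

end

/-! Copying the matching `M` of the black box after every update would be too expensive, so it is
copied lazily and locally. Let `F` be an earlier good matching and suppose that `ℓ` updates have
happened since. In the union of `M` and `F` every vertex has degree at most two, so a breadth-first
search from the at most `2ℓ` updated vertices has layers of at most `4ℓ` vertices each. Among
`⌈1/ε⌉` layers one has at most an `ε` fraction of the weight of both matchings. Cut there, take `M`
inside the explored set `R` and keep `F` outside. The opposite combination, `F` inside and `M`
outside, is a matching of the earlier graph, so its weight is at most the earlier optimum; adding
the two combinations shows that the new matching loses what `F` had already lost plus `5ε` times the
optimum (`mateWeight_combine_ge`, `wp_attempt`). Such a repair costs `O(ℓ/ε)` normalized steps.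

Losses add up along chains of repairs, so chains have to be short. A stack of earlier matchings, all
recoverable from one undo log, serves as the set of starting points. A repair becomes due when the
updates since the top entry could change the weight by an `ε` fraction of its reference weight.
Before a repair, entries that are short compared with the time since then are dropped; hence the
lengths of the entries halve upwards. Each length is at least `ε R₀ / W` and they sum to less than
`ε R₀`, so there are `O(log W)` entries (`Stack.size_le`) and the total loss is an `O(ε log W)`
fraction (`Running.approx`).

A loss that is small compared with an old weight is harmless only while the weight has not
collapsed. A repair at an entry whose reference weight is more than twice the weight of the repaired
matching is therefore rejected, and an earlier entry is tried. A rejection certifies that the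
optimum is at most `0.7` times the reference weight. If even the bottom entry is rejected, the
matching is rebuilt from the full list of the black box. Moreover a new phase starts, with a
rebuild, after `ε N` updates, where `N` is the largest size of a list in the phase.

The amortization is by a potential: every update pays according to the length and the reference
weight of the entry of the stack that contains it. When entries are merged, each of the updates
concerned moves to an entry that is longer by a factor `3/2`, or to one of reference weight at most
`0.7` times the old one; either raises its potential by at least one (`levelPotential_add_one_le`,
`Stack.potential_push`). An update pays `O(log² W)` in all, times `1/ε` for the search. Rebuilds
inside a phase are paid by a similar potential of the list, rebuilds between phases by the `ε N`
updates of the phase (`credit`).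

If `ε log W` exceeds a constant, the guarantee is void and it suffices to delete the updated edges.
Running times are computed with normalized costs and multiplied by `2T` at the end; the same
normalized costs bound the number of cells of the stored matching that change, and hence the
recourse. -/

set_option linter.unusedSimpArgs false

/-! Reasoning about programs -/

namespace Prog

/-- Sequential composition of a list of programs. -/
def block : List Prog → Prog
  | [] => .skip
  | [p] => p
  | p :: q :: l => .seq p (block (q :: l))

/-- `loop` over the values of the scalar `i` from its current value up to `hi`. -/
def forLoop (i : ℕ) (hi : WExp) (p : Prog) : Prog :=
  .loop (.neg (.wordLe hi (.get i (.const 0))))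
    (.seq p (.setWord i (.const 0) (.add (.get i (.const 0)) (.const 1))))

/-- The word arrays that a program may write. -/
def wordArrays : Prog → List ℕ
  | skip => []
  | setWord a _ _ => [a]
  | setReal _ _ _ => []
  | seq p q => p.wordArrays ++ q.wordArrays
  | branch _ p q => p.wordArrays ++ q.wordArrays
  | loop _ p => p.wordArrays
  | mate a _ _ => [a]
  | edges a b c => [a, b, c]

/-- The real arrays that a program may write. -/
def realArrays : Prog → List ℕ
  | skip => []
  | setWord _ _ _ => []
  | setReal a _ _ => [a]
  | seq p q => p.realArrays ++ q.realArrays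
  | branch _ p q => p.realArrays ++ q.realArrays
  | loop _ p => p.realArrays
  | mate _ _ _ => []
  | edges _ _ _ => []

/-- The query for all edges never writes to the word array `2`. -/
def ListsApart : Prog → Prop
  | seq p q => p.ListsApart ∧ q.ListsApart
  | branch _ p q => p.ListsApart ∧ q.ListsApart
  | loop _ p => p.ListsApart
  | edges a b c => a ≠ 2 ∧ b ≠ 2 ∧ c ≠ 2
  | _ => True

end Prog

/-- The surroundings of an execution: the current graph, the algorithm and its state, and the bound
on words. -/
structure Env (n : ℕ) where
  G : WGraph n
  A : DynAlg n
  s : A.State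
  B : ℕ

namespace Env

variable {n : ℕ} (E : Env n)

/-- Executions with the costs normalized: a vertex-match query counts as `2` steps, and a query for
all edges as one step more than the number of edges. -/
inductive Ex : Prog → Memory → ℕ → Memory → Prop where
  | skip (σ : Memory) : Ex .skip σ 0 σ
  | setWord (a : ℕ) (i x : WExp) (σ : Memory) (hi : i.eval σ < E.B) (hx : x.eval σ < E.B) :
      Ex (.setWord a i x) σ 1 (σ.setWord a (i.eval σ) (x.eval σ))
  | setReal (a : ℕ) (i : WExp) (x : RExp) (σ : Memory) (hi : i.eval σ < E.B) :
      Ex (.setReal a i x) σ 1 (σ.setReal a (i.eval σ) (x.eval E.G σ))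
  | seq (p q : Prog) (σ τ υ : Memory) (t t' : ℕ) (hp : Ex p σ t τ)
      (hq : Ex q τ t' υ) : Ex (.seq p q) σ (t + t') υ
  | branch_true (b : Test) (p q : Prog) (σ τ : Memory) (t : ℕ) (hb : b.Holds E.G σ)
      (hp : Ex p σ t τ) : Ex (.branch b p q) σ (t + 1) τ
  | branch_false (b : Test) (p q : Prog) (σ τ : Memory) (t : ℕ) (hb : ¬ b.Holds E.G σ)
      (hq : Ex q σ t τ) : Ex (.branch b p q) σ (t + 1) τ
  | loop_true (b : Test) (p : Prog) (σ τ υ : Memory) (t t' : ℕ) (hb : b.Holds E.G σ)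
      (hp : Ex p σ t τ) (hl : Ex (.loop b p) τ t' υ) :
      Ex (.loop b p) σ (t + t' + 1) υ
  | loop_false (b : Test) (p : Prog) (σ : Memory) (hb : ¬ b.Holds E.G σ) :
      Ex (.loop b p) σ 1 σ
  | mate (a : ℕ) (i v : WExp) (σ : Memory) (hi : i.eval σ < E.B) (hv : v.eval σ < n) :
      Ex (.mate a i v) σ 2
        (σ.setWord a (i.eval σ) (mateCode (E.A.mate E.s ⟨v.eval σ, hv⟩)))
  | edges (a b c : ℕ) (σ : Memory) :
      Ex (.edges a b c) σ ((E.A.edges E.s).length + 1)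
        (((σ.setList a ((E.A.edges E.s).map fun p => (p.1 : ℕ))).setList b
          ((E.A.edges E.s).map fun p => (p.2 : ℕ))).setWord c 0 (E.A.edges E.s).length)

variable {E}

/-- As `1 ≤ T`, the extra step of a query is at most `T`: a vertex-match query takes at most `T + 1
≤ 2T` steps and a listing at most `T (|M| + 1) + 1`. The listing has no repetitions, so its length
is `|M|`. -/
theorem Ex.exec {p : Prog} {σ τ : Memory} {x : ℕ} (h : E.Ex p σ x τ) {T : ℝ} (hT : 1 ≤ T)
    (hq : E.A.VertexMatch E.s T) :
    ∃ t : ℕ, Exec E.G E.A E.s E.B p σ t τ ∧ (t : ℝ) ≤ 2 * T * x := by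
  induction h with
  | skip σ => exact ⟨0, .skip σ, by simp⟩
  | setWord a i x σ hi hx => exact ⟨1, .setWord a i x σ hi hx, by norm_num; linarith⟩
  | setReal a i x σ hi => exact ⟨1, .setReal a i x σ hi, by norm_num; linarith⟩
  | seq p q σ τ υ t t' _ _ ih ih' =>
    obtain ⟨s, hs, hs'⟩ := ih
    obtain ⟨s', hs2, hs2'⟩ := ih'
    exact ⟨s + s', .seq p q σ τ υ s s' hs hs2, by push_cast; linarith⟩
  | branch_true b p q σ τ t hb _ ih =>
    obtain ⟨s, hs, hs'⟩ := ih
    exact ⟨s + 1, .branch_true b p q σ τ s hb hs, by push_cast; linarith⟩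
  | branch_false b p q σ τ t hb _ ih =>
    obtain ⟨s, hs, hs'⟩ := ih
    exact ⟨s + 1, .branch_false b p q σ τ s hb hs, by push_cast; linarith⟩
  | loop_true b p σ τ υ t t' hb _ _ ih ih' =>
    obtain ⟨s, hs, hs'⟩ := ih
    obtain ⟨s', hs2, hs2'⟩ := ih'
    exact ⟨s + s' + 1, .loop_true b p σ τ υ s s' hb hs hs2, by push_cast; linarith⟩
  | loop_false b p σ hb => exact ⟨1, .loop_false b p σ hb, by norm_num; linarith⟩
  | mate a i v σ hi hv =>
    refine ⟨_, .mate a i v σ hi hv, ?_⟩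
    have := hq.mate_time ⟨v.eval σ, hv⟩
    push_cast; linarith
  | edges a b c σ =>
    refine ⟨_, .edges a b c σ, ?_⟩
    have h1 := hq.edges_time
    have h2 : (E.A.matching E.s).card = (E.A.edges E.s).length := by
      classical
      have : E.A.matching E.s = ((E.A.edges E.s).map fun p => s(p.1, p.2)).toFinset := by
        ext e; rw [List.mem_toFinset, hq.mem_edges]
      rw [this, List.toFinset_card_of_nodup hq.edges_nodup, List.length_map]
    rw [h2] at h1
    have h3 : (0 : ℝ) ≤ (E.A.edges E.s).length := by positivity
    push_cast
    nlinarith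

/-- Every operation other than a listing writes at most one cell, and `ListsApart` keeps listings
away from the array `2` that stores the matching. This turns the bound on the cost into a bound on
the recourse. -/
theorem Ex.changes {p : Prog} {σ τ : Memory} {x : ℕ} (h : E.Ex p σ x τ) (hp : p.ListsApart) :
    ∃ D : Finset ℕ, D.card ≤ x ∧ ∀ u ∉ D, τ.word 2 u = σ.word 2 u := by
  classical
  have setw : ∀ (σ : Memory) (a i y k : ℕ), 1 ≤ k → ∃ D : Finset ℕ, D.card ≤ k ∧
      ∀ u ∉ D, (σ.setWord a i y).word 2 u = σ.word 2 u := by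
    intro σ a i y k hk
    refine ⟨{i}, by simpa using hk, fun u hu => ?_⟩
    have hu : u ≠ i := by simpa using hu
    by_cases ha : 2 = a
    · subst ha; simp [Memory.setWord, hu]
    · simp [Memory.setWord, Function.update_of_ne ha]
  have comb : ∀ (σ τ υ : Memory) (a b k : ℕ), a + b ≤ k →
      (∃ D : Finset ℕ, D.card ≤ a ∧ ∀ u ∉ D, τ.word 2 u = σ.word 2 u) →
      (∃ D : Finset ℕ, D.card ≤ b ∧ ∀ u ∉ D, υ.word 2 u = τ.word 2 u) →
      ∃ D : Finset ℕ, D.card ≤ k ∧ ∀ u ∉ D, υ.word 2 u = σ.word 2 u := by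
    rintro σ τ υ a b k hk ⟨D, hD, h⟩ ⟨D', hD', h'⟩
    refine ⟨D ∪ D', (Finset.card_union_le _ _).trans (by omega), fun u hu => ?_⟩
    simp only [Finset.mem_union, not_or] at hu
    rw [h' u hu.2, h u hu.1]
  induction h with
  | skip σ => exact ⟨∅, by simp⟩
  | setWord a i x σ hi hx => exact setw _ _ _ _ _ le_rfl
  | setReal a i x σ hi => exact ⟨∅, by simp [Memory.setReal]⟩
  | seq p q σ τ υ t t' _ _ ih ih' => exact comb σ τ υ t t' _ le_rfl (ih hp.1) (ih' hp.2)
  | branch_true b p q σ τ t hb _ ih => exact comb σ σ τ 0 t _ (by omega) ⟨∅, by simp⟩ (ih hp.1)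
  | branch_false b p q σ τ t hb _ ih => exact comb σ σ τ 0 t _ (by omega) ⟨∅, by simp⟩ (ih hp.2)
  | loop_true b p σ τ υ t t' hb _ _ ih ih' => exact comb σ τ υ t t' _ (by omega) (ih hp) (ih' hp)
  | loop_false b p σ hb => exact ⟨∅, by simp⟩
  | mate a i v σ hi hv => exact setw _ _ _ _ _ (by norm_num)
  | edges a b c σ =>
    refine ⟨∅, by simp, fun u _ => ?_⟩
    simp [Memory.setWord, Memory.setList, Function.update_of_ne hp.1.symm,
      Function.update_of_ne hp.2.1.symm, Function.update_of_ne hp.2.2.symm]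

/-- `τ` agrees with `σ` on all arrays that `p` does not write. -/
def Frame (p : Prog) (σ τ : Memory) : Prop :=
  (∀ a ∉ p.wordArrays, τ.word a = σ.word a) ∧ ∀ a ∉ p.realArrays, τ.real a = σ.real a

/-- The arrays that a program may write can be read off its syntax, and their names are numerals; so
`decide` later proves that a subprogram leaves an array alone. -/
theorem Ex.frame {p : Prog} {σ τ : Memory} {x : ℕ} (h : E.Ex p σ x τ) : Frame p σ τ := by
  induction h with
  | skip σ => exact ⟨fun _ _ => rfl, fun _ _ => rfl⟩
  | setWord a i x σ hi hx =>
    refine ⟨fun b hb => ?_, fun _ _ => rfl⟩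
    have : b ≠ a := by simpa [Prog.wordArrays] using hb
    simp [Memory.setWord, this]
  | setReal a i x σ hi =>
    refine ⟨fun _ _ => rfl, fun b hb => ?_⟩
    have : b ≠ a := by simpa [Prog.realArrays] using hb
    simp [Memory.setReal, this]
  | seq p q σ τ υ t t' _ _ ih ih' =>
    refine ⟨fun a ha => ?_, fun a ha => ?_⟩
    · simp only [Prog.wordArrays, List.mem_append, not_or] at ha
      rw [ih'.1 a ha.2, ih.1 a ha.1]
    · simp only [Prog.realArrays, List.mem_append, not_or] at ha
      rw [ih'.2 a ha.2, ih.2 a ha.1]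
  | branch_true b p q σ τ t hb _ ih =>
    refine ⟨fun a ha => ih.1 a ?_, fun a ha => ih.2 a ?_⟩ <;>
      simp_all [Prog.wordArrays, Prog.realArrays]
  | branch_false b p q σ τ t hb _ ih =>
    refine ⟨fun a ha => ih.1 a ?_, fun a ha => ih.2 a ?_⟩ <;>
      simp_all [Prog.wordArrays, Prog.realArrays]
  | loop_true b p σ τ υ t t' hb _ _ ih ih' =>
    exact ⟨fun a ha => (ih'.1 a ha).trans (ih.1 a ha), fun a ha => (ih'.2 a ha).trans (ih.2 a ha)⟩
  | loop_false b p σ hb => exact ⟨fun _ _ => rfl, fun _ _ => rfl⟩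
  | mate a i v σ hi hv =>
    refine ⟨fun b hb => ?_, fun _ _ => rfl⟩
    have : b ≠ a := by simpa [Prog.wordArrays] using hb
    simp [Memory.setWord, this]
  | edges a b c σ =>
    refine ⟨fun d hd => ?_, fun _ _ => rfl⟩
    have : d ≠ a ∧ d ≠ b ∧ d ≠ c := by simpa [Prog.wordArrays] using hd
    simp [Memory.setWord, Memory.setList, this]

variable (E)

/-- The weakest precondition; the postcondition may depend on the cost. -/
def wp (p : Prog) (Q : Memory → ℕ → Prop) (σ : Memory) : Prop := ∃ τ x, E.Ex p σ x τ ∧ Q τ x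

variable {E}

/-- Consequence rule; the frame of the program comes for free, so specifications need not list what
stays unchanged. -/
theorem wp_of {p : Prog} {σ : Memory} {P Q : Memory → ℕ → Prop} (h : E.wp p P σ)
    (hPQ : ∀ τ x, P τ x → Frame p σ τ → Q τ x) : E.wp p Q σ := by
  obtain ⟨τ, x, h, hP⟩ := h
  exact ⟨τ, x, h, hPQ τ x hP h.frame⟩

theorem wp_skip {Q : Memory → ℕ → Prop} {σ : Memory} : E.wp .skip Q σ ↔ Q σ 0 := by
  constructor
  · rintro ⟨τ, x, h, hQ⟩; cases h; exact hQ
  · exact fun h => ⟨σ, 0, .skip σ, h⟩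

theorem wp_setWord {a : ℕ} {i x : WExp} {Q : Memory → ℕ → Prop} {σ : Memory} :
    E.wp (.setWord a i x) Q σ ↔
      i.eval σ < E.B ∧ x.eval σ < E.B ∧ Q (σ.setWord a (i.eval σ) (x.eval σ)) 1 := by
  constructor
  · rintro ⟨τ, x, h, hQ⟩; cases h with | setWord _ _ _ _ hi hx => exact ⟨hi, hx, hQ⟩
  · exact fun h => ⟨_, 1, .setWord a i x σ h.1 h.2.1, h.2.2⟩

theorem wp_setReal {a : ℕ} {i : WExp} {x : RExp} {Q : Memory → ℕ → Prop} {σ : Memory} :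
    E.wp (.setReal a i x) Q σ ↔
      i.eval σ < E.B ∧ Q (σ.setReal a (i.eval σ) (x.eval E.G σ)) 1 := by
  constructor
  · rintro ⟨τ, x, h, hQ⟩; cases h with | setReal _ _ _ _ hi => exact ⟨hi, hQ⟩
  · exact fun h => ⟨_, 1, .setReal a i x σ h.1, h.2⟩

theorem wp_seq {p q : Prog} {Q : Memory → ℕ → Prop} {σ : Memory} :
    E.wp (.seq p q) Q σ ↔ E.wp p (fun τ x => E.wp q (fun υ y => Q υ (x + y)) τ) σ := by
  constructor
  · rintro ⟨τ, x, h, hQ⟩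
    cases h with | seq _ _ _ τ' _ t t' hp hq => exact ⟨τ', t, hp, τ, t', hq, hQ⟩
  · rintro ⟨τ, x, hp, υ, y, hq, hQ⟩
    exact ⟨υ, x + y, .seq p q σ τ υ x y hp hq, hQ⟩

theorem wp_branch {b : Test} {p q : Prog} {Q : Memory → ℕ → Prop} {σ : Memory} :
    E.wp (.branch b p q) Q σ ↔
      (b.Holds E.G σ → E.wp p (fun τ x => Q τ (x + 1)) σ) ∧
        (¬ b.Holds E.G σ → E.wp q (fun τ x => Q τ (x + 1)) σ) := by
  constructor
  · rintro ⟨τ, x, h, hQ⟩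
    cases h with
    | branch_true _ _ _ _ _ t hb hp => exact ⟨fun _ => ⟨τ, t, hp, hQ⟩, fun h => absurd hb h⟩
    | branch_false _ _ _ _ _ t hb hp => exact ⟨fun h => absurd h hb, fun _ => ⟨τ, t, hp, hQ⟩⟩
  · rintro ⟨h1, h2⟩
    by_cases hb : b.Holds E.G σ
    · obtain ⟨τ, x, hp, hQ⟩ := h1 hb
      exact ⟨τ, x + 1, .branch_true b p q σ τ x hb hp, hQ⟩
    · obtain ⟨τ, x, hp, hQ⟩ := h2 hb
      exact ⟨τ, x + 1, .branch_false b p q σ τ x hb hp, hQ⟩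

theorem wp_mate {a : ℕ} {i v : WExp} {Q : Memory → ℕ → Prop} {σ : Memory} :
    E.wp (.mate a i v) Q σ ↔
      i.eval σ < E.B ∧ ∃ hv : v.eval σ < n,
        Q (σ.setWord a (i.eval σ) (mateCode (E.A.mate E.s ⟨v.eval σ, hv⟩))) 2 := by
  constructor
  · rintro ⟨τ, x, h, hQ⟩; cases h with | mate _ _ _ _ hi hv => exact ⟨hi, hv, hQ⟩
  · rintro ⟨hi, hv, hQ⟩; exact ⟨_, 2, .mate a i v σ hi hv, hQ⟩

theorem wp_edges {a b c : ℕ} {Q : Memory → ℕ → Prop} {σ : Memory} :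
    E.wp (.edges a b c) Q σ ↔
      Q (((σ.setList a ((E.A.edges E.s).map fun p => (p.1 : ℕ))).setList b
          ((E.A.edges E.s).map fun p => (p.2 : ℕ))).setWord c 0 (E.A.edges E.s).length)
        ((E.A.edges E.s).length + 1) := by
  constructor
  · rintro ⟨τ, x, h, hQ⟩; cases h with | edges => exact hQ
  · exact fun h => ⟨_, _, .edges a b c σ, h⟩

theorem wp_block_one {p : Prog} {Q : Memory → ℕ → Prop} {σ : Memory} :
    E.wp (Prog.block [p]) Q σ ↔ E.wp p Q σ := Iff.rfl

theorem wp_block_cons {p q : Prog} {l : List Prog} {Q : Memory → ℕ → Prop} {σ : Memory} :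
    E.wp (Prog.block (p :: q :: l)) Q σ ↔
      E.wp p (fun τ x => E.wp (Prog.block (q :: l)) (fun υ y => Q υ (x + y)) τ) σ := wp_seq

theorem Frame.trans {p q r : Prog} {σ τ υ : Memory} (h : Frame p σ τ) (h' : Frame q τ υ)
    (hp : p.wordArrays ⊆ r.wordArrays ∧ p.realArrays ⊆ r.realArrays)
    (hq : q.wordArrays ⊆ r.wordArrays ∧ q.realArrays ⊆ r.realArrays) : Frame r σ υ :=
  ⟨fun a ha => (h'.1 a fun h => ha (hq.1 h)).trans (h.1 a fun h => ha (hp.1 h)),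
    fun a ha => (h'.2 a fun h => ha (hq.2 h)).trans (h.2 a fun h => ha (hp.2 h))⟩

/-- The rule for loops: `I` is an invariant of the memory and the cost so far, `m` a variant. -/
theorem wp_loop {b : Test} {p : Prog} {Q : Memory → ℕ → Prop} (I : Memory → ℕ → Prop)
    (m : Memory → ℕ) {σ : Memory} (h0 : I σ 0)
    (hstep : ∀ τ k, I τ k → b.Holds E.G τ → Frame p σ τ →
      E.wp p (fun υ x => I υ (k + x + 1) ∧ m υ < m τ) τ)
    (hend : ∀ τ k, I τ k → ¬ b.Holds E.G τ → Q τ (k + 1)) : E.wp (.loop b p) Q σ := by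
  -- Generalized to a loop entered at cost `k`, for induction on a bound of the variant.
  suffices h : ∀ (N : ℕ) (τ : Memory) (k : ℕ), m τ < N → I τ k → Frame p σ τ →
      E.wp (.loop b p) (fun υ x => Q υ (k + x)) τ by
    obtain ⟨τ, x, hx, hQ⟩ := h (m σ + 1) σ 0 (Nat.lt_succ_self _) h0
      ⟨fun _ _ => rfl, fun _ _ => rfl⟩
    exact ⟨τ, x, hx, by simpa using hQ⟩
  intro N
  induction N with
  | zero => intro τ k h; omega
  | succ N ih =>
    intro τ k hm hI hF
    by_cases hb : b.Holds E.G τ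
    · obtain ⟨υ, x, hx, hI', hm'⟩ := hstep τ k hI hb hF
      obtain ⟨υ', y, hy, hQ⟩ := ih υ (k + x + 1) (by omega) hI'
        (hF.trans hx.frame ⟨fun _ h => h, fun _ h => h⟩ ⟨fun _ h => h, fun _ h => h⟩)
      refine ⟨υ', x + y + 1, .loop_true b p τ υ υ' x y hb hx hy, ?_⟩
      have : k + (x + y + 1) = k + x + 1 + y := by omega
      change Q υ' (k + (x + y + 1))
      rwa [this]
    · exact ⟨τ, 1, .loop_false b p τ hb, hend τ k hI hb⟩

/-- The rule for `forLoop`: every round costs at most `c`. -/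
theorem wp_forLoop {i : ℕ} {hi : WExp} {p : Prog} {Q : Memory → ℕ → Prop} (c H : ℕ)
    (I : ℕ → Memory → Prop) {σ : Memory}
    (hlo : σ.word i 0 ≤ H) (hH : H < E.B) (h0 : I (σ.word i 0) σ)
    (hI : ∀ τ, (∀ a ∉ i :: p.wordArrays, τ.word a = σ.word a) → hi.eval τ = H)
    (hni : i ∉ p.wordArrays)
    (hstep : ∀ j τ, σ.word i 0 ≤ j → j < H → I j τ → τ.word i 0 = j →
      (∀ a ∉ i :: p.wordArrays, τ.word a = σ.word a) → (∀ a ∉ p.realArrays, τ.real a = σ.real a) →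
      E.wp p (fun υ x => x ≤ c ∧ ∀ υ', (∀ a ≠ i, υ'.word a = υ.word a) → υ'.real = υ.real →
        I (j + 1) υ') τ)
    (hend : ∀ τ x, I H τ → τ.word i 0 = H → x ≤ (H - σ.word i 0) * (c + 2) + 1 →
      (∀ a ∉ i :: p.wordArrays, τ.word a = σ.word a) → (∀ a ∉ p.realArrays, τ.real a = σ.real a) →
      Q τ x) :
    E.wp (Prog.forLoop i hi p) Q σ := by
  refine wp_loop (fun τ k => ∃ j, τ.word i 0 = j ∧ σ.word i 0 ≤ j ∧ j ≤ H ∧ I j τ ∧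
    k ≤ (j - σ.word i 0) * (c + 2) ∧ (∀ a ∉ i :: p.wordArrays, τ.word a = σ.word a) ∧
    (∀ a ∉ p.realArrays, τ.real a = σ.real a)) (fun τ => H - τ.word i 0)
    ⟨_, rfl, le_rfl, hlo, h0, by simp, fun _ _ => rfl, fun _ _ => rfl⟩ ?_ ?_
  · rintro τ k ⟨j, e1, hj, hjH, hIj, hk, hFw, hFr⟩ hb -
    have e2 := hI τ hFw
    simp only [Test.Holds, WExp.eval, e1, e2, not_le] at hb
    rw [wp_seq]
    refine wp_of (hstep j τ hj hb hIj e1 hFw hFr) ?_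
    rintro υ x ⟨hx, hI'⟩ hF
    have hv : υ.word i 0 = j := by rw [hF.1 i hni, e1]
    simp only [wp_setWord, WExp.eval, hv]
    -- The step hypothesis gives the invariant for every memory that agrees with `υ` outside the
    -- counter, which covers the increment after the body.
    refine ⟨by omega, by omega, ⟨j + 1, by simp [Memory.setWord], by omega, hb,
      hI' _ (fun a ha => by simp [Memory.setWord, ha]) rfl, ?_, fun a ha => ?_, fun a ha => ?_⟩, ?_⟩
    -- A round costs the body plus one test and one increment, hence `c + 2`.
    · have : j + 1 - σ.word i 0 = (j - σ.word i 0) + 1 := by omega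
      rw [this]; ring_nf; ring_nf at hk; omega
    · simp only [List.mem_cons, not_or] at ha
      rw [← hFw a (by simp [ha]), ← hF.1 a ha.2]
      simp [Memory.setWord, ha.1]
    · rw [← hFr a ha, ← hF.2 a ha]; rfl
    · simp [Memory.setWord, e1]; omega
  · rintro τ k ⟨j, e1, hj, hjH, hIj, hk, hFw, hFr⟩ hb
    have e2 := hI τ hFw
    simp only [Test.Holds, WExp.eval, e1, e2, not_not] at hb
    obtain rfl : j = H := by omega
    exact hend τ _ hIj e1 (by omega) hFw hFr

end Env

namespace Memory

theorem word_setWord (σ : Memory) (a i x b : ℕ) :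
    (σ.setWord a i x).word b = if b = a then Function.update (σ.word a) i x else σ.word b := by
  by_cases h : b = a
  · subst h; simp [setWord]
  · simp [setWord, h]

theorem real_setWord (σ : Memory) (a i x : ℕ) : (σ.setWord a i x).real = σ.real := rfl

theorem real_setReal (σ : Memory) (a i : ℕ) (x : ℝ) (b : ℕ) :
    (σ.setReal a i x).real b = if b = a then Function.update (σ.real a) i x else σ.real b := by
  by_cases h : b = a
  · subst h; simp [setReal]
  · simp [setReal, h]

theorem word_setReal (σ : Memory) (a i : ℕ) (x : ℝ) : (σ.setReal a i x).word = σ.word := rfl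

end Memory

noncomputable section

/-! Matchings as functions -/

namespace WGraph

variable {n : ℕ}

theorem lookup_symm (G : WGraph n) (u v : ℕ) : G.lookup u v = G.lookup v u := by
  unfold lookup
  by_cases h : u < n ∧ v < n
  · rw [dif_pos h, dif_pos h.symm, G.graph.adj_comm, Sym2.eq_swap]
  · rw [dif_neg h, dif_neg (fun h' => h h'.symm)]

theorem lookup_fin (G : WGraph n) {u v : Fin n} (h : G.graph.Adj u v) :
    G.lookup u v = G.weight s(u, v) := by
  simp [lookup, h]

theorem WeightsIn.lookup_eq_zero_or {G : WGraph n} {W : ℝ} (hG : G.WeightsIn W) (u v : ℕ) :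
    G.lookup u v = 0 ∨ 1 ≤ G.lookup u v ∧ G.lookup u v ≤ W := by
  unfold lookup
  split_ifs with h h'
  · exact Or.inr (hG _ ((SimpleGraph.mem_edgeSet _).2 h'))
  · exact Or.inl rfl
  · exact Or.inl rfl

theorem WeightsIn.lookup_nonneg {G : WGraph n} {W : ℝ} (hG : G.WeightsIn W) (u v : ℕ) :
    0 ≤ G.lookup u v := by
  rcases hG.lookup_eq_zero_or u v with h | h <;> linarith

theorem WeightsIn.lookup_le {G : WGraph n} {W : ℝ} (hG : G.WeightsIn W) (hW : 0 ≤ W) (u v : ℕ) :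
    G.lookup u v ≤ W := by
  rcases hG.lookup_eq_zero_or u v with h | h <;> linarith

theorem lookup_ne_zero {G : WGraph n} {u v : ℕ} (h : G.lookup u v ≠ 0) :
    ∃ (hu : u < n) (hv : v < n), G.graph.Adj ⟨u, hu⟩ ⟨v, hv⟩ := by
  unfold lookup at h
  split_ifs at h with h1 h2
  · exact ⟨h1.1, h1.2, h2⟩
  · exact absurd rfl h
  · exact absurd rfl h

theorem WeightsIn.lookup_ne_zero_of_adj {G : WGraph n} {W : ℝ} (hG : G.WeightsIn W) {u v : Fin n}
    (h : G.graph.Adj u v) : G.lookup u v ≠ 0 := by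
  rw [lookup_fin G h]
  have := hG s(u, v) ((SimpleGraph.mem_edgeSet _).2 h)
  linarith

/-- `f` codes a matching of `G`: `f u = v + 1` if `u` is matched to `v`, and `f u = 0` if `u` is
unmatched. -/
def IsMate (G : WGraph n) (f : ℕ → ℕ) : Prop :=
  ∀ u < n, f u ≠ 0 → G.lookup u (f u - 1) ≠ 0 ∧ f (f u - 1) = u + 1

/-- The weight of the edge at `u`. -/
def vertexWeight (G : WGraph n) (f : ℕ → ℕ) (u : ℕ) : ℝ :=
  if f u = 0 then 0 else G.lookup u (f u - 1)

/-- The sum of the weights at all vertices, which is twice the weight of the matching. -/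
def mateWeight (G : WGraph n) (f : ℕ → ℕ) : ℝ := ∑ u ∈ Finset.range n, G.vertexWeight f u

/-- The number of matched vertices. -/
def matchedCount (n : ℕ) (f : ℕ → ℕ) : ℕ := ((Finset.range n).filter fun u => f u ≠ 0).card

/-- Twice the maximum weight of a matching. -/
def opt (G : WGraph n) : ℝ := sSup {x | ∃ f, G.IsMate f ∧ G.mateWeight f = x}

theorem IsMate.lt {G : WGraph n} {f : ℕ → ℕ} (hf : G.IsMate f) {u : ℕ} (hu : u < n)
    (h : f u ≠ 0) : f u - 1 < n := (lookup_ne_zero (hf u hu h).1).2.1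

theorem IsMate.ne {G : WGraph n} {f : ℕ → ℕ} (hf : G.IsMate f) {u : ℕ} (hu : u < n)
    (h : f u ≠ 0) : f u - 1 ≠ u := by
  intro h'
  obtain ⟨h1, h2, h3⟩ := lookup_ne_zero (hf u hu h).1
  exact h3.ne (by ext; exact h'.symm)

theorem IsMate.le {G : WGraph n} {f : ℕ → ℕ} (hf : G.IsMate f) {u : ℕ} (hu : u < n) :
    f u ≤ n := by
  by_cases h : f u = 0
  · omega
  · have := hf.lt hu h; omega

theorem isMate_zero (G : WGraph n) : G.IsMate fun _ => 0 := fun _ _ h => absurd rfl h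

theorem IsMate.congr {G : WGraph n} {f g : ℕ → ℕ} (hf : G.IsMate f) (h : ∀ u < n, g u = f u) :
    G.IsMate g := by
  intro u hu h0
  have h1 := h u hu
  rw [h1] at h0 ⊢
  exact ⟨(hf u hu h0).1, by rw [h _ (hf.lt hu h0)]; exact (hf u hu h0).2⟩

theorem vertexWeight_congr (G : WGraph n) {f g : ℕ → ℕ} {u : ℕ} (h : g u = f u) :
    G.vertexWeight g u = G.vertexWeight f u := by simp [vertexWeight, h]

theorem mateWeight_congr (G : WGraph n) {f g : ℕ → ℕ} (h : ∀ u < n, g u = f u) :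
    G.mateWeight g = G.mateWeight f :=
  Finset.sum_congr rfl fun u hu => G.vertexWeight_congr (h u (Finset.mem_range.1 hu))

theorem WeightsIn.vertexWeight_nonneg {G : WGraph n} {W : ℝ} (hG : G.WeightsIn W)
    (f : ℕ → ℕ) (u : ℕ) : 0 ≤ G.vertexWeight f u := by
  unfold vertexWeight; split_ifs
  · exact le_rfl
  · exact hG.lookup_nonneg _ _

theorem WeightsIn.vertexWeight_le {G : WGraph n} {W : ℝ} (hG : G.WeightsIn W)
    (hW : 0 ≤ W) (f : ℕ → ℕ) (u : ℕ) : G.vertexWeight f u ≤ W := by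
  unfold vertexWeight; split_ifs
  · exact hW
  · exact hG.lookup_le hW _ _

theorem WeightsIn.mateWeight_nonneg {G : WGraph n} {W : ℝ} (hG : G.WeightsIn W)
    (f : ℕ → ℕ) : 0 ≤ G.mateWeight f :=
  Finset.sum_nonneg fun u _ => hG.vertexWeight_nonneg f u

theorem WeightsIn.mateWeight_le_matchedCount {G : WGraph n} {W : ℝ} (hG : G.WeightsIn W)
    (hW : 0 ≤ W) (f : ℕ → ℕ) :
    G.mateWeight f ≤ W * matchedCount n f := by
  unfold mateWeight matchedCount
  rw [Finset.card_filter]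
  push_cast
  rw [Finset.mul_sum]
  refine Finset.sum_le_sum fun u _ => ?_
  by_cases h : f u = 0
  · simp [h, vertexWeight]
  · simpa [h] using hG.vertexWeight_le hW f u

theorem WeightsIn.matchedCount_le_mateWeight {G : WGraph n} {W : ℝ} (hG : G.WeightsIn W)
    {f : ℕ → ℕ} (hf : G.IsMate f) :
    (matchedCount n f : ℝ) ≤ G.mateWeight f := by
  unfold mateWeight matchedCount
  rw [Finset.card_filter]
  push_cast
  refine Finset.sum_le_sum fun u hu => ?_
  by_cases h : f u = 0
  · simp [h, vertexWeight]
  · have h1 := (hf u (Finset.mem_range.1 hu) h).1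
    rcases hG.lookup_eq_zero_or u (f u - 1) with h2 | h2
    · exact absurd h2 h1
    · simpa [h, vertexWeight] using h2.1

theorem WeightsIn.mateWeight_le_opt {G : WGraph n} {W : ℝ} (hG : G.WeightsIn W)
    (hW : 0 ≤ W) {f : ℕ → ℕ} (hf : G.IsMate f) :
    G.mateWeight f ≤ G.opt := by
  refine le_csSup ⟨W * n, ?_⟩ ⟨f, hf, rfl⟩
  rintro _ ⟨g, -, rfl⟩
  refine (hG.mateWeight_le_matchedCount hW g).trans ?_
  have : (matchedCount n g : ℝ) ≤ n := by
    exact_mod_cast (Finset.card_filter_le _ _).trans (by simp)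
  exact mul_le_mul_of_nonneg_left this hW

theorem WeightsIn.opt_nonneg {G : WGraph n} {W : ℝ} (hG : G.WeightsIn W)
    (hW : 0 ≤ W) : 0 ≤ G.opt :=
  (hG.mateWeight_nonneg _).trans (hG.mateWeight_le_opt hW G.isMate_zero)

theorem opt_le {G : WGraph n} {z : ℝ} (h : ∀ f, G.IsMate f → G.mateWeight f ≤ z) : G.opt ≤ z :=
  csSup_le ⟨_, _, G.isMate_zero, rfl⟩ (by rintro _ ⟨f, hf, rfl⟩; exact h f hf)

open Classical in
/-- Remove all edges that satisfy `P`. -/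
def removeEdges (P : ℕ → ℕ → Prop) (f : ℕ → ℕ) (u : ℕ) : ℕ :=
  if f u ≠ 0 ∧ P u (f u - 1) then 0 else f u

theorem removeEdges_eq_or (P : ℕ → ℕ → Prop) (f : ℕ → ℕ) (u : ℕ) :
    removeEdges P f u = 0 ∨ removeEdges P f u = f u ∧ ¬ P u (f u - 1) := by
  unfold removeEdges
  split_ifs with h
  · exact Or.inl rfl
  · by_cases h0 : f u = 0
    · exact Or.inl h0
    · exact Or.inr ⟨rfl, fun h' => h ⟨h0, h'⟩⟩

/-- After the removal of every pair on which the two graphs may differ, the rest is a matching of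
both. By the symmetry of `P` the two ends of an edge agree on whether it goes. -/
theorem IsMate.removeEdges {G G' : WGraph n} {P : ℕ → ℕ → Prop} (hP : ∀ u v, P u v → P v u)
    (hGG : ∀ u v, ¬ P u v → G'.lookup u v = G.lookup u v) {f : ℕ → ℕ} (hf : G.IsMate f) :
    G'.IsMate (removeEdges P f) := by
  intro u hu h0
  rcases removeEdges_eq_or P f u with h | ⟨h, h'⟩
  · exact absurd h h0
  · rw [h] at h0 ⊢
    obtain ⟨h1, h2⟩ := hf u hu h0
    refine ⟨by rwa [hGG _ _ h'], ?_⟩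
    unfold WGraph.removeEdges
    rw [if_neg, h2]
    rintro ⟨-, h3⟩
    rw [h2] at h3
    exact h' (hP _ _ h3)

theorem vertexWeight_removeEdges {G G' : WGraph n} {P : ℕ → ℕ → Prop}
    (hGG : ∀ u v, ¬ P u v → G'.lookup u v = G.lookup u v) (f : ℕ → ℕ) (u : ℕ) :
    G'.vertexWeight (removeEdges P f) u =
      if WGraph.removeEdges P f u = 0 then 0 else G.vertexWeight f u := by
  rcases removeEdges_eq_or P f u with h | ⟨h, h'⟩
  · simp [h, vertexWeight]
  · unfold vertexWeight
    rw [h]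
    split_ifs with h0
    · rfl
    · exact hGG _ _ h'

/-- `G` and `G'` differ at most in the pair `a, b`. -/
def AgreeOff (G G' : WGraph n) (a b : ℕ) : Prop :=
  ∀ u v, ¬ (u = a ∧ v = b ∨ u = b ∧ v = a) → G'.lookup u v = G.lookup u v

theorem AgreeOff.symm {G G' : WGraph n} {a b : ℕ} (h : AgreeOff G G' a b) : AgreeOff G' G a b :=
  fun u v huv => (h u v huv).symm

/-- Remove the edge between `a` and `b`, if it is present. -/
def removePair (a b : ℕ) : (ℕ → ℕ) → ℕ → ℕ :=
  removeEdges fun u v => u = a ∧ v = b ∨ u = b ∧ v = a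

theorem AgreeOff.isMate {G G' : WGraph n} {a b : ℕ} (h : AgreeOff G G' a b) {f : ℕ → ℕ}
    (hf : G.IsMate f) : G'.IsMate (removePair a b f) :=
  hf.removeEdges (by tauto) h

theorem removePair_of_ne {a b u : ℕ} (f : ℕ → ℕ) (ha : u ≠ a) (hb : u ≠ b) :
    removePair a b f u = f u := by simp [removePair, removeEdges, ha, hb]

/-- `mateWeight` counts every edge at both of its ends, and only the two vertices `a` and `b` can
lose, each at most `W`. -/
theorem AgreeOff.mateWeight_le {G G' : WGraph n} {W : ℝ} (hG : G.WeightsIn W)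
    (hG' : G'.WeightsIn W) (hW : 0 ≤ W) {a b : ℕ} (h : AgreeOff G G' a b) (f : ℕ → ℕ) :
    G.mateWeight f ≤ G'.mateWeight (removePair a b f) + 2 * W := by
  have : ∀ u, G.vertexWeight f u ≤ G'.vertexWeight (removePair a b f) u +
      ((if u = a then W else 0) + if u = b then W else 0) := by
    intro u
    have h1 := hG'.vertexWeight_nonneg (removePair a b f) u
    have h2 := hG.vertexWeight_le hW f u
    by_cases ha : u = a
    · rw [if_pos ha]; split_ifs <;> linarith
    by_cases hb : u = b
    · rw [if_pos hb, if_neg ha]; linarith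
    · rw [if_neg ha, if_neg hb]
      unfold vertexWeight
      rw [removePair_of_ne f ha hb]
      split_ifs
      · simp
      · rw [h u (f u - 1) (by tauto)]; simp
  refine (Finset.sum_le_sum fun u _ => this u).trans ?_
  rw [Finset.sum_add_distrib, Finset.sum_add_distrib]
  have hs : ∀ c : ℕ, ∑ u ∈ Finset.range n, (if u = c then W else 0) ≤ W := by
    intro c
    rw [Finset.sum_ite_eq']
    split_ifs <;> simp [hW]
  have := hs a
  have := hs b
  unfold mateWeight
  linarith

theorem AgreeOff.opt_le {G G' : WGraph n} {W : ℝ} (hG : G.WeightsIn W)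
    (hG' : G'.WeightsIn W) (hW : 0 ≤ W) {a b : ℕ} (h : AgreeOff G G' a b) :
    G.opt ≤ G'.opt + 2 * W :=
  WGraph.opt_le fun f hf => (h.mateWeight_le hG hG' hW f).trans
    (by have := hG'.mateWeight_le_opt hW (h.isMate hf); linarith)

theorem matchedCount_removePair (n : ℕ) (a b : ℕ) (f : ℕ → ℕ) :
    matchedCount n f ≤ matchedCount n (removePair a b f) + 2 := by
  unfold matchedCount
  refine (Finset.card_le_card (t := ((Finset.range n).filter fun u => removePair a b f u ≠ 0) ∪
    {a, b}) ?_).trans ((Finset.card_union_le _ _).trans (by gcongr; exact Finset.card_le_two))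
  intro u hu
  simp only [Finset.mem_filter, Finset.mem_union, Finset.mem_insert, Finset.mem_singleton] at hu ⊢
  by_cases h : u = a ∨ u = b
  · exact Or.inr h
  · push Not at h
    exact Or.inl ⟨hu.1, by rw [removePair_of_ne f h.1 h.2]; exact hu.2⟩

/-! Combining two matchings -/

/-- The edges of `f` inside `R` and the edges of `g` outside `R`. -/
def combine (R : Finset ℕ) (f g : ℕ → ℕ) (u : ℕ) : ℕ :=
  if u ∈ R then (if f u ≠ 0 ∧ f u - 1 ∈ R then f u else 0)
  else if g u ≠ 0 ∧ g u - 1 ∈ R then 0 else g u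

/-- Edges inside `R` and edges outside `R` have no common vertex, and `combine` drops the edges that
leave `R`. So `G` only has to agree with `Gf` within `R` and with `Gg` within the complement. -/
theorem IsMate.combine {Gf Gg G : WGraph n} {R : Finset ℕ} {f g : ℕ → ℕ} (hf : Gf.IsMate f)
    (hg : Gg.IsMate g) (h1 : ∀ u ∈ R, ∀ v ∈ R, G.lookup u v = Gf.lookup u v)
    (h2 : ∀ u ∉ R, ∀ v ∉ R, G.lookup u v = Gg.lookup u v) : G.IsMate (combine R f g) := by
  intro u hu h0
  unfold WGraph.combine at h0 ⊢
  by_cases hR : u ∈ R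
  · simp only [hR, if_true] at h0 ⊢
    by_cases hc : f u ≠ 0 ∧ f u - 1 ∈ R
    · simp only [hc, ne_eq, not_false_eq_true, and_self, if_true]
      obtain ⟨h3, h4⟩ := hf u hu hc.1
      refine ⟨by rwa [h1 _ hR _ hc.2], ?_⟩
      simp [h4, hR]
    · rw [if_neg hc] at h0; exact absurd rfl h0
  · simp only [hR, if_false] at h0 ⊢
    by_cases hc : g u ≠ 0 ∧ g u - 1 ∈ R
    · rw [if_pos hc] at h0; exact absurd rfl h0
    · rw [if_neg hc] at h0 ⊢
      obtain ⟨h3, h4⟩ := hg u hu h0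
      have h5 : g u - 1 ∉ R := fun h => hc ⟨h0, h⟩
      refine ⟨by rwa [h2 _ hR _ h5], ?_⟩
      simp [h4, hR, h5]

/-- The total weight of the edges of `f` that leave `R`. -/
def crossing (G : WGraph n) (R : Finset ℕ) (f : ℕ → ℕ) : ℝ :=
  ∑ u ∈ Finset.range n, if u ∈ R ∧ f u - 1 ∉ R then G.vertexWeight f u else 0

/-- Twice the weight of the edges of `f` inside `R`. -/
def weightInside (G : WGraph n) (R : Finset ℕ) (f : ℕ → ℕ) : ℝ :=
  ∑ u ∈ Finset.range n, if u ∈ R ∧ f u - 1 ∈ R then G.vertexWeight f u else 0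

/-- Twice the weight of the edges of `f` outside `R`. -/
def weightOutside (G : WGraph n) (R : Finset ℕ) (f : ℕ → ℕ) : ℝ :=
  ∑ u ∈ Finset.range n, if u ∉ R ∧ f u - 1 ∉ R then G.vertexWeight f u else 0

/-- A crossing edge is seen from its end in `R` and from its end outside. The partner map exchanges
the two sums, so each of them equals `crossing`. -/
theorem IsMate.mateWeight_eq {G : WGraph n} {f : ℕ → ℕ} (hf : G.IsMate f) (R : Finset ℕ) :
    G.mateWeight f = G.weightInside R f + G.weightOutside R f + 2 * G.crossing R f := by
  have key : ∑ u ∈ Finset.range n, (if u ∉ R ∧ f u - 1 ∈ R then G.vertexWeight f u else 0) =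
      G.crossing R f := by
    unfold crossing
    -- For an unmatched vertex `f u - 1` is the junk value `0`, but its weight is `0`; only matched
    -- vertices need to be summed.
    have e : ∀ (P : ℕ → Prop) [DecidablePred P],
        ∑ u ∈ Finset.range n, (if P u then G.vertexWeight f u else 0) =
          ∑ u ∈ (Finset.range n).filter (fun u => P u ∧ f u ≠ 0), G.vertexWeight f u := by
      intro P _
      rw [Finset.sum_filter]
      refine Finset.sum_congr rfl fun u _ => ?_
      by_cases h : f u = 0 <;> simp [h, vertexWeight]
    rw [e, e]
    have inv : ∀ u ∈ Finset.range n, f u ≠ 0 → f u - 1 ∈ Finset.range n ∧ f (f u - 1) = u + 1 :=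
      fun u hu h => ⟨Finset.mem_range.2 (hf.lt (Finset.mem_range.1 hu) h),
        (hf u (Finset.mem_range.1 hu) h).2⟩
    refine Finset.sum_nbij' (fun u => f u - 1) (fun u => f u - 1) ?_ ?_ ?_ ?_ ?_
    · intro u hu
      simp only [Finset.mem_filter] at hu ⊢
      obtain ⟨h1, h2⟩ := inv u hu.1 hu.2.2
      rw [h2]
      exact ⟨h1, ⟨hu.2.1.2, by simpa using hu.2.1.1⟩, by omega⟩
    · intro u hu
      simp only [Finset.mem_filter] at hu ⊢
      obtain ⟨h1, h2⟩ := inv u hu.1 hu.2.2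
      rw [h2]
      exact ⟨h1, ⟨hu.2.1.2, by simpa using hu.2.1.1⟩, by omega⟩
    · intro u hu
      simp only [Finset.mem_filter] at hu
      simp [(inv u hu.1 hu.2.2).2]
    · intro u hu
      simp only [Finset.mem_filter] at hu
      simp [(inv u hu.1 hu.2.2).2]
    · intro u hu
      simp only [Finset.mem_filter] at hu
      simp [vertexWeight, hu.2.2, (inv u hu.1 hu.2.2).2, G.lookup_symm u]
  have : G.mateWeight f = G.weightInside R f + G.weightOutside R f + G.crossing R f +
      ∑ u ∈ Finset.range n, (if u ∉ R ∧ f u - 1 ∈ R then G.vertexWeight f u else 0) := by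
    unfold mateWeight weightInside weightOutside crossing
    rw [← Finset.sum_add_distrib, ← Finset.sum_add_distrib, ← Finset.sum_add_distrib]
    refine Finset.sum_congr rfl fun u _ => ?_
    by_cases h1 : u ∈ R <;> by_cases h2 : f u - 1 ∈ R <;> simp [h1, h2]
  rw [this, key]; ring

theorem mateWeight_combine {Gf Gg G : WGraph n} {R : Finset ℕ} {f g : ℕ → ℕ}
    (h1 : ∀ u ∈ R, ∀ v ∈ R, G.lookup u v = Gf.lookup u v)
    (h2 : ∀ u ∉ R, ∀ v ∉ R, G.lookup u v = Gg.lookup u v) :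
    G.mateWeight (combine R f g) = Gf.weightInside R f + Gg.weightOutside R g := by
  unfold mateWeight weightInside weightOutside
  rw [← Finset.sum_add_distrib]
  refine Finset.sum_congr rfl fun u _ => ?_
  unfold vertexWeight combine
  by_cases hu : u ∈ R
  · by_cases hf : f u = 0
    · simp [hu, hf]
    · by_cases hf' : f u - 1 ∈ R
      · simp [hu, hf, hf', h1 u hu _ hf']
      · simp [hu, hf']
  · by_cases hg : g u = 0
    · simp [hu, hg]
    · by_cases hg' : g u - 1 ∈ R
      · simp [hu, hg, hg']
      · simp [hu, hg, hg', h2 u hu _ hg']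

/-- Replacing an earlier matching `F` by the current matching `M` inside `R` loses no more than the
edges that leave `R` and what `F` lost against the optimum. -/
theorem mateWeight_combine_ge {Gq Gp : WGraph n} {W : ℝ} (hGq : Gq.WeightsIn W) (hW : 0 ≤ W)
    {R : Finset ℕ} {M F : ℕ → ℕ} (hM : Gp.IsMate M) (hF : Gq.IsMate F)
    (hR : ∀ u v, u ∉ R → Gp.lookup u v = Gq.lookup u v) :
    Gp.mateWeight M - (Gq.opt - Gq.mateWeight F) - 2 * Gp.crossing R M - 2 * Gq.crossing R F ≤
      Gp.mateWeight (combine R M F) := by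
  have h1 := mateWeight_combine (Gf := Gp) (Gg := Gq) (G := Gp) (R := R) (f := M) (g := F)
    (fun _ _ _ _ => rfl) (fun u hu v _ => hR u v hu)
  -- The opposite combination, `F` inside `R` and `M` outside, is a matching of the earlier graph,
  -- hence at most `Gq.opt`. The two combinations together contain all edges of `M` and `F` except
  -- the crossing ones.
  have h2 := mateWeight_combine (Gf := Gq) (Gg := Gp) (G := Gq) (R := R) (f := F) (g := M)
    (fun _ _ _ _ => rfl) (fun u hu v _ => (hR u v hu).symm)
  have h3 := hGq.mateWeight_le_opt hW (IsMate.combine (G := Gq) (R := R) hF hM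
    (fun _ _ _ _ => rfl) (fun u hu v _ => (hR u v hu).symm))
  have h4 := hM.mateWeight_eq R
  have h5 := hF.mateWeight_eq R
  linarith

end WGraph

end

noncomputable section

/-! Matchings as sets of edges and as functions -/

namespace WGraph

variable {n : ℕ}

open Classical in
/-- The set of edges that `f` codes. -/
def edgesOf (n : ℕ) (f : ℕ → ℕ) : Finset (Sym2 (Fin n)) :=
  Finset.univ.filter fun e => ∃ u v : Fin n, e = s(u, v) ∧ f u = v + 1

theorem IsMate.mem_edgesOf {G : WGraph n} {f : ℕ → ℕ} (hf : G.IsMate f) {u v : Fin n} :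
    s(u, v) ∈ edgesOf n f ↔ f u = v + 1 := by
  simp only [edgesOf, Finset.mem_filter, Finset.mem_univ, true_and]
  constructor
  · rintro ⟨u', v', h, h'⟩
    rcases Sym2.eq_iff.1 h with ⟨rfl, rfl⟩ | ⟨rfl, rfl⟩
    · exact h'
    · have := (hf _ v.2 (by omega)).2
      rwa [h', Nat.add_sub_cancel] at this
  · exact fun h => ⟨u, v, rfl, h⟩

theorem IsMate.isMatching {G : WGraph n} {f : ℕ → ℕ} (hf : G.IsMate f) :
    G.IsMatching (edgesOf n f) := by
  have key : ∀ e ∈ edgesOf n f, ∀ v : Fin n, v ∈ e → ∃ w : Fin n, e = s(v, w) ∧ f v = w + 1 := by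
    intro e he v hv
    obtain ⟨w, rfl⟩ := Sym2.mem_iff_exists.1 hv
    exact ⟨w, rfl, hf.mem_edgesOf.1 he⟩
  constructor
  · intro e he
    simp only [edgesOf, Finset.mem_filter, Finset.mem_univ, true_and] at he
    obtain ⟨u, v, rfl, h⟩ := he
    have h1 := (hf u u.2 (by omega)).1
    rw [h, Nat.add_sub_cancel] at h1
    obtain ⟨_, _, h2⟩ := lookup_ne_zero h1
    exact (SimpleGraph.mem_edgeSet _).2 h2
  · intro e he e' he' v hv hv'
    obtain ⟨w, rfl, hw⟩ := key e he v hv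
    obtain ⟨w', rfl, hw'⟩ := key e' he' v hv'
    have : w = w' := by ext; omega
    rw [this]

/-- Vertices are grouped by the edge at them; the fibre over an edge consists of its two distinct
endpoints. Used both for weights and for counting. -/
theorem IsMate.sum_edgesOf {G : WGraph n} {f : ℕ → ℕ} (hf : G.IsMate f) (g : Sym2 (Fin n) → ℝ)
    (h : ℕ → ℝ) (hgh : ∀ u v : Fin n, f u = v + 1 → h u = g s(u, v)) (h0 : ∀ u, f u = 0 → h u = 0) :
    ∑ u ∈ Finset.range n, h u = 2 * ∑ e ∈ edgesOf n f, g e := by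
  classical
  have hlt : ∀ u : Fin n, f u ≠ 0 → f u - 1 < n := fun u hu => hf.lt u.2 hu
  set U : Finset (Fin n) := Finset.univ.filter fun u => f u ≠ 0 with hU
  have e1 : ∑ u ∈ Finset.range n, h u = ∑ u ∈ U, h u := by
    rw [Finset.sum_range, hU, Finset.sum_filter]
    refine Finset.sum_congr rfl fun u _ => ?_
    split_ifs with hu
    · rfl
    · exact h0 _ (not_not.1 hu)
  -- The loop `s(u, u)` is a default for unmatched vertices, which are not in `U`.
  let φ : Fin n → Sym2 (Fin n) := fun u => if hu : f u ≠ 0 then s(u, ⟨f u - 1, hlt u hu⟩) else s(u, u)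
  have hφ : ∀ u v : Fin n, f u = v + 1 → φ u = s(u, v) := by
    intro u v huv
    have hu : f u ≠ 0 := by omega
    simp only [φ, dif_pos hu]
    have : (⟨f u - 1, hlt u hu⟩ : Fin n) = v := by ext; simp [huv]
    rw [this]
  have hmem : ∀ u ∈ U, ∃ v : Fin n, f u = v + 1 := by
    intro u hu
    have hu : f u ≠ 0 := by simpa [hU] using hu
    exact ⟨⟨f u - 1, hlt u hu⟩, by simp; omega⟩
  have hmaps : ∀ u ∈ U, φ u ∈ edgesOf n f := by
    intro u hu
    obtain ⟨v, hv⟩ := hmem u hu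
    rw [hφ u v hv]
    exact hf.mem_edgesOf.2 hv
  rw [e1, ← Finset.sum_fiberwise_of_maps_to hmaps, Finset.mul_sum]
  refine Finset.sum_congr rfl fun e he => ?_
  have he' := he
  simp only [edgesOf, Finset.mem_filter, Finset.mem_univ, true_and] at he
  obtain ⟨u, v, rfl, huv⟩ := he
  have hvu : f v = u + 1 := by
    have := (hf u u.2 (by omega)).2
    rwa [huv, Nat.add_sub_cancel] at this
  have hne : u ≠ v := by
    rintro rfl
    exact hf.ne u.2 (by omega) (by omega)
  have : U.filter (fun w => φ w = s(u, v)) = {u, v} := by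
    ext w
    simp only [Finset.mem_filter, Finset.mem_insert, Finset.mem_singleton]
    constructor
    · rintro ⟨hw, hw'⟩
      obtain ⟨x, hx⟩ := hmem w hw
      rw [hφ w x hx] at hw'
      rcases Sym2.eq_iff.1 hw' with h | h <;> tauto
    · rintro (rfl | rfl)
      · exact ⟨by simp [hU]; omega, hφ _ _ huv⟩
      · exact ⟨by simp [hU]; omega, by rw [hφ _ _ hvu, Sym2.eq_swap]⟩
  rw [this, Finset.sum_pair hne, hgh u v huv, hgh v u hvu, Sym2.eq_swap]
  ring

theorem IsMate.mateWeight_eq_sum {G : WGraph n} {f : ℕ → ℕ} (hf : G.IsMate f) :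
    G.mateWeight f = 2 * ∑ e ∈ edgesOf n f, G.weight e := by
  refine hf.sum_edgesOf _ _ (fun u v huv => ?_) (fun u hu => by simp [vertexWeight, hu])
  have hu : f u ≠ 0 := by omega
  have h1 := (hf u u.2 hu).1
  rw [vertexWeight, if_neg hu]
  rw [huv, Nat.add_sub_cancel] at h1 ⊢
  obtain ⟨_, _, h2⟩ := lookup_ne_zero h1
  exact lookup_fin G h2

theorem IsMate.matchedCount_eq {G : WGraph n} {f : ℕ → ℕ} (hf : G.IsMate f) :
    matchedCount n f = 2 * (edgesOf n f).card := by
  have := hf.sum_edgesOf (fun _ => 1) (fun u => if f u ≠ 0 then 1 else 0)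
    (fun u v huv => by simp [huv]) (fun u hu => by simp [hu])
  rw [matchedCount, Finset.card_filter]
  simp only [Finset.sum_const, nsmul_eq_mul, mul_one] at this
  exact_mod_cast this

/-- Every matching is coded by some function. -/
theorem WeightsIn.exists_isMate {G : WGraph n} {W : ℝ} (hG : G.WeightsIn W)
    {N : Finset (Sym2 (Fin n))} (hN : G.IsMatching N) : ∃ f, G.IsMate f ∧ edgesOf n f = N := by
  classical
  let f : ℕ → ℕ := fun u =>
    if h : ∃ (hu : u < n) (v : Fin n), s(⟨u, hu⟩, v) ∈ N then h.choose_spec.choose + 1 else 0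
  have hf : ∀ u v : Fin n, f u = v + 1 ↔ s(u, v) ∈ N := by
    intro u v
    by_cases h : ∃ (hu : (u : ℕ) < n) (v : Fin n), s(⟨u, hu⟩, v) ∈ N
    · have h1 : s(u, h.choose_spec.choose) ∈ N := h.choose_spec.choose_spec
      have h2 : f u = h.choose_spec.choose + 1 := dif_pos h
      rw [h2]
      constructor
      · intro h3
        have : h.choose_spec.choose = v := by ext; omega
        rwa [this] at h1
      · intro h3
        have := hN.2 _ h1 _ h3 u (Sym2.mem_mk_left _ _) (Sym2.mem_mk_left _ _)
        rcases Sym2.eq_iff.1 this with h4 | h4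
        · rw [h4.2]
        · have h5 : h.choose_spec.choose = v := h4.2.trans h4.1
          rw [h5]
    · have h2 : f u = 0 := dif_neg h
      rw [h2]
      refine ⟨fun h3 => by omega, fun h3 => absurd ⟨u.2, v, h3⟩ h⟩
  have hmate : G.IsMate f := by
    intro u hu h0
    have h : ∃ (hu : u < n) (v : Fin n), s(⟨u, hu⟩, v) ∈ N := by
      by_contra h; exact h0 (dif_neg h)
    obtain ⟨_, v, hv⟩ := h
    have h1 : f u = v + 1 := (hf ⟨u, hu⟩ v).2 hv
    have h2 : f v = u + 1 := (hf v ⟨u, hu⟩).2 (by rwa [Sym2.eq_swap])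
    rw [h1, Nat.add_sub_cancel]
    exact ⟨hG.lookup_ne_zero_of_adj (u := ⟨u, hu⟩) ((SimpleGraph.mem_edgeSet _).1 (hN.1 _ hv)), h2⟩
  refine ⟨f, hmate, ?_⟩
  ext e
  induction e with
  | _ u v => rw [hmate.mem_edgesOf, hf]

theorem matchingNumber_bdd (G : WGraph n) :
    BddAbove {k : ℕ | ∃ M : Finset (Sym2 (Fin n)), G.IsMatching M ∧ M.card = k} :=
  ⟨Fintype.card (Sym2 (Fin n)), by rintro _ ⟨M, -, rfl⟩; exact Finset.card_le_univ M⟩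

theorem IsMatching.card_le {G : WGraph n} {M : Finset (Sym2 (Fin n))} (hM : G.IsMatching M) :
    M.card ≤ G.matchingNumber := le_csSup G.matchingNumber_bdd ⟨M, hM, rfl⟩

theorem IsMate.matchedCount_le {G : WGraph n} {f : ℕ → ℕ} (hf : G.IsMate f) :
    matchedCount n f ≤ 2 * G.matchingNumber := by
  rw [hf.matchedCount_eq]
  exact Nat.mul_le_mul_left _ hf.isMatching.card_le

theorem WeightsIn.isApproxMWM_of {G : WGraph n} {W : ℝ} (hG : G.WeightsIn W) (hW : 0 ≤ W)
    {f : ℕ → ℕ} (hf : G.IsMate f) {δ : ℝ} (h : (1 - δ) * G.opt ≤ G.mateWeight f) :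
    G.IsApproxMWM δ (edgesOf n f) := by
  refine ⟨hf.isMatching, fun N hN => ?_⟩
  obtain ⟨g, hg, rfl⟩ := hG.exists_isMate hN
  have h1 := hf.mateWeight_eq_sum
  have h2 := hg.mateWeight_eq_sum
  have h3 := hG.mateWeight_le_opt hW hg
  have h4 := hG.mateWeight_nonneg g
  have h5 := hG.mateWeight_nonneg f
  -- The error `C ε log W` may exceed `1`; then the required lower bound is not positive.
  by_cases hδ : 0 ≤ 1 - δ
  · nlinarith
  · have : (1 - δ) * ∑ e ∈ edgesOf n g, G.weight e ≤ 0 :=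
      mul_nonpos_of_nonpos_of_nonneg (by linarith) (by linarith)
    linarith

theorem IsApproxMWM.opt_le {G : WGraph n} {δ : ℝ} (hδ : δ < 1) {f : ℕ → ℕ} (hf : G.IsMate f)
    (h : G.IsApproxMWM δ (edgesOf n f)) : (1 - δ) * G.opt ≤ G.mateWeight f := by
  have : G.opt ≤ G.mateWeight f / (1 - δ) := by
    refine WGraph.opt_le fun g hg => ?_
    rw [le_div_iff₀ (by linarith)]
    have h1 := hf.mateWeight_eq_sum
    have h2 := hg.mateWeight_eq_sum
    have h3 := h.2 _ hg.isMatching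
    rw [h1, h2]
    linarith
  rw [le_div_iff₀ (by linarith)] at this
  linarith

/-- A memory that stores a mate function stores its set of edges. -/
theorem IsMate.stores {G : WGraph n} {σ : Memory} (hf : G.IsMate (σ.word 2)) :
    σ.Stores (edgesOf n (σ.word 2)) :=
  fun u => ⟨hf.le u.2, fun _ => hf.mem_edgesOf.symm⟩

/-- The number of edges that change is at most twice the number of vertices that change. -/
theorem card_symmDiff_edgesOf_le {G G' : WGraph n} {f g : ℕ → ℕ} (hf : G.IsMate f)
    (hg : G'.IsMate g) (D : Finset ℕ) (hD : ∀ u ∉ D, g u = f u) :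
    (symmDiff (edgesOf n f) (edgesOf n g)).card ≤ 2 * D.card := by
  classical
  have key : ∀ {H H' : WGraph n} {f g : ℕ → ℕ}, H.IsMate f → H'.IsMate g →
      (∀ u ∉ D, g u = f u) → (edgesOf n f \ edgesOf n g).card ≤ D.card := by
    intro H H' f g hf hg hD
    have h1 : (Finset.univ.filter fun u : Fin n => (u : ℕ) ∈ D).card ≤ D.card :=
      Finset.card_le_card_of_injOn (fun u => (u : ℕ)) (by intro u hu; simpa using hu)
        (fun u _ v _ h => Fin.ext h)
    -- An edge `s(u, v)` coded by `f` but not by `g` has `f u ≠ g u`, so `u` lies in `D`; and `u`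
    -- determines the edge through `f`.
    refine le_trans (le_trans (Finset.card_le_card ?_) (Finset.card_image_le (f := fun u : Fin n =>
      if h : f u - 1 < n then s(u, ⟨f u - 1, h⟩) else s(u, u)))) h1
    intro e he
    obtain ⟨he1, he2⟩ := Finset.mem_sdiff.1 he
    induction e with
    | _ u v =>
      rw [hf.mem_edgesOf] at he1
      rw [hg.mem_edgesOf] at he2
      refine Finset.mem_image.2 ⟨u, ?_, ?_⟩
      · simp only [Finset.mem_filter, Finset.mem_univ, true_and]
        by_contra hu
        exact he2 ((hD u hu).trans he1)
      · have : f u - 1 = v := by omega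
        rw [dif_pos (by omega)]
        congr 2
  have h1 := key hf hg hD
  have h2 := key hg hf (fun u hu => (hD u hu).symm)
  calc (symmDiff (edgesOf n f) (edgesOf n g)).card
      ≤ (edgesOf n f \ edgesOf n g).card + (edgesOf n g \ edgesOf n f).card :=
        Finset.card_union_le _ _
    _ ≤ 2 * D.card := by omega

/-! The effect of updates -/

/-- Without the edge `s(a, b)`, a matching of the new graph is a matching of the old one. -/
theorem IsMatching.card_apply_le {G G' : WGraph n} (a b : Fin n)
    (h : ∀ u v, ¬ (u = a ∧ v = b ∨ u = b ∧ v = a) → G'.graph.Adj u v → G.graph.Adj u v) :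
    G'.matchingNumber ≤ G.matchingNumber + 1 := by
  classical
  refine csSup_le ⟨0, ∅, ⟨by simp, by simp⟩, rfl⟩ ?_
  rintro _ ⟨M, hM, rfl⟩
  have h1 : G.IsMatching (M.erase s(a, b)) := by
    refine ⟨fun e he => ?_, fun e he f hf => hM.2 e (Finset.mem_of_mem_erase he) f
      (Finset.mem_of_mem_erase hf)⟩
    obtain ⟨h1, h2⟩ := Finset.mem_erase.1 he
    induction e with
    | _ u v =>
      refine (SimpleGraph.mem_edgeSet _).2 (h u v ?_ ((SimpleGraph.mem_edgeSet _).1 (hM.1 _ h2)))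
      rintro (⟨rfl, rfl⟩ | ⟨rfl, rfl⟩)
      · exact h1 rfl
      · exact h1 Sym2.eq_swap
  have h2 := h1.card_le
  have h3 := Finset.pred_card_le_card_erase (s := M) (a := s(a, b))
  omega

end WGraph

namespace Update

variable {n : ℕ}

/-- The first endpoint of the updated pair. -/
def fst : Update n → Fin n
  | ins u _ _ => u
  | del u _ => u

/-- The second endpoint of the updated pair. -/
def snd : Update n → Fin n
  | ins _ v _ => v
  | del _ v => v

theorem adj_apply_iff (G : WGraph n) (x : Update n) (u v : Fin n)
    (h : ¬ (u = x.fst ∧ v = x.snd ∨ u = x.snd ∧ v = x.fst)) :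
    (x.apply G).graph.Adj u v ↔ G.graph.Adj u v := by
  cases x with
  | ins a b y =>
    simp only [fst, snd] at h
    simp only [apply, SimpleGraph.sup_adj, SimpleGraph.edge_adj]
    tauto
  | del a b =>
    simp only [fst, snd] at h
    simp only [apply, SimpleGraph.deleteEdges_adj, Set.mem_singleton_iff, Sym2.eq_iff]
    tauto

theorem agreeOff_apply (G : WGraph n) (x : Update n) :
    WGraph.AgreeOff G (x.apply G) x.fst x.snd := by
  intro u v h
  unfold WGraph.lookup
  by_cases huv : u < n ∧ v < n
  · have h' : ¬ ((⟨u, huv.1⟩ : Fin n) = x.fst ∧ (⟨v, huv.2⟩ : Fin n) = x.snd ∨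
        (⟨u, huv.1⟩ : Fin n) = x.snd ∧ (⟨v, huv.2⟩ : Fin n) = x.fst) := by
      simpa [Fin.ext_iff] using h
    have hw : (x.apply G).weight s(⟨u, huv.1⟩, ⟨v, huv.2⟩) =
        G.weight s(⟨u, huv.1⟩, ⟨v, huv.2⟩) := by
      cases x with
      | ins a b y =>
        refine Function.update_of_ne ?_ _ _
        rw [Ne, Sym2.eq_iff]
        exact h'
      | del a b => rfl
    rw [dif_pos huv, dif_pos huv, hw]
    classical exact if_congr (adj_apply_iff G x _ _ h') rfl rfl
  · rw [dif_neg huv, dif_neg huv]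

theorem weightsIn_apply {G : WGraph n} {W : ℝ} (hG : G.WeightsIn W) {x : Update n}
    (hx : x.Valid G W) : (x.apply G).WeightsIn W := by
  intro e he
  induction e with
  | _ u v =>
    have he := (SimpleGraph.mem_edgeSet _).1 he
    cases x with
    | ins a b y =>
      by_cases h : s(u, v) = s(a, b)
      · rw [h]; simpa [apply] using hx.2.2
      · have : G.graph.Adj u v := by
          refine (adj_apply_iff G (.ins a b y) u v ?_).1 he
          rw [← Sym2.eq_iff]; exact h
        have h2 : (apply G (.ins a b y)).weight s(u, v) = G.weight s(u, v) :=
          Function.update_of_ne h _ _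
        rw [h2]
        exact hG _ ((SimpleGraph.mem_edgeSet _).2 this)
    | del a b =>
      have : G.graph.Adj u v := by
        simp only [apply, SimpleGraph.deleteEdges_adj] at he
        exact he.1
      exact hG _ ((SimpleGraph.mem_edgeSet _).2 this)

theorem matchingNumber_apply_le (G : WGraph n) (x : Update n) :
    (x.apply G).matchingNumber ≤ G.matchingNumber + 1 :=
  WGraph.IsMatching.card_apply_le x.fst x.snd fun u v h => (adj_apply_iff G x u v h).1

end Update

namespace UpdateSeq

variable {n : ℕ}

theorem graphAt_succ (S : UpdateSeq n) {i : ℕ} (h : i < S.updates.length) :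
    S.graphAt (i + 1) = (S.updates[i]).apply (S.graphAt i) := by
  unfold graphAt
  rw [List.take_succ_eq_append_getElem h, List.foldl_append]
  rfl

theorem weightsIn {mdl : UpdateModel} {m : ℕ} {W : ℝ} {S : UpdateSeq n}
    (hS : S ∈ mdl.sequences n m W) : ∀ i ≤ S.length, (S.graphAt i).WeightsIn W := by
  intro i
  induction i with
  | zero => exact fun _ => hS.1
  | succ i ih =>
    intro hi
    rw [graphAt_succ S hi]
    exact Update.weightsIn_apply (ih (Nat.le_of_succ_le hi)) (hS.2.1 i hi).1

theorem matchingNumber_le (S : UpdateSeq n) :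
    ∀ i ≤ S.length, (S.graphAt i).matchingNumber ≤ S.start.matchingNumber + i := by
  intro i
  induction i with
  | zero => exact fun _ => le_rfl
  | succ i ih =>
    intro hi
    rw [graphAt_succ S hi]
    have := Update.matchingNumber_apply_le (S.graphAt i) (S.updates[i]'hi)
    have := ih (Nat.le_of_succ_le hi)
    omega

end UpdateSeq

/-! The matching of a dynamic algorithm -/

namespace DynAlg

variable {n : ℕ}

/-- The matching that the algorithm maintains in the state `s`, as a function. -/
def mateFun (A : DynAlg n) (s : A.State) (u : ℕ) : ℕ :=
  if h : u < n then mateCode (A.mate s ⟨u, h⟩) else 0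

theorem mateFun_eq_iff {A : DynAlg n} {s : A.State} {T : ℝ} (h : A.VertexMatch s T) (u v : Fin n) :
    A.mateFun s u = v + 1 ↔ s(u, v) ∈ A.matching s := by
  rw [← h.mate_iff, mateFun, dif_pos u.2]
  cases hm : A.mate s ⟨u, u.2⟩ with
  | none => simp [mateCode]
  | some w =>
    simp [mateCode, Fin.ext_iff]

theorem isMate_mateFun {A : DynAlg n} {s : A.State} {T : ℝ} (h : A.VertexMatch s T) {G : WGraph n}
    {W : ℝ} (hG : G.WeightsIn W) (hM : G.IsMatching (A.matching s)) : G.IsMate (A.mateFun s) := by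
  intro u hu h0
  have : ∃ v : Fin n, A.mateFun s u = v + 1 := by
    unfold mateFun at h0 ⊢
    rw [dif_pos hu] at h0 ⊢
    cases hm : A.mate s ⟨u, hu⟩ with
    | none => simp [hm, mateCode] at h0
    | some v => exact ⟨v, rfl⟩
  obtain ⟨v, hv⟩ := this
  have h1 := (mateFun_eq_iff h ⟨u, hu⟩ v).1 hv
  have h2 := (mateFun_eq_iff h v ⟨u, hu⟩).2 (by rwa [Sym2.eq_swap])
  rw [hv, Nat.add_sub_cancel]
  exact ⟨hG.lookup_ne_zero_of_adj (u := ⟨u, hu⟩) ((SimpleGraph.mem_edgeSet _).1 (hM.1 _ h1)), h2⟩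

theorem edgesOf_mateFun {A : DynAlg n} {s : A.State} {T : ℝ} (h : A.VertexMatch s T) {G : WGraph n}
    {W : ℝ} (hG : G.WeightsIn W) (hM : G.IsMatching (A.matching s)) :
    WGraph.edgesOf n (A.mateFun s) = A.matching s := by
  ext e
  induction e with
  | _ u v => rw [(isMate_mateFun h hG hM).mem_edgesOf, mateFun_eq_iff h]

theorem length_edges {A : DynAlg n} {s : A.State} {T : ℝ} (h : A.VertexMatch s T) :
    (A.edges s).length = (A.matching s).card := by
  classical
  have : A.matching s = ((A.edges s).map fun p => s(p.1, p.2)).toFinset := by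
    ext e; rw [List.mem_toFinset, h.mem_edges]
  rw [this, List.toFinset_card_of_nodup h.edges_nodup, List.length_map]

end DynAlg

end

noncomputable section

/-! The memory layout: word arrays -/

notation "aM" => 2
notation "aTU" => 10
notation "aTV" => 11
notation "vCnt" => 12
notation "vSc" => 13
notation "vMax" => 14
notation "aLA" => 15
notation "aLB" => 16
notation "vLN" => 17
notation "aLC" => 18
notation "aLV" => 19
notation "vH" => 20
notation "aPos" => 21
notation "aMark" => 22
notation "vSp" => 23
notation "aQ" => 24
notation "vQn" => 25
notation "aIn" => 26
notation "vHi" => 28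
notation "vLay" => 29
notation "vBest" => 30
notation "vI" => 31
notation "vY" => 32
notation "vL" => 33
notation "vFin" => 34
notation "vOk" => 35
notation "vC" => 40
notation "vX" => 41
notation "vV" => 42
notation "vA" => 43
notation "vEu" => 44
notation "vEv" => 45
notation "vP" => 46

/-! The memory layout: real arrays -/

notation "rWV" => 4
notation "rLR" => 5
notation "rWt" => 6
notation "rR" => 7
notation "rCst" => 8
notation "rBest" => 9
notation "rD" => 10
notation "rRr" => 11
notation "rY" => 12

/-- The scalar in the cell `0` of a word array. -/
abbrev WExp.var (a : ℕ) : WExp := .get a (.const 0)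

/-- The scalar in the cell `0` of a real array. -/
abbrev RExp.var (a : ℕ) : RExp := .get a (.const 0)

/-- Assignment to a scalar. -/
abbrev Prog.assign (a : ℕ) (x : WExp) : Prog := .setWord a (.const 0) x

/-- Assignment to a real scalar. -/
abbrev Prog.assignReal (a : ℕ) (x : RExp) : Prog := .setReal a (.const 0) x

/-- Equality of words. -/
abbrev Test.wordEq (x y : WExp) : Test := .both (.wordLe x y) (.wordLe y x)

theorem Test.holds_wordEq {n : ℕ} (G : WGraph n) (σ : Memory) (x y : WExp) :
    (Test.wordEq x y).Holds G σ ↔ x.eval σ = y.eval σ := by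
  simp only [Test.Holds]; omega

/-! ### Elementary operations on the stored matching, and the undo log. -/

namespace Prog

/-- Change the partner of the vertex `vC` to `vX` and the weight at `vC` to `rY`, and log it. -/
def set : Prog := block [
  setWord aLC (.var vH) (.var vC),
  setWord aLV (.var vH) (.get aM (.var vC)),
  setReal rLR (.var vH) (.get rWV (.var vC)),
  assign vH (.add (.var vH) (.const 1)),
  assignReal rWt (.add (.var rWt) (.sub (.var rY) (.get rWV (.var vC)))),
  setWord aM (.var vC) (.var vX),
  setReal rWV (.var vC) (.var rY)]

/-- Remove the edge at the vertex `vV`. -/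
def remove : Prog := block [
  assign vA (.get aM (.var vV)),
  branch (.wordLe (.var vA) (.const 0)) skip (block [
    assign vC (.sub (.var vA) (.const 1)),
    assign vX (.const 0),
    assignReal rY (.ofWord (.const 0)),
    set,
    assign vC (.var vV),
    set])]

/-- Remove the edge between `vEu` and `vEv`. -/
def touch : Prog :=
  branch (.wordEq (.get aM (.var vEu)) (.add (.var vEv) (.const 1)))
    (block [assign vV (.var vEu), remove]) skip

/-- Undo the logged changes down to the mark of the top of the stack. -/
def revert : Prog :=
  loop (.neg (.wordLe (.var vH) (.get aMark (.var vSp)))) (block [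
    assign vH (.sub (.var vH) (.const 1)),
    assignReal rWt (.add (.var rWt)
      (.sub (.get rLR (.var vH)) (.get rWV (.get aLC (.var vH))))),
    setWord aM (.get aLC (.var vH)) (.get aLV (.var vH)),
    setReal rWV (.get aLC (.var vH)) (.get rLR (.var vH))])

/-- Append the vertex `vP` to the queue, unless it is there. -/
def push : Prog :=
  branch (.wordEq (.get aIn (.var vP)) (.const 0)) (block [
    setWord aQ (.var vQn) (.var vP),
    assign vQn (.add (.var vQn) (.const 1)),
    setWord aIn (.var vP) (.const 1)]) skip

end Prog

/-- A mate function together with the weights at the vertices. -/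
abbrev MateState := (ℕ → ℕ) × (ℕ → ℝ)

/-- The log of changes is in order: `hist j` is the matching when the log had length `j`. -/
structure LogInv (n : ℕ) (hist : ℕ → MateState) (σ : Memory) : Prop where
  cur : hist (σ.word vH 0) = (σ.word aM, σ.real rWV)
  undo : ∀ j < σ.word vH 0, hist j =
    (Function.update (hist (j + 1)).1 (σ.word aLC j) (σ.word aLV j),
      Function.update (hist (j + 1)).2 (σ.word aLC j) (σ.real rLR j))
  bound : ∀ j < σ.word vH 0, σ.word aLC j < n ∧ σ.word aLV j ≤ n
  val : ∀ u < n, σ.word aM u ≤ n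
  wt : σ.real rWt 0 = ∑ u ∈ Finset.range n, σ.real rWV u

/-- The log is in order, and up to the length `m` it yields the matchings `hist`. -/
def Logged (n : ℕ) (hist : ℕ → MateState) (m : ℕ) (σ : Memory) : Prop :=
  ∃ hist', LogInv n hist' σ ∧ m ≤ σ.word vH 0 ∧ ∀ j ≤ m, hist' j = hist j

theorem LogInv.of_eq {n : ℕ} {hist : ℕ → MateState} {σ τ : Memory} (h : LogInv n hist σ)
    (h1 : τ.word aM = σ.word aM) (h2 : τ.word vH = σ.word vH) (h3 : τ.word aLC = σ.word aLC)
    (h4 : τ.word aLV = σ.word aLV) (h5 : τ.real rWV = σ.real rWV) (h6 : τ.real rLR = σ.real rLR)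
    (h7 : τ.real rWt = σ.real rWt) : LogInv n hist τ := by
  obtain ⟨a, b, c, d, e⟩ := h
  constructor
  · rw [h2, h1, h5]; exact a
  · rw [h2, h3, h4, h6]; exact b
  · rw [h2, h3, h4]; exact c
  · rw [h1]; exact d
  · rw [h7, h5]; exact e

theorem Logged.of_eq {n : ℕ} {hist : ℕ → MateState} {m : ℕ} {σ τ : Memory} (h : Logged n hist m σ)
    (h1 : τ.word aM = σ.word aM) (h2 : τ.word vH = σ.word vH) (h3 : τ.word aLC = σ.word aLC)
    (h4 : τ.word aLV = σ.word aLV) (h5 : τ.real rWV = σ.real rWV) (h6 : τ.real rLR = σ.real rLR)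
    (h7 : τ.real rWt = σ.real rWt) : Logged n hist m τ := by
  obtain ⟨hist', h, hm, h'⟩ := h
  exact ⟨hist', h.of_eq h1 h2 h3 h4 h5 h6 h7, by rwa [h2], h'⟩

theorem Logged.val {n : ℕ} {hist : ℕ → MateState} {m : ℕ} {σ : Memory} (h : Logged n hist m σ) :
    ∀ u < n, σ.word aM u ≤ n := by
  obtain ⟨_, h, -⟩ := h; exact h.val

theorem Logged.le {n : ℕ} {hist : ℕ → MateState} {m : ℕ} {σ : Memory} (h : Logged n hist m σ) :
    m ≤ σ.word vH 0 := by
  obtain ⟨_, -, h, -⟩ := h; exact h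

theorem Logged.mono {n : ℕ} {hist : ℕ → MateState} {m m' : ℕ} {σ : Memory}
    (h : Logged n hist m σ) (hm : m' ≤ m) : Logged n hist m' σ := by
  obtain ⟨hist', h1, h2, h3⟩ := h
  exact ⟨hist', h1, hm.trans h2, fun j hj => h3 j (hj.trans hm)⟩

theorem Logged.wt {n : ℕ} {hist : ℕ → MateState} {m : ℕ} {σ : Memory} (h : Logged n hist m σ) :
    σ.real rWt 0 = ∑ u ∈ Finset.range n, σ.real rWV u := by
  obtain ⟨_, h, -⟩ := h; exact h.wt

/-- `f` pairs up vertices. -/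
def Pairing (n : ℕ) (f : ℕ → ℕ) : Prop := ∀ u < n, f u ≠ 0 → f u - 1 < n ∧ f (f u - 1) = u + 1

theorem WGraph.IsMate.pairing {n : ℕ} {G : WGraph n} {f : ℕ → ℕ} (hf : G.IsMate f) :
    Pairing n f := fun _ hu h => ⟨hf.lt hu h, (hf _ hu h).2⟩

namespace Env

variable {n : ℕ} {E : Env n} {hist : ℕ → MateState} {m : ℕ} {σ : Memory}

theorem sum_update (f : ℕ → ℝ) {c : ℕ} (hc : c < n) (y : ℝ) :
    ∑ u ∈ Finset.range n, Function.update f c y u = ∑ u ∈ Finset.range n, f u + (y - f c) := by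
  rw [Finset.sum_update_of_mem (Finset.mem_range.2 hc),
    ← Finset.add_sum_erase _ _ (Finset.mem_range.2 hc), Finset.sdiff_singleton_eq_erase]
  ring

/-- The old values at the vertex are logged before they are overwritten. The recorded history grows
by one state, and its first `m + 1` states survive since `m` is at most the old length of the log.
-/
theorem wp_set (hL : Logged n hist m σ) (hc : σ.word vC 0 < n) (hx : σ.word vX 0 ≤ n)
    (hB : n < E.B) (hh : σ.word vH 0 + 1 < E.B) :
    E.wp .set (fun τ x => x = 7 ∧ Logged n hist m τ ∧
      τ.word aM = Function.update (σ.word aM) (σ.word vC 0) (σ.word vX 0) ∧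
      τ.real rWV = Function.update (σ.real rWV) (σ.word vC 0) (σ.real rY 0) ∧
      τ.word vH 0 = σ.word vH 0 + 1) σ := by
  have hv := hL.val _ hc
  simp only [Prog.set, wp_block_cons, wp_block_one, wp_setWord, wp_setReal, WExp.eval, RExp.eval,
    Memory.word_setWord, Memory.real_setWord, Memory.real_setReal, Memory.word_setReal,
    Nat.reduceEqDiff, if_true, if_false, Function.update_self]
  obtain ⟨hist', h, hm, h'⟩ := hL
  refine ⟨by omega, by omega, by omega, by omega, by omega, by omega, hh, by omega, by omega,
    by omega, by omega, trivial, ?_, trivial, trivial, trivial⟩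
  -- The state after the assignment becomes the entry of the history at the new length of the log.
  refine ⟨Function.update hist' (σ.word vH 0 + 1) (Function.update (σ.word aM) (σ.word vC 0)
    (σ.word vX 0), Function.update (σ.real rWV) (σ.word vC 0) (σ.real rY 0)), ?_, ?_, ?_⟩
  · constructor <;>
    simp only [Memory.word_setWord, Memory.real_setWord, Memory.real_setReal, Memory.word_setReal,
      Nat.reduceEqDiff, if_true, if_false, Function.update_self]
    · intro j hj
      rcases Nat.lt_succ_iff_lt_or_eq.1 hj with hj | rfl
      · rw [Function.update_of_ne (by omega), Function.update_of_ne (by omega),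
          Function.update_of_ne (by omega), Function.update_of_ne (by omega),
          Function.update_of_ne (by omega)]
        exact h.undo j hj
      · rw [Function.update_of_ne (by omega)]
        simp [h.cur]
    · intro j hj
      rcases Nat.lt_succ_iff_lt_or_eq.1 hj with hj | rfl
      · rw [Function.update_of_ne (by omega), Function.update_of_ne (by omega)]
        exact h.bound j hj
      · simp [hc, hv]
    · intro u hu
      by_cases hu' : u = σ.word vC 0
      · subst hu'; simpa using hx
      · rw [Function.update_of_ne hu']; exact h.val u hu
    · rw [sum_update _ hc, h.wt]
  · simp only [Memory.word_setWord, Memory.word_setReal, Nat.reduceEqDiff, if_true, if_false,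
      Function.update_self]
    omega
  · intro j hj
    rw [Function.update_of_ne (by omega)]
    exact h' j hj

end Env

end

/-! ### Deleting edges, undoing changes, and the queue. -/

noncomputable section

namespace Env

variable {n : ℕ} {E : Env n} {hist : ℕ → MateState} {m : ℕ} {σ : Memory}

/-- Both ends of the edge are cleared, which takes at most two entries of the log. The stored weight
of an unmatched vertex is kept at `0`, so that `rWt` remains the sum of the weights. -/
theorem wp_remove (hL : Logged n hist m σ) (hv : σ.word vV 0 < n)
    (hP : Pairing n (σ.word aM)) (hz : ∀ u < n, σ.word aM u = 0 → σ.real rWV u = 0)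
    (hB : n < E.B) (hh : σ.word vH 0 + 2 < E.B) :
    E.wp .remove (fun τ x => x ≤ 21 ∧ Logged n hist m τ ∧
      (∀ u < n, τ.word aM u =
        if u = σ.word vV 0 ∨ u + 1 = σ.word aM (σ.word vV 0) then 0 else σ.word aM u) ∧
      (∀ u < n, τ.real rWV u = if τ.word aM u = 0 then 0 else σ.real rWV u) ∧
      τ.word vH 0 ≤ σ.word vH 0 + 2) σ := by
  have hle := hL.val _ hv
  simp only [Prog.remove, wp_block_cons, wp_block_one, wp_setWord, wp_setReal, wp_skip, WExp.eval, RExp.eval,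
    Memory.word_setWord, Memory.real_setWord, Memory.real_setReal, Memory.word_setReal,
    Nat.reduceEqDiff, if_true, if_false, Function.update_self, wp_branch, Test.Holds]
  refine ⟨by omega, by omega, fun h0 => ?_, fun h0 => ?_⟩
  · have h0 : σ.word aM (σ.word vV 0) = 0 := by omega
    refine ⟨by omega, hL.of_eq ?_ ?_ ?_ ?_ ?_ ?_ ?_, ?_, ?_, ?_⟩ <;>
    try simp only [Memory.word_setWord, Memory.real_setWord, Memory.real_setReal, Memory.word_setReal,
    Nat.reduceEqDiff, if_true, if_false, Function.update_self]
    · intro u _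
      split_ifs with h
      · rcases h with rfl | h
        · exact h0
        · omega
      · rfl
    · intro u hu
      split_ifs with h
      · exact hz u hu h
      · rfl
    · omega
  · obtain ⟨hlt, hinv⟩ := hP _ hv (by omega)
    refine ⟨by omega, by omega, by omega, by omega, by omega, ?_⟩
    refine wp_of (wp_set (hist := hist) (m := m) (hL.of_eq ?_ ?_ ?_ ?_ ?_ ?_ ?_) ?_ ?_ hB ?_) ?_ <;>
    try simp only [Memory.word_setWord, Memory.real_setWord, Memory.real_setReal, Memory.word_setReal,
    Nat.reduceEqDiff, if_true, if_false, Function.update_self]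
    · exact hlt
    · omega
    · omega
    rintro τ x ⟨rfl, hL', hM, hW, hH⟩ hF
    have e1 : τ.word vV = σ.word vV := by
      rw [hF.1 vV (by decide)]; simp only [Memory.word_setWord, Memory.real_setWord, Memory.real_setReal, Memory.word_setReal,
    Nat.reduceEqDiff, if_true, if_false, Function.update_self]
    have e2 : τ.word vX 0 = 0 := by
      rw [hF.1 vX (by decide)]; simp only [Memory.word_setWord, Memory.real_setWord, Memory.real_setReal, Memory.word_setReal,
    Nat.reduceEqDiff, if_true, if_false, Function.update_self]
    have e3 : τ.real rY 0 = ((0 : ℕ) : ℝ) := by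
      rw [hF.2 rY (by decide)]; simp only [Memory.word_setWord, Memory.real_setWord, Memory.real_setReal, Memory.word_setReal,
    Nat.reduceEqDiff, if_true, if_false, Function.update_self]

    rw [e1]
    refine ⟨by omega, by omega, ?_⟩
    refine wp_of (wp_set (hist := hist) (m := m) (hL'.of_eq ?_ ?_ ?_ ?_ ?_ ?_ ?_) ?_ ?_ hB ?_) ?_ <;>
    try simp only [Memory.word_setWord, Memory.real_setWord, Memory.real_setReal, Memory.word_setReal,
    Nat.reduceEqDiff, if_true, if_false, Function.update_self]
    · exact hv
    · omega
    · omega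
    rintro υ x ⟨rfl, hL'', hM', hW', hH'⟩ -
    simp only [Memory.word_setWord, Memory.real_setWord, Memory.real_setReal, Memory.word_setReal,
    Nat.reduceEqDiff, if_true, if_false, Function.update_self, e1, e2, e3, Nat.cast_zero, hM, hW] at hM' hW' hH'
    have hM2 : ∀ u < n, υ.word aM u =
        if u = σ.word vV 0 ∨ u + 1 = σ.word aM (σ.word vV 0) then 0 else σ.word aM u := by
      intro u hu
      rw [hM']
      by_cases h1 : u = σ.word vV 0
      · simp [h1]
      · rw [Function.update_of_ne h1]
        by_cases h2 : u = σ.word aM (σ.word vV 0) - 1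
        · rw [h2, Function.update_self, if_pos (by omega)]
        · rw [Function.update_of_ne h2, if_neg (by omega)]
    refine ⟨by omega, hL'', hM2, fun u hu => ?_, by omega⟩
    rw [hM2 u hu, hW']
    by_cases h1 : u = σ.word vV 0
    · simp [h1]
    · rw [Function.update_of_ne h1]
      by_cases h2 : u = σ.word aM (σ.word vV 0) - 1
      · rw [h2, Function.update_self, if_pos]
        rw [if_pos (by omega)]
      · rw [Function.update_of_ne h2, if_neg (by omega : ¬ (u = σ.word vV 0 ∨ _))]
        split_ifs with h3
        · exact hz u hu h3
        · rfl

/-- Looking at one end of the pair is enough: by `Pairing`, the other end points back exactly when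
this end points to it. -/
theorem wp_touch (hL : Logged n hist m σ) (hu : σ.word vEu 0 < n) (hv : σ.word vEv 0 < n)
    (hP : Pairing n (σ.word aM)) (hz : ∀ u < n, σ.word aM u = 0 → σ.real rWV u = 0)
    (hB : n < E.B) (hh : σ.word vH 0 + 2 < E.B) :
    E.wp .touch (fun τ x => x ≤ 23 ∧ Logged n hist m τ ∧
      (∀ u < n, τ.word aM u =
        WGraph.removePair (σ.word vEu 0) (σ.word vEv 0) (σ.word aM) u) ∧
      (∀ u < n, τ.real rWV u = if τ.word aM u = 0 then 0 else σ.real rWV u) ∧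
      τ.word vH 0 ≤ σ.word vH 0 + 2) σ := by
  simp only [Prog.touch, wp_branch, Test.holds_wordEq, wp_block_cons, wp_block_one, wp_setWord, wp_setReal, wp_skip, WExp.eval, RExp.eval,
    Memory.word_setWord, Memory.real_setWord, Memory.real_setReal, Memory.word_setReal,
    Nat.reduceEqDiff, if_true, if_false, Function.update_self]
  refine ⟨fun h => ⟨by omega, by omega, ?_⟩, fun h => ?_⟩
  · refine wp_of (wp_remove (hist := hist) (m := m) (hL.of_eq ?_ ?_ ?_ ?_ ?_ ?_ ?_) ?_ ?_ ?_ hB ?_)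
      ?_ <;>
    try simp only [Memory.word_setWord, Memory.real_setWord, Memory.real_setReal, Memory.word_setReal,
    Nat.reduceEqDiff, if_true, if_false, Function.update_self]
    · exact hu
    · exact hP
    · exact hz
    · exact hh
    rintro τ x ⟨hx, hL', hM, hW, hH⟩ -
    refine ⟨by omega, hL', fun u hu' => ?_, hW, hH⟩
    rw [hM u hu']
    obtain ⟨h1, h2⟩ := hP _ hu (by omega)
    rw [h, Nat.add_sub_cancel] at h2
    unfold WGraph.removePair WGraph.removeEdges
    by_cases c1 : u = σ.word vEu 0
    · subst c1; simp [h]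
    · by_cases c2 : u = σ.word vEv 0
      · rw [if_pos (by omega), if_pos]
        rw [c2, h2]; simp
      · rw [if_neg (by omega), if_neg (by tauto)]
  · refine ⟨by omega, hL, fun u hu' => ?_, fun u hu' => ?_, by omega⟩
    · unfold WGraph.removePair WGraph.removeEdges
      rw [if_neg]
      rintro ⟨h0, ⟨rfl, h1⟩ | ⟨rfl, h1⟩⟩
      · omega
      · have := (hP _ hu' h0).2
        rw [h1] at this
        exact h this
    · split_ifs with h0
      · exact hz u hu' h0
      · rfl

/-- Each round undoes one entry of the log at a cost of exactly `5`, which is why the accounting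
charges `5` in advance for every entry of the log. -/
theorem wp_revert (hL : Logged n hist m σ) (hm : σ.word aMark (σ.word vSp 0) = m)
    (hB : n < E.B) (hh : σ.word vH 0 < E.B) :
    E.wp .revert (fun τ x => x = 5 * (σ.word vH 0 - m) + 1 ∧ Logged n hist m τ ∧
      (τ.word aM, τ.real rWV) = hist m ∧ τ.word vH 0 = m) σ := by
  refine wp_loop (fun τ k => Logged n hist m τ ∧ τ.word aMark (τ.word vSp 0) = m ∧
    τ.word vH 0 ≤ σ.word vH 0 ∧ k = 5 * (σ.word vH 0 - τ.word vH 0)) (fun τ => τ.word vH 0)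
    ⟨hL, hm, le_rfl, by omega⟩ ?_ ?_
  · rintro τ k ⟨⟨hist', h, hmh, h'⟩, hmark, hle, hk⟩ hb -
    simp only [Test.Holds, WExp.eval, hmark, not_le] at hb
    simp only [wp_block_cons, wp_block_one, wp_setWord, wp_setReal, wp_skip, WExp.eval, RExp.eval,
    Memory.word_setWord, Memory.real_setWord, Memory.real_setReal, Memory.word_setReal,
    Nat.reduceEqDiff, if_true, if_false, Function.update_self]
    obtain ⟨b1, b2⟩ := h.bound (τ.word vH 0 - 1) (by omega)
    have hu := h.undo (τ.word vH 0 - 1) (by omega)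
    have e : τ.word vH 0 - 1 + 1 = τ.word vH 0 := by omega
    rw [e, h.cur] at hu
    refine ⟨by omega, by omega, by omega, by omega, by omega, by omega, ⟨⟨hist', ?_, ?_, h'⟩,
      by rw [hmark], by omega, by omega⟩, by omega⟩
    · constructor <;>
    try simp only [Memory.word_setWord, Memory.real_setWord, Memory.real_setReal, Memory.word_setReal,
    Nat.reduceEqDiff, if_true, if_false, Function.update_self]
      · exact hu
      · exact fun j hj => h.undo j (by omega)
      · exact fun j hj => h.bound j (by omega)
      · intro u hu'
        by_cases hc : u = τ.word aLC (τ.word vH 0 - 1)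
        · rw [hc, Function.update_self]; exact b2
        · rw [Function.update_of_ne hc]; exact h.val u hu'
      · rw [sum_update _ b1, h.wt]
    · simp only [Memory.word_setWord, Memory.real_setWord, Memory.real_setReal, Memory.word_setReal,
    Nat.reduceEqDiff, if_true, if_false, Function.update_self]; omega
  · rintro τ k ⟨⟨hist', h, hmh, h'⟩, hmark, hle, hk⟩ hb
    simp only [Test.Holds, WExp.eval, hmark, not_not] at hb
    have e : τ.word vH 0 = m := by omega
    refine ⟨by omega, ⟨hist', h, hmh, h'⟩, ?_, e⟩
    rw [← h.cur, e]
    exact h' m le_rfl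

/-- The queue holds distinct vertices, and they are marked. -/
structure QueueInv (n : ℕ) (σ : Memory) : Prop where
  lt : ∀ j < σ.word vQn 0, σ.word aQ j < n
  inj : ∀ i < σ.word vQn 0, ∀ j < σ.word vQn 0, σ.word aQ i = σ.word aQ j → i = j
  mark : ∀ u < n, σ.word aIn u = if ∃ j < σ.word vQn 0, σ.word aQ j = u then 1 else 0

theorem QueueInv.of_eq {τ : Memory} (h : QueueInv n σ) (h1 : τ.word vQn 0 = σ.word vQn 0)
    (h2 : τ.word aQ = σ.word aQ) (h3 : τ.word aIn = σ.word aIn) : QueueInv n τ := by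
  obtain ⟨a, b, c⟩ := h
  constructor <;> rw [h1, h2]
  · exact a
  · exact b
  · rw [h3]; exact c

theorem QueueInv.le (h : QueueInv n σ) : σ.word vQn 0 ≤ n := by
  have := Finset.card_le_card_of_injOn (s := Finset.range (σ.word vQn 0)) (t := Finset.range n)
    (σ.word aQ) (fun j hj => by simpa using h.lt j (by simpa using hj))
    (fun i hi j hj => h.inj i (by simpa using hi) j (by simpa using hj))
  simpa using this

/-- The marks make membership testable in constant time. The last disjunction bounds the growth of
the queue and identifies a new entry. -/
theorem wp_push (hQ : QueueInv n σ) (hp : σ.word vP 0 < n) (hB : n < E.B) :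
    E.wp .push (fun τ x => x ≤ 4 ∧ QueueInv n τ ∧
      (∀ j < σ.word vQn 0, τ.word aQ j = σ.word aQ j) ∧
      (∃ j < τ.word vQn 0, τ.word aQ j = σ.word vP 0) ∧
      (τ.word vQn 0 = σ.word vQn 0 ∨ τ.word vQn 0 = σ.word vQn 0 + 1 ∧
        τ.word aQ (σ.word vQn 0) = σ.word vP 0 ∧
        ¬ ∃ j < σ.word vQn 0, σ.word aQ j = σ.word vP 0)) σ := by
  have hle := hQ.le
  have hm := hQ.mark _ hp
  simp only [Prog.push, wp_branch, Test.holds_wordEq, wp_block_cons, wp_block_one, wp_setWord, wp_setReal, wp_skip, WExp.eval, RExp.eval,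
    Memory.word_setWord, Memory.real_setWord, Memory.real_setReal, Memory.word_setReal,
    Nat.reduceEqDiff, if_true, if_false, Function.update_self]
  refine ⟨fun h => ?_, fun h => ?_⟩
  · have hnot : ¬ ∃ j < σ.word vQn 0, σ.word aQ j = σ.word vP 0 := by
      intro h'
      rw [if_pos h'] at hm; omega
    -- A queue with `n` distinct vertices would contain every vertex, also the unmarked `vP`.
    have hlt : σ.word vQn 0 < n := by
      by_contra hge
      have e : σ.word vQn 0 = n := by omega
      refine hnot ?_
      have hs := Finset.surj_on_of_inj_on_of_card_le (s := Finset.range (σ.word vQn 0))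
        (t := Finset.range n) (fun j _ => σ.word aQ j)
        (fun j hj => by simpa using hQ.lt j (by simpa using hj))
        (fun i j hi hj => hQ.inj i (by simpa using hi) j (by simpa using hj)) (by simp [e])
        (σ.word vP 0) (by simpa using hp)
      obtain ⟨j, hj, hj'⟩ := hs
      exact ⟨j, by simpa using hj, hj'.symm⟩
    refine ⟨by omega, by omega, by omega, by omega, by omega, by omega, by omega, ?_, ?_, ?_, ?_⟩
    · constructor <;>
    try simp only [Memory.word_setWord, Memory.real_setWord, Memory.real_setReal, Memory.word_setReal,
    Nat.reduceEqDiff, if_true, if_false, Function.update_self]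
      · intro j hj
        by_cases hj' : j = σ.word vQn 0
        · rw [hj', Function.update_self]; exact hp
        · rw [Function.update_of_ne hj']; exact hQ.lt j (by omega)
      · intro i hi j hj hij
        by_cases hi' : i = σ.word vQn 0 <;> by_cases hj' : j = σ.word vQn 0
        · omega
        · rw [hi', Function.update_self, Function.update_of_ne hj'] at hij
          exact absurd ⟨j, by omega, hij.symm⟩ hnot
        · rw [hj', Function.update_self, Function.update_of_ne hi'] at hij
          exact absurd ⟨i, by omega, hij⟩ hnot
        · rw [Function.update_of_ne hi', Function.update_of_ne hj'] at hij
          exact hQ.inj i (by omega) j (by omega) hij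
      · intro u hu
        by_cases hu' : u = σ.word vP 0
        · rw [hu', Function.update_self, if_pos]
          exact ⟨σ.word vQn 0, by omega, Function.update_self _ _ _⟩
        · rw [Function.update_of_ne hu', hQ.mark u hu]
          refine if_congr ⟨?_, ?_⟩ rfl rfl
          · rintro ⟨j, hj, hj'⟩
            exact ⟨j, by omega, by rw [Function.update_of_ne (by omega)]; exact hj'⟩
          · rintro ⟨j, hj, hj'⟩
            by_cases hjq : j = σ.word vQn 0
            · rw [hjq, Function.update_self] at hj'; exact absurd hj'.symm hu'
            · rw [Function.update_of_ne hjq] at hj'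
              exact ⟨j, by omega, hj'⟩
    · exact fun j hj => Function.update_of_ne (by omega) _ _
    · exact ⟨σ.word vQn 0, by omega, Function.update_self _ _ _⟩
    · exact Or.inr ⟨trivial, trivial, hnot⟩
  · refine ⟨by omega, hQ, fun _ _ => trivial, ?_, Or.inl trivial⟩
    by_contra h'
    rw [if_neg h'] at hm
    exact h hm

end Env

end

/-! ### Collecting the updated pairs since an entry of the stack. -/

noncomputable section

namespace Prog

/-- Remove all pairs that were updated since the top of the stack, and collect their vertices. -/
def gather : Prog := block [
  assign vQn (.const 0),
  assign vI (.get aPos (.var vSp)),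
  forLoop vI (.var vCnt) (block [
    assign vEu (.get aTU (.var vI)),
    assign vEv (.get aTV (.var vI)),
    touch,
    assign vP (.var vEu),
    push,
    assign vP (.var vEv),
    push])]

end Prog

/-- The pair `u, v` is among the logged updates with an index in `[a, b)`. -/
def Touched (tu tv : ℕ → ℕ) (a b u v : ℕ) : Prop :=
  ∃ j, a ≤ j ∧ j < b ∧ (u = tu j ∧ v = tv j ∨ u = tv j ∧ v = tu j)

theorem Touched.symm {tu tv : ℕ → ℕ} {a b u v : ℕ} (h : Touched tu tv a b u v) :
    Touched tu tv a b v u := by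
  obtain ⟨j, h1, h2, h3⟩ := h
  exact ⟨j, h1, h2, by tauto⟩

theorem touched_succ {tu tv : ℕ → ℕ} {a b u v : ℕ} (hab : a ≤ b) :
    Touched tu tv a (b + 1) u v ↔
      Touched tu tv a b u v ∨ (u = tu b ∧ v = tv b ∨ u = tv b ∧ v = tu b) := by
  constructor
  · rintro ⟨j, h1, h2, h3⟩
    rcases Nat.lt_succ_iff_lt_or_eq.1 h2 with h | rfl
    · exact Or.inl ⟨j, h1, h, h3⟩
    · exact Or.inr h3
  · rintro (⟨j, h1, h2, h3⟩ | h)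
    · exact ⟨j, h1, by omega, h3⟩
    · exact ⟨b, hab, by omega, h⟩

theorem WGraph.pairing_removeEdges {n : ℕ} {P : ℕ → ℕ → Prop} (hP : ∀ u v, P u v → P v u)
    {f : ℕ → ℕ} (hf : Pairing n f) : Pairing n (WGraph.removeEdges P f) := by
  intro u hu h0
  rcases WGraph.removeEdges_eq_or P f u with h | ⟨h, h'⟩
  · exact absurd h h0
  · rw [h] at h0 ⊢
    obtain ⟨h1, h2⟩ := hf u hu h0
    refine ⟨h1, ?_⟩
    unfold WGraph.removeEdges
    rw [if_neg, h2]
    rintro ⟨-, h3⟩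
    rw [h2] at h3
    exact h' (hP _ _ h3)

theorem Pairing.congr {n : ℕ} {f g : ℕ → ℕ} (hf : Pairing n f) (h : ∀ u < n, g u = f u) :
    Pairing n g := by
  intro u hu h0
  have h1 := h u hu
  rw [h1] at h0 ⊢
  obtain ⟨h2, h3⟩ := hf u hu h0
  exact ⟨h2, by rw [h _ h2]; exact h3⟩

theorem WGraph.removePair_removeEdges (P : ℕ → ℕ → Prop) (a b : ℕ) (f : ℕ → ℕ) (u : ℕ) :
    WGraph.removePair a b (WGraph.removeEdges P f) u =
      WGraph.removeEdges (fun u v => P u v ∨ (u = a ∧ v = b ∨ u = b ∧ v = a)) f u := by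
  unfold WGraph.removePair WGraph.removeEdges
  by_cases h0 : f u = 0
  · simp [h0]
  · by_cases h1 : P u (f u - 1)
    · simp [h0, h1]
    · simp [h0, h1]

theorem WGraph.removePair_congr {a b : ℕ} {f g : ℕ → ℕ} {u : ℕ} (h : f u = g u) :
    WGraph.removePair a b f u = WGraph.removePair a b g u := by
  unfold WGraph.removePair WGraph.removeEdges; rw [h]

theorem WGraph.removeEdges_congr {P Q : ℕ → ℕ → Prop} {f : ℕ → ℕ} {u : ℕ}
    (h : ∀ v, P u v ↔ Q u v) : WGraph.removeEdges P f u = WGraph.removeEdges Q f u := by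
  unfold WGraph.removeEdges
  classical exact if_congr (and_congr_right fun _ => h _) rfl rfl

namespace Env

variable {n : ℕ} {E : Env n} {hist : ℕ → MateState} {m : ℕ} {σ : Memory}

/-- Deleting all pairs updated since the top entry makes its matching valid in the current graph.
Their endpoints, at most two for each update, are the seeds of the search. -/
theorem wp_gather (hL : Logged n hist m σ)
    (hP : Pairing n (σ.word aM)) (hz : ∀ u < n, σ.word aM u = 0 → σ.real rWV u = 0)
    (hT : ∀ j < σ.word vCnt 0, σ.word aTU j < n ∧ σ.word aTV j < n)
    (hIn : ∀ u < n, σ.word aIn u = 0) (hpos : σ.word aPos (σ.word vSp 0) ≤ σ.word vCnt 0)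
    (hB : n < E.B) (hcnt : σ.word vCnt 0 < E.B)
    (hh : σ.word vH 0 + 2 * (σ.word vCnt 0 - σ.word aPos (σ.word vSp 0)) + 2 < E.B) :
    E.wp .gather (fun τ x => x ≤ 37 * (σ.word vCnt 0 - σ.word aPos (σ.word vSp 0)) + 3 ∧
      Logged n hist m τ ∧ QueueInv n τ ∧
      τ.word vQn 0 ≤ 2 * (σ.word vCnt 0 - σ.word aPos (σ.word vSp 0)) ∧
      (∀ u v, Touched (σ.word aTU) (σ.word aTV) (σ.word aPos (σ.word vSp 0)) (σ.word vCnt 0) u v →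
        ∃ j < τ.word vQn 0, τ.word aQ j = u) ∧
      (∀ u < n, τ.word aM u = WGraph.removeEdges (Touched (σ.word aTU) (σ.word aTV)
        (σ.word aPos (σ.word vSp 0)) (σ.word vCnt 0)) (σ.word aM) u) ∧
      (∀ u < n, τ.real rWV u = if τ.word aM u = 0 then 0 else σ.real rWV u) ∧
      τ.word vH 0 ≤ σ.word vH 0 + 2 * (σ.word vCnt 0 - σ.word aPos (σ.word vSp 0))) σ := by
  set p := σ.word aPos (σ.word vSp 0) with hp
  set q := σ.word vCnt 0 with hq
  simp only [Prog.gather, wp_block_cons, wp_block_one, wp_setWord, wp_setReal, wp_skip, WExp.eval, RExp.eval,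
    Memory.word_setWord, Memory.real_setWord, Memory.real_setReal, Memory.word_setReal,
    Nat.reduceEqDiff, if_true, if_false, Function.update_self]
  refine ⟨by omega, by omega, by omega, by omega, ?_⟩
  -- `touch` costs at most `23`, the two calls of `push` at most `4` each, and there are four
  -- assignments.
  refine wp_forLoop (c := 35) (H := q) (I := fun j τ => Logged n hist m τ ∧ QueueInv n τ ∧
      τ.word vQn 0 ≤ 2 * (j - p) ∧
      (∀ u v, Touched (σ.word aTU) (σ.word aTV) p j u v → ∃ j < τ.word vQn 0, τ.word aQ j = u) ∧
      (∀ u < n, τ.word aM u =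
        WGraph.removeEdges (Touched (σ.word aTU) (σ.word aTV) p j) (σ.word aM) u) ∧
      (∀ u < n, τ.real rWV u = if τ.word aM u = 0 then 0 else σ.real rWV u) ∧
      τ.word vH 0 ≤ σ.word vH 0 + 2 * (j - p)) ?_ ?_ ?_ ?_ (by decide) ?_ ?_
  · simp only [Memory.word_setWord, Memory.real_setWord, Memory.real_setReal, Memory.word_setReal,
    Nat.reduceEqDiff, if_true, if_false, Function.update_self]; omega
  · omega
  · simp only [Memory.word_setWord, Memory.real_setWord, Memory.real_setReal, Memory.word_setReal,
    Nat.reduceEqDiff, if_true, if_false, Function.update_self]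
    have hno : ∀ u v, ¬ Touched (σ.word aTU) (σ.word aTV) p p u v := by
      rintro u v ⟨j, h1, h2, -⟩; omega
    refine ⟨hL.of_eq ?_ ?_ ?_ ?_ ?_ ?_ ?_, ⟨?_, ?_, ?_⟩, by omega,
      fun u v h => absurd h (hno u v), fun u hu => ?_, fun u hu => ?_, by omega⟩ <;>
    try simp only [Memory.word_setWord, Memory.real_setWord, Memory.real_setReal, Memory.word_setReal,
    Nat.reduceEqDiff, if_true, if_false, Function.update_self]
    · intro j hj; omega
    · intro j hj; omega
    · intro u hu; rw [hIn u hu, if_neg]; rintro ⟨j, hj, -⟩; omega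
    · unfold WGraph.removeEdges; rw [if_neg]; exact fun h => hno _ _ h.2
    · split_ifs with h
      · exact hz u hu h
      · rfl
  · intro τ hτ
    have := hτ vCnt (by decide)
    simp only [WExp.eval, this, Memory.word_setWord, Memory.real_setWord, Memory.real_setReal, Memory.word_setReal,
    Nat.reduceEqDiff, if_true, if_false, Function.update_self]
    exact hq.symm
  · simp only [Memory.word_setWord, Memory.real_setWord, Memory.real_setReal, Memory.word_setReal,
    Nat.reduceEqDiff, if_true, if_false, Function.update_self]
    rintro j τ hpj hjq ⟨hL', hQ', hqn, hX, hM, hW, hH⟩ hvI hFw -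
    have eU : τ.word aTU = σ.word aTU := by
      rw [hFw aTU (by decide)]; simp only [Memory.word_setWord, Memory.real_setWord, Memory.real_setReal, Memory.word_setReal,
    Nat.reduceEqDiff, if_true, if_false, Function.update_self]
    have eV : τ.word aTV = σ.word aTV := by
      rw [hFw aTV (by decide)]; simp only [Memory.word_setWord, Memory.real_setWord, Memory.real_setReal, Memory.word_setReal,
    Nat.reduceEqDiff, if_true, if_false, Function.update_self]
    obtain ⟨t1, t2⟩ := hT j hjq
    have sy : ∀ u v, Touched (σ.word aTU) (σ.word aTV) p j u v →
      Touched (σ.word aTU) (σ.word aTV) p j v u := fun u v h => h.symm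
    simp only [wp_block_cons, wp_block_one, wp_setWord, wp_setReal, wp_skip, WExp.eval, RExp.eval,
    Memory.word_setWord, Memory.real_setWord, Memory.real_setReal, Memory.word_setReal,
    Nat.reduceEqDiff, if_true, if_false, Function.update_self, hvI, eU, eV]
    refine ⟨by omega, by omega, by omega, by omega, ?_⟩
    refine wp_of (wp_touch (hist := hist) (m := m) (hL'.of_eq ?_ ?_ ?_ ?_ ?_ ?_ ?_) ?_ ?_ ?_ ?_ hB ?_)
      ?_ <;>
    try simp only [Memory.word_setWord, Memory.real_setWord, Memory.real_setReal, Memory.word_setReal,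
    Nat.reduceEqDiff, if_true, if_false, Function.update_self]
    · exact t1
    · exact t2
    · exact (WGraph.pairing_removeEdges sy hP).congr hM
    · intro u hu h0
      rw [hW u hu, if_pos h0]
    · omega
    rintro τ1 x1 ⟨hx1, hL1, hM1, hW1, hH1⟩ hF1
    have e1 : τ1.word vEu 0 = σ.word aTU j := by
      rw [hF1.1 vEu (by decide)]; simp only [Memory.word_setWord, Memory.real_setWord, Memory.real_setReal, Memory.word_setReal,
    Nat.reduceEqDiff, if_true, if_false, Function.update_self]
    have e2 : τ1.word vEv 0 = σ.word aTV j := by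
      rw [hF1.1 vEv (by decide)]; simp only [Memory.word_setWord, Memory.real_setWord, Memory.real_setReal, Memory.word_setReal,
    Nat.reduceEqDiff, if_true, if_false, Function.update_self]
    have e3 : τ1.word vQn = τ.word vQn := by
      rw [hF1.1 vQn (by decide)]; simp only [Memory.word_setWord, Memory.real_setWord, Memory.real_setReal, Memory.word_setReal,
    Nat.reduceEqDiff, if_true, if_false, Function.update_self]
    have e4 : τ1.word aQ = τ.word aQ := by
      rw [hF1.1 aQ (by decide)]; simp only [Memory.word_setWord, Memory.real_setWord, Memory.real_setReal, Memory.word_setReal,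
    Nat.reduceEqDiff, if_true, if_false, Function.update_self]
    have e5 : τ1.word aIn = τ.word aIn := by
      rw [hF1.1 aIn (by decide)]; simp only [Memory.word_setWord, Memory.real_setWord, Memory.real_setReal, Memory.word_setReal,
    Nat.reduceEqDiff, if_true, if_false, Function.update_self]
    have e6 : τ1.word vI = τ.word vI := by
      rw [hF1.1 vI (by decide)]; simp only [Memory.word_setWord, Memory.real_setWord, Memory.real_setReal, Memory.word_setReal,
    Nat.reduceEqDiff, if_true, if_false, Function.update_self]
    rw [e1]
    refine ⟨by omega, by omega, ?_⟩
    refine wp_of (wp_push (hQ'.of_eq ?_ ?_ ?_) ?_ hB) ?_ <;>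
    try simp only [Memory.word_setWord, Memory.real_setWord, Memory.real_setReal, Memory.word_setReal,
    Nat.reduceEqDiff, if_true, if_false, Function.update_self]
    · rw [e3]
    · exact e4
    · exact e5
    · exact t1
    rintro τ2 x2 ⟨hx2, hQ2, hpre2, hin2, hc2⟩ hF2
    have f1 : τ2.word vEv 0 = σ.word aTV j := by
      rw [hF2.1 vEv (by decide)]; simp only [Memory.word_setWord, Memory.real_setWord, Memory.real_setReal, Memory.word_setReal,
    Nat.reduceEqDiff, if_true, if_false, Function.update_self]; exact e2
    rw [f1]
    refine ⟨by omega, by omega, ?_⟩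
    refine wp_of (wp_push (hQ2.of_eq ?_ ?_ ?_) ?_ hB) ?_ <;>
    try simp only [Memory.word_setWord, Memory.real_setWord, Memory.real_setReal, Memory.word_setReal,
    Nat.reduceEqDiff, if_true, if_false, Function.update_self]
    · exact t2
    rintro τ3 x3 ⟨hx3, hQ3, hpre3, hin3, hc3⟩ hF3
    refine ⟨by omega, ?_⟩
    rintro υ hυ hυr
    have g : ∀ a, a ∉ [vI, aQ, vQn, aIn, vP] → υ.word a = τ1.word a := by
      intro a ha
      simp only [List.mem_cons, List.not_mem_nil, not_or] at ha
      rw [hυ a ha.1, hF3.1 a (by simp [Prog.wordArrays, Prog.push, Prog.block]; omega), Memory.word_setWord,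
        if_neg ha.2.2.2.2.1, hF2.1 a (by simp [Prog.wordArrays, Prog.push, Prog.block]; omega),
        Memory.word_setWord, if_neg ha.2.2.2.2.1]
    have gr : υ.real = τ1.real := by
      rw [hυr]; ext a i
      rw [hF3.2 a (by simp [Prog.realArrays, Prog.push, Prog.block]), Memory.real_setWord,
        hF2.2 a (by simp [Prog.realArrays, Prog.push, Prog.block]), Memory.real_setWord]
    have hqn' : υ.word vQn = τ3.word vQn := hυ _ (by decide)
    have hq' : υ.word aQ = τ3.word aQ := hυ _ (by decide)
    have hi' : υ.word aIn = τ3.word aIn := hυ _ (by decide)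
    have mono2 : τ1.word vQn 0 ≤ τ2.word vQn 0 := by omega
    have mono3 : τ2.word vQn 0 ≤ τ3.word vQn 0 := by omega
    rw [e3] at hc2 mono2 hpre2
    rw [e4] at hpre2
    refine ⟨hL1.of_eq (g _ (by decide)) (g _ (by decide)) (g _ (by decide)) (g _ (by decide))
      (by rw [gr]) (by rw [gr]) (by rw [gr]), hQ3.of_eq (by rw [hqn']) hq' hi', ?_, ?_, ?_, ?_, ?_⟩
    · rw [hqn']; omega
    · intro u v huv
      rw [hqn', hq']
      rw [touched_succ hpj] at huv
      rcases huv with h | ⟨rfl, -⟩ | ⟨rfl, -⟩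
      · obtain ⟨i, hi, hi2⟩ := hX u v h
        exact ⟨i, by omega, by rw [hpre3 i (by omega), hpre2 i hi, hi2]⟩
      · obtain ⟨i, hi, hi2⟩ := hin2
        exact ⟨i, by omega, by rw [hpre3 i hi, hi2]⟩
      · exact hin3
    · intro u hu
      rw [g aM (by decide), hM1 u hu, WGraph.removePair_congr (hM u hu),
        WGraph.removePair_removeEdges]
      exact WGraph.removeEdges_congr fun v => (touched_succ hpj).symm
    · intro u hu
      rw [gr, g aM (by decide), hW1 u hu, hW u hu]
      split_ifs with h1 h2
      · rfl
      · exfalso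
        apply h1
        rw [hM1 u hu]
        unfold WGraph.removePair WGraph.removeEdges
        simp [h2]
      · rfl
    · rw [g vH (by decide)]; omega
  · simp only [Memory.word_setWord, Memory.real_setWord, Memory.real_setReal, Memory.word_setReal,
    Nat.reduceEqDiff, if_true, if_false, Function.update_self]
    rintro τ x ⟨h1, h2, h3, h4, h5, h6, h7⟩ - hx - -
    refine ⟨?_, h1, h2, h3, h4, h5, h6, h7⟩
    omega

end Env

end

/-! ### Visiting a vertex in the union of the two matchings. -/

noncomputable section

namespace Prog

/-- Append the partner of `vV` in the stored matching to the queue. -/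
def visitStored : Prog :=
  branch (.wordEq (.get aM (.var vV)) (.const 0)) skip (block [
    assignReal rCst (.add (.var rCst) (.get rWV (.var vV))),
    assign vP (.sub (.get aM (.var vV)) (.const 1)),
    push])

/-- Append the neighbors of the vertex at the position `vI` of the queue. -/
def visit : Prog := block [
  assign vV (.get aQ (.var vI)),
  mate vY (.const 0) (.var vV),
  branch (.wordEq (.var vY) (.const 0)) skip (block [
    assignReal rCst (.add (.var rCst) (.weight (.var vV) (.sub (.var vY) (.const 1)))),
    assign vP (.sub (.var vY) (.const 1)),
    push]),
  visitStored]

/-- Visit one layer, and remember it if it is the lightest one so far. -/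
def layer : Prog := block [
  assignReal rCst (.ofWord (.const 0)),
  assign vHi (.var vQn),
  forLoop vI (.var vHi) visit,
  branch (.both (.wordLe (.const 1) (.var vLay)) (.realLe (.var rBest) (.var rCst))) skip (block [
    assignReal rBest (.var rCst),
    assign vBest (.var vHi)]),
  assign vLay (.add (.var vLay) (.const 1))]

/-- Visit `⌈1 / ε⌉` layers. -/
def search : Prog := block [
  assign vLay (.const 0),
  assign vI (.const 0),
  loop (.neg (.realLe (.ofWord (.const 1)) (.mul (.ofWord (.var vLay)) (.get 0 (.const 1))))) layer]

end Prog

namespace Env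

variable {n : ℕ} {E : Env n} {hist : ℕ → MateState} {m : ℕ} {σ : Memory}

/-- The matching that the algorithm maintains in the current state. -/
abbrev target (E : Env n) : ℕ → ℕ := E.A.mateFun E.s

theorem mateCode_eq_target (v : ℕ) (hv : v < n) :
    mateCode (E.A.mate E.s ⟨v, hv⟩) = E.target v := by
  simp [target, DynAlg.mateFun, hv]

/-- The weight of the edges at `v` in the two matchings. -/
def cost (E : Env n) (w : ℕ → ℝ) (v : ℕ) : ℝ := E.G.vertexWeight E.target v + w v

/-- The neighbor that is coded by `y` is among the first `b` entries of the queue. -/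
def Queued (q : ℕ → ℕ) (b y : ℕ) : Prop := y ≠ 0 → ∃ i < b, q i + 1 = y

theorem Queued.mono {q q' : ℕ → ℕ} {b b' y : ℕ} (h : Queued q b y) (hb : b ≤ b')
    (hq : ∀ i < b, q' i = q i) : Queued q' b' y := by
  intro hy
  obtain ⟨i, hi, hi'⟩ := h hy
  exact ⟨i, by omega, by rw [hq i hi, hi']⟩

/-- In the union of two matchings a vertex has at most two neighbors, so at most two vertices are
appended, and at most one if some neighbor is already in the queue. The latter applies to every
vertex that was reached from another one, so that only seeds can branch. -/
theorem wp_visit (hM : E.G.IsMate E.target) (hQ : QueueInv n σ) (hP : Pairing n (σ.word aM))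
    (hz : ∀ u < n, σ.word aM u = 0 → σ.real rWV u = 0) (hi : σ.word vI 0 < σ.word vQn 0)
    (hB : n < E.B) :
    E.wp .visit (fun τ x => x ≤ 22 ∧ QueueInv n τ ∧
      (∀ j < σ.word vQn 0, τ.word aQ j = σ.word aQ j) ∧ σ.word vQn 0 ≤ τ.word vQn 0 ∧
      Queued (τ.word aQ) (τ.word vQn 0) (E.target (σ.word aQ (σ.word vI 0))) ∧
      Queued (τ.word aQ) (τ.word vQn 0) (σ.word aM (σ.word aQ (σ.word vI 0))) ∧
      τ.real rCst 0 = σ.real rCst 0 + E.cost (σ.real rWV) (σ.word aQ (σ.word vI 0)) ∧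
      (∀ i, σ.word vQn 0 ≤ i → i < τ.word vQn 0 →
        E.target (τ.word aQ i) = σ.word aQ (σ.word vI 0) + 1 ∨
        σ.word aM (τ.word aQ i) = σ.word aQ (σ.word vI 0) + 1) ∧
      τ.word vQn 0 ≤ σ.word vQn 0 + 2 ∧
      ((∃ i < σ.word vQn 0, E.target (σ.word aQ (σ.word vI 0)) = σ.word aQ i + 1 ∨
        σ.word aM (σ.word aQ (σ.word vI 0)) = σ.word aQ i + 1) →
        τ.word vQn 0 ≤ σ.word vQn 0 + 1)) σ := by
  have hv := hQ.lt _ hi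
  set v := σ.word aQ (σ.word vI 0) with hvdef
  have hle := hQ.le
  have hMle : E.target v ≤ n := hM.le hv
  -- the second half, from a memory `τ` in which the first neighbor has been treated
  have second : ∀ (τ : Memory) (k : ℕ), k ≤ 14 → (∀ a, a ∉ [vV, vY, vP, aQ, vQn, aIn] → τ.word a = σ.word a) →
      τ.real rWV = σ.real rWV → τ.word vV 0 = v →
      QueueInv n τ → (∀ j < σ.word vQn 0, τ.word aQ j = σ.word aQ j) → σ.word vQn 0 ≤ τ.word vQn 0 →
      Queued (τ.word aQ) (τ.word vQn 0) (E.target v) →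
      τ.real rCst 0 = σ.real rCst 0 + E.G.vertexWeight E.target v →
      (τ.word vQn 0 = σ.word vQn 0 ∨ τ.word vQn 0 = σ.word vQn 0 + 1 ∧
        E.target (τ.word aQ (σ.word vQn 0)) = v + 1 ∧
        ¬ ∃ i < σ.word vQn 0, E.target v = σ.word aQ i + 1) →
      E.wp .visitStored (fun υ y => k + y ≤ 22 ∧ QueueInv n υ ∧
      (∀ j < σ.word vQn 0, υ.word aQ j = σ.word aQ j) ∧ σ.word vQn 0 ≤ υ.word vQn 0 ∧
      Queued (υ.word aQ) (υ.word vQn 0) (E.target v) ∧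
      Queued (υ.word aQ) (υ.word vQn 0) (σ.word aM v) ∧
      υ.real rCst 0 = σ.real rCst 0 + E.cost (σ.real rWV) v ∧
      (∀ i, σ.word vQn 0 ≤ i → i < υ.word vQn 0 →
        E.target (υ.word aQ i) = v + 1 ∨ σ.word aM (υ.word aQ i) = v + 1) ∧
      υ.word vQn 0 ≤ σ.word vQn 0 + 2 ∧
      ((∃ i < σ.word vQn 0, E.target v = σ.word aQ i + 1 ∨ σ.word aM v = σ.word aQ i + 1) →
        υ.word vQn 0 ≤ σ.word vQn 0 + 1)) τ := by
    intro τ k hk hFw hFr hV hQ1 hpre hqn hq1 hc hnew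
    have eM : τ.word aM = σ.word aM := hFw _ (by decide)
    have old : ∀ i, σ.word vQn 0 ≤ i → i < τ.word vQn 0 → E.target (τ.word aQ i) = v + 1 := by
      intro i h1 h2
      rcases hnew with h | ⟨h, h', -⟩
      · omega
      · obtain rfl : i = σ.word vQn 0 := by omega
        exact h'
    have hMM : σ.word aM v ≠ 0 → σ.word aM v - 1 < n ∧ σ.word aM (σ.word aM v - 1) = v + 1 :=
      fun h => hP v hv h
    simp only [Prog.visitStored, wp_branch, Test.holds_wordEq, wp_block_cons, wp_block_one, wp_setWord, wp_setReal, wp_skip, WExp.eval, RExp.eval,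
    Memory.word_setWord, Memory.real_setWord, Memory.real_setReal, Memory.word_setReal,
    Nat.reduceEqDiff, if_true, if_false, Function.update_self, eM, hV, hFr]
    refine ⟨fun h0 => ?_, fun h0 => ?_⟩
    · refine ⟨by omega, hQ1, hpre, hqn, hq1, fun h => absurd h0 h, ?_, fun i h1 h2 => Or.inl (old i h1 h2),
        by omega, ?_⟩
      · rw [hc, cost, hz v hv h0, add_zero]
      · rintro ⟨i, hi, h⟩; omega
    · obtain ⟨h3, h4⟩ := hMM h0
      refine ⟨by omega, by omega, by omega, ?_⟩
      refine wp_of (wp_push (hQ1.of_eq ?_ ?_ ?_) ?_ hB) ?_ <;>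
    try simp only [Memory.word_setWord, Memory.real_setWord, Memory.real_setReal, Memory.word_setReal,
    Nat.reduceEqDiff, if_true, if_false, Function.update_self]
      · exact h3
      rintro υ y ⟨hy, hQ2, hpre2, hin2, hc2⟩ hF2
      have er : υ.real rCst 0 = σ.real rCst 0 + E.cost (σ.real rWV) v := by
        rw [hF2.2 rCst (by decide)]
        simp only [Memory.word_setWord, Memory.real_setWord, Memory.real_setReal, Memory.word_setReal,
    Nat.reduceEqDiff, if_true, if_false, Function.update_self]
        rw [hc, cost, add_assoc]
      have hmono : τ.word vQn 0 ≤ υ.word vQn 0 := by omega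
      refine ⟨by omega, hQ2, fun j hj => by rw [hpre2 j (by omega), hpre j hj], by omega,
        hq1.mono hmono hpre2, ?_, er, ?_, by omega, ?_⟩
      · intro _
        obtain ⟨i, hi, hi'⟩ := hin2
        exact ⟨i, hi, by omega⟩
      · intro i h1 h2
        by_cases h5 : i < τ.word vQn 0
        · rw [hpre2 i h5]; exact Or.inl (old i h1 h5)
        · right
          rcases hc2 with h | ⟨h, h', -⟩
          · omega
          · obtain rfl : i = τ.word vQn 0 := by omega
            rw [h']; exact h4
      -- If both calls of `push` had appended something, neither neighbor could have been in the
      -- queue before.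
      · rintro ⟨i, hi, h⟩
        rcases hnew with e | ⟨e, -, e'⟩
        · omega
        · rcases h with h | h
          · exact absurd ⟨i, hi, h⟩ e'
          · rcases hc2 with e2 | ⟨e2, -, e2'⟩
            · omega
            · refine absurd ⟨i, by omega, ?_⟩ e2'
              rw [hpre i hi, h]; omega
  simp only [Prog.visit, wp_mate, wp_branch, Test.holds_wordEq, wp_block_cons, wp_block_one, wp_setWord, wp_setReal, wp_skip, WExp.eval, RExp.eval,
    Memory.word_setWord, Memory.real_setWord, Memory.real_setReal, Memory.word_setReal,
    Nat.reduceEqDiff, if_true, if_false, Function.update_self]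
  refine ⟨by omega, by omega, by omega, hv, ?_, ?_⟩ <;>
    simp only [mateCode_eq_target, ← hvdef]
  · intro h0
    refine wp_of (second _ 4 (by omega) ?_ rfl ?_ (hQ.of_eq ?_ ?_ ?_) ?_ ?_ ?_ ?_ ?_) ?_ <;>
    try simp only [Memory.word_setWord, Memory.real_setWord, Memory.real_setReal, Memory.word_setReal,
    Nat.reduceEqDiff, if_true, if_false, Function.update_self]
    · intro a ha
      simp only [List.mem_cons, List.not_mem_nil, not_or] at ha
      simp [ha.1, ha.2.1]
    · intro j hj; trivial
    · exact le_rfl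
    · exact fun h => absurd h0 h
    · simp [WGraph.vertexWeight, h0]
    · exact Or.inl trivial
    rintro τ x ⟨hx, h⟩ -
    exact ⟨by omega, h⟩
  · intro h0
    obtain ⟨h3, h4⟩ := hM.pairing v hv h0
    refine ⟨by omega, by omega, by omega, ?_⟩
    refine wp_of (wp_push (hQ.of_eq ?_ ?_ ?_) ?_ hB) ?_ <;>
    try simp only [Memory.word_setWord, Memory.real_setWord, Memory.real_setReal, Memory.word_setReal,
    Nat.reduceEqDiff, if_true, if_false, Function.update_self]
    · exact h3
    rintro τ x ⟨hx, hQ1, hpre, hin, hc⟩ hF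
    refine wp_of (second τ (1 + (2 + (1 + (1 + x) + 1))) (by omega) ?_ ?_ ?_ hQ1 hpre ?_ ?_ ?_ ?_) ?_
    · intro a ha
      simp only [List.mem_cons, List.not_mem_nil, not_or] at ha
      rw [hF.1 a (by simp [Prog.wordArrays, Prog.push, Prog.block]; omega)]
      simp only [Memory.word_setWord, Memory.real_setWord, Memory.real_setReal, Memory.word_setReal,
    Nat.reduceEqDiff, if_true, if_false, Function.update_self]
      simp [ha.1, ha.2.1, ha.2.2.1]
    · rw [hF.2 rWV (by decide)]; simp only [Memory.word_setWord, Memory.real_setWord, Memory.real_setReal, Memory.word_setReal,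
    Nat.reduceEqDiff, if_true, if_false, Function.update_self]
    · rw [hF.1 vV (by decide)]; simp only [Memory.word_setWord, Memory.real_setWord, Memory.real_setReal, Memory.word_setReal,
    Nat.reduceEqDiff, if_true, if_false, Function.update_self]
    · omega
    · intro _
      obtain ⟨i, hi, hi'⟩ := hin
      exact ⟨i, hi, by omega⟩
    · rw [hF.2 rCst (by decide)]
      simp only [Memory.word_setWord, Memory.real_setWord, Memory.real_setReal, Memory.word_setReal,
    Nat.reduceEqDiff, if_true, if_false, Function.update_self]
      rw [WGraph.vertexWeight, if_neg h0]
    · rcases hc with h | ⟨h, h', h''⟩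
      · exact Or.inl h
      · refine Or.inr ⟨h, by rw [h', h4], ?_⟩
        rintro ⟨i, hi, hi'⟩
        exact h'' ⟨i, hi, by omega⟩
    rintro υ y ⟨hy, h⟩ -
    exact ⟨by omega, h⟩

end Env

end

/-! ### Layers of the search and the lightest one. -/

noncomputable section

namespace Env

variable {n : ℕ} {E : Env n} {hist : ℕ → MateState} {m : ℕ} {σ σ₀ : Memory}

/-- The state of the search that started from `σ₀`, when the first `j` vertices of the queue have
been visited. -/
structure SearchInv (E : Env n) (σ₀ : Memory) (j : ℕ) (τ : Memory) : Prop where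
  queue : QueueInv n τ
  initial : ∀ i < σ₀.word vQn 0, τ.word aQ i = σ₀.word aQ i
  le : σ₀.word vQn 0 ≤ τ.word vQn 0
  size : τ.word vQn 0 ≤ σ₀.word vQn 0 + j + min j (σ₀.word vQn 0)
  closed : ∀ i < j, Queued (τ.word aQ) (τ.word vQn 0) (E.target (τ.word aQ i)) ∧
    Queued (τ.word aQ) (τ.word vQn 0) (σ₀.word aM (τ.word aQ i))
  parent : ∀ i, σ₀.word vQn 0 ≤ i → i < τ.word vQn 0 →
    ∃ k < i, E.target (τ.word aQ i) = τ.word aQ k + 1 ∨ σ₀.word aM (τ.word aQ i) = τ.word aQ k + 1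

theorem SearchInv.of_eq {j : ℕ} {τ : Memory} (h : E.SearchInv σ₀ j σ)
    (h1 : τ.word vQn = σ.word vQn) (h2 : τ.word aQ = σ.word aQ) (h3 : τ.word aIn = σ.word aIn) :
    E.SearchInv σ₀ j τ := by
  obtain ⟨a, b, c, d, e, f⟩ := h
  refine ⟨a.of_eq (by rw [h1]) h2 h3, ?_, ?_, ?_, ?_, ?_⟩ <;> simp only [h1, h2] <;> assumption

/-- A layer consists of the entries that are waiting when it begins. By the bound `size` of the
invariant, at most twice the number of seeds are ever waiting, so the layers do not grow. -/
theorem wp_layerLoop (hM : E.G.IsMate E.target) (hP : Pairing n (σ₀.word aM))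
    (hz : ∀ u < n, σ₀.word aM u = 0 → σ₀.real rWV u = 0) (hB : n < E.B)
    (hS : E.SearchInv σ₀ (σ.word vI 0) σ) (hle : σ.word vI 0 ≤ σ.word vQn 0)
    (hhi : σ.word vHi 0 = σ.word vQn 0) (h0 : σ.real rCst 0 = 0)
    (hM0 : σ.word aM = σ₀.word aM) (hw0 : σ.real rWV = σ₀.real rWV) :
    E.wp (.forLoop vI (.var vHi) .visit) (fun τ x =>
      x ≤ (σ.word vQn 0 - σ.word vI 0) * 24 + 1 ∧ E.SearchInv σ₀ (σ.word vQn 0) τ ∧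
      τ.word vI 0 = σ.word vQn 0 ∧ σ.word vQn 0 ≤ τ.word vQn 0 ∧
      (∀ i < σ.word vQn 0, τ.word aQ i = σ.word aQ i) ∧
      τ.real rCst 0 = ∑ i ∈ Finset.Ico (σ.word vI 0) (σ.word vQn 0),
        E.cost (σ₀.real rWV) (τ.word aQ i)) σ := by
  have hqn := hS.queue.le
  refine wp_forLoop (c := 22) (H := σ.word vQn 0) (I := fun j τ => E.SearchInv σ₀ j τ ∧
      σ.word vQn 0 ≤ τ.word vQn 0 ∧ (∀ i < σ.word vQn 0, τ.word aQ i = σ.word aQ i) ∧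
      τ.real rCst 0 = ∑ i ∈ Finset.Ico (σ.word vI 0) j, E.cost (σ₀.real rWV) (τ.word aQ i))
      hle (by omega) ⟨hS, le_rfl, fun _ _ => rfl, by simp [h0]⟩ ?_ (by decide) ?_ ?_
  · intro τ hτ
    rw [WExp.eval, WExp.eval, hτ vHi (by decide), hhi]
  · rintro j τ hj hjH ⟨hS', hqn', hpre, hc⟩ hvI hFw hFr
    have eM : τ.word aM = σ₀.word aM := by rw [hFw aM (by decide), hM0]
    have ew : τ.real rWV = σ₀.real rWV := by rw [hFr rWV (by decide), hw0]
    refine wp_of (wp_visit hM hS'.queue (by rw [eM]; exact hP) (by rw [eM, ew]; exact hz)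
      (by rw [hvI]; omega) hB) ?_
    rw [hvI, eM, ew]
    rintro υ x ⟨hx, hQ, hpre2, hmono, hq1, hq2, hcost, hnew, htwo, hone⟩ -
    refine ⟨hx, fun υ' hυ hυr => ?_⟩
    have e1 : υ'.word vQn = υ.word vQn := hυ _ (by decide)
    have e2 : υ'.word aQ = υ.word aQ := hυ _ (by decide)
    have e3 : υ'.word aIn = υ.word aIn := hυ _ (by decide)
    have ejq : υ.word aQ j = τ.word aQ j := hpre2 j (by omega)
    refine ⟨SearchInv.of_eq (σ := υ) ⟨hQ, ?_, ?_, ?_, ?_, ?_⟩ e1 e2 e3, ?_, ?_, ?_⟩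
    · intro i hi
      rw [hpre2 i (by have := hS'.le; omega), hS'.initial i hi]
    · have := hS'.le; omega
    · have h1 := hS'.size
      -- A seed may append two vertices, and then the minimum in `size` grows as well. Any other
      -- entry has a parent in the queue and appends at most one.
      by_cases hjk : j < σ₀.word vQn 0
      · omega
      · obtain ⟨k, hk, hk'⟩ := hS'.parent j (by omega) (by omega)
        have := hone ⟨k, by omega, hk'⟩
        omega
    · intro i hi
      rcases Nat.lt_succ_iff_lt_or_eq.1 hi with hi | rfl
      · rw [hpre2 i (by omega)]
        exact ⟨(hS'.closed i hi).1.mono hmono hpre2, (hS'.closed i hi).2.mono hmono hpre2⟩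
      · rw [ejq]; exact ⟨hq1, hq2⟩
    · intro i hi hi'
      by_cases hin : i < τ.word vQn 0
      · obtain ⟨k, hk, hk'⟩ := hS'.parent i hi hin
        exact ⟨k, hk, by rw [hpre2 i hin, hpre2 k (by omega)]; exact hk'⟩
      · refine ⟨j, by omega, ?_⟩
        rw [ejq]
        exact hnew i (by omega) hi'
    · rw [e1]; omega
    · intro i hi
      rw [e2, hpre2 i (by omega), hpre i hi]
    · rw [hυr, hcost, hc, Finset.sum_Ico_succ_top hj, e2, ejq]
      congr 1
      refine Finset.sum_congr rfl fun i hi => ?_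
      rw [hpre2 i (by have := (Finset.mem_Ico.1 hi).2; omega)]
  · rintro τ x ⟨h1, h2, h3, h4⟩ hvI hx - -
    exact ⟨hx, h1, hvI, h2, h3, h4⟩

/-- The first `b` entries of the queue leave out only light edges, where `z` bounds their weight. -/
def GoodCut (E : Env n) (f : ℕ → ℕ) (w : ℕ → ℝ) (q : ℕ → ℕ) (b : ℕ) (z : ℝ) : Prop :=
  ∃ lo ≤ b, (∀ i < lo, Queued q b (E.target (q i)) ∧ Queued q b (f (q i))) ∧
    ∑ i ∈ Finset.Ico lo b, E.cost w (q i) = z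

theorem GoodCut.congr {f : ℕ → ℕ} {w : ℕ → ℝ} {q q' : ℕ → ℕ} {b : ℕ} {z : ℝ}
    (h : E.GoodCut f w q b z) (hq : ∀ i < b, q' i = q i) : E.GoodCut f w q' b z := by
  obtain ⟨lo, hlo, h1, h2⟩ := h
  refine ⟨lo, hlo, fun i hi => ?_, ?_⟩
  · rw [hq i (by omega)]
    exact ⟨(h1 i hi).1.mono le_rfl hq, (h1 i hi).2.mono le_rfl hq⟩
  · rw [← h2]
    refine Finset.sum_congr rfl fun i hi => ?_
    rw [hq i (Finset.mem_Ico.1 hi).2]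

/-- Layers occupy disjoint ranges of the queue, so their costs sum to at most the weight of both
matchings, and the lightest of at least `1/ε` layers costs at most an `ε` fraction. The prefix that
ends with this layer is the cut: neighbors of earlier entries are in the prefix. -/
theorem wp_search {ε : ℝ} (hε : 0 < ε) (hM : E.G.IsMate E.target) (hP : Pairing n (σ.word aM))
    (hz : ∀ u < n, σ.word aM u = 0 → σ.real rWV u = 0) (hB : n < E.B) (hB' : ⌈1 / ε⌉₊ + 1 < E.B)
    (hcost : ∀ u < n, 0 ≤ E.cost (σ.real rWV) u)
    (hQ : QueueInv n σ) (hσε : σ.real 0 1 = ε) :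
    E.wp .search (fun τ x => x ≤ ⌈1 / ε⌉₊ * (48 * σ.word vQn 0 + 10) + 3 ∧ QueueInv n τ ∧
      (∀ i < σ.word vQn 0, τ.word aQ i = σ.word aQ i) ∧
      τ.word vQn 0 ≤ (2 * ⌈1 / ε⌉₊ + 2) * σ.word vQn 0 ∧
      σ.word vQn 0 ≤ τ.word vBest 0 ∧ τ.word vBest 0 ≤ τ.word vQn 0 ∧
      ∃ z, E.GoodCut (σ.word aM) (σ.real rWV) (τ.word aQ) (τ.word vBest 0) z ∧
        z ≤ ε * ∑ u ∈ Finset.range n, E.cost (σ.real rWV) u) σ := by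
  set r := ⌈1 / ε⌉₊ with hr
  set k := σ.word vQn 0 with hk
  have hkn := hQ.le
  simp only [Prog.search, wp_block_cons, wp_block_one, wp_setWord, wp_setReal, wp_skip, WExp.eval, RExp.eval,
    Memory.word_setWord, Memory.real_setWord, Memory.real_setReal, Memory.word_setReal,
    Nat.reduceEqDiff, if_true, if_false, Function.update_self]
  refine ⟨by omega, by omega, by omega, by omega, ?_⟩
  -- With `k` seeds, at most `2k` entries are waiting at any time. The number of layers times the
  -- best cost is at most the total cost visited so far: the minimum is at most the average.
  refine wp_loop (I := fun τ x => ∃ lay j, τ.word vLay 0 = lay ∧ τ.word vI 0 = j ∧ lay ≤ r ∧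
      E.SearchInv σ j τ ∧ j ≤ τ.word vQn 0 ∧ τ.word vQn 0 ≤ j + 2 * k ∧ j ≤ 2 * k * lay ∧
      k ≤ τ.word vQn 0 ∧ x ≤ lay * (48 * k + 10) ∧ (1 ≤ lay → k ≤ τ.word vBest 0 ∧ τ.word vBest 0 ≤ j ∧
        E.GoodCut (σ.word aM) (σ.real rWV) (τ.word aQ) (τ.word vBest 0) (τ.real rBest 0)) ∧
      lay * τ.real rBest 0 ≤ ∑ i ∈ Finset.range j, E.cost (σ.real rWV) (τ.word aQ i) ∧
      τ.real 0 1 = ε)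
    (m := fun τ => r - τ.word vLay 0) ?_ ?_ ?_
  · refine ⟨0, 0, ?_, ?_, by omega, ?_, ?_⟩ <;>
    try simp only [Memory.word_setWord, Memory.real_setWord, Memory.real_setReal, Memory.word_setReal,
    Nat.reduceEqDiff, if_true, if_false, Function.update_self]
    · refine ⟨hQ.of_eq ?_ ?_ ?_, ?_, ?_, ?_, ?_, ?_⟩ <;>
    try simp only [Memory.word_setWord, Memory.real_setWord, Memory.real_setReal, Memory.word_setReal,
    Nat.reduceEqDiff, if_true, if_false, Function.update_self]
      · intro i _; trivial
      · exact le_rfl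
      · omega
      · intro i hi; omega
      · intro i h1 h2; omega
    · refine ⟨by omega, by omega, by omega, by omega, by omega, fun h => by omega, ?_, hσε⟩
      simp
  · rintro τ x ⟨lay, j, hlay, hj, hlr, hS, hjq, hqj, hj2, hkq, hx, hbest, hsum, hτε⟩ hb hF
    have fw : ∀ a, a ∉ vLay :: vI :: Prog.layer.wordArrays → τ.word a = σ.word a := by
      intro a ha
      simp only [List.mem_cons, not_or] at ha
      rw [hF.1 a ha.2.2]
      simp only [Memory.word_setWord, if_neg ha.1, if_neg ha.2.1]
    have fr : ∀ a, a ∉ Prog.layer.realArrays → τ.real a = σ.real a := by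
      intro a ha
      rw [hF.2 a ha]; simp only [Memory.word_setWord, Memory.real_setWord, Memory.real_setReal, Memory.word_setReal,
    Nat.reduceEqDiff, if_true, if_false, Function.update_self]
    have eε : τ.real 0 = σ.real 0 := fr 0 (by decide)
    have eM : τ.word aM = σ.word aM := fw aM (by decide)
    have ew : τ.real rWV = σ.real rWV := fr rWV (by decide)
    simp only [Test.Holds, RExp.eval, WExp.eval, eε, hσε, hlay, Nat.cast_one, not_le] at hb
    -- The loop continues only while `lay * ε < 1`, hence for at most `⌈1/ε⌉` layers.
    have hlr' : lay < r := by
      by_contra h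
      have h1 : (r : ℝ) ≤ lay := by exact_mod_cast not_lt.1 h
      have h2 : 1 / ε ≤ lay := (Nat.le_ceil _).trans h1
      rw [div_le_iff₀ hε] at h2
      linarith
    have hqn := hS.queue.le
    simp only [Prog.layer, wp_block_cons, wp_block_one, wp_setWord, wp_setReal, wp_skip, WExp.eval, RExp.eval,
    Memory.word_setWord, Memory.real_setWord, Memory.real_setReal, Memory.word_setReal,
    Nat.reduceEqDiff, if_true, if_false, Function.update_self]
    refine ⟨by omega, by omega, by omega, ?_⟩
    refine wp_of (wp_layerLoop (σ₀ := σ) hM hP hz hB ?_ ?_ ?_ ?_ ?_ ?_) ?_ <;>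
    try simp only [Memory.word_setWord, Memory.real_setWord, Memory.real_setReal, Memory.word_setReal,
    Nat.reduceEqDiff, if_true, if_false, Function.update_self]
    · rw [hj]
      exact hS.of_eq (by simp only [Memory.word_setWord, Memory.real_setWord, Memory.real_setReal, Memory.word_setReal,
    Nat.reduceEqDiff, if_true, if_false, Function.update_self]) (by simp only [Memory.word_setWord, Memory.real_setWord, Memory.real_setReal, Memory.word_setReal,
    Nat.reduceEqDiff, if_true, if_false, Function.update_self]) (by simp only [Memory.word_setWord, Memory.real_setWord, Memory.real_setReal, Memory.word_setReal,
    Nat.reduceEqDiff, if_true, if_false, Function.update_self])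
    · omega
    · simp
    · exact eM
    · exact ew
    rintro τ1 x1 ⟨hx1, hS1, hvI1, hqn1, hpre1, hc1⟩ hF1
    rw [hj] at hx1 hc1
    have e1 : τ1.word vHi 0 = τ.word vQn 0 := by
      rw [hF1.1 vHi (by decide)]; simp only [Memory.word_setWord, Memory.real_setWord, Memory.real_setReal, Memory.word_setReal,
    Nat.reduceEqDiff, if_true, if_false, Function.update_self]
    have e2 : τ1.word vLay 0 = lay := by
      rw [hF1.1 vLay (by decide)]; simp only [Memory.word_setWord, Memory.real_setWord, Memory.real_setReal, Memory.word_setReal,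
    Nat.reduceEqDiff, if_true, if_false, Function.update_self]; exact hlay
    have e3 : τ1.word vBest 0 = τ.word vBest 0 := by
      rw [hF1.1 vBest (by decide)]; simp only [Memory.word_setWord, Memory.real_setWord, Memory.real_setReal, Memory.word_setReal,
    Nat.reduceEqDiff, if_true, if_false, Function.update_self]
    have e4 : τ1.real rBest 0 = τ.real rBest 0 := by
      rw [hF1.2 rBest (by decide)]; simp only [Memory.word_setWord, Memory.real_setWord, Memory.real_setReal, Memory.word_setReal,
    Nat.reduceEqDiff, if_true, if_false, Function.update_self]
    have eε1 : τ1.real 0 1 = ε := by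
      rw [hF1.2 0 (by decide)]; simp only [Memory.word_setWord, Memory.real_setWord, Memory.real_setReal, Memory.word_setReal,
    Nat.reduceEqDiff, if_true, if_false, Function.update_self]; exact hτε
    have hsz := hS1.size
    have hsum1 : ∑ i ∈ Finset.range (τ.word vQn 0), E.cost (σ.real rWV) (τ1.word aQ i) =
        ∑ i ∈ Finset.range j, E.cost (σ.real rWV) (τ.word aQ i) + τ1.real rCst 0 := by
      rw [hc1, ← Finset.sum_range_add_sum_Ico _ hjq]
      congr 1
      refine Finset.sum_congr rfl fun i hi => ?_
      rw [hpre1 i (by have := Finset.mem_range.1 hi; omega)]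
    have hcut : E.GoodCut (σ.word aM) (σ.real rWV) (τ1.word aQ) (τ.word vQn 0) (τ1.real rCst 0) := by
      refine ⟨j, hjq, fun i hi => ?_, hc1.symm⟩
      rw [hpre1 i (by omega)]
      exact ⟨(hS.closed i hi).1.mono le_rfl hpre1, (hS.closed i hi).2.mono le_rfl hpre1⟩
    have hj2' : τ.word vQn 0 ≤ 2 * k * (lay + 1) := by ring_nf; ring_nf at hj2; omega
    -- At most `2k` vertices in the layer, at `24` for each round of `forLoop`.
    have hcost' : 1 + (1 + (x1 + 4)) + 1 ≤ 48 * k + 10 := by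
      have : (τ.word vQn 0 - j) * 24 ≤ 2 * k * 24 := Nat.mul_le_mul_right _ (by omega)
      omega
    have hx' : x + (1 + (1 + (x1 + 4)) + 1) ≤ (lay + 1) * (48 * k + 10) := by
      rw [add_mul, one_mul]; omega
    simp only [wp_branch, Test.Holds, wp_block_cons, wp_block_one, wp_setWord, wp_setReal, wp_skip, WExp.eval, RExp.eval,
    Memory.word_setWord, Memory.real_setWord, Memory.real_setReal, Memory.word_setReal,
    Nat.reduceEqDiff, if_true, if_false, Function.update_self, e1, e2, e3, e4]
    refine ⟨fun hcond => ?_, fun hcond => ?_⟩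
    · refine ⟨by omega, by omega, ⟨lay + 1, τ.word vQn 0, rfl, hvI1, hlr', hS1.of_eq ?_ ?_ ?_, hqn1,
        by omega, hj2', by omega, by omega, fun _ => ?_, ?_, eε1⟩, by omega⟩ <;>
    try simp only [Memory.word_setWord, Memory.real_setWord, Memory.real_setReal, Memory.word_setReal,
    Nat.reduceEqDiff, if_true, if_false, Function.update_self]
      · obtain ⟨h1, h2, h3⟩ := hbest hcond.1
        exact ⟨h1, by omega, h3.congr fun i hi => hpre1 i (by omega)⟩
      · rw [hsum1]; push_cast; linarith [hcond.2]
    · refine ⟨by omega, by omega, by omega, by omega, by omega,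
        ⟨lay + 1, τ.word vQn 0, rfl, hvI1, hlr', hS1.of_eq ?_ ?_ ?_, hqn1,
        by omega, hj2', by omega, by omega, fun _ => ⟨hkq, le_rfl, hcut⟩, ?_, eε1⟩, by omega⟩ <;>
    try simp only [Memory.word_setWord, Memory.real_setWord, Memory.real_setReal, Memory.word_setReal,
    Nat.reduceEqDiff, if_true, if_false, Function.update_self]
      rw [hsum1]; push_cast
      by_cases hl : 1 ≤ lay
      · have h1 : τ1.real rCst 0 ≤ τ.real rBest 0 := by
          by_contra h
          exact hcond ⟨hl, le_of_lt (not_le.1 h)⟩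
        have : (lay : ℝ) * τ1.real rCst 0 ≤ lay * τ.real rBest 0 :=
          mul_le_mul_of_nonneg_left h1 (by positivity)
        linarith
      -- The first layer is recorded unconditionally, since `rBest` still holds an old value.
      · have : lay = 0 := by omega
        subst this
        simp only [Nat.cast_zero, zero_mul] at hsum
        simp only [Nat.cast_zero]
        linarith
  · rintro τ x ⟨lay, j, hlay, hj, hlr, hS, hjq, hqj, hj2, hkq, hx, hbest, hsum, hτε⟩ hb
    simp only [Test.Holds, RExp.eval, WExp.eval, hτε, hlay, Nat.cast_one, not_not] at hb
    have hl : 1 ≤ lay := by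
      rcases Nat.eq_zero_or_pos lay with rfl | h
      · simp at hb; linarith
      · exact h
    obtain ⟨h1, h2, h3⟩ := hbest hl
    have hqn := hS.queue.le
    have hr1 : lay * (48 * k + 10) ≤ r * (48 * k + 10) := Nat.mul_le_mul_right _ hlr
    have hr2 : 2 * k * lay ≤ 2 * k * r := Nat.mul_le_mul_left _ hlr
    have hle : ∑ i ∈ Finset.range j, E.cost (σ.real rWV) (τ.word aQ i) ≤
        ∑ u ∈ Finset.range n, E.cost (σ.real rWV) u := by
      rw [← Finset.sum_image (s := Finset.range j) (g := τ.word aQ)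
        (f := fun u => E.cost (σ.real rWV) u)]
      · refine Finset.sum_le_sum_of_subset_of_nonneg ?_ fun u hu _ =>
          hcost u (Finset.mem_range.1 hu)
        intro u hu
        obtain ⟨i, hi, rfl⟩ := Finset.mem_image.1 hu
        exact Finset.mem_range.2 (hS.queue.lt i (by have := Finset.mem_range.1 hi; omega))
      · intro a ha b hb hab
        simp only [Finset.coe_range, Set.mem_Iio] at ha hb
        exact hS.queue.inj a (by omega) b (by omega) hab
    refine ⟨by omega, hS.queue, hS.initial, ?_, h1, by omega, _, h3, ?_⟩
    · have : (2 * r + 2) * k = 2 * k * r + 2 * k := by ring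
      omega
    · have h4 : 0 ≤ τ.real rBest 0 := by
        obtain ⟨lo, hlo, -, h5⟩ := h3
        rw [← h5]
        refine Finset.sum_nonneg fun i hi => hcost _ (hS.queue.lt i ?_)
        have := (Finset.mem_Ico.1 hi).2; omega
      -- The loop has ended, so `1 ≤ lay * ε`; the best cost is not negative.
      have h5 : τ.real rBest 0 ≤ lay * ε * τ.real rBest 0 := by nlinarith
      have h6 := mul_le_mul_of_nonneg_left (hsum.trans hle) hε.le
      linarith

end Env

end

/-! ### Switching to the matching of the black box inside the cut. -/

noncomputable section

namespace Prog

/-- Unmark the vertices in the queue from the position `vI` on. -/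
def unmark (hi : ℕ) : Prog :=
  forLoop vI (.var hi) (setWord aIn (.get aQ (.var vI)) (.const 0))

/-- Remove the edges at the first `vBest` vertices of the queue. -/
def isolate : Prog :=
  forLoop vI (.var vBest) (block [assign vV (.get aQ (.var vI)), remove])

/-- Give `vC` its partner `vY` in the matching of the algorithm. -/
def adoptStep : Prog :=
  branch (.both (.wordLe (.const 1) (.var vY))
      (.wordEq (.get aIn (.sub (.var vY) (.const 1))) (.const 1)))
    (block [
      assign vX (.var vY),
      assignReal rY (.weight (.var vC) (.sub (.var vY) (.const 1))),
      set]) skip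

/-- Take the edges between marked vertices from the matching of the algorithm. -/
def adopt : Prog :=
  forLoop vI (.var vBest) (block [
    assign vC (.get aQ (.var vI)),
    mate vY (.const 0) (.var vC),
    adoptStep])

/-- Switch to the matching of the algorithm on the first `vBest` vertices of the queue. -/
def switch : Prog := block [
  assign vI (.var vBest),
  unmark vQn,
  assign vI (.const 0),
  isolate,
  assign vI (.const 0),
  adopt,
  assign vI (.const 0),
  unmark vBest]

end Prog

/-- One of the first `b` vertices of the queue is `u` or `v`. -/
def Incident (q : ℕ → ℕ) (b u v : ℕ) : Prop := ∃ i < b, q i = u ∨ q i = v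

theorem Incident.symm {q : ℕ → ℕ} {b u v : ℕ} (h : Incident q b u v) : Incident q b v u := by
  obtain ⟨i, hi, h⟩ := h
  exact ⟨i, hi, h.symm⟩

theorem incident_succ {q : ℕ → ℕ} {b u v : ℕ} :
    Incident q (b + 1) u v ↔ Incident q b u v ∨ (q b = u ∨ q b = v) := by
  constructor
  · rintro ⟨i, hi, h⟩
    rcases Nat.lt_succ_iff_lt_or_eq.1 hi with hi | rfl
    · exact Or.inl ⟨i, hi, h⟩
    · exact Or.inr h
  · rintro (⟨i, hi, h⟩ | h)
    · exact ⟨i, by omega, h⟩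
    · exact ⟨b, by omega, h⟩

/-- The first `b` vertices of the queue. -/
def prefixSet (q : ℕ → ℕ) (b : ℕ) : Finset ℕ := (Finset.range b).image q

theorem mem_prefixSet {q : ℕ → ℕ} {b u : ℕ} : u ∈ prefixSet q b ↔ ∃ i < b, q i = u := by
  simp [prefixSet]

namespace Env

variable {n : ℕ} {E : Env n} {hist : ℕ → MateState} {m : ℕ} {σ : Memory}

theorem wp_unmark {a : ℕ} (ha : a ≠ vI) (ha' : a ≠ aIn) (hle : σ.word vI 0 ≤ σ.word a 0) (hB : n < E.B)
    (hq : ∀ i < σ.word a 0, σ.word aQ i < n) (hB' : σ.word a 0 ≤ n) :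
    E.wp (.unmark a) (fun τ x => x ≤ 3 * (σ.word a 0 - σ.word vI 0) + 1 ∧
      ∀ u, ((∃ i, σ.word vI 0 ≤ i ∧ i < σ.word a 0 ∧ σ.word aQ i = u) → τ.word aIn u = 0) ∧
        ((¬ ∃ i, σ.word vI 0 ≤ i ∧ i < σ.word a 0 ∧ σ.word aQ i = u) →
          τ.word aIn u = σ.word aIn u)) σ := by
  classical
  refine wp_forLoop (c := 1) (H := σ.word a 0) (I := fun j τ => ∀ u, τ.word aIn u =
      if ∃ i, σ.word vI 0 ≤ i ∧ i < j ∧ σ.word aQ i = u then 0 else σ.word aIn u)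
      hle (by omega) ?_ ?_ (by decide) ?_ ?_
  · intro u
    rw [if_neg]
    rintro ⟨i, h1, h2, -⟩; omega
  · intro τ hτ
    rw [WExp.eval, WExp.eval, hτ a]
    simp [Prog.wordArrays, ha, ha']
  · intro j τ hj hjH hI hvI hFw hFr
    have e1 : τ.word aQ = σ.word aQ := hFw _ (by decide)
    have := hq j hjH
    simp only [wp_block_cons, wp_block_one, wp_setWord, wp_setReal, wp_skip, WExp.eval, RExp.eval,
    Memory.word_setWord, Memory.real_setWord, Memory.real_setReal, Memory.word_setReal,
    Nat.reduceEqDiff, if_true, if_false, Function.update_self, hvI, e1]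
    refine ⟨by omega, by omega, le_rfl, fun υ' hυ _ u => ?_⟩
    rw [hυ aIn (by decide)]
    simp only [Memory.word_setWord, Memory.real_setWord, Memory.real_setReal, Memory.word_setReal,
    Nat.reduceEqDiff, if_true, if_false, Function.update_self]
    by_cases hu : u = σ.word aQ j
    · rw [hu, Function.update_self, if_pos ⟨j, hj, by omega, rfl⟩]
    · rw [Function.update_of_ne hu, hI]
      refine if_congr ⟨?_, ?_⟩ rfl rfl
      · rintro ⟨i, h1, h2, h3⟩
        exact ⟨i, h1, by omega, h3⟩
      · rintro ⟨i, h1, h2, h3⟩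
        rcases Nat.lt_succ_iff_lt_or_eq.1 h2 with h2 | rfl
        · exact ⟨i, h1, h2, h3⟩
        · exact absurd h3.symm hu
  · intro τ x h _ hx _ _
    exact ⟨by omega, fun u => ⟨fun h' => by rw [h, if_pos h'], fun h' => by rw [h, if_neg h']⟩⟩

theorem wp_isolate (hL : Logged n hist m σ) (hvI : σ.word vI 0 = 0)
    (hP : Pairing n (σ.word aM)) (hz : ∀ u < n, σ.word aM u = 0 → σ.real rWV u = 0)
    (hq : ∀ i < σ.word vBest 0, σ.word aQ i < n) (hB' : σ.word vBest 0 ≤ n)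
    (hB : n < E.B) (hh : σ.word vH 0 + 2 * σ.word vBest 0 + 2 < E.B) :
    E.wp .isolate (fun τ x => x ≤ 24 * σ.word vBest 0 + 1 ∧ Logged n hist m τ ∧
      (∀ u < n, τ.word aM u =
        WGraph.removeEdges (Incident (σ.word aQ) (σ.word vBest 0)) (σ.word aM) u) ∧
      (∀ u < n, τ.real rWV u = if τ.word aM u = 0 then 0 else σ.real rWV u) ∧
      τ.word vH 0 ≤ σ.word vH 0 + 2 * σ.word vBest 0) σ := by
  set b := σ.word vBest 0 with hb
  refine wp_forLoop (c := 22) (H := b) (I := fun j τ => Logged n hist m τ ∧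
      (∀ u < n, τ.word aM u = WGraph.removeEdges (Incident (σ.word aQ) j) (σ.word aM) u) ∧
      (∀ u < n, τ.real rWV u = if τ.word aM u = 0 then 0 else σ.real rWV u) ∧
      τ.word vH 0 ≤ σ.word vH 0 + 2 * j) (by omega) (by omega) ?_ ?_ (by decide) ?_ ?_
  · rw [hvI]
    refine ⟨hL, fun u hu => ?_, fun u hu => ?_, by omega⟩
    · unfold WGraph.removeEdges
      rw [if_neg]
      rintro ⟨-, i, hi, -⟩; omega
    · split_ifs with h
      · exact hz u hu h
      · rfl
  · intro τ hτ
    rw [WExp.eval, WExp.eval, hτ vBest (by decide)]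
  · rintro j τ hj hjH ⟨hL', hM', hw', hH'⟩ hvIτ hFw hFr
    have e1 : τ.word aQ = σ.word aQ := hFw _ (by decide)
    have hqj := hq j hjH
    have hP' : Pairing n (τ.word aM) :=
      (WGraph.pairing_removeEdges (fun _ _ h => Incident.symm h) hP).congr hM'
    simp only [wp_block_cons, wp_block_one, wp_setWord, wp_setReal, wp_skip, WExp.eval, RExp.eval,
    Memory.word_setWord, Memory.real_setWord, Memory.real_setReal, Memory.word_setReal,
    Nat.reduceEqDiff, if_true, if_false, Function.update_self, hvIτ, e1]
    refine ⟨by omega, by omega, ?_⟩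
    refine wp_of (wp_remove (hist := hist) (m := m) (hL'.of_eq ?_ ?_ ?_ ?_ ?_ ?_ ?_) ?_ ?_ ?_ hB ?_)
      ?_ <;>
    try simp only [Memory.word_setWord, Memory.real_setWord, Memory.real_setReal, Memory.word_setReal,
    Nat.reduceEqDiff, if_true, if_false, Function.update_self]
    · exact hqj
    · exact hP'
    · intro u hu h0; rw [hw' u hu, if_pos h0]
    · omega
    rintro υ x ⟨hx, hL2, hM2, hw2, hH2⟩ -
    refine ⟨by omega, fun υ' hυ hυr => ?_⟩
    rw [hυ aM (by decide), hυ vH (by decide), hυr]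
    have hM3 : ∀ u < n, υ.word aM u =
        WGraph.removeEdges (Incident (σ.word aQ) (j + 1)) (σ.word aM) u := by
      intro u hu
      rw [hM2 u hu, hM' u hu, hM' _ hqj]
      unfold WGraph.removeEdges
      by_cases h0 : σ.word aM u = 0
      · simp [h0]
      · obtain ⟨h1, h2⟩ := hP u hu h0
        by_cases h3 : Incident (σ.word aQ) j u (σ.word aM u - 1)
        · simp only [incident_succ, h0, h3, ne_eq, not_false_eq_true, and_self, true_or, if_true]
          split_ifs <;> rfl
        · by_cases h4 : σ.word aQ j = u
          · simp [incident_succ, h0, h4]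
          · by_cases h5 : σ.word aQ j = σ.word aM u - 1
            · have h6 : ¬ Incident (σ.word aQ) j (σ.word aM u - 1) u := fun h => h3 h.symm
              simp [incident_succ, h0, h3, h5, h2, h6]
            · rw [if_neg]
              · simp [incident_succ, h0, h3, h4, h5]
              · rintro (h | h)
                · exact h4 h.symm
                · split_ifs at h with h7
                  have h8 : σ.word aM (σ.word aQ j) ≠ 0 := by omega
                  have h9 := (hP _ hqj h8).2
                  rw [← h, Nat.add_sub_cancel] at h9
                  omega
    refine ⟨hL2.of_eq ?_ ?_ ?_ ?_ ?_ ?_ ?_, hM3, fun u hu => ?_, by omega⟩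
    · exact hυ _ (by decide)
    · exact hυ _ (by decide)
    · exact hυ _ (by decide)
    · exact hυ _ (by decide)
    · rw [hυr]
    · rw [hυr]
    · rw [hυr]
    · rw [hw2 u hu]
      by_cases h0 : υ.word aM u = 0
      · rw [if_pos h0, if_pos h0]
      · rw [if_neg h0, if_neg h0, hw' u hu, if_neg]
        intro h1
        rw [hM2 u hu, h1] at h0
        simp at h0
  · rintro τ x ⟨h1, h2, h3, h4⟩ _ hx _ _
    rw [hvI] at hx
    exact ⟨by omega, h1, h2, h3, h4⟩

/-- All vertices of the prefix are unmatched at the beginning. Each of them copies its own target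
partner when this partner is in the prefix too; the partner does the same in its own round, so the
result is symmetric. -/
theorem wp_adopt (hM : E.G.IsMate E.target) (hL : Logged n hist m σ) (hvI : σ.word vI 0 = 0)
    (h0 : ∀ i < σ.word vBest 0, σ.word aM (σ.word aQ i) = 0)
    (hw : ∀ u < n, σ.real rWV u = E.G.vertexWeight (σ.word aM) u)
    (hin : ∀ u < n, σ.word aIn u = if u ∈ prefixSet (σ.word aQ) (σ.word vBest 0) then 1 else 0)
    (hq : ∀ i < σ.word vBest 0, σ.word aQ i < n) (hB' : σ.word vBest 0 ≤ n)
    (hB : n < E.B) (hh : σ.word vH 0 + σ.word vBest 0 + 2 < E.B) :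
    E.wp .adopt (fun τ x => x ≤ 15 * σ.word vBest 0 + 1 ∧ Logged n hist m τ ∧
      (∀ u < n, τ.word aM u = if u ∈ prefixSet (σ.word aQ) (σ.word vBest 0) then
        (if E.target u ≠ 0 ∧ E.target u - 1 ∈ prefixSet (σ.word aQ) (σ.word vBest 0) then
          E.target u else 0) else σ.word aM u) ∧
      (∀ u < n, τ.real rWV u = E.G.vertexWeight (τ.word aM) u) ∧
      τ.word vH 0 ≤ σ.word vH 0 + σ.word vBest 0) σ := by
  set b := σ.word vBest 0 with hb
  set R := prefixSet (σ.word aQ) b with hR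
  refine wp_forLoop (c := 13) (H := b) (I := fun j τ => Logged n hist m τ ∧
      (∀ u < n, τ.word aM u = if u ∈ prefixSet (σ.word aQ) j then
        (if E.target u ≠ 0 ∧ E.target u - 1 ∈ R then E.target u else 0) else σ.word aM u) ∧
      (∀ u < n, τ.real rWV u = E.G.vertexWeight (τ.word aM) u) ∧
      τ.word vH 0 ≤ σ.word vH 0 + j) (by omega) (by omega) ?_ ?_ (by decide) ?_ ?_
  · rw [hvI]
    refine ⟨hL, fun u hu => ?_, hw, by omega⟩
    simp [prefixSet]
  · intro τ hτ
    rw [WExp.eval, WExp.eval, hτ vBest (by decide)]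
  · rintro j τ hj hjH ⟨hL', hM', hw', hH'⟩ hvIτ hFw hFr
    have e1 : τ.word aQ = σ.word aQ := hFw _ (by decide)
    have e2 : τ.word aIn = σ.word aIn := hFw _ (by decide)
    have hqj := hq j hjH
    have hMle : E.target (σ.word aQ j) ≤ n := hM.le hqj
    have hsucc : ∀ u, u ∈ prefixSet (σ.word aQ) (j + 1) ↔
        u ∈ prefixSet (σ.word aQ) j ∨ u = σ.word aQ j := by
      intro u
      simp only [mem_prefixSet]
      constructor
      · rintro ⟨i, hi, rfl⟩
        rcases Nat.lt_succ_iff_lt_or_eq.1 hi with hi | rfl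
        · exact Or.inl ⟨i, hi, rfl⟩
        · exact Or.inr rfl
      · rintro (⟨i, hi, rfl⟩ | rfl)
        · exact ⟨i, by omega, rfl⟩
        · exact ⟨j, by omega, rfl⟩
    simp only [Prog.adoptStep, wp_mate, wp_branch, Test.Holds, wp_block_cons, wp_block_one, wp_setWord, wp_setReal, wp_skip, WExp.eval, RExp.eval,
    Memory.word_setWord, Memory.real_setWord, Memory.real_setReal, Memory.word_setReal,
    Nat.reduceEqDiff, if_true, if_false, Function.update_self, hvIτ, e1, e2,
      mateCode_eq_target]
    refine ⟨by omega, by omega, by omega, hqj, ?_⟩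
    set c := σ.word aQ j with hc
    by_cases hbr : E.target c ≠ 0 ∧ E.target c - 1 ∈ R
    · obtain ⟨h3, h4⟩ := hM.pairing c hqj hbr.1
      refine ⟨fun _ => ?_, fun hn => absurd ⟨by omega, ?_⟩ hn⟩
      swap
      · rw [hin _ h3, if_pos hbr.2]; omega
      refine ⟨by omega, by omega, by omega, ?_⟩
      refine wp_of (wp_set (hist := hist) (m := m) (hL'.of_eq ?_ ?_ ?_ ?_ ?_ ?_ ?_) ?_ ?_ hB ?_)
        ?_ <;>
    try simp only [Memory.word_setWord, Memory.real_setWord, Memory.real_setReal, Memory.word_setReal,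
    Nat.reduceEqDiff, if_true, if_false, Function.update_self]
      · exact hqj
      · exact hMle
      · omega
      rintro υ x ⟨rfl, hL2, hM2, hw2, hH2⟩ -
      refine ⟨by omega, fun υ' hυ hυr => ⟨hL2.of_eq ?_ ?_ ?_ ?_ ?_ ?_ ?_, ?_, ?_, ?_⟩⟩
      · exact hυ _ (by decide)
      · exact hυ _ (by decide)
      · exact hυ _ (by decide)
      · exact hυ _ (by decide)
      · rw [hυr]
      · rw [hυr]
      · rw [hυr]
      · intro u hu
        rw [hυ aM (by decide), hM2]
        by_cases huc : u = c
        · subst huc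
          rw [Function.update_self, if_pos ((hsucc _).2 (Or.inr rfl)), if_pos hbr]
        · rw [Function.update_of_ne huc, hM' u hu]
          classical exact if_congr (by rw [hsucc]; tauto) rfl rfl
      · intro u hu
        rw [hυ aM (by decide), hυr, hM2, hw2]
        by_cases huc : u = c
        · subst huc
          rw [Function.update_self, WGraph.vertexWeight, Function.update_self, if_neg hbr.1]
        · rw [Function.update_of_ne huc, hw' u hu]
          exact (E.G.vertexWeight_congr (Function.update_of_ne huc _ _)).symm
      · rw [hυ vH (by decide)]; omega
    · have hcond : ¬ (1 ≤ E.target c ∧ σ.word aIn (E.target c - 1) ≤ 1 ∧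
          1 ≤ σ.word aIn (E.target c - 1)) := by
        rintro ⟨hy, hy1, hy2⟩
        have h3 := (hM.pairing c hqj (by omega)).1
        refine hbr ⟨by omega, ?_⟩
        by_contra h
        have := hin _ h3
        rw [if_neg h] at this
        omega
      refine ⟨fun hy => absurd hy hcond, fun _ => ⟨by omega, fun υ' hυ hυr => ?_⟩⟩
      have hυ2 : υ'.word aM = τ.word aM := by rw [hυ aM (by decide)]; simp only [Memory.word_setWord, Memory.real_setWord, Memory.real_setReal, Memory.word_setReal,
    Nat.reduceEqDiff, if_true, if_false, Function.update_self]
      have hυ3 : υ'.word vH = τ.word vH := by rw [hυ vH (by decide)]; simp only [Memory.word_setWord, Memory.real_setWord, Memory.real_setReal, Memory.word_setReal,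
    Nat.reduceEqDiff, if_true, if_false, Function.update_self]
      have hυ4 : υ'.real = τ.real := hυr
      refine ⟨hL'.of_eq hυ2 hυ3 ?_ ?_ ?_ ?_ ?_, ?_, ?_, ?_⟩
      · rw [hυ _ (by decide)]; simp only [Memory.word_setWord, Memory.real_setWord, Memory.real_setReal, Memory.word_setReal,
    Nat.reduceEqDiff, if_true, if_false, Function.update_self]
      · rw [hυ _ (by decide)]; simp only [Memory.word_setWord, Memory.real_setWord, Memory.real_setReal, Memory.word_setReal,
    Nat.reduceEqDiff, if_true, if_false, Function.update_self]
      · rw [hυ4]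
      · rw [hυ4]
      · rw [hυ4]
      · intro u hu
        rw [hυ2, hM' u hu]
        by_cases huc : u = c
        · subst huc
          rw [if_pos ((hsucc _).2 (Or.inr rfl)), if_neg hbr]
          split_ifs
          · rfl
          · exact h0 j hjH
        · classical exact if_congr (by rw [hsucc]; tauto) rfl rfl
      · rw [hυ2, hυ4]; exact hw'
      · rw [hυ3]; omega
  · rintro τ x ⟨h1, h2, h3, h4⟩ _ hx _ _
    rw [hvI] at hx
    exact ⟨by omega, h1, h2, h3, h4⟩

/-- Clearing all edges at `R` and adopting the target edges within `R` yields `combine`. The stored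
weights need to be right only outside `R`, since those in `R` are all rewritten; this lets the
program be used for a rebuild, too. All marks are cleared by walking through the queue, without a
pass over all vertices. -/
theorem wp_switch (hM : E.G.IsMate E.target) (hL : Logged n hist m σ) (hQ : QueueInv n σ)
    (hb : σ.word vBest 0 ≤ σ.word vQn 0) (hP : Pairing n (σ.word aM))
    (hz : ∀ u < n, σ.word aM u = 0 → σ.real rWV u = 0)
    (hw : ∀ u < n, u ∉ prefixSet (σ.word aQ) (σ.word vBest 0) →
      σ.real rWV u = E.G.vertexWeight (σ.word aM) u)
    (hB : n < E.B) (hh : σ.word vH 0 + 3 * σ.word vBest 0 + 2 < E.B) :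
    E.wp .switch (fun τ x => x ≤ 42 * σ.word vQn 0 + 8 ∧ Logged n hist m τ ∧
      (∀ u < n, τ.word aM u = WGraph.combine (prefixSet (σ.word aQ) (σ.word vBest 0)) E.target
        (σ.word aM) u) ∧
      (∀ u < n, τ.real rWV u = E.G.vertexWeight (τ.word aM) u) ∧
      τ.word vH 0 ≤ σ.word vH 0 + 3 * σ.word vBest 0 ∧ ∀ u < n, τ.word aIn u = 0) σ := by
  have hqn := hQ.le
  set b := σ.word vBest 0 with hbdef
  set q := σ.word vQn 0 with hqdef
  set Q := σ.word aQ with hQdef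
  set R := prefixSet Q b with hRdef
  simp only [Prog.switch, wp_block_cons, wp_block_one, wp_setWord, wp_setReal, wp_skip, WExp.eval, RExp.eval,
    Memory.word_setWord, Memory.real_setWord, Memory.real_setReal, Memory.word_setReal,
    Nat.reduceEqDiff, if_true, if_false, Function.update_self]
  refine ⟨by omega, by omega, ?_⟩
  refine wp_of (wp_unmark (by decide) (by decide) ?_ hB ?_ ?_) ?_ <;>
    try simp only [Memory.word_setWord, Memory.real_setWord, Memory.real_setReal, Memory.word_setReal,
    Nat.reduceEqDiff, if_true, if_false, Function.update_self]
  · exact hb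
  · exact hQ.lt
  · exact hqn
  rintro τ x ⟨hx, hin⟩ hF
  have f1 : ∀ a, a ∉ [aIn, vI] → τ.word a = σ.word a := by
    intro a ha
    simp only [List.mem_cons, List.not_mem_nil, not_or] at ha
    rw [hF.1 a (by simp [Prog.wordArrays, Prog.unmark, Prog.forLoop]; omega)]
    simp only [Memory.word_setWord, Memory.real_setWord, Memory.real_setReal, Memory.word_setReal,
    Nat.reduceEqDiff, if_true, if_false, Function.update_self, if_neg ha.2.1]
  have r1 : τ.real = σ.real := by
    funext a
    rw [hF.2 a (by simp [Prog.realArrays, Prog.unmark, Prog.forLoop])]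
    simp only [Memory.word_setWord, Memory.real_setWord, Memory.real_setReal, Memory.word_setReal,
    Nat.reduceEqDiff, if_true, if_false, Function.update_self]
  -- The queue has no repetitions, so clearing the marks behind the cut does not touch the prefix:
  -- the marks are now the indicator of `R`.
  have hin1 : ∀ u < n, τ.word aIn u = if u ∈ R then 1 else 0 := by
    intro u hu
    by_cases h1 : u ∈ R
    · obtain ⟨i, hi, hi'⟩ := mem_prefixSet.1 h1
      rw [if_pos h1, (hin u).2, hQ.mark u hu, if_pos ⟨i, by omega, hi'⟩]
      rintro ⟨j, hj, hj', hjj⟩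
      have := hQ.inj i (by omega) j hj' (by rw [hjj]; exact hi')
      omega
    · rw [if_neg h1]
      by_cases h3 : ∃ j < σ.word vQn 0, σ.word aQ j = u
      · obtain ⟨j, hj, hjj⟩ := h3
        refine (hin u).1 ⟨j, ?_, hj, hjj⟩
        by_contra hlt
        exact h1 (mem_prefixSet.2 ⟨j, by omega, hjj⟩)
      · rw [(hin u).2, hQ.mark u hu, if_neg h3]
        rintro ⟨j, -, hj, hjj⟩
        exact h3 ⟨j, hj, hjj⟩
  have s1 := f1 vBest (by decide)
  have s2 := f1 vH (by decide)
  have s3 := f1 aQ (by decide)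
  have s4 := f1 aM (by decide)
  have hLτ : Logged n hist m τ := hL.of_eq s4 s2 (f1 _ (by decide)) (f1 _ (by decide))
    (by rw [r1]) (by rw [r1]) (by rw [r1])
  refine ⟨by omega, by omega, ?_⟩
  refine wp_of (wp_isolate (hist := hist) (m := m) (hLτ.of_eq ?_ ?_ ?_ ?_ ?_ ?_ ?_) ?_ ?_ ?_ ?_ ?_
    hB ?_) ?_ <;> simp only [Memory.word_setWord, Memory.real_setWord, Memory.real_setReal, Memory.word_setReal,
    Nat.reduceEqDiff, if_true, if_false, Function.update_self, s1, s2, s3, s4, r1]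
  · exact hP
  · exact hz
  · exact fun i hi => hQ.lt i (by omega)
  · omega
  · omega
  rintro υ y ⟨hy, hLυ, hMυ, hwυ, hHυ⟩ hF2
  have f2 : ∀ a, a ∉ vI :: Prog.isolate.wordArrays → υ.word a = τ.word a := by
    intro a ha
    simp only [List.mem_cons, not_or] at ha
    rw [hF2.1 a ha.2]
    simp only [Memory.word_setWord, Memory.real_setWord, Memory.real_setReal, Memory.word_setReal,
    Nat.reduceEqDiff, if_true, if_false, Function.update_self, if_neg ha.1]
  have t1 : υ.word vBest = σ.word vBest := by rw [f2 vBest (by decide), s1]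
  have t3 : υ.word aQ = σ.word aQ := by rw [f2 aQ (by decide), s3]
  have t4 : υ.word aIn = τ.word aIn := f2 aIn (by decide)
  rw [← hQdef, ← hbdef] at hMυ
  have hrem : ∀ u < n, u ∈ R → υ.word aM u = 0 := by
    intro u hu huR
    obtain ⟨i, hi, hi'⟩ := mem_prefixSet.1 huR
    rw [hMυ u hu]
    unfold WGraph.removeEdges
    by_cases h0 : σ.word aM u = 0
    · simp [h0]
    · rw [if_pos ⟨h0, i, hi, Or.inl hi'⟩]
  refine ⟨by omega, by omega, ?_⟩
  refine wp_of (wp_adopt (hist := hist) (m := m) hM (hLυ.of_eq ?_ ?_ ?_ ?_ ?_ ?_ ?_) ?_ ?_ ?_ ?_ ?_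
    ?_ hB ?_) ?_ <;> simp only [Memory.word_setWord, Memory.real_setWord, Memory.real_setReal, Memory.word_setReal,
    Nat.reduceEqDiff, if_true, if_false, Function.update_self, t1, t3, t4]
  · exact fun i hi => hrem _ (hQ.lt i (by omega)) (mem_prefixSet.2 ⟨i, hi, rfl⟩)
  · intro u hu
    rw [hwυ u hu]
    by_cases h0 : υ.word aM u = 0
    · simp [WGraph.vertexWeight, h0]
    · have h1 : υ.word aM u = σ.word aM u := by
        rcases WGraph.removeEdges_eq_or (Incident Q b) (σ.word aM) u with h | h
        · rw [hMυ u hu] at h0; exact absurd h h0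
        · rw [hMυ u hu]; exact h.1
      rw [if_neg h0, hw u hu fun h => h0 (hrem u hu h)]
      exact (E.G.vertexWeight_congr h1).symm
  · exact hin1
  · exact fun i hi => hQ.lt i (by omega)
  · omega
  · omega
  rintro φ z ⟨hzz, hLφ, hMφ, hwφ, hHφ⟩ hF3
  have f3 : ∀ a, a ∉ vI :: Prog.adopt.wordArrays → φ.word a = υ.word a := by
    intro a ha
    simp only [List.mem_cons, not_or] at ha
    rw [hF3.1 a ha.2]
    simp only [Memory.word_setWord, Memory.real_setWord, Memory.real_setReal, Memory.word_setReal,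
    Nat.reduceEqDiff, if_true, if_false, Function.update_self, if_neg ha.1]
  have v1 : φ.word vBest = σ.word vBest := by rw [f3 vBest (by decide), t1]
  have v3 : φ.word aQ = σ.word aQ := by rw [f3 aQ (by decide), t3]
  have v4 : φ.word aIn = τ.word aIn := by rw [f3 aIn (by decide), t4]
  refine ⟨by omega, by omega, ?_⟩
  refine wp_of (wp_unmark (by decide) (by decide) ?_ hB ?_ ?_) ?_ <;> simp only [Memory.word_setWord, Memory.real_setWord, Memory.real_setReal, Memory.word_setReal,
    Nat.reduceEqDiff, if_true, if_false, Function.update_self, v1, v3]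
  · omega
  · exact fun i hi => hQ.lt i (by omega)
  · omega
  rintro ψ w ⟨hw', hinψ⟩ hF4
  have f4 : ∀ a, a ∉ [aIn, vI] → ψ.word a = φ.word a := by
    intro a ha
    simp only [List.mem_cons, List.not_mem_nil, not_or] at ha
    rw [hF4.1 a (by simp [Prog.wordArrays, Prog.unmark, Prog.forLoop]; omega)]
    simp only [Memory.word_setWord, Memory.real_setWord, Memory.real_setReal, Memory.word_setReal,
    Nat.reduceEqDiff, if_true, if_false, Function.update_self, if_neg ha.2.1]
  have r4 : ψ.real = φ.real := by
    funext a
    rw [hF4.2 a (by simp [Prog.realArrays, Prog.unmark, Prog.forLoop])]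
    simp only [Memory.word_setWord, Memory.real_setWord, Memory.real_setReal, Memory.word_setReal,
    Nat.reduceEqDiff, if_true, if_false, Function.update_self]
  have w4 := f4 aM (by decide)
  have w2 := f4 vH (by decide)
  refine ⟨by omega, hLφ.of_eq w4 w2 (f4 _ (by decide)) (f4 _ (by decide))
    (by rw [r4]) (by rw [r4]) (by rw [r4]), fun u hu => ?_, by rw [w4, r4]; exact hwφ,
    by rw [w2]; omega, fun u hu => ?_⟩
  · rw [w4, hMφ u hu, hMυ u hu]
    unfold WGraph.combine
    rw [← hbdef, ← hQdef]
    by_cases h1 : u ∈ R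
    · rw [if_pos h1, if_pos h1]
    · rw [if_neg h1, if_neg h1]
      unfold WGraph.removeEdges
      have : ∀ v, Incident Q b u v ↔ v ∈ R := by
        intro v
        rw [mem_prefixSet]
        constructor
        · rintro ⟨i, hi, h | h⟩
          · exact absurd (mem_prefixSet.2 ⟨i, hi, h⟩) h1
          · exact ⟨i, hi, h⟩
        · rintro ⟨i, hi, h⟩
          exact ⟨i, hi, Or.inr h⟩
      simp only [this]
  · by_cases h2 : u ∈ R
    · obtain ⟨i, hi, hi'⟩ := mem_prefixSet.1 h2
      exact (hinψ u).1 ⟨i, by omega, hi, hi'⟩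
    · rw [(hinψ u).2, v4, hin1 u hu, if_neg h2]
      rintro ⟨i, -, hi, hi'⟩
      exact h2 (mem_prefixSet.2 ⟨i, hi, hi'⟩)

end Env

end

/-! ### Quality and cost of one repair. -/

noncomputable section

/-- The matching and the weights at the vertices fit to the graph `G`. -/
structure MateState.In {n : ℕ} (G : WGraph n) (s : MateState) : Prop where
  isMate : G.IsMate s.1
  weight : ∀ u < n, s.2 u = G.vertexWeight s.1 u

theorem MateState.In.zero {n : ℕ} {G : WGraph n} {s : MateState} (h : s.In G) :
    ∀ u < n, s.1 u = 0 → s.2 u = 0 := by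
  intro u hu h0
  rw [h.weight u hu, WGraph.vertexWeight, if_pos h0]

theorem MateState.In.sum {n : ℕ} {G : WGraph n} {s : MateState} (h : s.In G) :
    ∑ u ∈ Finset.range n, s.2 u = G.mateWeight s.1 :=
  Finset.sum_congr rfl fun u hu => h.weight u (Finset.mem_range.1 hu)

namespace Prog

/-- Repair the matching at the top of the stack after the later updates. -/
def attempt : Prog := block [gather, search, switch]

end Prog

namespace Env

variable {n : ℕ} {E : Env n} {hist : ℕ → MateState} {m : ℕ} {σ : Memory}

theorem Queued.mem_prefixSet {q : ℕ → ℕ} {b y : ℕ} (h : Queued q b y) (hy : y ≠ 0) :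
    y - 1 ∈ prefixSet q b := by
  obtain ⟨i, hi, h⟩ := h hy
  exact _root_.mem_prefixSet.2 ⟨i, hi, by omega⟩

/-- Entries of the queue before `lo` have both neighbors in the prefix, so an edge that leaves the
prefix starts at an entry in `[lo, b)` and is paid for by the cost of that entry. -/
theorem GoodCut.crossing_le {W : ℝ} (hG : E.G.WeightsIn W) {f : ℕ → ℕ} {w : ℕ → ℝ} {q : ℕ → ℕ}
    {b : ℕ} {z : ℝ} (h : E.GoodCut f w q b z) (hw : ∀ u < n, w u = E.G.vertexWeight f u)
    (hq : ∀ i < b, q i < n) :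
    E.G.crossing (prefixSet q b) E.target + E.G.crossing (prefixSet q b) f ≤ z := by
  obtain ⟨lo, hlo, h1, rfl⟩ := h
  unfold WGraph.crossing
  rw [← Finset.sum_add_distrib]
  set g : ℕ → ℝ := fun u =>
    (if u ∈ prefixSet q b ∧ E.target u - 1 ∉ prefixSet q b then E.G.vertexWeight E.target u else 0) +
    if u ∈ prefixSet q b ∧ f u - 1 ∉ prefixSet q b then E.G.vertexWeight f u else 0 with hg
  have key : ∀ u < n, g u ≠ 0 → ∃ i, lo ≤ i ∧ i < b ∧ q i = u := by
    intro u hu hgu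
    by_cases hR : u ∈ prefixSet q b
    swap
    · simp [hg, hR] at hgu
    obtain ⟨i, hi, rfl⟩ := mem_prefixSet.1 hR
    refine ⟨i, ?_, hi, rfl⟩
    by_contra hlt
    obtain ⟨h2, h3⟩ := h1 i (by omega)
    apply hgu
    have e1 : (if q i ∈ prefixSet q b ∧ E.target (q i) - 1 ∉ prefixSet q b then
        E.G.vertexWeight E.target (q i) else 0) = 0 := by
      by_cases h0 : E.target (q i) = 0
      · simp [WGraph.vertexWeight, h0]
      · rw [if_neg]; rintro ⟨-, h⟩; exact h (h2.mem_prefixSet h0)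
    have e2 : (if q i ∈ prefixSet q b ∧ f (q i) - 1 ∉ prefixSet q b then
        E.G.vertexWeight f (q i) else 0) = 0 := by
      by_cases h0 : f (q i) = 0
      · simp [WGraph.vertexWeight, h0]
      · rw [if_neg]; rintro ⟨-, h⟩; exact h (h3.mem_prefixSet h0)
    simp only [hg, e1, e2, add_zero]
  have hnn : ∀ u, 0 ≤ E.G.vertexWeight E.target u := hG.vertexWeight_nonneg _
  have hnn' : ∀ u, 0 ≤ E.G.vertexWeight f u := hG.vertexWeight_nonneg _
  have hcost : ∀ u < n, g u ≤ E.cost w u := by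
    intro u hu
    simp only [hg, cost, hw u hu]
    have := hnn u
    have := hnn' u
    split_ifs <;> linarith
  calc ∑ u ∈ Finset.range n, g u
      ≤ ∑ u ∈ (Finset.Ico lo b).image q, E.cost w u := by
        rw [← Finset.sum_subset (s₁ := (Finset.range n).filter fun u => g u ≠ 0)
          (Finset.filter_subset _ _)]
        · refine (Finset.sum_le_sum fun u hu => hcost u
            (Finset.mem_range.1 (Finset.mem_filter.1 hu).1)).trans ?_
          refine Finset.sum_le_sum_of_subset_of_nonneg ?_ ?_
          · intro u hu
            obtain ⟨hu1, hu2⟩ := Finset.mem_filter.1 hu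
            obtain ⟨i, hi, hi', rfl⟩ := key u (Finset.mem_range.1 hu1) hu2
            exact Finset.mem_image.2 ⟨i, Finset.mem_Ico.2 ⟨hi, hi'⟩, rfl⟩
          · intro u hu _
            obtain ⟨i, hi, rfl⟩ := Finset.mem_image.1 hu
            have := hq i (Finset.mem_Ico.1 hi).2
            simp only [cost, hw _ this]
            have := hnn (q i)
            have := hnn' (q i)
            linarith
        · intro u hu hu'
          simp only [Finset.mem_filter, hu, true_and, not_not] at hu'
          exact hu'
    _ ≤ ∑ i ∈ Finset.Ico lo b, E.cost w (q i) := by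
        refine Finset.sum_image_le_of_nonneg ?_
        intro u hu
        obtain ⟨i, hi, rfl⟩ := Finset.mem_image.1 hu
        have := hq i (Finset.mem_Ico.1 hi).2
        simp only [cost, hw _ this]
        have := hnn (q i)
        have := hnn' (q i)
        linarith

/-- The loss `Gq.opt - Gq.mateWeight F` of the old matching is inherited and `5ε` times the current
optimum is added; the weights may have changed completely inside `R`, as the exchange argument
compares each graph with its own optimum. The queue holds at most `8 ⌈1/ε⌉ ℓ` vertices, which bounds
both the cost and the growth of the log. -/
theorem wp_attempt {W ε : ℝ} (hW : 0 ≤ W) (hε : 0 < ε) (hG : E.G.WeightsIn W) {Gq : WGraph n}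
    (hGq : Gq.WeightsIn W) (hM : E.G.IsMate E.target)
    (happ : (1 - ε) * E.G.opt ≤ E.G.mateWeight E.target) (hσε : σ.real 0 1 = ε)
    (hL : Logged n hist m σ) (hin : MateState.In Gq (σ.word aM, σ.real rWV)) {ℓ : ℕ}
    (hℓ : σ.word aPos (σ.word vSp 0) + ℓ = σ.word vCnt 0) (hℓ1 : 1 ≤ ℓ)
    (hT : ∀ j < σ.word vCnt 0, σ.word aTU j < n ∧ σ.word aTV j < n)
    (hagree : ∀ u v, ¬ Touched (σ.word aTU) (σ.word aTV) (σ.word aPos (σ.word vSp 0))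
      (σ.word vCnt 0) u v → E.G.lookup u v = Gq.lookup u v)
    (hIn : ∀ u < n, σ.word aIn u = 0)
    (hB : n < E.B) (hB' : ⌈1 / ε⌉₊ + 1 < E.B) (hcnt : σ.word vCnt 0 < E.B)
    (hh : σ.word vH 0 + 2 * ℓ + 3 * n + 2 < E.B) :
    E.wp .attempt (fun τ x => x ≤ 500 * (⌈1 / ε⌉₊ * ℓ) ∧ Logged n hist m τ ∧
      MateState.In E.G (τ.word aM, τ.real rWV) ∧
      E.G.opt - E.G.mateWeight (τ.word aM) ≤
        Gq.opt - Gq.mateWeight (σ.word aM) + 5 * ε * E.G.opt ∧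
      τ.word vH 0 ≤ σ.word vH 0 + 2 * ℓ + 3 * n ∧
      τ.word vH 0 ≤ σ.word vH 0 + 26 * (⌈1 / ε⌉₊ * ℓ) ∧
      ∀ u < n, τ.word aIn u = 0) σ := by
  have hr1 : 1 ≤ ⌈1 / ε⌉₊ := Nat.one_le_ceil_iff.2 (by positivity)
  set r := ⌈1 / ε⌉₊ with hr
  have eℓ : σ.word vCnt 0 - σ.word aPos (σ.word vSp 0) = ℓ := by omega
  have hrl : ℓ ≤ r * ℓ := Nat.le_mul_of_pos_left _ hr1
  have hrl' : r ≤ r * ℓ := Nat.le_mul_of_pos_right _ hℓ1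
  have hF := hin.isMate
  simp only [Prog.attempt, wp_block_cons, wp_block_one, wp_setWord, wp_setReal, wp_skip, WExp.eval, RExp.eval,
    Memory.word_setWord, Memory.real_setWord, Memory.real_setReal, Memory.word_setReal,
    Nat.reduceEqDiff, if_true, if_false, Function.update_self]
  refine wp_of (wp_gather hL hF.pairing hin.zero hT hIn (by omega) hB hcnt (by rw [eℓ]; omega)) ?_
  rw [eℓ]
  set P := Touched (σ.word aTU) (σ.word aTV) (σ.word aPos (σ.word vSp 0)) (σ.word vCnt 0) with hPdef
  have hPs : ∀ u v, P u v → P v u := fun u v h => Touched.symm h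
  rintro τ x ⟨hx, hLτ, hQτ, hqτ, htch, hMτ, hwτ, hHτ⟩ hF1
  have hmate : E.G.IsMate (τ.word aM) := (hF.removeEdges hPs hagree).congr hMτ
  have hw1 : ∀ u < n, τ.real rWV u = E.G.vertexWeight (τ.word aM) u := by
    intro u hu
    rw [hwτ u hu, E.G.vertexWeight_congr (hMτ u hu),
      WGraph.vertexWeight_removeEdges (G := Gq) hagree, hMτ u hu]
    exact if_congr Iff.rfl rfl (hin.weight u hu)
  have hz1 : ∀ u < n, τ.word aM u = 0 → τ.real rWV u = 0 := by
    intro u hu h0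
    rw [hw1 u hu, WGraph.vertexWeight, if_pos h0]
  have hε1 : τ.real 0 = σ.real 0 := hF1.2 0 (by decide)
  refine wp_of (wp_search hε hM hmate.pairing hz1 hB hB' ?_ hQτ (by rw [hε1]; exact hσε)) ?_
  · intro u hu
    rw [cost, hw1 u hu]
    exact add_nonneg (hG.vertexWeight_nonneg _ _) (hG.vertexWeight_nonneg _ _)
  rw [← hr]
  rintro υ y ⟨hy, hQυ, hpre, hqυ, hbk, hbq, z, hcut, hzle⟩ hF2
  have s1 : υ.word aM = τ.word aM := hF2.1 _ (by decide)
  have s2 : υ.real rWV = τ.real rWV := hF2.2 _ (by decide)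
  have s3 : υ.word vH = τ.word vH := hF2.1 _ (by decide)
  have hqn := hQυ.le
  -- There are at most `2ℓ` seeds.
  have hmul : (2 * r + 2) * τ.word vQn 0 ≤ 8 * (r * ℓ) := by
    calc (2 * r + 2) * τ.word vQn 0 ≤ (4 * r) * (2 * ℓ) := Nat.mul_le_mul (by omega) hqτ
      _ = 8 * (r * ℓ) := by ring
  have hmul2 : r * (48 * τ.word vQn 0 + 10) ≤ 106 * (r * ℓ) := by
    calc r * (48 * τ.word vQn 0 + 10) ≤ r * (106 * ℓ) := Nat.mul_le_mul_left _ (by omega)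
      _ = 106 * (r * ℓ) := by ring
  have hLυ : Logged n hist m υ := hLτ.of_eq s1 s3 (hF2.1 _ (by decide)) (hF2.1 _ (by decide)) s2
    (hF2.2 _ (by decide)) (hF2.2 _ (by decide))
  refine wp_of (wp_switch hM hLυ hQυ hbq ?_ ?_ ?_ hB ?_) ?_
  · rw [s1]; exact hmate.pairing
  · rw [s1, s2]; exact hz1
  · rw [s1, s2]; exact fun u hu _ => hw1 u hu
  · rw [s3]; omega
  set R := prefixSet (υ.word aQ) (υ.word vBest 0) with hR
  rw [s1, s3]
  rintro φ w ⟨hw, hLφ, hMφ, hwφ, hHφ, hInφ⟩ -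
  -- everything outside `R` is untouched
  have hPR : ∀ u v, P u v → u ∈ R := by
    intro u v h
    obtain ⟨j, hj, hj'⟩ := htch u v h
    exact mem_prefixSet.2 ⟨j, by omega, by rw [hpre j hj, hj']⟩
  have hPR' : ∀ u v, u ∉ R → E.G.lookup u v = Gq.lookup u v :=
    fun u v h => hagree u v fun h' => h (hPR u v h')
  -- Outside `R` the collection of updated pairs deleted nothing, so the uncleaned matching `F`
  -- gives the same combination.
  have hMφ' : ∀ u < n, φ.word aM u = WGraph.combine R E.target (σ.word aM) u := by
    intro u hu
    rw [hMφ u hu]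
    unfold WGraph.combine
    by_cases h1 : u ∈ R
    · rw [if_pos h1, if_pos h1]
    · have : τ.word aM u = σ.word aM u := by
        rw [hMτ u hu]
        unfold WGraph.removeEdges
        rw [if_neg]
        exact fun h => h1 (hPR _ _ h.2)
      rw [if_neg h1, if_neg h1, this]
  -- An edge of `F` that leaves `R` is not an updated pair, hence it has survived with its old
  -- weight; the search has charged for it.
  have hcross : Gq.crossing R (σ.word aM) ≤ E.G.crossing R (τ.word aM) := by
    unfold WGraph.crossing
    refine Finset.sum_le_sum fun u hu => ?_
    have hu := Finset.mem_range.1 hu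
    by_cases h0 : σ.word aM u = 0
    · have : Gq.vertexWeight (σ.word aM) u = 0 := by simp [WGraph.vertexWeight, h0]
      rw [this]
      have := hG.vertexWeight_nonneg (τ.word aM) u
      split_ifs <;> linarith
    · by_cases h1 : u ∈ R ∧ σ.word aM u - 1 ∉ R
      · have h2 : ¬ P u (σ.word aM u - 1) := fun h => h1.2 (hPR _ _ (hPs _ _ h))
        have h3 : τ.word aM u = σ.word aM u := by
          rw [hMτ u hu]
          unfold WGraph.removeEdges
          rw [if_neg fun h => h2 h.2]
        rw [if_pos h1, h3, if_pos h1, WGraph.vertexWeight, WGraph.vertexWeight, h3, if_neg h0,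
          if_neg h0, hagree _ _ h2]
      · rw [if_neg h1]
        have := hG.vertexWeight_nonneg (τ.word aM) u
        split_ifs <;> linarith
  have hmateφ : E.G.IsMate (φ.word aM) :=
    (WGraph.IsMate.combine (G := E.G) hM hF (fun _ _ _ _ => rfl) fun u hu v _ => hPR' u v hu).congr hMφ'
  refine ⟨by omega, hLφ, ⟨hmateφ, hwφ⟩, ?_, by omega, by omega, hInφ⟩
  have k1 := WGraph.mateWeight_combine_ge hGq hW hM hF hPR'
  rw [← WGraph.mateWeight_congr E.G hMφ'] at k1
  have k2 := hcut.crossing_le hG hw1 fun i hi => hQυ.lt i (by omega)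
  have k3 : ∑ u ∈ Finset.range n, E.cost (τ.real rWV) u =
      E.G.mateWeight E.target + E.G.mateWeight (τ.word aM) := by
    unfold WGraph.mateWeight
    rw [← Finset.sum_add_distrib]
    exact Finset.sum_congr rfl fun u hu => by rw [cost, hw1 u (Finset.mem_range.1 hu)]
  have k4 := hG.mateWeight_le_opt hW hM
  have k5 := hG.mateWeight_le_opt hW hmate
  rw [k3] at hzle
  -- The crossing edges weigh at most `2ε` times the optimum and enter twice; a further `ε` comes
  -- from the approximation by the black box: `5ε` together.
  have k6 : ε * (E.G.mateWeight E.target + E.G.mateWeight (τ.word aM)) ≤ ε * (2 * E.G.opt) :=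
    mul_le_mul_of_nonneg_left (by linarith) hε.le
  rw [← hR] at k2
  linarith

end Env

end

/-! ### Rebuilding from the list of the black box. -/

noncomputable section

/-- The list in the memory consists of vertices, and all vertices that `f` matches are among them. -/
structure Listing (n : ℕ) (f : ℕ → ℕ) (σ : Memory) : Prop where
  lt : ∀ i < σ.word vLN 0, σ.word aLA i < n ∧ σ.word aLB i < n
  cover : ∀ u < n, f u ≠ 0 → ∃ i < σ.word vLN 0, σ.word aLA i = u ∨ σ.word aLB i = u

theorem Listing.of_eq {n : ℕ} {f : ℕ → ℕ} {σ τ : Memory} (h : Listing n f σ)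
    (h1 : τ.word vLN = σ.word vLN) (h2 : τ.word aLA = σ.word aLA) (h3 : τ.word aLB = σ.word aLB) :
    Listing n f τ := by
  obtain ⟨a, b⟩ := h
  constructor <;> rw [h1, h2, h3] <;> assumption

namespace Prog

/-- Append the listed vertices to the queue. -/
def enlist : Prog := forLoop vI (.var vLN) (block [
  assign vP (.get aLA (.var vI)),
  push,
  assign vP (.get aLB (.var vI)),
  push])

/-- Start a new stack from the current matching. -/
def reset : Prog := block [
  assign vCnt (.const 0),
  assign vH (.const 0),
  assign aPos (.const 0),
  assignReal rR (.var rWt)]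

/-- Switch to the matching of the algorithm everywhere. -/
def rebuild : Prog := block [
  assign vSp (.const 0),
  revert,
  assign vQn (.const 0),
  assign vI (.const 0),
  enlist,
  edges aLA aLB vLN,
  assign vI (.const 0),
  enlist,
  assign vBest (.var vQn),
  switch,
  reset]

end Prog

namespace Env

variable {n : ℕ} {E : Env n} {hist : ℕ → MateState} {m : ℕ} {σ : Memory}

/-- The black box answers correctly in the current state. -/
structure Fits (E : Env n) (W ε : ℝ) : Prop where
  weightsIn : E.G.WeightsIn W
  isMate : E.G.IsMate E.target
  approx : (1 - ε) * E.G.opt ≤ E.G.mateWeight E.target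
  listed : ∀ u < n, E.target u ≠ 0 → ∃ p ∈ E.A.edges E.s, (p.1 : ℕ) = u ∨ (p.2 : ℕ) = u
  count : 2 * (E.A.edges E.s).length = WGraph.matchedCount n E.target

theorem Fits.of_vertexMatch {W ε T : ℝ} (hW : 0 ≤ W) (hε : ε < 1) (hG : E.G.WeightsIn W)
    (h : E.A.VertexMatch E.s T) (hM : E.G.IsApproxMWM ε (E.A.matching E.s)) : E.Fits W ε := by
  have hm := DynAlg.isMate_mateFun h hG hM.1
  have he := DynAlg.edgesOf_mateFun h hG hM.1
  refine ⟨hG, hm, ?_, fun u hu h0 => ?_, ?_⟩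
  · rw [← he] at hM
    exact hM.opt_le hε hm
  · have hv := hm.lt hu h0
    have h1 : s((⟨u, hu⟩ : Fin n), ⟨E.target u - 1, hv⟩) ∈ E.A.matching E.s := by
      rw [← DynAlg.mateFun_eq_iff h]
      change E.target u = _
      simp only
      omega
    rw [← h.mem_edges, List.mem_map] at h1
    obtain ⟨p, hp, hp'⟩ := h1
    refine ⟨p, hp, ?_⟩
    rcases Sym2.eq_iff.1 hp' with ⟨h2, -⟩ | ⟨-, h2⟩
    · left; rw [h2]
    · right; rw [h2]
  · rw [DynAlg.length_edges h, ← he, hm.matchedCount_eq]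

theorem wp_enlist (hQ : QueueInv n σ) (hvI : σ.word vI 0 = 0)
    (hl : ∀ i < σ.word vLN 0, σ.word aLA i < n ∧ σ.word aLB i < n) (hB : n < E.B)
    (hB' : σ.word vLN 0 < E.B) :
    E.wp .enlist (fun τ x => x ≤ 12 * σ.word vLN 0 + 1 ∧ QueueInv n τ ∧
      (∀ j < σ.word vQn 0, τ.word aQ j = σ.word aQ j) ∧ σ.word vQn 0 ≤ τ.word vQn 0 ∧
      τ.word vQn 0 ≤ σ.word vQn 0 + 2 * σ.word vLN 0 ∧
      ∀ i < σ.word vLN 0, ∀ u, (σ.word aLA i = u ∨ σ.word aLB i = u) →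
        ∃ j < τ.word vQn 0, τ.word aQ j = u) σ := by
  refine wp_forLoop (c := 10) (H := σ.word vLN 0) (I := fun j τ => QueueInv n τ ∧
      (∀ j < σ.word vQn 0, τ.word aQ j = σ.word aQ j) ∧ σ.word vQn 0 ≤ τ.word vQn 0 ∧
      τ.word vQn 0 ≤ σ.word vQn 0 + 2 * j ∧
      ∀ i < j, ∀ u, (σ.word aLA i = u ∨ σ.word aLB i = u) → ∃ j < τ.word vQn 0, τ.word aQ j = u)
      (by omega) (by omega) ?_ ?_ (by decide) ?_ ?_
  · rw [hvI]
    exact ⟨hQ, fun _ _ => rfl, le_rfl, by omega, fun i hi => absurd hi (by omega)⟩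
  · intro τ hτ
    rw [WExp.eval, WExp.eval, hτ vLN (by decide)]
  · rintro j τ hj hjH ⟨hQτ, hpre, hge, hle, hcov⟩ hvIτ hFw hFr
    have e1 : τ.word aLA = σ.word aLA := hFw _ (by decide)
    have e2 : τ.word aLB = σ.word aLB := hFw _ (by decide)
    obtain ⟨hl1, hl2⟩ := hl j hjH
    simp only [wp_block_cons, wp_block_one, wp_setWord, wp_setReal, wp_skip, WExp.eval, RExp.eval,
    Memory.word_setWord, Memory.real_setWord, Memory.real_setReal, Memory.word_setReal,
    Nat.reduceEqDiff, if_true, if_false, Function.update_self, hvIτ, e1]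
    refine ⟨by omega, by omega, ?_⟩
    refine wp_of (wp_push (hQτ.of_eq ?_ ?_ ?_) ?_ hB) ?_ <;>
    try simp only [Memory.word_setWord, Memory.real_setWord, Memory.real_setReal, Memory.word_setReal,
    Nat.reduceEqDiff, if_true, if_false, Function.update_self]
    · exact hl1
    rintro υ x ⟨hx, hQυ, hpreυ, hinυ, hcυ⟩ hF
    have v1 : υ.word vI 0 = j := by
      rw [hF.1 vI (by decide)]; simp only [Memory.word_setWord, Memory.real_setWord, Memory.real_setReal, Memory.word_setReal,
    Nat.reduceEqDiff, if_true, if_false, Function.update_self]; exact hvIτ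
    have v2 : υ.word aLB = σ.word aLB := by
      rw [hF.1 aLB (by decide)]; simp only [Memory.word_setWord, Memory.real_setWord, Memory.real_setReal, Memory.word_setReal,
    Nat.reduceEqDiff, if_true, if_false, Function.update_self]; exact e2
    simp only [v1, v2]
    refine ⟨by omega, by omega, ?_⟩
    refine wp_of (wp_push (hQυ.of_eq ?_ ?_ ?_) ?_ hB) ?_ <;>
    try simp only [Memory.word_setWord, Memory.real_setWord, Memory.real_setReal, Memory.word_setReal,
    Nat.reduceEqDiff, if_true, if_false, Function.update_self]
    · exact hl2
    rintro φ y ⟨hy, hQφ, hpreφ, hinφ, hcφ⟩ -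
    refine ⟨by omega, fun υ' hυ hυr => ⟨hQφ.of_eq ?_ ?_ ?_, ?_⟩⟩
    · rw [hυ _ (by decide)]
    · exact hυ _ (by decide)
    · exact hυ _ (by decide)
    rw [hυ aQ (by decide), hυ vQn (by decide)]
    have hmono1 : τ.word vQn 0 ≤ υ.word vQn 0 := by omega
    have hmono2 : υ.word vQn 0 ≤ φ.word vQn 0 := by omega
    refine ⟨fun i hi => ?_, by omega, by omega, fun i hi u hu => ?_⟩
    · rw [hpreφ i (by omega), hpreυ i (by omega), hpre i hi]
    · rcases Nat.lt_succ_iff_lt_or_eq.1 hi with hi | rfl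
      · obtain ⟨k, hk, hk'⟩ := hcov i hi u hu
        exact ⟨k, by omega, by rw [hpreφ k (by omega), hpreυ k hk, hk']⟩
      · rcases hu with rfl | rfl
        · obtain ⟨k, hk, hk'⟩ := hinυ
          exact ⟨k, by omega, by rw [hpreφ k hk, hk']⟩
        · exact hinφ
  · rintro τ x ⟨h1, h2, h3, h4, h5⟩ _ hx _ _
    rw [hvI] at hx
    exact ⟨by omega, h1, h2, h3, h4, h5⟩

/-- The log is undone down to the bottom entry because all vertices matched there are on the stored
list. Together with the new list they form the set on which to switch; both matchings are empty
elsewhere. The cost is thus proportional to the two lists and the log, not to `n`. An edge costs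
`97` at most: `12` for enlisting it, `84` for switching its two ends, and `1` for listing it if it
is new. -/
theorem wp_rebuild {W ε : ℝ} (hE : E.Fits W ε) {s₀ : MateState}
    (hL : Logged n (fun _ => s₀) 0 σ) (hP : Pairing n s₀.1) (hz : ∀ u < n, s₀.1 u = 0 → s₀.2 u = 0)
    (hmark : σ.word aMark 0 = 0) (hLst : Listing n s₀.1 σ) (hIn : ∀ u < n, σ.word aIn u = 0)
    (hB : n < E.B) (hB' : σ.word vLN 0 < E.B) (hh : σ.word vH 0 < E.B) (hB3 : 3 * n + 2 < E.B) :
    E.wp .rebuild (fun τ x =>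
      x ≤ 5 * σ.word vH 0 + 97 * (σ.word vLN 0 + (E.A.edges E.s).length) + 30 ∧
      Logged n (fun _ => (τ.word aM, τ.real rWV)) 0 τ ∧
      MateState.In E.G (τ.word aM, τ.real rWV) ∧ (∀ u < n, τ.word aM u = E.target u) ∧
      τ.word vH 0 = 0 ∧ τ.word vCnt 0 = 0 ∧ τ.word vSp 0 = 0 ∧ τ.word aPos 0 = 0 ∧
      τ.real rR 0 = E.G.mateWeight E.target ∧
      τ.word vLN 0 = (E.A.edges E.s).length ∧ Listing n (τ.word aM) τ ∧
      ∀ u < n, τ.word aIn u = 0) σ := by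
  have hlen : (E.A.edges E.s).length ≤ n := by
    have h1 := hE.count
    have h2 : WGraph.matchedCount n E.target ≤ n := by
      unfold WGraph.matchedCount
      exact (Finset.card_filter_le _ _).trans (by simp)
    omega
  simp only [Prog.rebuild, wp_block_cons, wp_block_one, wp_setWord, wp_setReal, wp_skip, WExp.eval, RExp.eval,
    Memory.word_setWord, Memory.real_setWord, Memory.real_setReal, Memory.word_setReal,
    Nat.reduceEqDiff, if_true, if_false, Function.update_self]
  refine ⟨by omega, by omega, ?_⟩
  refine wp_of (wp_revert (hist := fun _ => s₀) (m := 0) (hL.of_eq ?_ ?_ ?_ ?_ ?_ ?_ ?_) ?_ hB ?_)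
    ?_ <;>
    try simp only [Memory.word_setWord, Memory.real_setWord, Memory.real_setReal, Memory.word_setReal,
    Nat.reduceEqDiff, if_true, if_false, Function.update_self]
  · exact hmark
  · exact hh
  rintro τ x ⟨hx, hLτ, hs, hHτ⟩ hF
  have f1 : ∀ a, a ∉ vSp :: Prog.revert.wordArrays → τ.word a = σ.word a := by
    intro a ha
    simp only [List.mem_cons, not_or] at ha
    rw [hF.1 a ha.2]
    simp only [Memory.word_setWord, Memory.real_setWord, Memory.real_setReal, Memory.word_setReal,
    Nat.reduceEqDiff, if_true, if_false, Function.update_self, if_neg ha.1]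
  have a1 : τ.word aLA = σ.word aLA := f1 _ (by decide)
  have a2 : τ.word aLB = σ.word aLB := f1 _ (by decide)
  have a3 : τ.word vLN = σ.word vLN := f1 _ (by decide)
  have a4 : τ.word aIn = σ.word aIn := f1 _ (by decide)
  have a5 : τ.word vSp 0 = 0 := by rw [hF.1 vSp (by decide)]; simp only [Memory.word_setWord, Memory.real_setWord, Memory.real_setReal, Memory.word_setReal,
    Nat.reduceEqDiff, if_true, if_false, Function.update_self]
  have hs1 : τ.word aM = s₀.1 := by rw [← hs]
  have hs2 : τ.real rWV = s₀.2 := by rw [← hs]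
  refine ⟨by omega, by omega, by omega, by omega, ?_⟩
  refine wp_of (wp_enlist ⟨?_, ?_, ?_⟩ ?_ ?_ hB ?_) ?_ <;> simp only [Memory.word_setWord, Memory.real_setWord, Memory.real_setReal, Memory.word_setReal,
    Nat.reduceEqDiff, if_true, if_false, Function.update_self, a1, a2, a3, a4]
  · intro j hj; omega
  · intro j hj; omega
  · intro u hu
    rw [hIn u hu, if_neg]; rintro ⟨j, hj, -⟩; omega
  · exact hLst.lt
  · exact hB'
  rintro υ y ⟨hy, hQυ, -, -, hqυ, hcovυ⟩ hF2
  have f2 : ∀ a, a ∉ vQn :: vI :: Prog.enlist.wordArrays → υ.word a = τ.word a := by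
    intro a ha
    simp only [List.mem_cons, not_or] at ha
    rw [hF2.1 a ha.2.2]
    simp only [Memory.word_setWord, Memory.real_setWord, Memory.real_setReal, Memory.word_setReal,
    Nat.reduceEqDiff, if_true, if_false, Function.update_self, if_neg ha.1, if_neg ha.2.1]
  have r2 : υ.real = τ.real := by
    funext a
    rw [hF2.2 a (by simp [Prog.realArrays, Prog.enlist, Prog.forLoop, Prog.push, Prog.block])]
    simp only [Memory.word_setWord, Memory.real_setWord, Memory.real_setReal, Memory.word_setReal,
    Nat.reduceEqDiff, if_true, if_false, Function.update_self]
  rw [wp_edges]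
  set L := E.A.edges E.s with hLdef
  set υ1 : Memory := (((υ.setList aLA (L.map fun p => (p.1 : ℕ))).setList aLB
    (L.map fun p => (p.2 : ℕ))).setWord vLN 0 L.length) with hυ1
  have g1 : ∀ i (h : i < L.length), υ1.word aLA i = (L[i].1 : ℕ) := by
    intro i h
    simp [hυ1, Memory.setWord, Memory.setList, h]
  have g2 : ∀ i (h : i < L.length), υ1.word aLB i = (L[i].2 : ℕ) := by
    intro i h
    simp [hυ1, Memory.setWord, Memory.setList, h]
  have g3 : υ1.word vLN 0 = L.length := by simp [hυ1, Memory.setWord]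
  have g4 : ∀ a, a ∉ [aLA, aLB, vLN] → υ1.word a = υ.word a := by
    intro a ha
    simp only [List.mem_cons, List.not_mem_nil, not_or] at ha
    simp [hυ1, Memory.setWord, Memory.setList, ha]
  have g5 : υ1.real = υ.real := rfl
  have hltL : ∀ i < L.length, υ1.word aLA i < n ∧ υ1.word aLB i < n := by
    intro i h
    rw [g1 i h, g2 i h]
    exact ⟨L[i].1.2, L[i].2.2⟩
  refine ⟨by omega, by omega, ?_⟩
  refine wp_of (wp_enlist (hQυ.of_eq ?_ ?_ ?_) ?_ ?_ hB ?_) ?_ <;>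
    simp only [Memory.word_setWord, Memory.real_setWord, Memory.real_setReal, Memory.word_setReal,
    Nat.reduceEqDiff, if_true, if_false, Function.update_self, g3]
  · rw [g4 vQn (by decide)]
  · exact g4 aQ (by decide)
  · exact g4 aIn (by decide)
  · exact hltL
  · omega
  rintro φ z ⟨hz', hQφ, hpreφ, hgeφ, hqφ, hcovφ⟩ hF3
  rw [g4 vQn (by decide), g4 aQ (by decide)] at hpreφ
  rw [g4 vQn (by decide)] at hgeφ hqφ
  have f3 : ∀ a, a ∉ vI :: Prog.enlist.wordArrays → φ.word a = υ1.word a := by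
    intro a ha
    simp only [List.mem_cons, not_or] at ha
    rw [hF3.1 a ha.2]
    simp only [Memory.word_setWord, Memory.real_setWord, Memory.real_setReal, Memory.word_setReal,
    Nat.reduceEqDiff, if_true, if_false, Function.update_self, if_neg ha.1]
  have r3 : φ.real = τ.real := by
    funext a
    rw [hF3.2 a (by simp [Prog.realArrays, Prog.enlist, Prog.forLoop, Prog.push, Prog.block])]
    simp only [Memory.word_setWord, Memory.real_setWord, Memory.real_setReal, Memory.word_setReal,
    Nat.reduceEqDiff, if_true, if_false, Function.update_self]
    rw [g5, r2]
  have f4 : ∀ a, a ∉ vQn :: vI :: aLA :: aLB :: vLN :: Prog.enlist.wordArrays →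
      φ.word a = τ.word a := by
    intro a ha
    simp only [List.mem_cons, not_or] at ha
    rw [f3 a (by simp [ha]), g4 a (by simp [ha]), f2 a (by simp [ha])]
  have b1 : φ.word aLA = υ1.word aLA := f3 _ (by decide)
  have b2 : φ.word aLB = υ1.word aLB := f3 _ (by decide)
  have b3 : φ.word vLN 0 = L.length := by rw [f3 vLN (by decide), g3]
  have b5 : φ.word vSp 0 = 0 := by rw [f4 vSp (by decide), a5]
  have b6 : φ.word aM = s₀.1 := by rw [f4 aM (by decide), hs1]
  have b7 : φ.word vH 0 = 0 := by rw [f4 vH (by decide), hHτ]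
  have hqn := hQφ.le
  set R := prefixSet (φ.word aQ) (φ.word vQn 0) with hR
  have hR1 : ∀ u < n, s₀.1 u ≠ 0 → u ∈ R := by
    intro u hu h0
    obtain ⟨i, hi, hi'⟩ := hLst.cover u hu h0
    obtain ⟨j, hj, hj'⟩ := hcovυ i hi u hi'
    exact mem_prefixSet.2 ⟨j, by omega, by rw [hpreφ j hj, hj']⟩
  have hR2 : ∀ u < n, E.target u ≠ 0 → u ∈ R := by
    intro u hu h0
    obtain ⟨p, hp, hp'⟩ := hE.listed u hu h0
    obtain ⟨i, hi, rfl⟩ := List.getElem_of_mem hp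
    obtain ⟨j, hj, hj'⟩ := hcovφ i hi u (by rw [g1 i hi, g2 i hi]; exact hp')
    exact mem_prefixSet.2 ⟨j, hj, hj'⟩
  refine ⟨by omega, by omega, ?_⟩
  refine wp_of (wp_switch (hist := fun _ => s₀) (m := 0) hE.isMate (hLτ.of_eq ?_ ?_ ?_ ?_ ?_ ?_ ?_)
    (hQφ.of_eq ?_ ?_ ?_) ?_ ?_ ?_ ?_ hB ?_) ?_ <;> simp only [Memory.word_setWord, Memory.real_setWord, Memory.real_setReal, Memory.word_setReal,
    Nat.reduceEqDiff, if_true, if_false, Function.update_self, b6, b7, r3, hs2]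
  · rw [hs1]
  · exact f4 _ (by decide)
  · exact f4 _ (by decide)
  · exact f4 _ (by decide)
  · exact le_rfl
  · exact hP
  · exact hz
  -- The state `s₀` belongs to an earlier graph, but it is empty outside `R`, where all weights are
  -- `0` in any graph.
  · intro u hu huR
    have h0 : s₀.1 u = 0 := by
      by_contra h
      exact huR (hR1 u hu h)
    rw [hz u hu h0, WGraph.vertexWeight, if_pos h0]
  · omega
  rintro ψ w ⟨hw, hLψ, hMψ, hwψ, hHψ, hInψ⟩ hF4
  have h1 : ∀ u < n, ψ.word aM u = E.target u := by
    intro u hu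
    rw [hMψ u hu]
    unfold WGraph.combine
    by_cases huR : u ∈ R
    · rw [if_pos huR]
      by_cases h0 : E.target u = 0
      · simp [h0]
      · obtain ⟨h2, h3⟩ := hE.isMate.pairing u hu h0
        rw [if_pos ⟨h0, hR2 _ h2 (by omega)⟩]
    · have h0 : s₀.1 u = 0 := by
        by_contra h
        exact huR (hR1 u hu h)
      have h2 : E.target u = 0 := by
        by_contra h
        exact huR (hR2 u hu h)
      rw [if_neg huR, h0, h2]; simp
  have f5 : ∀ a, a ∉ vBest :: Prog.switch.wordArrays → ψ.word a = φ.word a := by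
    intro a ha
    simp only [List.mem_cons, not_or] at ha
    rw [hF4.1 a ha.2]
    simp only [Memory.word_setWord, Memory.real_setWord, Memory.real_setReal, Memory.word_setReal,
    Nat.reduceEqDiff, if_true, if_false, Function.update_self, if_neg ha.1]
  have c1 := f5 aLA (by decide)
  have c2 := f5 aLB (by decide)
  have c3 := f5 vLN (by decide)
  have c5 := f5 vSp (by decide)
  have hin : MateState.In E.G (ψ.word aM, ψ.real rWV) := ⟨hE.isMate.congr h1, hwψ⟩
  simp only [Prog.reset, wp_block_cons, wp_block_one, wp_setWord, wp_setReal, wp_skip, WExp.eval, RExp.eval,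
    Memory.word_setWord, Memory.real_setWord, Memory.real_setReal, Memory.word_setReal,
    Nat.reduceEqDiff, if_true, if_false, Function.update_self]
  refine ⟨by omega, by omega, by omega, by omega, by omega, by omega, by omega, ?_, ?_, hin, h1,
    trivial, trivial, ?_, trivial, ?_, by rw [c3]; exact b3, ⟨?_, ?_⟩, hInψ⟩
  · omega
  · refine ⟨fun _ => (ψ.word aM, ψ.real rWV), ?_, by omega, fun _ _ => rfl⟩
    constructor <;>
    try simp only [Memory.word_setWord, Memory.real_setWord, Memory.real_setReal, Memory.word_setReal,
    Nat.reduceEqDiff, if_true, if_false, Function.update_self]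
    · intro j hj; omega
    · intro j hj; omega
    · exact hLψ.val
    · exact hLψ.wt
  · rw [c5, b5]
  · rw [hLψ.wt, hin.sum]
    exact E.G.mateWeight_congr h1
  · simp only [Memory.word_setWord, Memory.real_setWord, Memory.real_setReal, Memory.word_setReal,
    Nat.reduceEqDiff, if_true, if_false, Function.update_self, c1, c2, c3, b1, b2, b3]
    exact hltL
  · simp only [Memory.word_setWord, Memory.real_setWord, Memory.real_setReal, Memory.word_setReal,
    Nat.reduceEqDiff, if_true, if_false, Function.update_self, c1, c2, c3, b1, b2, b3]
    intro u hu h0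
    rw [h1 u hu] at h0
    obtain ⟨p, hp, hp'⟩ := hE.listed u hu h0
    obtain ⟨i, hi, rfl⟩ := List.getElem_of_mem hp
    exact ⟨i, hi, by rw [g1 i hi, g2 i hi]; exact hp'⟩

end Env

end

/-! ### The stack of earlier matchings. -/

noncomputable section

/-- The entries `0, …, sp` of the stack. The entry `j` was made after `pos j` updates, with the
matching `hist (mark j)`, and the weight of that matching is about `R j`. -/
structure Stack {n : ℕ} (W ε : ℝ) (N : ℕ) (Γ : ℕ → WGraph n) (hist : ℕ → MateState)
    (pos mark : ℕ → ℕ) (R : ℕ → ℝ) (sp : ℕ) : Prop where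
  pos_zero : pos 0 = 0
  mark_zero : mark 0 = 0
  pos_lt : ∀ j < sp, pos j < pos (j + 1)
  mark_le : ∀ j < sp, mark j ≤ mark (j + 1)
  mark_bound : ∀ j ≤ sp, mark j ≤ (3 * n + 2) * pos j
  isIn : ∀ j ≤ sp, (hist (mark j)).In (Γ (pos j))
  slack : ∀ j ≤ sp, (Γ (pos j)).opt - (Γ (pos j)).mateWeight (hist (mark j)).1 ≤
    15 * ε * (j + 1) * R j
  grow : ∀ j < sp, R (j + 1) = R j ∨ 2 * R j ≤ R (j + 1)
  low : ∀ j ≤ sp, R j ≤ 2 * (Γ (pos j)).mateWeight (hist (mark j)).1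
  high : ∀ j ≤ sp, (Γ (pos j)).mateWeight (hist (mark j)).1 ≤ 2 * R j
  halve : ∀ j, j + 2 ≤ sp → 2 * pos (j + 2) + pos j ≤ 3 * pos (j + 1)
  long : ∀ j < sp, ε * R 0 ≤ ((pos (j + 1) : ℝ) - pos j) * W
  top : ∀ j ≤ sp, R j ≤ 5 * W * N
  base : (N : ℝ) ≤ R 0

namespace Stack

variable {n : ℕ} {W ε : ℝ} {N : ℕ} {Γ : ℕ → WGraph n} {hist : ℕ → MateState}
  {pos mark : ℕ → ℕ} {R : ℕ → ℝ} {sp q q' : ℕ}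

theorem mono (h : Stack W ε N Γ hist pos mark R sp) (hq : q ≤ sp) :
    Stack W ε N Γ hist pos mark R q where
  pos_zero := h.pos_zero
  mark_zero := h.mark_zero
  pos_lt j hj := h.pos_lt j (by omega)
  mark_le j hj := h.mark_le j (by omega)
  mark_bound j hj := h.mark_bound j (by omega)
  isIn j hj := h.isIn j (by omega)
  slack j hj := h.slack j (by omega)
  grow j hj := h.grow j (by omega)
  low j hj := h.low j (by omega)
  high j hj := h.high j (by omega)
  halve j hj := h.halve j (by omega)
  long j hj := h.long j (by omega)
  top j hj := h.top j (by omega)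
  base := h.base

/-- Reference weights stay or at least double from one entry to the next; so any two of them are
equal or differ by a factor of at least two. A repair can thus be compared with a rejected entry by
equality or by doubling alone. -/
theorem R_gap (h : Stack W ε N Γ hist pos mark R sp) (hq : q ≤ q') (hq' : q' ≤ sp) :
    0 ≤ R q ∧ R q ≤ R q' ∧ (R q' = R q ∨ 2 * R q ≤ R q') := by
  have h0 : ∀ j ≤ sp, 0 ≤ R j := by
    intro j
    induction j with
    | zero => exact fun _ => (Nat.cast_nonneg N).trans h.base
    | succ j ih =>
      intro hj
      have := ih (by omega)
      rcases h.grow j hj with h1 | h1 <;> linarith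
  refine ⟨h0 q (by omega), ?_⟩
  induction q', hq using Nat.le_induction with
  | base => exact ⟨le_rfl, Or.inl rfl⟩
  | succ k hk ih =>
    obtain ⟨h1, h2⟩ := ih (by omega)
    have h3 := h0 k (by omega)
    rcases h.grow k (by omega) with h4 | h4
    · rw [h4]; exact ⟨h1, h2⟩
    · exact ⟨by linarith, Or.inr (by linarith)⟩

theorem R_mono (h : Stack W ε N Γ hist pos mark R sp) (hq : q ≤ q') (hq' : q' ≤ sp) :
    R q ≤ R q' := (h.R_gap hq hq').2.1

theorem R_nonneg (h : Stack W ε N Γ hist pos mark R sp) (hq : q ≤ sp) : 0 ≤ R q :=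
  (h.R_gap le_rfl hq).1

theorem pos_add_le (h : Stack W ε N Γ hist pos mark R sp) (hq : q ≤ q') (hq' : q' ≤ sp) :
    pos q + (q' - q) ≤ pos q' := by
  induction q', hq using Nat.le_induction with
  | base => omega
  | succ k hk ih =>
    have := ih (by omega)
    have := h.pos_lt k (by omega)
    omega

theorem mark_mono (h : Stack W ε N Γ hist pos mark R sp) (hq : q ≤ q') (hq' : q' ≤ sp) :
    mark q ≤ mark q' := by
  induction q', hq using Nat.le_induction with
  | base => exact le_rfl
  | succ k hk ih => exact (ih (by omega)).trans (h.mark_le k (by omega))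

/-- The lengths decrease geometrically. -/
theorem pow_mul_le (h : Stack W ε N Γ hist pos mark R sp) (hq : q + 1 ≤ sp) :
    2 ^ q * (pos (q + 1) - pos q) ≤ pos 1 := by
  induction q with
  | zero => simp
  | succ k ih =>
    have h1 := ih (by omega)
    have h2 := h.halve k (by omega)
    have h3 := h.pos_lt k (by omega)
    have h4 : pos (k + 1) < pos (k + 2) := h.pos_lt (k + 1) (by omega)
    calc 2 ^ (k + 1) * (pos (k + 2) - pos (k + 1))
        = 2 ^ k * (2 * (pos (k + 2) - pos (k + 1))) := by ring
      _ ≤ 2 ^ k * (pos (k + 1) - pos k) := Nat.mul_le_mul_left _ (by omega)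
      _ ≤ pos 1 := h1

/-- The length of the first entry is less than `ε R₀`, the lengths halve upwards, and the last one
is still at least `ε R₀ / W`. Hence `2 ^ (sp - 1) < W ≤ 2 ^ L`. -/
theorem size_le (h : Stack W ε N Γ hist pos mark R sp) {L : ℕ} (hL : W ≤ 2 ^ L) (hW : 0 < W)
    (hε : 0 < ε) (hp : (pos sp : ℝ) < ε * N) : sp ≤ L := by
  rcases Nat.eq_zero_or_pos sp with rfl | hsp
  · omega
  obtain ⟨k, rfl⟩ : ∃ k, sp = k + 1 := ⟨sp - 1, by omega⟩
  have h1 := h.pow_mul_le (q := k) le_rfl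
  have h2 := h.long k (by omega)
  have h3 := h.pos_add_le (q := 1) (q' := k + 1) (by omega) le_rfl
  have h4 : pos k ≤ pos (k + 1) := (h.pos_lt k (by omega)).le
  have h5 : ((2 : ℝ) ^ k) * ((pos (k + 1) : ℝ) - pos k) ≤ pos 1 := by
    rw [← Nat.cast_sub h4]; exact_mod_cast h1
  have h6 : ((pos 1 : ℕ) : ℝ) ≤ pos (k + 1) := by exact_mod_cast (by omega : pos 1 ≤ pos (k + 1))
  have h7 : (pos 1 : ℝ) < ε * R 0 := by
    have := mul_le_mul_of_nonneg_left h.base hε.le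
    linarith
  have hR : 0 < ε * R 0 := lt_of_le_of_lt (Nat.cast_nonneg _) h7
  have h8 : (2 : ℝ) ^ k * (ε * R 0) < 2 ^ L * (ε * R 0) := by
    calc (2 : ℝ) ^ k * (ε * R 0) ≤ 2 ^ k * (((pos (k + 1) : ℝ) - pos k) * W) := by gcongr
      _ = (2 ^ k * ((pos (k + 1) : ℝ) - pos k)) * W := by ring
      _ ≤ pos 1 * W := by gcongr
      _ < ε * R 0 * W := by gcongr
      _ ≤ ε * R 0 * 2 ^ L := by gcongr
      _ = 2 ^ L * (ε * R 0) := by ring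
  have h9 : (2 : ℝ) ^ k < 2 ^ L := lt_of_mul_lt_mul_right h8 hR.le
  exact (pow_lt_pow_iff_right₀ (by norm_num)).1 h9

/-- What an attempt at the entry `q` yields about the current optimum. -/
theorem opt_le (h : Stack W ε N Γ hist pos mark R sp) (hq : q ≤ sp) (hε : 0 < ε) {L : ℕ}
    (hL : 1000 * ε * (L + 10) ≤ 1) (hqL : q ≤ L) {o w : ℝ} (ho : 0 ≤ o)
    (hs : o - w ≤ (Γ (pos q)).opt - (Γ (pos q)).mateWeight (hist (mark q)).1 + 5 * ε * o) :
    0.99 * o ≤ w + 0.015 * R q := by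
  have h1 := h.slack q hq
  have h2 := h.R_nonneg hq
  have h3 : (q : ℝ) ≤ L := by exact_mod_cast hqL
  -- The choice of `1000` makes the slack of every entry at most `0.015 R`, so the factors two in
  -- the acceptance test leave room for `0.7`.
  have h4 : ε * (q + 1) ≤ 0.001 := by nlinarith
  have h5 : ε * 10 ≤ 0.001 := by
    have : (0 : ℝ) ≤ L := Nat.cast_nonneg _
    nlinarith
  have h6 : 15 * ε * (q + 1) * R q ≤ 0.015 * R q := by
    have := mul_le_mul_of_nonneg_right h4 h2
    nlinarith
  have h7 : ε * 10 * o ≤ 0.001 * o := mul_le_mul_of_nonneg_right h5 ho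
  nlinarith

/-- The log up to the mark of the top is untouched, which preserves all older entries; only the
clauses about the new top are hypotheses. -/
theorem push (h : Stack W ε N Γ hist pos mark R sp) (hε : 0 < ε) (hW : 0 < W) {hist' : ℕ → MateState}
    {c m : ℕ} {r : ℝ} (hhist : ∀ j ≤ mark sp, hist' j = hist j) (hc : pos sp < c)
    (hm : mark sp ≤ m) (hm' : m ≤ (3 * n + 2) * c) (hin : (hist' m).In (Γ c))
    (hslack : (Γ c).opt - (Γ c).mateWeight (hist' m).1 ≤ 15 * ε * (sp + 2) * r)
    (hgrow : r = R sp ∨ 2 * R sp ≤ r) (hlow : r ≤ 2 * (Γ c).mateWeight (hist' m).1)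
    (hhigh : (Γ c).mateWeight (hist' m).1 ≤ 2 * r)
    (hhalve : 1 ≤ sp → 2 * c + pos (sp - 1) ≤ 3 * pos sp)
    (hlong : ε * R 0 ≤ ((c : ℝ) - pos sp) * W) (htop : r ≤ 5 * W * N) :
    Stack W ε N Γ hist' (Function.update pos (sp + 1) c) (Function.update mark (sp + 1) m)
      (Function.update R (sp + 1) r) (sp + 1) := by
  have e : ∀ {α : Type} (f : ℕ → α) (x : α) (j : ℕ), j ≤ sp → Function.update f (sp + 1) x j = f j :=
    fun f x j hj => Function.update_of_ne (by omega) _ _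
  have e' : ∀ j ≤ sp, hist' (mark j) = hist (mark j) := fun j hj => hhist _ (h.mark_mono hj le_rfl)
  have cases : ∀ {P : ℕ → Prop}, (∀ j ≤ sp, P j) → P (sp + 1) → ∀ j ≤ sp + 1, P j := by
    intro P h1 h2 j hj
    rcases Nat.lt_succ_iff_lt_or_eq.1 (Nat.lt_succ_of_le hj) with h3 | rfl
    · exact h1 j (by omega)
    · exact h2
  have cases' : ∀ {P : ℕ → Prop}, (∀ j < sp, P j) → P sp → ∀ j < sp + 1, P j := by
    intro P h1 h2 j hj
    rcases Nat.lt_succ_iff_lt_or_eq.1 hj with h3 | rfl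
    · exact h1 j (by omega)
    · exact h2
  constructor
  · rw [e _ _ 0 (by omega)]; exact h.pos_zero
  · rw [e _ _ 0 (by omega)]; exact h.mark_zero
  · refine cases' (fun j hj => ?_) ?_
    · rw [e _ _ j (by omega), e _ _ (j + 1) (by omega)]; exact h.pos_lt j hj
    · rw [e _ _ sp le_rfl, Function.update_self]; exact hc
  · refine cases' (fun j hj => ?_) ?_
    · rw [e _ _ j (by omega), e _ _ (j + 1) (by omega)]; exact h.mark_le j hj
    · rw [e _ _ sp le_rfl, Function.update_self]; exact hm
  · refine cases (fun j hj => ?_) ?_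
    · rw [e _ _ j hj, e _ _ j hj]; exact h.mark_bound j hj
    · rw [Function.update_self, Function.update_self]; exact hm'
  · refine cases (fun j hj => ?_) ?_
    · rw [e _ _ j hj, e _ _ j hj, e' j hj]; exact h.isIn j hj
    · rw [Function.update_self, Function.update_self]; exact hin
  · refine cases (fun j hj => ?_) ?_
    · rw [e _ _ j hj, e _ _ j hj, e _ _ j hj, e' j hj]; exact h.slack j hj
    · rw [Function.update_self, Function.update_self, Function.update_self]
      push_cast
      rw [add_assoc, one_add_one_eq_two]
      exact hslack
  · refine cases' (fun j hj => ?_) ?_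
    · rw [e _ _ j (by omega), e _ _ (j + 1) (by omega)]; exact h.grow j hj
    · rw [e _ _ sp le_rfl, Function.update_self]; exact hgrow
  · refine cases (fun j hj => ?_) ?_
    · rw [e _ _ j hj, e _ _ j hj, e _ _ j hj, e' j hj]; exact h.low j hj
    · rw [Function.update_self, Function.update_self, Function.update_self]; exact hlow
  · refine cases (fun j hj => ?_) ?_
    · rw [e _ _ j hj, e _ _ j hj, e _ _ j hj, e' j hj]; exact h.high j hj
    · rw [Function.update_self, Function.update_self, Function.update_self]; exact hhigh
  · intro j hj
    by_cases hj' : j + 2 ≤ sp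
    · rw [e _ _ j (by omega), e _ _ (j + 1) (by omega), e _ _ (j + 2) (by omega)]
      exact h.halve j hj'
    · obtain rfl : sp = j + 1 := by omega
      rw [e _ _ j (by omega), e _ _ (j + 1) (by omega), Function.update_self]
      exact hhalve (by omega)
  · refine cases' (fun j hj => ?_) ?_
    · rw [e _ _ j (by omega), e _ _ (j + 1) (by omega), e _ _ 0 (by omega)]; exact h.long j hj
    · rw [e _ _ sp le_rfl, Function.update_self, e _ _ 0 (by omega)]; exact hlong
  · refine cases (fun j hj => ?_) ?_
    · rw [e _ _ j hj]; exact h.top j hj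
    · rw [Function.update_self]; exact htop
  · rw [e _ _ 0 (by omega)]; exact h.base

end Stack

/-! The potential of the stack -/

/-- The potential of one update in an entry of the stack of length `x` with weight `R`. -/
def levelPotential (W ε R₀ : ℝ) (N : ℕ) (x R : ℝ) : ℝ :=
  5 / 2 * (3 * Real.log (5 * W) + 1) * Real.log (x * W / (ε * R₀)) +
    3 * Real.log (5 * W * N / R) + 1

/-- The potential of the stack. -/
def potential (W ε : ℝ) (N : ℕ) (pos : ℕ → ℕ) (R : ℕ → ℝ) (sp : ℕ) : ℝ :=
  ∑ j ∈ Finset.range sp, ((pos (j + 1) : ℝ) - pos j) *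
    levelPotential W ε (R 0) N ((pos (j + 1) : ℝ) - pos j) (R (j + 1))

/-- The factor `5/2` in the potential is chosen so that growth of the length by `3/2` counts as at
least one unit. -/
theorem log_three_halves : 1 ≤ 5 / 2 * Real.log (3 / 2) := by
  have h : (2 / 5 : ℝ) ≤ Real.log (3 / 2) := by
    rw [Real.le_log_iff_exp_le (by norm_num)]
    have h1 : Real.exp 1 < 2.7182818286 := Real.exp_one_lt_d9
    -- The claim amounts to `e ^ 2 ≤ (3/2) ^ 5`, that is, about `7.39` against `7.59`.
    have h2 : Real.exp (2 / 5) ^ 5 = Real.exp 1 ^ 2 := by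
      rw [← Real.exp_nat_mul, ← Real.exp_nat_mul]; norm_num
    by_contra hlt
    push Not at hlt
    have h3 : (3 / 2 : ℝ) ^ 5 < Real.exp (2 / 5) ^ 5 := by gcongr
    rw [h2] at h3
    nlinarith [Real.exp_pos 1]
  linarith

/-- The factor `3` in the potential is chosen so that a drop of the reference weight to `0.7` counts
as at least one unit; it amounts to `e ≤ (10/7) ^ 3`. -/
theorem log_ten_sevenths : 1 ≤ 3 * Real.log (10 / 7) := by
  have h : (1 / 3 : ℝ) ≤ Real.log (10 / 7) := by
    rw [Real.le_log_iff_exp_le (by norm_num)]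
    have h1 : Real.exp 1 < 2.7182818286 := Real.exp_one_lt_d9
    have h2 : Real.exp (1 / 3) ^ 3 = Real.exp 1 := by
      rw [← Real.exp_nat_mul]; norm_num
    by_contra hlt
    push Not at hlt
    have h3 : (10 / 7 : ℝ) ^ 3 < Real.exp (1 / 3) ^ 3 := by gcongr
    rw [h2] at h3
    norm_num at h3
    linarith
  linarith

theorem one_le_levelPotential {W ε R₀ x R : ℝ} {N : ℕ} (hW : 2 ≤ W) (hε : 0 < ε) (hR₀ : 0 < R₀)
    (hx : ε * R₀ ≤ x * W) (hR : 0 < R) (hRN : R ≤ 5 * W * N) : 1 ≤ levelPotential W ε R₀ N x R := by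
  have h1 : 0 ≤ Real.log (5 * W) := Real.log_nonneg (by linarith)
  have h2 : 0 ≤ Real.log (x * W / (ε * R₀)) :=
    Real.log_nonneg ((one_le_div (by positivity)).2 hx)
  have h3 : 0 ≤ Real.log (5 * W * N / R) := Real.log_nonneg ((one_le_div hR).2 hRN)
  unfold levelPotential
  have : 0 ≤ 5 / 2 * (3 * Real.log (5 * W) + 1) * Real.log (x * W / (ε * R₀)) := by positivity
  linarith

/-- Growth of the length by `3/2` adds at least `3 log (5W) + 1` to the first term, while the second
can fall by at most `3 log (5W)`, as reference weights lie between `N` and `5WN`. This is why the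
first term has that coefficient. If instead the weight drops to `0.7`, the second term gains at
least `1` and the first does not fall. -/
theorem levelPotential_add_one_le {W ε R₀ x y R R' : ℝ} {N : ℕ} (hW : 2 ≤ W) (hε : 0 < ε)
    (hR₀ : 0 < R₀) (hx : 0 < x) (hxy : x ≤ y) (hR : 0 < R) (hR' : 0 < R') (hN : 0 < N)
    (hNR : (N : ℝ) ≤ R) (hR'N : R' ≤ 5 * W * N) (h : 3 / 2 * x ≤ y ∨ R' ≤ 0.7 * R) :
    levelPotential W ε R₀ N x R + 1 ≤ levelPotential W ε R₀ N y R' := by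
  have hWpos : 0 < W := by linarith
  have hNpos : (0 : ℝ) < N := by exact_mod_cast hN
  have hy : 0 < y := by linarith
  have hK : 0 ≤ Real.log (5 * W) := Real.log_nonneg (by linarith)
  have e1 : ∀ z : ℝ, 0 < z → Real.log (z * W / (ε * R₀)) =
      Real.log z + (Real.log W - Real.log (ε * R₀)) := by
    intro z hz
    rw [Real.log_div (by positivity) (by positivity), Real.log_mul hz.ne' hWpos.ne']; ring
  have e2 : ∀ z : ℝ, 0 < z → Real.log (5 * W * N / z) = Real.log (5 * W * N) - Real.log z := by
    intro z hz
    rw [Real.log_div (by positivity) hz.ne']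
  unfold levelPotential
  rw [e1 x hx, e1 y hy, e2 R hR, e2 R' hR']
  rcases h with h | h
  · have h1 : Real.log (3 / 2) + Real.log x ≤ Real.log y := by
      rw [← Real.log_mul (by norm_num) hx.ne']
      exact Real.log_le_log (by positivity) h
    -- `R' ≤ 5WN ≤ 5WR`.
    have h2 : Real.log R' ≤ Real.log (5 * W) + Real.log R := by
      rw [← Real.log_mul (by positivity) hR.ne']
      refine Real.log_le_log hR' (hR'N.trans ?_)
      gcongr
    have h3 := log_three_halves
    have h4 : (3 * Real.log (5 * W) + 1) * 1 ≤
        (3 * Real.log (5 * W) + 1) * (5 / 2 * (Real.log y - Real.log x)) :=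
      mul_le_mul_of_nonneg_left (by linarith) (by linarith)
    nlinarith
  · have h1 : Real.log x ≤ Real.log y := Real.log_le_log hx hxy
    have h2 : Real.log (10 / 7) + Real.log R' ≤ Real.log R := by
      rw [← Real.log_mul (by norm_num) hR'.ne']
      exact Real.log_le_log (by positivity) (by linarith)
    have h3 := log_ten_sevenths
    have h4 : 0 ≤ 5 / 2 * (3 * Real.log (5 * W) + 1) * (Real.log y - Real.log x) :=
      mul_nonneg (by linarith) (by linarith)
    nlinarith

/-- A length of at most `ε R₀` makes the first logarithm at most `log W`, and `N ≤ R` makes the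
second at most `log (5W)`. An update therefore never pays more than `O(log² W)`. -/
theorem levelPotential_le {W ε R₀ x R : ℝ} {N : ℕ} (hW : 2 ≤ W) (hε : 0 < ε) (hR₀ : 0 < R₀)
    (hx : 0 < x) (hx' : x ≤ ε * R₀) (hN : 0 < N) (hNR : (N : ℝ) ≤ R) :
    levelPotential W ε R₀ N x R ≤
      5 / 2 * (3 * Real.log (5 * W) + 1) * Real.log W + 3 * Real.log (5 * W) + 1 := by
  have hWpos : 0 < W := by linarith
  have hNpos : (0 : ℝ) < N := by exact_mod_cast hN
  have hK : 0 ≤ Real.log (5 * W) := Real.log_nonneg (by linarith)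
  have hR : 0 < R := by linarith
  have h1 : Real.log (x * W / (ε * R₀)) ≤ Real.log W := by
    refine Real.log_le_log (by positivity) ?_
    rw [div_le_iff₀ (by positivity)]
    nlinarith
  have h2 : Real.log (5 * W * N / R) ≤ Real.log (5 * W) := by
    refine Real.log_le_log (by positivity) ?_
    rw [div_le_iff₀ hR]
    gcongr
  unfold levelPotential
  have h3 := mul_le_mul_of_nonneg_left h1 (by linarith : 0 ≤ 5 / 2 * (3 * Real.log (5 * W) + 1))
  linarith

namespace Stack

variable {n : ℕ} {W ε : ℝ} {N : ℕ} {Γ : ℕ → WGraph n} {hist : ℕ → MateState}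
  {pos mark : ℕ → ℕ} {R : ℕ → ℝ} {sp q q' : ℕ}

theorem R_pos (h : Stack W ε N Γ hist pos mark R sp) (hN : 0 < N) (hq : q ≤ sp) :
    (N : ℝ) ≤ R q ∧ 0 < R q := by
  have h1 := h.base.trans (h.R_mono (Nat.zero_le q) hq)
  have : (0 : ℝ) < N := by exact_mod_cast hN
  exact ⟨h1, by linarith⟩

theorem potential_le (h : Stack W ε N Γ hist pos mark R sp) (hW : 2 ≤ W) (hε : 0 < ε) (hN : 0 < N)
    (hp : (pos sp : ℝ) ≤ ε * N) :
    potential W ε N pos R sp ≤ pos sp *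
      (5 / 2 * (3 * Real.log (5 * W) + 1) * Real.log W + 3 * Real.log (5 * W) + 1) := by
  set K := 5 / 2 * (3 * Real.log (5 * W) + 1) * Real.log W + 3 * Real.log (5 * W) + 1 with hK
  have hR0 := (h.R_pos hN (Nat.zero_le _)).2
  have h1 : potential W ε N pos R sp ≤ ∑ j ∈ Finset.range sp, ((pos (j + 1) : ℝ) - pos j) * K := by
    refine Finset.sum_le_sum fun j hj => ?_
    have hj := Finset.mem_range.1 hj
    have h2 : (pos j : ℝ) < pos (j + 1) := by exact_mod_cast h.pos_lt j hj
    have h3 : (pos (j + 1) : ℝ) ≤ pos sp := by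
      have := h.pos_add_le (q := j + 1) (q' := sp) hj le_rfl
      exact_mod_cast (by omega : pos (j + 1) ≤ pos sp)
    refine mul_le_mul_of_nonneg_left ?_ (by linarith)
    refine levelPotential_le hW hε hR0 (by linarith) ?_ hN (h.R_pos hN hj).1
    have h4 := mul_le_mul_of_nonneg_left h.base hε.le
    have h5 : (0 : ℝ) ≤ pos j := Nat.cast_nonneg _
    linarith
  refine h1.trans (le_of_eq ?_)
  rw [← Finset.sum_mul, Finset.sum_range_sub (fun j => (pos j : ℝ)), h.pos_zero]
  simp

/-- Replacing the entries above `q` by one new entry increases the potential. -/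
theorem potential_push (h : Stack W ε N Γ hist pos mark R sp) (hW : 2 ≤ W) (hε : 0 < ε) (hN : 0 < N)
    (hq : q ≤ sp) {c : ℕ} {r : ℝ} (hc : pos sp < c) (hr : R q ≤ r) (htop : r ≤ 5 * W * N)
    (hlong : ε * R 0 ≤ ((c : ℝ) - pos q) * W)
    (hpop : ∀ j, q ≤ j → j < sp → 3 * (pos (j + 1) - pos j) ≤ 2 * (c - pos q) ∨
      r ≤ 0.7 * R (j + 1)) :
    potential W ε N pos R sp + ((c : ℝ) - pos q) ≤
      potential W ε N (Function.update pos (q + 1) c) (Function.update R (q + 1) r) (q + 1) := by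
  have hR0 := (h.R_pos hN (Nat.zero_le _)).2
  have hr0 : 0 < r := (h.R_pos hN hq).2.trans_le hr
  have e : potential W ε N (Function.update pos (q + 1) c) (Function.update R (q + 1) r) (q + 1) =
      ∑ j ∈ Finset.range q, ((pos (j + 1) : ℝ) - pos j) *
        levelPotential W ε (R 0) N ((pos (j + 1) : ℝ) - pos j) (R (j + 1)) +
      ((c : ℝ) - pos q) * levelPotential W ε (R 0) N ((c : ℝ) - pos q) r := by
    unfold potential
    rw [Finset.sum_range_succ, Function.update_self, Function.update_self,
      Function.update_of_ne (by omega : q ≠ q + 1), Function.update_of_ne (by omega : 0 ≠ q + 1)]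
    congr 1
    refine Finset.sum_congr rfl fun j hj => ?_
    have hj := Finset.mem_range.1 hj
    rw [Function.update_of_ne (by omega : j ≠ q + 1), Function.update_of_ne (by omega : j + 1 ≠ q + 1),
      Function.update_of_ne (by omega : j + 1 ≠ q + 1)]
  rw [e]
  unfold potential
  rw [← Finset.sum_range_add_sum_Ico _ hq]
  set g := levelPotential W ε (R 0) N ((c : ℝ) - pos q) r with hg
  have hg1 : 1 ≤ g := one_le_levelPotential hW hε hR0 hlong hr0 htop
  have hcs : (pos sp : ℝ) < c := by exact_mod_cast hc
  -- Every update in a merged entry had a potential of at most `g - 1`, where `g` is the potential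
  -- in the new entry.
  have key : ∑ j ∈ Finset.Ico q sp, ((pos (j + 1) : ℝ) - pos j) *
      levelPotential W ε (R 0) N ((pos (j + 1) : ℝ) - pos j) (R (j + 1)) ≤
      ∑ j ∈ Finset.Ico q sp, ((pos (j + 1) : ℝ) - pos j) * (g - 1) := by
    refine Finset.sum_le_sum fun j hj => ?_
    obtain ⟨hj1, hj2⟩ := Finset.mem_Ico.1 hj
    have h2 : (pos j : ℝ) < pos (j + 1) := by exact_mod_cast h.pos_lt j hj2
    have h3 := h.pos_add_le (q := j + 1) (q' := sp) hj2 le_rfl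
    have h4 := h.pos_add_le (q := q) (q' := j) hj1 (by omega)
    have h5 : (pos (j + 1) : ℝ) ≤ pos sp := by exact_mod_cast (by omega : pos (j + 1) ≤ pos sp)
    have h6 : (pos q : ℝ) ≤ pos j := by exact_mod_cast (by omega : pos q ≤ pos j)
    refine mul_le_mul_of_nonneg_left ?_ (by linarith)
    obtain ⟨h7, h8⟩ := h.R_pos hN (q := j + 1) hj2
    have := levelPotential_add_one_le hW hε hR0 (x := (pos (j + 1) : ℝ) - pos j)
      (y := (c : ℝ) - pos q) (R := R (j + 1)) (R' := r) (N := N) (by linarith) (by linarith) h8 hr0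
      hN h7 htop ?_
    · linarith
    · rcases hpop j hj1 hj2 with h9 | h9
      · left
        have h10 := h.pos_lt j hj2
        have h11 : 3 * ((pos (j + 1) : ℝ) - pos j) ≤ 2 * ((c : ℝ) - pos q) := by
          rw [← Nat.cast_sub h10.le, ← Nat.cast_sub (by omega)]
          exact_mod_cast h9
        linarith
      · exact Or.inr h9
  rw [← Finset.sum_mul, Finset.sum_Ico_sub (fun j => (pos j : ℝ)) hq] at key
  have h12 : (pos q : ℝ) ≤ pos sp := by
    have := h.pos_add_le hq le_rfl
    exact_mod_cast (by omega : pos q ≤ pos sp)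
  -- The updates up to `pos sp` gain at least one each by `key`, the ones after it by `1 ≤ g`.
  nlinarith [mul_nonneg (sub_nonneg.2 hcs.le) (sub_nonneg.2 hg1)]

end Stack

end

/-! ### Choosing the entry to repair. -/

noncomputable section

namespace Prog

/-- Drop the entries at the top of the stack that are short compared to the time since then. -/
def popShort : Prog :=
  loop (.both (.wordLe (.const 1) (.var vSp))
    (.neg (.wordLe (.mul (.const 2) (.sub (.var vCnt) (.get aPos (.var vSp))))
      (.sub (.get aPos (.var vSp)) (.get aPos (.sub (.var vSp) (.const 1)))))))
    (assign vSp (.sub (.var vSp) (.const 1)))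

/-- Go on with an earlier entry of the stack. -/
def retreat : Prog :=
  branch (.wordLe (.var vSp) (.const 0)) (assign vFin (.const 1))
    (block [assign vSp (.sub (.var vSp) (.const 1)), popShort])

/-- Accept or reject an attempt. -/
def judge : Prog :=
  branch (.both (.realLe (.get rR (.var vSp)) (.mul (.ofWord (.const 2)) (.var rWt)))
      (.realLe (.mul (.ofWord (.const 2)) (.get rR (.var vSp))) (.var rRr)))
    (block [assign vOk (.const 1), assign vFin (.const 1)])
    (block [assignReal rRr (.get rR (.var vSp)), retreat])

/-- Try the entries of the stack until an attempt is accepted. -/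
def repair : Prog := loop (.wordLe (.var vFin) (.const 0)) (block [revert, attempt, judge])

/-- Find an entry of the stack and an accepted attempt for it. -/
def process : Prog := block [
  assign vOk (.const 0),
  assign vFin (.const 0),
  popShort,
  assignReal rRr (.mul (.ofWord (.const 2)) (.get rR (.var vSp))),
  repair]

end Prog

/-- The entries between `q` and `f` are short. -/
def Short (pos : ℕ → ℕ) (c q f : ℕ) : Prop :=
  ∀ j, q ≤ j → j < f → 3 * (pos (j + 1) - pos j) ≤ 2 * (c - pos q)

/-- The entry `q` is long compared to the time since then. -/
def LongTop (pos : ℕ → ℕ) (c q : ℕ) : Prop := 1 ≤ q → 2 * c + pos (q - 1) ≤ 3 * pos q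

namespace Env

variable {n : ℕ} {E : Env n} {hist : ℕ → MateState} {m : ℕ} {σ : Memory} {W ε : ℝ} {N : ℕ}
  {Γ : ℕ → WGraph n} {R : ℕ → ℝ} {mark : ℕ → ℕ}

/-- If the entry that ends at `q` is dropped, its length is less than `2 (c - pos q)`; adding twice
the length to both sides gives the factor `2/3` in `Short` relative to the merged interval. If it
stays, the negated test is `LongTop`, which is what `halve` needs for the next push. -/
theorem wp_popShort {sp : ℕ} (hsp : σ.word vSp 0 = sp)
    (S : Stack W ε N Γ hist (σ.word aPos) mark R sp) (hc : σ.word aPos sp < σ.word vCnt 0)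
    (hB : sp < E.B) (hB0 : 0 < E.B) :
    E.wp .popShort (fun τ x => τ.word vSp 0 ≤ sp ∧ x ≤ 2 * (sp - τ.word vSp 0) + 1 ∧
      LongTop (σ.word aPos) (σ.word vCnt 0) (τ.word vSp 0) ∧
      Short (σ.word aPos) (σ.word vCnt 0) (τ.word vSp 0) sp) σ := by
  set pos := σ.word aPos with hpos
  set c := σ.word vCnt 0 with hcdef
  refine wp_loop (fun τ k => τ.word vSp 0 ≤ sp ∧ k ≤ 2 * (sp - τ.word vSp 0) ∧
      τ.word aPos = pos ∧ τ.word vCnt 0 = c ∧ Short pos c (τ.word vSp 0) sp)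
    (fun τ => τ.word vSp 0) ?_ ?_ ?_
  · rw [hsp]
    exact ⟨le_rfl, by omega, rfl, rfl, fun j h1 h2 => by omega⟩
  · rintro τ k ⟨hle, hk, e1, e2, hsh⟩ hb -
    simp only [Test.Holds, WExp.eval, e1, e2] at hb
    obtain ⟨hb1, hb2⟩ := hb
    set q := τ.word vSp 0 with hq
    have h1 := S.pos_lt (q - 1) (by omega)
    have h2 := S.pos_add_le hle le_rfl
    rw [Nat.sub_add_cancel hb1] at h1
    simp only [wp_block_cons, wp_block_one, wp_setWord, wp_setReal, wp_skip, WExp.eval, RExp.eval,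
    Memory.word_setWord, Memory.real_setWord, Memory.real_setReal, Memory.word_setReal,
    Nat.reduceEqDiff, if_true, if_false, Function.update_self, ← hq]
    refine ⟨by omega, by omega, ⟨by omega, by omega, e1, e2, ?_⟩, by omega⟩
    intro j hj hj'
    by_cases hjq : q ≤ j
    · have := hsh j hjq hj'
      omega
    · obtain rfl : j = q - 1 := by omega
      rw [Nat.sub_add_cancel hb1]
      omega
  · rintro τ k ⟨hle, hk, e1, e2, hsh⟩ hb
    simp only [Test.Holds, WExp.eval, e1, e2] at hb
    refine ⟨hle, by omega, fun h => ?_, hsh⟩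
    have h1 := S.pos_lt (τ.word vSp 0 - 1) (by omega)
    have h2 := S.pos_add_le hle le_rfl
    rw [Nat.sub_add_cancel h] at h1
    by_contra hlt
    refine hb ⟨h, ?_⟩
    omega

/-- The outcome of `repair` when an attempt at the entry `q` has been accepted. -/
structure Accepted (E : Env n) (Γ : ℕ → WGraph n) (hist : ℕ → MateState) (ε : ℝ) (c sp : ℕ)
    (pos mark : ℕ → ℕ) (R : ℕ → ℝ) (q : ℕ) (τ : Memory) : Prop where
  isIn : MateState.In E.G (τ.word aM, τ.real rWV)
  slack : E.G.opt - E.G.mateWeight (τ.word aM) ≤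
    (Γ (pos q)).opt - (Γ (pos q)).mateWeight (hist (mark q)).1 + 5 * ε * E.G.opt
  low : R q ≤ 2 * E.G.mateWeight (τ.word aM)
  longTop : LongTop pos c q
  pop : q = sp ∨ ∃ f, q < f ∧ f ≤ sp ∧ E.G.opt ≤ 0.7 * R f ∧ 2 * R q ≤ R f ∧ Short pos c q (f - 1)

/-- A rejection at `q` shows `E.G.opt ≤ 0.7 R q`, so that entries merged because of it pay through
the drop of the weight. `LongTop` makes the distance `c - pos q` at least triple with every retreat,
so the costs of the rejected repairs form a geometric series dominated by the last repair. Cost and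
five times the length of the log are bounded together, since undoing a repair consumes the entries
that it made. -/
theorem wp_repair {L sp : ℕ} (hW : 0 ≤ W) (hε : 0 < ε) (hE : E.Fits W ε) (hsp : σ.word vSp 0 = sp)
    (S : Stack W ε N Γ hist (σ.word aPos) (σ.word aMark) (σ.real rR) sp)
    (hc : σ.word aPos sp < σ.word vCnt 0) (hΓ : ∀ j ≤ σ.word vCnt 0, (Γ j).WeightsIn W)
    (hLε : 1000 * ε * (L + 10) ≤ 1) (hspL : sp ≤ L) (hσε : σ.real 0 1 = ε)
    (hagree : ∀ a ≤ σ.word vCnt 0, ∀ u v, ¬ Touched (σ.word aTU) (σ.word aTV) a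
      (σ.word vCnt 0) u v → E.G.lookup u v = (Γ a).lookup u v)
    (hT : ∀ j < σ.word vCnt 0, σ.word aTU j < n ∧ σ.word aTV j < n)
    (hIn : ∀ u < n, σ.word aIn u = 0) (hLog : Logged n hist (σ.word aMark sp) σ)
    (hH : σ.word vH 0 ≤ (3 * n + 2) * σ.word vCnt 0)
    (htop : LongTop (σ.word aPos) (σ.word vCnt 0) sp) (hfin : σ.word vFin 0 = 0)
    (hok : σ.word vOk 0 = 0) (hrr : σ.real rRr 0 = 2 * σ.real rR sp)
    (hB : n < E.B) (hB' : ⌈1 / ε⌉₊ + 1 < E.B) (hB2 : (3 * n + 2) * σ.word vCnt 0 + 2 < E.B) :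
    E.wp .repair (fun τ x => τ.word vSp 0 ≤ sp ∧ Logged n hist (σ.word aMark (τ.word vSp 0)) τ ∧
      (∀ u < n, τ.word aIn u = 0) ∧ τ.word vH 0 ≤ (3 * n + 2) * σ.word vCnt 0 ∧
      x + 5 * τ.word vH 0 ≤ 5 * σ.word vH 0 +
        1000 * (⌈1 / ε⌉₊ * (σ.word vCnt 0 - σ.word aPos (τ.word vSp 0))) + 1 ∧
      (τ.word vOk 0 = 1 ∧ E.Accepted Γ hist ε (σ.word vCnt 0) sp (σ.word aPos) (σ.word aMark)
          (σ.real rR) (τ.word vSp 0) τ ∨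
        τ.word vOk 0 = 0 ∧ τ.word vSp 0 = 0 ∧ E.G.opt ≤ 0.7 * σ.real rR 0)) σ := by
  have hr1 : 1 ≤ ⌈1 / ε⌉₊ := Nat.one_le_ceil_iff.2 (by positivity)
  set r := ⌈1 / ε⌉₊ with hr
  set pos := σ.word aPos with hpos
  set mk := σ.word aMark with hmk
  set Rs := σ.real rR with hRs
  set c := σ.word vCnt 0 with hcdef
  have hopt0 : 0 ≤ E.G.opt := hE.weightsIn.opt_nonneg hW
  have hc2 : c ≤ (3 * n + 2) * c := Nat.le_mul_of_pos_left _ (by omega)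
  -- While undecided, `330` covers all earlier repairs; one more repair adds `500` for its cost and
  -- `5 * 26` for its log. These `960`, with small terms, fit into `1000` on acceptance and into
  -- `330 * 3` after a retreat.
  refine wp_loop (fun τ k => τ.word vSp 0 ≤ sp ∧ Logged n hist (mk (τ.word vSp 0)) τ ∧
      (∀ u < n, τ.word aIn u = 0) ∧ τ.word vH 0 ≤ (3 * n + 2) * c ∧
      (τ.word vFin 0 = 0 ∧ τ.word vOk 0 = 0 ∧ LongTop pos c (τ.word vSp 0) ∧
        k + 5 * τ.word vH 0 ≤ 5 * σ.word vH 0 + 330 * (r * (c - pos (τ.word vSp 0))) ∧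
        (τ.word vSp 0 = sp ∧ τ.real rRr 0 = 2 * Rs sp ∨ ∃ f, τ.word vSp 0 < f ∧ f ≤ sp ∧
          τ.real rRr 0 = Rs f ∧ E.G.opt ≤ 0.7 * Rs f ∧ Short pos c (τ.word vSp 0) (f - 1)) ∨
      τ.word vFin 0 = 1 ∧
        k + 5 * τ.word vH 0 ≤ 5 * σ.word vH 0 + 1000 * (r * (c - pos (τ.word vSp 0))) ∧
        (τ.word vOk 0 = 1 ∧ E.Accepted Γ hist ε c sp pos mk Rs (τ.word vSp 0) τ ∨
        τ.word vOk 0 = 0 ∧ τ.word vSp 0 = 0 ∧ E.G.opt ≤ 0.7 * Rs 0)))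
    (fun τ => if τ.word vFin 0 = 0 then τ.word vSp 0 + 1 else 0) ?_ ?_ ?_
  · rw [hsp]
    exact ⟨le_rfl, hLog, hIn, hH, Or.inl ⟨hfin, hok, htop, by omega, Or.inl ⟨rfl, hrr⟩⟩⟩
  · rintro τ k ⟨hle, hLτ, hInτ, hHτ, hcase⟩ hb hF
    simp only [Test.Holds, WExp.eval] at hb
    obtain ⟨hfinτ, hokτ, htopτ, hk, hrrτ⟩ : _ ∧ _ ∧ _ ∧ _ ∧ _ := by
      rcases hcase with h | h
      · exact h
      · omega
    clear hcase
    have e1 : τ.word aPos = pos := hF.1 _ (by decide)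
    have e2 : τ.word aMark = mk := hF.1 _ (by decide)
    have e3 : τ.real rR = Rs := hF.2 _ (by decide)
    have e4 : τ.word vCnt = σ.word vCnt := hF.1 _ (by decide)
    have e5 : τ.word aTU = σ.word aTU := hF.1 _ (by decide)
    have e6 : τ.word aTV = σ.word aTV := hF.1 _ (by decide)
    have e7 : τ.real 0 = σ.real 0 := hF.2 _ (by decide)
    have hle' := hle
    set q := τ.word vSp 0 with hq
    have Sq := S.mono hle
    have hpq : pos q < c := by
      have := S.pos_add_le hle le_rfl
      omega
    obtain ⟨ℓ, hℓ⟩ : ∃ ℓ, pos q + ℓ = c := ⟨c - pos q, by omega⟩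
    have hℓ1 : 1 ≤ ℓ := by omega
    have eℓ : c - pos q = ℓ := by omega
    have hmq := S.mark_bound q hle
    have hmul : (3 * n + 2) * c = (3 * n + 2) * pos q + (3 * n + 2) * ℓ := by
      rw [← hℓ, mul_add]
    -- A repair adds at most `2ℓ + 3n` entries to the log, so the length stays below `3n + 2` per
    -- update of the stack.
    have hmul2 : 3 * n + 2 * ℓ ≤ (3 * n + 2) * ℓ := by
      rw [add_mul]
      have : 3 * n ≤ 3 * n * ℓ := Nat.le_mul_of_pos_right _ hℓ1
      omega
    have hrl : ℓ ≤ r * ℓ := Nat.le_mul_of_pos_left _ hr1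
    simp only [wp_block_cons, wp_block_one, wp_setWord, wp_setReal, wp_skip, WExp.eval, RExp.eval,
    Memory.word_setWord, Memory.real_setWord, Memory.real_setReal, Memory.word_setReal,
    Nat.reduceEqDiff, if_true, if_false, Function.update_self]
    refine wp_of (wp_revert (hist := hist) (m := mk q) hLτ (by rw [e2, ← hq]) hB (by omega)) ?_
    rintro υ x ⟨hx, hLυ, hcur, hHυ⟩ hF2
    have f1 : υ.word aPos = pos := by rw [hF2.1 _ (by decide), e1]
    have f2 : υ.word aMark = mk := by rw [hF2.1 _ (by decide), e2]
    have f3 : υ.real rR = Rs := by rw [hF2.2 _ (by decide), e3]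
    have f4 : υ.word vCnt = σ.word vCnt := by rw [hF2.1 _ (by decide), e4]
    have f5 : υ.word aTU = σ.word aTU := by rw [hF2.1 _ (by decide), e5]
    have f6 : υ.word aTV = σ.word aTV := by rw [hF2.1 _ (by decide), e6]
    have f7 : υ.real 0 = σ.real 0 := by rw [hF2.2 _ (by decide), e7]
    have f8 : υ.word vSp 0 = q := by rw [hF2.1 _ (by decide)]
    have f9 : υ.word aIn = τ.word aIn := hF2.1 _ (by decide)
    have hinq := S.isIn q hle
    rw [← hcur] at hinq
    refine wp_of (wp_attempt (hist := hist) (m := mk q) (ℓ := ℓ) (Gq := Γ (pos q)) hW hε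
      hE.weightsIn (hΓ _ hpq.le) hE.isMate hE.approx (by rw [f7]; exact hσε) hLυ hinq ?_ hℓ1 ?_ ?_
      (by rw [f9]; exact hInτ) hB hB' ?_ ?_) ?_
    · rw [f8, f1, f4]; exact hℓ
    · rw [f4, f5, f6]; exact hT
    · rw [f8, f1, f4, f5, f6]; exact hagree _ hpq.le
    · rw [f4]; omega
    · omega
    rintro φ y ⟨hy, hLφ, hinφ, hslφ, hHφ1, hHφ2, hInφ⟩ hF3
    rw [← hr] at hy hHφ2
    have g1 : φ.word aPos = pos := by rw [hF3.1 _ (by decide), f1]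
    have g2 : φ.word aMark = mk := by rw [hF3.1 _ (by decide), f2]
    have g3 : φ.real rR = Rs := by rw [hF3.2 _ (by decide), f3]
    have g4 : φ.word vCnt = σ.word vCnt := by rw [hF3.1 _ (by decide), f4]
    have g8 : φ.word vSp 0 = q := by rw [hF3.1 _ (by decide), f8]
    have g9 : φ.word vOk 0 = 0 := by rw [hF3.1 _ (by decide), hF2.1 _ (by decide), hokτ]
    have g10 : φ.word vFin 0 = 0 := by rw [hF3.1 _ (by decide), hF2.1 _ (by decide), hfinτ]
    have g11 : φ.real rRr 0 = τ.real rRr 0 := by rw [hF3.2 _ (by decide), hF2.2 _ (by decide)]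
    have hwt : φ.real rWt 0 = E.G.mateWeight (φ.word aM) := by rw [hLφ.wt, hinφ.sum]
    have hsl : E.G.opt - E.G.mateWeight (φ.word aM) ≤
        (Γ (pos q)).opt - (Γ (pos q)).mateWeight (hist (mk q)).1 + 5 * ε * E.G.opt := by
      rw [← hcur]; exact hslφ
    have hopt := S.opt_le hle hε hLε (by omega) hopt0 hsl
    have hRq := S.R_nonneg hle
    rw [eℓ] at hk
    have hmτ := hLτ.le
    have hHle : φ.word vH 0 ≤ (3 * n + 2) * c := by omega
    simp only [Prog.judge, wp_branch, Test.Holds, wp_block_cons, wp_block_one, wp_setWord, wp_setReal, wp_skip, WExp.eval, RExp.eval,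
    Memory.word_setWord, Memory.real_setWord, Memory.real_setReal, Memory.word_setReal,
    Nat.reduceEqDiff, if_true, if_false, Function.update_self, g8, g3, g11, hwt, Nat.cast_ofNat]
    refine ⟨fun hacc => ?_, fun hrej => ?_⟩
    · refine ⟨by omega, by omega, by omega, by omega, ⟨hle, ?_, hInφ, hHle, Or.inr ⟨trivial, ?_,
        Or.inl ⟨trivial, ?_⟩⟩⟩, by simp [hfinτ]⟩
      · exact hLφ.of_eq rfl rfl rfl rfl rfl rfl rfl
      · rw [eℓ]; omega
      · refine ⟨hinφ, hsl, hacc.1, htopτ, ?_⟩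
        rcases hrrτ with ⟨h, -⟩ | ⟨f, h1, h2, h3, h4, h5⟩
        · exact Or.inl h
        · exact Or.inr ⟨f, h1, h2, h4, by rw [← h3]; exact hacc.2, h5⟩
    -- If the weight is below `R q / 2`, then `0.99` times the optimum is at most `0.515 R q`.
    -- Otherwise `2 R q` exceeds the weight `R f` of the entry rejected before; then `R q = R f` by
    -- `R_gap`, and the bound for `f` carries over.
    · have hfail : E.G.opt ≤ 0.7 * Rs q := by
        by_cases h1 : Rs q ≤ 2 * E.G.mateWeight (φ.word aM)
        · rcases hrrτ with ⟨h, h'⟩ | ⟨f, hf1, hf2, hf3, hf4, hf5⟩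
          · exact absurd ⟨h1, by rw [h', h]⟩ hrej
          · rcases (S.R_gap hf1.le hf2).2.2 with h6 | h6
            · rw [← h6]; exact hf4
            · exact absurd ⟨h1, by rw [hf3]; exact h6⟩ hrej
        · linarith
      refine ⟨by omega, ?_⟩
      simp only [Prog.retreat, wp_branch, Test.Holds, wp_block_cons, wp_block_one, wp_setWord, wp_setReal, wp_skip, WExp.eval, RExp.eval,
    Memory.word_setWord, Memory.real_setWord, Memory.real_setReal, Memory.word_setReal,
    Nat.reduceEqDiff, if_true, if_false, Function.update_self, g8]
      refine ⟨fun h0 => ?_, fun h0 => ?_⟩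
      · have hq0 : q = 0 := by omega
        refine ⟨by omega, by omega, ⟨hle, ?_, hInφ, hHle, Or.inr ⟨trivial, ?_,
          Or.inr ⟨g9, hq0, ?_⟩⟩⟩, by simp [hfinτ]⟩
        · exact hLφ.of_eq rfl rfl rfl rfl rfl rfl rfl
        · rw [eℓ]; omega
        · rw [← hq0]; exact hfail
      · refine ⟨by omega, ?_, ?_⟩
        · have := S.pos_add_le (Nat.zero_le q) hle
          omega
        have hpq1 := S.pos_lt (q - 1) (by omega)
        rw [Nat.sub_add_cancel (by omega)] at hpq1
        have hS1 := S.mono (q := q - 1) (by omega)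
        refine wp_of (wp_popShort (W := W) (ε := ε) (N := N) (Γ := Γ) (hist := hist) (mark := mk)
          (R := Rs) (sp := q - 1) ?_ ?_ ?_ ?_ (by omega)) ?_ <;> try simp only [Memory.word_setWord, Memory.real_setWord, Memory.real_setReal, Memory.word_setReal,
    Nat.reduceEqDiff, if_true, if_false, Function.update_self, g1]
        · exact hS1
        · rw [g4]; omega
        · have := S.pos_add_le (Nat.zero_le q) hle
          omega
        rintro ψ z ⟨hle2, hz, htop2, hsh2⟩ hF4
        rw [g4] at htop2 hsh2
        have k1 : ∀ a, a ≠ vSp → ψ.word a = φ.word a := by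
          intro a ha
          rw [hF4.1 a (by simp [Prog.wordArrays, Prog.popShort, ha])]
          simp only [Memory.word_setWord, Memory.real_setWord, Memory.real_setReal, Memory.word_setReal,
    Nat.reduceEqDiff, if_true, if_false, Function.update_self, if_neg ha]
        have k2 : ∀ a, a ≠ rRr → ψ.real a = φ.real a := by
          intro a ha
          rw [hF4.2 a (by simp [Prog.realArrays, Prog.popShort])]
          simp only [Memory.word_setWord, Memory.real_setWord, Memory.real_setReal, Memory.word_setReal,
    Nat.reduceEqDiff, if_true, if_false, Function.update_self, if_neg ha]
        have k3 : ψ.real rRr 0 = Rs q := by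
          rw [hF4.2 rRr (by simp [Prog.realArrays, Prog.popShort])]
          simp only [Memory.word_setWord, Memory.real_setWord, Memory.real_setReal, Memory.word_setReal,
    Nat.reduceEqDiff, if_true, if_false, Function.update_self]
        set q' := ψ.word vSp 0 with hq'
        have hb1 := S.pos_add_le (q := q') (q' := q - 1) hle2 (by omega)
        -- By `LongTop` the entry that ends at `q` has length at least `2ℓ`.
        have hℓ' : 3 * ℓ ≤ c - pos q' := by
          have := htopτ (by omega)
          omega
        have hrl' : 3 * (r * ℓ) ≤ r * (c - pos q') := by
          calc 3 * (r * ℓ) = r * (3 * ℓ) := by ring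
            _ ≤ r * (c - pos q') := Nat.mul_le_mul_left _ hℓ'
        have hrl2 : c - pos q' ≤ r * (c - pos q') := Nat.le_mul_of_pos_left _ hr1
        have hvH : ψ.word vH 0 = φ.word vH 0 := by rw [k1 vH (by decide)]
        refine ⟨⟨by omega, ?_, ?_, by omega, Or.inl ⟨?_, ?_, htop2, ?_, Or.inr ⟨q, by omega, hle,
          k3, hfail, hsh2⟩⟩⟩, ?_⟩
        · refine (hLφ.of_eq (k1 _ (by decide)) (k1 _ (by decide)) (k1 _ (by decide))
            (k1 _ (by decide)) (k2 _ (by decide)) (k2 _ (by decide)) (k2 _ (by decide))).mono ?_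
          exact S.mark_mono (by omega) hle
        · rw [k1 aIn (by decide)]; exact hInφ
        · rw [k1 vFin (by decide), g10]
        · rw [k1 vOk (by decide), g9]
        · omega
        · rw [k1 vFin (by decide), g10, if_pos rfl, hfinτ, if_pos rfl]
          omega
  · rintro τ k ⟨hle, hLτ, hInτ, hHτ, hcase⟩ hb
    simp only [Test.Holds, WExp.eval] at hb
    rcases hcase with h | ⟨-, h1, h2⟩
    · omega
    · exact ⟨hle, hLτ, hInτ, hHτ, by omega, h2⟩

end Env

end

/-! ### The invariant between two updates and the credit. -/

noncomputable section

namespace Prog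

/-- Make an entry of the stack for the current matching. -/
def accept : Prog := block [
  branch (.realLe (.mul (.ofWord (.const 2)) (.get rR (.var vSp))) (.var rWt))
    (setReal rR (.add (.var vSp) (.const 1)) (.var rWt))
    (setReal rR (.add (.var vSp) (.const 1)) (.get rR (.var vSp))),
  assign vSp (.add (.var vSp) (.const 1)),
  setWord aPos (.var vSp) (.var vCnt),
  setWord aMark (.var vSp) (.var vH)]

/-- Record the size of the list, if it is larger than before. -/
def enlarge : Prog := branch (.wordLe (.var vMax) (.var vLN)) (assign vMax (.var vLN)) skip

/-- Repair the current matching after many updates. -/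
def renew : Prog := block [
  process,
  branch (.wordLe (.const 1) (.var vOk)) accept (block [rebuild, enlarge])]

/-- Start again from the matching of the algorithm. -/
def refresh : Prog := block [
  rebuild,
  assign vSc (.const 0),
  assign vMax (.var vLN)]

end Prog

/-- The state after a rebuild. -/
structure Rebuilt {n : ℕ} (E : Env n) (τ : Memory) : Prop where
  logged : Logged n (fun _ => (τ.word aM, τ.real rWV)) 0 τ
  isIn : MateState.In E.G (τ.word aM, τ.real rWV)
  eq_target : ∀ u < n, τ.word aM u = E.target u
  log_zero : τ.word vH 0 = 0
  cnt_zero : τ.word vCnt 0 = 0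
  sp_zero : τ.word vSp 0 = 0
  pos_zero : τ.word aPos 0 = 0
  mark_zero : τ.word aMark 0 = 0
  weight : τ.real rR 0 = E.G.mateWeight E.target
  length : τ.word vLN 0 = (E.A.edges E.s).length
  listing : Listing n (τ.word aM) τ
  marks : ∀ u < n, τ.word aIn u = 0

theorem Rebuilt.of_eq {n : ℕ} {E : Env n} {σ τ : Memory} (h : Rebuilt E σ)
    (h1 : ∀ a, a ≠ vSc → a ≠ vMax → τ.word a = σ.word a) (h2 : τ.real = σ.real) : Rebuilt E τ := by
  have e := fun a => h1 a
  obtain ⟨a1, a2, a3, a4, a5, a6, a7, a8, a9, a10, a11, a12⟩ := h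
  have m2 := h1 aM (by decide) (by decide)
  constructor
  · rw [m2, h2]
    exact a1.of_eq m2 (h1 _ (by decide) (by decide)) (h1 _ (by decide) (by decide))
      (h1 _ (by decide) (by decide)) (by rw [h2]) (by rw [h2]) (by rw [h2])
  · rw [m2, h2]; exact a2
  · rw [m2]; exact a3
  · rw [h1 vH (by decide) (by decide)]; exact a4
  · rw [h1 vCnt (by decide) (by decide)]; exact a5
  · rw [h1 vSp (by decide) (by decide)]; exact a6
  · rw [h1 aPos (by decide) (by decide)]; exact a7
  · rw [h1 aMark (by decide) (by decide)]; exact a8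
  · rw [h2]; exact a9
  · rw [h1 vLN (by decide) (by decide)]; exact a10
  · rw [m2]
    exact a11.of_eq (h1 _ (by decide) (by decide)) (h1 _ (by decide) (by decide))
      (h1 _ (by decide) (by decide))
  · rw [h1 aIn (by decide) (by decide)]; exact a12

/-- The state of the data structure at the time `i`, where `𝒢` are the graphs and `eu`, `ev` the
endpoints of the updates, apart from the bounds on the number of updates. -/
structure Core {n : ℕ} (W ε : ℝ) (𝒢 : ℕ → WGraph n) (eu ev : ℕ → ℕ) (hist : ℕ → MateState) (i : ℕ)
    (σ : Memory) : Prop where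
  stack : Stack W ε (σ.word vMax 0) (fun j => 𝒢 (i - σ.word vCnt 0 + j)) hist (σ.word aPos)
    (σ.word aMark) (σ.real rR) (σ.word vSp 0)
  logged : Logged n hist (σ.word aMark (σ.word vSp 0)) σ
  log_le : σ.word vH 0 ≤ (3 * n + 2) * σ.word vCnt 0
  isIn : MateState.In (𝒢 i) (σ.word aM, σ.real rWV)
  cnt_le : σ.word vCnt 0 ≤ σ.word vSc 0
  sc_le : σ.word vSc 0 ≤ i
  pos_le : σ.word aPos (σ.word vSp 0) ≤ σ.word vCnt 0
  touched : ∀ j < σ.word vCnt 0, σ.word aTU j = eu (i - σ.word vCnt 0 + j) ∧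
    σ.word aTV j = ev (i - σ.word vCnt 0 + j)
  touched_lt : ∀ j < σ.word vCnt 0, σ.word aTU j < n ∧ σ.word aTV j < n
  weight : (𝒢 (i - σ.word vCnt 0 + σ.word aPos (σ.word vSp 0))).mateWeight
      (hist (σ.word aMark (σ.word vSp 0))).1 ≤ (𝒢 i).mateWeight (σ.word aM) +
        2 * W * ((σ.word vCnt 0 : ℝ) - σ.word aPos (σ.word vSp 0))
  listing : Listing n (hist 0).1 σ
  marks : ∀ u < n, σ.word aIn u = 0
  length_le : σ.word vLN 0 ≤ σ.word vMax 0
  max_le : σ.word vMax 0 ≤ n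
  wide : ∃ f, (𝒢 i).IsMate f ∧ 2 * σ.word vMax 0 ≤ WGraph.matchedCount n f + 2 * σ.word vSc 0
  opt_le : (𝒢 i).opt ≤ 3 * W * σ.word vMax 0 + 2 * W * σ.word vSc 0

/-- The state of the data structure between two updates. -/
structure Running {n : ℕ} (W ε : ℝ) (𝒢 : ℕ → WGraph n) (eu ev : ℕ → ℕ) (hist : ℕ → MateState)
    (i : ℕ) (σ : Memory) : Prop extends Core W ε 𝒢 eu ev hist i σ where
  pending : ((σ.word vCnt 0 : ℝ) - σ.word aPos (σ.word vSp 0)) * W ≤ ε * σ.real rR (σ.word vSp 0)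
  count : (σ.word vSc 0 : ℝ) ≤ ε * σ.word vMax 0

/-- After a rebuild the stack has one entry, whose reference weight is the exact weight. Its slack
is `ε E.G.opt`, at most `2ε` times this weight because `ε ≤ 1/2`. The bounds on `vMax` remain
hypotheses because they differ between the start of a phase and a rebuild within a phase. -/
theorem Rebuilt.running {n : ℕ} {E : Env n} {τ : Memory} {W ε : ℝ} {𝒢 : ℕ → WGraph n}
    {eu ev : ℕ → ℕ} {i : ℕ} (h : Rebuilt E τ) (hE : E.Fits W ε) (hW : 0 ≤ W) (hε : 0 < ε)
    (hε1 : ε ≤ 1 / 2) (hG : E.G = 𝒢 i) (hbase : (τ.word vMax 0 : ℝ) ≤ E.G.mateWeight E.target)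
    (hlen : τ.word vLN 0 ≤ τ.word vMax 0) (hmax : τ.word vMax 0 ≤ n) (hsc : τ.word vSc 0 ≤ i)
    (hcount : (τ.word vSc 0 : ℝ) ≤ ε * τ.word vMax 0)
    (hwide : ∃ f, (𝒢 i).IsMate f ∧ 2 * τ.word vMax 0 ≤ WGraph.matchedCount n f + 2 * τ.word vSc 0)
    (hopt : (𝒢 i).opt ≤ 3 * W * τ.word vMax 0 + 2 * W * τ.word vSc 0) :
    Running W ε 𝒢 eu ev (fun _ => (τ.word aM, τ.real rWV)) i τ := by
  have hw : E.G.mateWeight (τ.word aM) = E.G.mateWeight E.target :=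
    E.G.mateWeight_congr h.eq_target
  have hw0 : 0 ≤ E.G.mateWeight E.target := (Nat.cast_nonneg _).trans hbase
  have hopt2 : E.G.opt ≤ 2 * E.G.mateWeight E.target := by
    have h1 := hE.approx
    have h2 := hE.weightsIn.opt_nonneg hW
    nlinarith
  have htw : E.G.mateWeight E.target ≤ 5 * W * τ.word vMax 0 := by
    have h1 := hE.weightsIn.mateWeight_le_matchedCount hW E.target
    rw [← hE.count, ← h.length] at h1
    have h2 : (τ.word vLN 0 : ℝ) ≤ τ.word vMax 0 := by exact_mod_cast hlen
    have h3 := mul_le_mul_of_nonneg_left h2 hW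
    have h4 : 0 ≤ W * (τ.word vMax 0 : ℝ) := by positivity
    push_cast at h1
    linarith
  refine ⟨?_, ?_, hcount⟩
  · constructor
    · rw [h.sp_zero, h.cnt_zero]
      simp only [Nat.sub_zero]
      constructor
      · exact h.pos_zero
      · exact h.mark_zero
      · intro j hj; omega
      · intro j hj; omega
      · intro j hj
        obtain rfl : j = 0 := by omega
        rw [h.mark_zero]; omega
      · intro j hj
        obtain rfl : j = 0 := by omega
        rw [h.pos_zero, add_zero, ← hG]; exact h.isIn
      · intro j hj
        obtain rfl : j = 0 := by omega
        rw [h.pos_zero, add_zero, ← hG]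
        simp only
        rw [hw, h.weight]
        have h1 := hE.approx
        have h2 := mul_le_mul_of_nonneg_left hopt2 hε.le
        have h3 : 0 ≤ ε * E.G.mateWeight E.target := by positivity
        push_cast
        linarith
      · intro j hj; omega
      · intro j hj
        obtain rfl : j = 0 := by omega
        rw [h.pos_zero, add_zero, ← hG]
        simp only
        rw [hw, h.weight]; linarith
      · intro j hj
        obtain rfl : j = 0 := by omega
        rw [h.pos_zero, add_zero, ← hG]
        simp only
        rw [hw, h.weight]; linarith
      · intro j hj; omega
      · intro j hj; omega
      · intro j hj
        obtain rfl : j = 0 := by omega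
        rw [h.weight]; exact htw
      · rw [h.weight]; exact hbase
    · rw [h.sp_zero, h.mark_zero]; exact h.logged
    · rw [h.log_zero]; omega
    · rw [← hG]; exact h.isIn
    · rw [h.cnt_zero]; omega
    · exact hsc
    · rw [h.sp_zero, h.pos_zero]; omega
    · rw [h.cnt_zero]; intro j hj; omega
    · rw [h.cnt_zero]; intro j hj; omega
    · rw [h.sp_zero, h.pos_zero, h.cnt_zero]; simp
    · exact h.listing
    · exact h.marks
    · exact hlen
    · exact hmax
    · exact hwide
    · exact hopt
  · rw [h.sp_zero, h.pos_zero, h.cnt_zero, h.weight]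
    have : 0 ≤ ε * E.G.mateWeight E.target := by positivity
    simpa using this

/-- A bound on the potential of one update. -/
def maxPotential (W : ℝ) : ℝ :=
  5 / 2 * (3 * Real.log (5 * W) + 1) * Real.log W + 3 * Real.log (5 * W) + 1

/-- What the rebuilds with a list of length `N` may cost. -/
def listPotential (W : ℝ) (N : ℕ) (R₀ : ℝ) : ℝ := N * (1 + 3 * Real.log (5 * W * N / R₀))

/-- The cost that the state at the time `i` accounts for, up to a constant for every update. -/
def credit (W ε : ℝ) (i : ℕ) (σ : Memory) : ℝ :=
  1100 * ⌈1 / ε⌉₊ * (maxPotential W + 1) * ((i : ℝ) - σ.word vCnt 0) +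
  1100 * ⌈1 / ε⌉₊ * potential W ε (σ.word vMax 0) (σ.word aPos) (σ.real rR) (σ.word vSp 0) +
  194 * ((1 + 3 * Real.log (5 * W)) / ε) * ((i : ℝ) - σ.word vSc 0) +
  194 * listPotential W (σ.word vMax 0) (σ.real rR 0) - 5 * σ.word vH 0 - 97 * σ.word vLN 0

theorem maxPotential_nonneg {W : ℝ} (hW : 2 ≤ W) : 0 ≤ maxPotential W := by
  have h1 : 0 ≤ Real.log (5 * W) := Real.log_nonneg (by linarith)
  have h2 : 0 ≤ Real.log W := Real.log_nonneg (by linarith)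
  unfold maxPotential
  positivity

theorem potential_zero (W ε : ℝ) (N : ℕ) (pos : ℕ → ℕ) (R : ℕ → ℝ) : potential W ε N pos R 0 = 0 := by
  simp [potential]

/-- A fresh list brings its own length as potential; multiplied by `194 = 2 * 97` it pays for making
the list now and for going through it again at the next rebuild. -/
theorem le_listPotential {W : ℝ} {N : ℕ} {R₀ : ℝ} (hR : R₀ ≤ 5 * W * N) (hN : (N : ℝ) ≤ R₀) :
    (N : ℝ) ≤ listPotential W N R₀ := by
  unfold listPotential
  rcases Nat.eq_zero_or_pos N with rfl | h
  · simp
  · have hN0 : (0 : ℝ) < N := by exact_mod_cast h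
    have h3 : 0 ≤ Real.log (5 * W * N / R₀) :=
      Real.log_nonneg ((one_le_div (by linarith)).2 hR)
    nlinarith

theorem listPotential_le {W : ℝ} {N : ℕ} {R₀ : ℝ} (hW : 2 ≤ W) (hR : (N : ℝ) ≤ R₀) :
    listPotential W N R₀ ≤ N * (1 + 3 * Real.log (5 * W)) := by
  unfold listPotential
  rcases Nat.eq_zero_or_pos N with rfl | h
  · simp
  · have hN0 : (0 : ℝ) < N := by exact_mod_cast h
    have hR0 : 0 < R₀ := by linarith
    have h2 : Real.log (5 * W * N / R₀) ≤ Real.log (5 * W) := by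
      refine Real.log_le_log (by positivity) ?_
      rw [div_le_iff₀ hR0]
      gcongr
    have : 1 + 3 * Real.log (5 * W * N / R₀) ≤ 1 + 3 * Real.log (5 * W) := by linarith
    exact mul_le_mul_of_nonneg_left this hN0.le

/-- When the weight has dropped, the potential of the list pays for a rebuild. -/
theorem listPotential_add_le {W : ℝ} {N N' : ℕ} {R₀ R₀' : ℝ} (hW : 2 ≤ W) (hN : 0 < N)
    (hNN : N ≤ N') (hR' : R₀' ≤ 0.7 * R₀) (hNR : (N' : ℝ) ≤ R₀') (hR'N : R₀' ≤ 5 * W * N') :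
    listPotential W N R₀ + N' ≤ listPotential W N' R₀' := by
  have hN0 : (0 : ℝ) < N := by exact_mod_cast hN
  have hNN' : (N : ℝ) ≤ N' := by exact_mod_cast hNN
  have h0' : 0 < R₀' := by linarith
  have h0 : 0 < R₀ := by linarith
  have hWp : 0 < W := by linarith
  unfold listPotential
  have h1 : Real.log (10 / 7) + Real.log (5 * W * N / R₀) ≤ Real.log (5 * W * N' / R₀') := by
    rw [← Real.log_mul (by norm_num) (by positivity)]
    refine Real.log_le_log (by positivity) ?_
    rw [div_eq_mul_inv, div_eq_mul_inv]
    have h2 : 10 / 7 * R₀⁻¹ ≤ R₀'⁻¹ := by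
      rw [← div_eq_mul_inv, div_le_iff₀ h0, inv_mul_eq_div, le_div_iff₀ h0']
      linarith
    calc 10 / 7 * (5 * W * N * R₀⁻¹) = 5 * W * N * (10 / 7 * R₀⁻¹) := by ring
      _ ≤ 5 * W * N' * R₀'⁻¹ := by gcongr
  have h2 := log_ten_sevenths
  have h3 : 0 ≤ Real.log (5 * W * N' / R₀') := Real.log_nonneg ((one_le_div h0').2 hR'N)
  have h4 : N * (1 + 3 * Real.log (5 * W * N / R₀)) + N ≤ N * (1 + 3 * Real.log (5 * W * N' / R₀')) := by
    nlinarith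
  have h5 : 0 ≤ ((N' : ℝ) - N) * (3 * Real.log (5 * W * N' / R₀')) :=
    mul_nonneg (by linarith) (by linarith)
  nlinarith

/-- The graphs agree on all pairs that were not updated in between. -/
theorem lookup_eq_of_not_touched {n : ℕ} {𝒢 : ℕ → WGraph n} {eu ev : ℕ → ℕ}
    (hA : ∀ i, WGraph.AgreeOff (𝒢 i) (𝒢 (i + 1)) (eu i) (ev i)) {tu tv : ℕ → ℕ} {t a b u v : ℕ}
    (hab : a ≤ b) (ht : ∀ j < b, tu j = eu (t + j) ∧ tv j = ev (t + j))
    (h : ¬ Touched tu tv a b u v) : (𝒢 (t + b)).lookup u v = (𝒢 (t + a)).lookup u v := by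
  induction b, hab using Nat.le_induction with
  | base => rfl
  | succ b hb ih =>
    rw [touched_succ hb] at h
    push Not at h
    rw [← ih (fun j hj => ht j (by omega)) h.1]
    obtain ⟨h1, h2⟩ := ht b (by omega)
    refine hA (t + b) u v ?_
    rw [← h1, ← h2]
    have := h.2
    tauto

end

/-! ### Dropping short entries and repairing. -/

noncomputable section

namespace Env

variable {n : ℕ} {E : Env n} {hist : ℕ → MateState} {m : ℕ} {σ : Memory} {W ε : ℝ} {N : ℕ}
  {Γ : ℕ → WGraph n} {𝒢 : ℕ → WGraph n} {eu ev : ℕ → ℕ} {i : ℕ}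

/-- Only the bottom state `hist 0` of the history matters, as everything above it is undone. -/
theorem wp_rebuilt (hE : E.Fits W ε) {G₀ : WGraph n} (h0 : (hist 0).In G₀)
    (hL : Logged n hist m σ) (hmark : σ.word aMark 0 = 0) (hLst : Listing n (hist 0).1 σ)
    (hIn : ∀ u < n, σ.word aIn u = 0) (hB : n < E.B) (hB' : σ.word vLN 0 < E.B)
    (hh : σ.word vH 0 < E.B) (hB3 : 3 * n + 2 < E.B) :
    E.wp .rebuild (fun τ x => Rebuilt E τ ∧
      x ≤ 5 * σ.word vH 0 + 97 * (σ.word vLN 0 + τ.word vLN 0) + 30) σ := by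
  have hL0 : Logged n (fun _ => hist 0) 0 σ := by
    obtain ⟨hist', h1, -, h3⟩ := hL
    refine ⟨hist', h1, by omega, fun j hj => ?_⟩
    obtain rfl : j = 0 := by omega
    exact h3 0 (by omega)
  refine wp_of (wp_rebuild hE hL0 h0.isMate.pairing h0.zero hmark hLst hIn hB hB' hh hB3) ?_
  rintro τ x ⟨hx, h1, h2, h3, h4, h5, h6, h7, h8, h9, h10, h11⟩ hF
  refine ⟨⟨h1, h2, h3, h4, h5, h6, h7, ?_, h8, h9, h10, h11⟩, by rw [h9]; exact hx⟩
  rw [hF.1 aMark (by decide)]; exact hmark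

/-- Dropping entries costs two steps each, and an entry contains at least one update; this is the
difference between `1000` and `1002`. Starting `rRr` at twice the weight of the top makes the second
part of the acceptance test hold at the top. -/
theorem wp_process {L sp : ℕ} (hW : 2 ≤ W) (hε : 0 < ε) (hE : E.Fits W ε) (hsp : σ.word vSp 0 = sp)
    (S : Stack W ε N Γ hist (σ.word aPos) (σ.word aMark) (σ.real rR) sp)
    (hc : σ.word aPos sp < σ.word vCnt 0) (hΓ : ∀ j ≤ σ.word vCnt 0, (Γ j).WeightsIn W)
    (hLε : 1000 * ε * (L + 10) ≤ 1) (hspL : sp ≤ L) (hσε : σ.real 0 1 = ε)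
    (hagree : ∀ a ≤ σ.word vCnt 0, ∀ u v, ¬ Touched (σ.word aTU) (σ.word aTV) a
      (σ.word vCnt 0) u v → E.G.lookup u v = (Γ a).lookup u v)
    (hT : ∀ j < σ.word vCnt 0, σ.word aTU j < n ∧ σ.word aTV j < n)
    (hIn : ∀ u < n, σ.word aIn u = 0) (hLog : Logged n hist (σ.word aMark sp) σ)
    (hH : σ.word vH 0 ≤ (3 * n + 2) * σ.word vCnt 0)
    (hB : n < E.B) (hB' : ⌈1 / ε⌉₊ + 1 < E.B) (hB2 : (3 * n + 2) * σ.word vCnt 0 + 2 < E.B) :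
    E.wp .process (fun τ x => ∃ s ≤ sp, τ.word vSp 0 ≤ s ∧
      Short (σ.word aPos) (σ.word vCnt 0) s sp ∧
      Logged n hist (σ.word aMark (τ.word vSp 0)) τ ∧
      (∀ u < n, τ.word aIn u = 0) ∧ τ.word vH 0 ≤ (3 * n + 2) * σ.word vCnt 0 ∧
      x + 5 * τ.word vH 0 ≤ 5 * σ.word vH 0 +
        1002 * (⌈1 / ε⌉₊ * (σ.word vCnt 0 - σ.word aPos (τ.word vSp 0))) + 5 ∧
      (τ.word vOk 0 = 1 ∧ E.Accepted Γ hist ε (σ.word vCnt 0) s (σ.word aPos) (σ.word aMark)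
          (σ.real rR) (τ.word vSp 0) τ ∨
        τ.word vOk 0 = 0 ∧ τ.word vSp 0 = 0 ∧ E.G.opt ≤ 0.7 * σ.real rR 0)) σ := by
  have hr1 : 1 ≤ ⌈1 / ε⌉₊ := Nat.one_le_ceil_iff.2 (by positivity)
  have hc2 : σ.word vCnt 0 ≤ (3 * n + 2) * σ.word vCnt 0 := Nat.le_mul_of_pos_left _ (by omega)
  have hspp := S.pos_add_le (Nat.zero_le sp) le_rfl
  simp only [Prog.process, wp_block_cons, wp_block_one, wp_setWord, wp_setReal, wp_skip, WExp.eval, RExp.eval,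
    Memory.word_setWord, Memory.real_setWord, Memory.real_setReal, Memory.word_setReal,
    Nat.reduceEqDiff, if_true, if_false, Function.update_self]
  refine ⟨by omega, by omega, by omega, by omega, ?_⟩
  refine wp_of (wp_popShort (W := W) (ε := ε) (N := N) (Γ := Γ) (hist := hist) (mark := σ.word aMark)
    (R := σ.real rR) (sp := sp) ?_ ?_ ?_ ?_ (by omega)) ?_ <;> try simp only [Memory.word_setWord, Memory.real_setWord, Memory.real_setReal, Memory.word_setReal,
    Nat.reduceEqDiff, if_true, if_false, Function.update_self]
  · exact hsp
  · exact S
  · exact hc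
  · omega
  rintro τ x ⟨hle, hx, htop, hsh⟩ hF
  have f1 : ∀ a, a ∉ [vSp, vOk, vFin] → τ.word a = σ.word a := by
    intro a ha
    simp only [List.mem_cons, List.not_mem_nil, not_or] at ha
    rw [hF.1 a (by simp [Prog.wordArrays, Prog.popShort, ha])]
    simp only [Memory.word_setWord, Memory.real_setWord, Memory.real_setReal, Memory.word_setReal,
    Nat.reduceEqDiff, if_true, if_false, Function.update_self, if_neg ha.2.1, if_neg ha.2.2.1]
  have f2 : τ.real = σ.real := by
    funext a
    rw [hF.2 a (by simp [Prog.realArrays, Prog.popShort])]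
    simp only [Memory.word_setWord, Memory.real_setWord, Memory.real_setReal, Memory.word_setReal,
    Nat.reduceEqDiff, if_true, if_false, Function.update_self]
  have f3 : τ.word vOk 0 = 0 := by rw [hF.1 vOk (by decide)]; simp only [Memory.word_setWord, Memory.real_setWord, Memory.real_setReal, Memory.word_setReal,
    Nat.reduceEqDiff, if_true, if_false, Function.update_self]
  have f4 : τ.word vFin 0 = 0 := by rw [hF.1 vFin (by decide)]; simp only [Memory.word_setWord, Memory.real_setWord, Memory.real_setReal, Memory.word_setReal,
    Nat.reduceEqDiff, if_true, if_false, Function.update_self]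
  set s := τ.word vSp 0 with hs
  have e1 := f1 aPos (by decide)
  have e2 := f1 aMark (by decide)
  have e3 := f1 vCnt (by decide)
  have e4 := f1 aTU (by decide)
  have e5 := f1 aTV (by decide)
  have e6 := f1 aIn (by decide)
  have e7 := f1 vH (by decide)
  have hb1 := S.pos_add_le hle le_rfl
  refine ⟨by omega, ?_⟩
  refine wp_of (wp_repair (hist := hist) (W := W) (ε := ε) (N := N) (Γ := Γ) (L := L) (sp := s)
    (by linarith) hε hE ?_ ?_ ?_ ?_ hLε (by omega) ?_ ?_ ?_ ?_ ?_ ?_ ?_ ?_ ?_ ?_ hB hB' ?_) ?_ <;>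
    try simp only [Memory.word_setWord, Memory.real_setWord, Memory.real_setReal, Memory.word_setReal,
    Nat.reduceEqDiff, if_true, if_false, Function.update_self, e1, e2, e3, e4, e5, e6, e7, f2]
  · rfl
  · exact S.mono hle
  · omega
  · exact hΓ
  · exact hσε
  · exact hagree
  · exact hT
  · exact hIn
  · refine (hLog.of_eq ?_ ?_ ?_ ?_ ?_ ?_ ?_).mono (S.mark_mono hle le_rfl) <;>
      try simp only [Memory.word_setWord, Memory.real_setWord, Memory.real_setReal, Memory.word_setReal,
    Nat.reduceEqDiff, if_true, if_false, Function.update_self]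
    · exact f1 _ (by decide)
    · exact f1 _ (by decide)
    · exact f1 _ (by decide)
    · exact f1 _ (by decide)
    · rw [f2]
    · rw [f2]
    · rw [f2]
  · exact hH
  · exact htop
  · exact f4
  · exact f3
  · norm_num
  · exact hB2
  rintro υ y ⟨hle2, hLυ, hInυ, hHυ, hy, hcase⟩ -
  refine ⟨s, hle, hle2, hsh, hLυ, hInυ, hHυ, ?_, hcase⟩
  have hb2 := S.pos_add_le hle2 hle
  have hrl : σ.word vCnt 0 - σ.word aPos (υ.word vSp 0) ≤
    ⌈1 / ε⌉₊ * (σ.word vCnt 0 - σ.word aPos (υ.word vSp 0)) := Nat.le_mul_of_pos_left _ hr1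
  omega

end Env

end

/-! ### Accepted repairs. -/

noncomputable section

namespace Env

variable {n : ℕ} {E : Env n} {hist : ℕ → MateState} {σ τ : Memory} {W ε : ℝ}
  {𝒢 : ℕ → WGraph n} {eu ev : ℕ → ℕ} {i : ℕ}

theorem Accepted.le_opt {Γ : ℕ → WGraph n} {c sp q : ℕ} {pos mark : ℕ → ℕ} {R : ℕ → ℝ}
    (h : E.Accepted Γ hist ε c sp pos mark R q τ) (hE : E.Fits W ε) (hW : 0 ≤ W) :
    E.G.mateWeight (τ.word aM) ≤ E.G.opt :=
  hE.weightsIn.mateWeight_le_opt hW h.isIn.isMate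

/-- The weight of the new entry of the stack. -/
def newWeight (R w : ℝ) : ℝ := if 2 * R ≤ w then w else R

/-- The reference weight changes only when the weight has at least doubled. It stays within a factor
two of the weight on both sides and never decreases from an entry to the next. -/
theorem newWeight_cases (R w : ℝ) (hR : 0 ≤ R) (h : R ≤ 2 * w) :
    R ≤ newWeight R w ∧ w ≤ 2 * newWeight R w ∧ newWeight R w ≤ 2 * w ∧
      (newWeight R w = R ∨ 2 * R ≤ newWeight R w) ∧ (newWeight R w = R ∨ newWeight R w = w) := by
  unfold newWeight
  split_ifs with h1
  · exact ⟨by linarith, by linarith, by linarith, Or.inr h1, Or.inr rfl⟩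
  · exact ⟨le_rfl, by linarith, h, Or.inl rfl, Or.inl rfl⟩

theorem wp_accept {q : ℕ} (hq : τ.word vSp 0 = q) (hB : q + 1 < E.B) (hc : τ.word vCnt 0 < E.B)
    (hh : τ.word vH 0 < E.B) :
    E.wp .accept (fun υ x => x = 5 ∧
      υ.word vSp 0 = q + 1 ∧ υ.word aPos = Function.update (τ.word aPos) (q + 1) (τ.word vCnt 0) ∧
      υ.word aMark = Function.update (τ.word aMark) (q + 1) (τ.word vH 0) ∧
      υ.real rR = Function.update (τ.real rR) (q + 1) (newWeight (τ.real rR q) (τ.real rWt 0)) ∧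
      (∀ a, a ∉ [vSp, aPos, aMark] → υ.word a = τ.word a) ∧
      ∀ a, a ≠ rR → υ.real a = τ.real a) τ := by
  simp only [Prog.accept, wp_branch, Test.Holds, wp_block_cons, wp_block_one, wp_setWord, wp_setReal, wp_skip, WExp.eval, RExp.eval,
    Memory.word_setWord, Memory.real_setWord, Memory.real_setReal, Memory.word_setReal,
    Nat.reduceEqDiff, if_true, if_false, Function.update_self, hq, Nat.cast_ofNat]
  refine ⟨fun h => ⟨by omega, by omega, by omega, by omega, hc, by omega, hh, trivial, trivial,
      trivial, trivial, by rw [newWeight, if_pos h], ?_, ?_⟩,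
    fun h => ⟨by omega, by omega, by omega, by omega, hc, by omega, hh, trivial, trivial,
      trivial, trivial, by rw [newWeight, if_neg h], ?_, ?_⟩⟩
  all_goals intro a ha
  · simp only [List.mem_cons, List.not_mem_nil, not_or] at ha
    simp only [if_neg ha.1, if_neg ha.2.1, if_neg ha.2.2.1]
  · simp only [if_neg ha]
  · simp only [List.mem_cons, List.not_mem_nil, not_or] at ha
    simp only [if_neg ha.1, if_neg ha.2.1, if_neg ha.2.2.1]
  · simp only [if_neg ha]

/-- The state after an accepted attempt, with the potential. -/
theorem Accepted.running (K : Core W ε 𝒢 eu ev hist i σ) {L s : ℕ} (hW : 2 ≤ W) (hε : 0 < ε)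
    (hE : E.Fits W ε) (hG : E.G = 𝒢 i) (hLε : 1000 * ε * (L + 10) ≤ 1)
    (hspL : σ.word vSp 0 ≤ L) (hcount : (σ.word vSc 0 : ℝ) < ε * σ.word vMax 0)
    (hpos : σ.word aPos (σ.word vSp 0) < σ.word vCnt 0)
    (hdue : ε * σ.real rR (σ.word vSp 0) ≤
      ((σ.word vCnt 0 : ℝ) - σ.word aPos (σ.word vSp 0)) * W)
    (hs : s ≤ σ.word vSp 0) {q : ℕ} (hq : q ≤ s)
    (hsh : Short (σ.word aPos) (σ.word vCnt 0) s (σ.word vSp 0))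
    (hlog : Logged n hist (σ.word aMark q) τ) (hmarks : ∀ u < n, τ.word aIn u = 0)
    (hH : τ.word vH 0 ≤ (3 * n + 2) * σ.word vCnt 0)
    (hA : E.Accepted (fun j => 𝒢 (i - σ.word vCnt 0 + j)) hist ε (σ.word vCnt 0) s (σ.word aPos)
      (σ.word aMark) (σ.real rR) q τ)
    {υ : Memory} (h1 : υ.word vSp 0 = q + 1)
    (h2 : υ.word aPos = Function.update (σ.word aPos) (q + 1) (σ.word vCnt 0))
    (h3 : υ.word aMark = Function.update (σ.word aMark) (q + 1) (τ.word vH 0))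
    (h4 : υ.real rR = Function.update (σ.real rR) (q + 1)
      (newWeight (σ.real rR q) (E.G.mateWeight (τ.word aM))))
    (h5 : ∀ a ∈ [aM, vH, aLC, aLV, aIn], υ.word a = τ.word a)
    (h6 : ∀ a ∈ [rWV, rLR, rWt], υ.real a = τ.real a)
    (h7 : ∀ a ∈ [vCnt, vSc, vMax, aLA, aLB, vLN, aTU, aTV], υ.word a = σ.word a) :
    (∃ hist', Running W ε 𝒢 eu ev hist' i υ) ∧
      1100 * ⌈1 / ε⌉₊ * ((σ.word vCnt 0 : ℝ) - σ.word aPos q) + 5 * σ.word vH 0 + credit W ε i σ ≤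
        5 * υ.word vH 0 + credit W ε i υ := by
  have hWp : 0 < W := by linarith
  have hN : 0 < σ.word vMax 0 := by
    by_contra h
    have h0 : σ.word vMax 0 = 0 := by omega
    rw [h0] at hcount
    have : (0 : ℝ) ≤ σ.word vSc 0 := Nat.cast_nonneg _
    simp at hcount
    linarith
  have hci : σ.word vCnt 0 ≤ i := K.cnt_le.trans K.sc_le
  have eΓ : 𝒢 (i - σ.word vCnt 0 + σ.word vCnt 0) = E.G := by rw [Nat.sub_add_cancel hci, hG]
  have e7a : υ.word vCnt = σ.word vCnt := h7 _ (by simp)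
  have e7b : υ.word vSc = σ.word vSc := h7 _ (by simp)
  have e7c : υ.word vMax = σ.word vMax := h7 _ (by simp)
  have e7d : υ.word vLN = σ.word vLN := h7 _ (by simp)
  have e5a : υ.word aM = τ.word aM := h5 _ (by simp)
  have e5b : υ.word vH = τ.word vH := h5 _ (by simp)
  have e6a : υ.real rWV = τ.real rWV := h6 _ (by simp)
  have S := K.stack
  set c := σ.word vCnt 0 with hc
  set sp := σ.word vSp 0 with hsp
  set pos := σ.word aPos with hposd
  set mk := σ.word aMark with hmk
  set R := σ.real rR with hR
  set N := σ.word vMax 0 with hNd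
  set w := E.G.mateWeight (τ.word aM) with hw
  set r := newWeight (R q) w with hr
  have hqsp : q ≤ sp := hq.trans hs
  have Sq := S.mono hqsp
  have hRq := S.R_nonneg hqsp
  have hwo : w ≤ E.G.opt := hA.le_opt hE hWp.le
  have hopt0 := hE.weightsIn.opt_nonneg hWp.le
  obtain ⟨r1, r2, r3, r4, r5⟩ := newWeight_cases (R q) w hRq hA.low
  rw [← hr] at r1 r2 r3 r4 r5
  have hopt := S.opt_le hqsp hε hLε (hqsp.trans hspL) hopt0 hA.slack
  have hppq := S.pos_add_le hqsp le_rfl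
  have hεb : ε ≤ 1 / 2 := by
    have : (0 : ℝ) ≤ L := Nat.cast_nonneg _
    nlinarith
  -- Less than `ε N` updates in the phase: `3WN + 2W ε N ≤ 5WN`.
  have hoptN : E.G.opt ≤ 5 * W * N := by
    have h := K.opt_le
    rw [← hG] at h
    have h' : W * (σ.word vSc 0 : ℝ) ≤ W * (ε * N) := by gcongr
    have h'' : W * (ε * N) ≤ W * (1 / 2 * N) := by gcongr
    have : 0 ≤ W * (N : ℝ) := by positivity
    linarith
  have htop : r ≤ 5 * W * N := by
    rcases r5 with h | h
    · rw [h]; exact S.top q hqsp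
    · rw [h]; exact hwo.trans hoptN
  have hlong : ε * R 0 ≤ ((c : ℝ) - pos q) * W := by
    have h : R 0 ≤ R sp := S.R_mono (Nat.zero_le _) le_rfl
    have h' : (pos q : ℝ) ≤ pos sp := by exact_mod_cast (by omega : pos q ≤ pos sp)
    have h'' : ε * R 0 ≤ ε * R sp := by gcongr
    nlinarith
  obtain ⟨hist', l1, l2, l3⟩ := hlog
  have hcur : hist' (τ.word vH 0) = (υ.word aM, υ.real rWV) := by rw [e5a, e6a]; exact l1.cur
  -- The optimum is at most `3r`, so the new loss `5ε E.G.opt` is at most `15 ε r`: one more unit in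
  -- the coefficient of the slack.
  have hslack : E.G.opt - w ≤ 15 * ε * (q + 2) * r := by
    have k1 := S.slack q hqsp
    have k2 := hA.slack
    have k3 : E.G.opt ≤ 3 * r := by linarith
    have k4 : 15 * ε * (q + 1) * R q ≤ 15 * ε * (q + 1) * r := by gcongr
    have k5 : ε * E.G.opt ≤ ε * (3 * r) := by gcongr
    linarith
  have hS' : Stack W ε N (fun j => 𝒢 (i - c + j)) hist' (Function.update pos (q + 1) c)
      (Function.update mk (q + 1) (τ.word vH 0)) (Function.update R (q + 1) r) (q + 1) := by
    refine Sq.push hε hWp l3 (by omega) l2 hH ?_ ?_ r4 ?_ ?_ hA.longTop hlong htop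
    · rw [eΓ, hcur, e5a, e6a]; exact hA.isIn
    · rw [eΓ, hcur, e5a]; exact hslack
    · rw [eΓ, hcur, e5a]; exact r3
    · rw [eΓ, hcur, e5a]; exact r2
  have hlistm : hist' 0 = hist 0 := l3 0 (Nat.zero_le _)
  refine ⟨⟨hist', ⟨?_, ?_, ?_, ?_, ?_, ?_, ?_, ?_, ?_, ?_, ?_, ?_, ?_, ?_, ?_, ?_⟩, ?_, ?_⟩, ?_⟩
  · rw [e7a, e7c, h1, h2, h3, h4]; exact hS'
  · rw [h1, h3, Function.update_self]
    refine ⟨hist', l1.of_eq e5a e5b (h5 _ (by simp)) (h5 _ (by simp)) e6a (h6 _ (by simp))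
      (h6 _ (by simp)), ?_, fun _ _ => rfl⟩
    rw [e5b]
  · rw [e5b, e7a]; exact hH
  · rw [e5a, e6a, ← hG]; exact hA.isIn
  · rw [e7a, e7b]; exact K.cnt_le
  · rw [e7b]; exact K.sc_le
  · rw [h1, h2, e7a, Function.update_self]
  · rw [e7a, h7 aTU (by simp), h7 aTV (by simp)]; exact K.touched
  · rw [e7a, h7 aTU (by simp), h7 aTV (by simp)]; exact K.touched_lt
  · rw [e7a, h1, h2, h3, Function.update_self, Function.update_self, ← hc, eΓ, hcur, e5a, e6a, ← hG]
    simp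
  · rw [hlistm]
    exact K.listing.of_eq e7d (h7 _ (by simp)) (h7 _ (by simp))
  · rw [h5 aIn (by simp)]; exact hmarks
  · rw [e7d, e7c]; exact K.length_le
  · rw [e7c]; exact K.max_le
  · rw [e7b, e7c]; exact K.wide
  · rw [e7b, e7c]; exact K.opt_le
  · rw [e7a, h1, h2, h4, Function.update_self, Function.update_self, ← hc, sub_self, zero_mul]
    have : 0 ≤ r := hRq.trans r1
    positivity
  · rw [e7b, e7c]; exact hcount.le
  · have hpot := S.potential_push hW hε hN hqsp hpos r1 htop hlong ?_
    · unfold credit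
      rw [e7a, e7b, e7c, e7d, h1, h2, h4, Function.update_of_ne (by omega : 0 ≠ q + 1)]
      rw [← hc, ← hNd, ← hsp, ← hposd, ← hR]
      have hr0 : (0 : ℝ) ≤ 1100 * (⌈1 / ε⌉₊ : ℝ) := by positivity
      have := mul_le_mul_of_nonneg_left hpot hr0
      linarith
    -- Entries from `s` on were dropped as short before the first repair, those below `f - 1` after
    -- the last rejection. The remaining ones have at least the reference weight of the rejected
    -- entry `f`, and the new weight is at most `0.7` of that, being either `R q ≤ R f / 2` or at
    -- most the optimum.
    · intro j hj1 hj2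
      by_cases hjs : s ≤ j
      · left
        have := hsh j hjs hj2
        have := S.pos_add_le hq hs
        omega
      · rcases hA.pop with h | ⟨f, f1, f2, f3, f4, f5⟩
        · omega
        · by_cases hjf : j < f - 1
          · exact Or.inl (f5 j hj1 hjf)
          · right
            have hRf : R f ≤ R (j + 1) := S.R_mono (by omega) hj2
            have hRf0 := S.R_nonneg (f2.trans hs)
            rcases r5 with h | h
            · rw [h]; linarith
            · rw [h]; linarith

end Env

end

/-! ### Renewal after many updates. -/

noncomputable section

namespace Env

variable {n : ℕ} {E : Env n} {hist : ℕ → MateState} {σ τ : Memory} {W ε : ℝ}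
  {𝒢 : ℕ → WGraph n} {eu ev : ℕ → ℕ} {i : ℕ}

theorem Fits.matchedCount_le {f : ℕ → ℕ} (hE : E.Fits W ε) (hf : E.G.IsMate f) (hW : 0 ≤ W) :
    (1 - ε) * WGraph.matchedCount n f ≤ E.G.mateWeight E.target ∨ 1 ≤ ε := by
  by_cases h : 1 ≤ ε
  · exact Or.inr h
  · left
    have h1 := hE.weightsIn.matchedCount_le_mateWeight hf
    have h2 := hE.weightsIn.mateWeight_le_opt hW hf
    have h3 := hE.approx
    have h4 := mul_le_mul_of_nonneg_left (h1.trans h2) (by linarith : 0 ≤ 1 - ε)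
    linarith

theorem Fits.length_le (hE : E.Fits W ε) :
    (E.A.edges E.s).length ≤ E.G.matchingNumber ∧ (E.A.edges E.s).length ≤ n := by
  have h1 := hE.count
  have h2 : WGraph.matchedCount n E.target ≤ n := by
    unfold WGraph.matchedCount
    exact (Finset.card_filter_le _ _).trans (by simp)
  have h3 := hE.isMate.matchedCount_le
  omega

theorem Fits.length_le_weight (hE : E.Fits W ε) :
    2 * ((E.A.edges E.s).length : ℝ) ≤ E.G.mateWeight E.target := by
  have h1 := hE.weightsIn.matchedCount_le_mateWeight hE.isMate
  rw [← hE.count] at h1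
  push_cast at h1
  exact h1

theorem Fits.weight_le_length (hE : E.Fits W ε) (hW : 0 ≤ W) :
    E.G.mateWeight E.target ≤ 2 * W * (E.A.edges E.s).length := by
  have h1 := hE.weightsIn.mateWeight_le_matchedCount hW E.target
  rw [← hE.count] at h1
  push_cast at h1
  linarith

theorem wp_enlarge {Q : Memory → ℕ → Prop} (hB : σ.word vLN 0 < E.B) (hB0 : 0 < E.B)
    (hQ : ∀ τ, τ.word vMax 0 = max (σ.word vMax 0) (σ.word vLN 0) →
      (∀ a, a ≠ vMax → τ.word a = σ.word a) → τ.real = σ.real → ∀ x ≤ 2, Q τ x) :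
    E.wp .enlarge Q σ := by
  simp only [Prog.enlarge, wp_branch, Test.Holds, wp_block_cons, wp_block_one, wp_setWord, wp_setReal, wp_skip, WExp.eval, RExp.eval,
    Memory.word_setWord, Memory.real_setWord, Memory.real_setReal, Memory.word_setReal,
    Nat.reduceEqDiff, if_true, if_false, Function.update_self]
  refine ⟨fun h => ⟨hB0, hB, hQ (σ.setWord vMax 0 (σ.word vLN 0)) ?_ (fun a ha => ?_) rfl _ le_rfl⟩,
    fun h => hQ σ ?_ (fun a ha => rfl) rfl _ (by omega)⟩
  · simp only [Memory.word_setWord, Memory.real_setWord, Memory.real_setReal, Memory.word_setReal,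
    Nat.reduceEqDiff, if_true, if_false, Function.update_self]; omega
  · simp only [Memory.word_setWord, Memory.real_setWord, Memory.real_setReal, Memory.word_setReal,
    Nat.reduceEqDiff, if_true, if_false, Function.update_self, if_neg ha]
  · omega

/-- An accepted repair is paid by `potential_push`. If all entries are rejected, the optimum is at
most `0.7 R₀`, and the growth of `listPotential` pays for the rebuild. The phase goes on in that
case: `vSc` is kept, and `vMax` can only grow. -/
theorem wp_renew {L : ℕ} (K : Core W ε 𝒢 eu ev hist i σ) (hW : 2 ≤ W) (hε : 0 < ε)
    (hE : E.Fits W ε) (hG : E.G = 𝒢 i) (h𝒢 : ∀ j, (𝒢 j).WeightsIn W)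
    (hA : ∀ j, WGraph.AgreeOff (𝒢 j) (𝒢 (j + 1)) (eu j) (ev j)) (hL : W ≤ 2 ^ L)
    (hLε : 1000 * ε * (L + 10) ≤ 1) (hcount : (σ.word vSc 0 : ℝ) < ε * σ.word vMax 0)
    (hpos : σ.word aPos (σ.word vSp 0) < σ.word vCnt 0)
    (hdue : ε * σ.real rR (σ.word vSp 0) ≤
      ((σ.word vCnt 0 : ℝ) - σ.word aPos (σ.word vSp 0)) * W)
    (hσε : σ.real 0 1 = ε) (hB' : ⌈1 / ε⌉₊ + 1 < E.B)
    (hB2 : (3 * n + 2) * σ.word vCnt 0 + 2 < E.B) :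
    E.wp .renew (fun τ x => (∃ hist', Running W ε 𝒢 eu ev hist' i τ) ∧
      (x : ℝ) + credit W ε i σ ≤ credit W ε i τ + 50 ∧
      τ.word vMax 0 ≤ max (σ.word vMax 0) (𝒢 i).matchingNumber) σ := by
  have hWp : 0 < W := by linarith
  have hr1 : 1 ≤ ⌈1 / ε⌉₊ := Nat.one_le_ceil_iff.2 (by positivity)
  have S := K.stack
  have hc1 : 1 ≤ σ.word vCnt 0 := by omega
  have hci : σ.word vCnt 0 ≤ i := K.cnt_le.trans K.sc_le
  have h3n : 3 * n + 2 ≤ (3 * n + 2) * σ.word vCnt 0 := Nat.le_mul_of_pos_right _ hc1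
  have hcn : σ.word vCnt 0 ≤ (3 * n + 2) * σ.word vCnt 0 := Nat.le_mul_of_pos_left _ (by omega)
  have hposN : (σ.word aPos (σ.word vSp 0) : ℝ) < ε * σ.word vMax 0 := by
    have h1 : (σ.word aPos (σ.word vSp 0) : ℝ) < σ.word vCnt 0 := by exact_mod_cast hpos
    have h2 : (σ.word vCnt 0 : ℝ) ≤ σ.word vSc 0 := by exact_mod_cast K.cnt_le
    linarith
  have hspL := S.size_le hL hWp hε hposN
  have hspc := S.pos_add_le (Nat.zero_le (σ.word vSp 0)) le_rfl
  have hεb : ε ≤ 1 / 1000 := by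
    have : (0 : ℝ) ≤ L := Nat.cast_nonneg _
    nlinarith
  simp only [Prog.renew, wp_block_cons, wp_block_one]
  refine wp_of (wp_process (N := σ.word vMax 0) (Γ := fun j => 𝒢 (i - σ.word vCnt 0 + j)) hW hε hE
    rfl S hpos (fun j _ => h𝒢 _) hLε hspL hσε ?_ K.touched_lt K.marks K.logged K.log_le (by omega)
    hB' hB2) ?_
  · intro a ha u v huv
    rw [← lookup_eq_of_not_touched hA ha K.touched huv, Nat.sub_add_cancel hci, hG]
  rintro υ x ⟨s, hs, hq, hsh, hLυ, hInυ, hHυ, hx, hcase⟩ hF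
  have f1 : υ.word vCnt = σ.word vCnt := hF.1 _ (by decide)
  have f2 : υ.word aPos = σ.word aPos := hF.1 _ (by decide)
  have f3 : υ.word aMark = σ.word aMark := hF.1 _ (by decide)
  have f4 : υ.real rR = σ.real rR := hF.2 _ (by decide)
  have f5 : υ.word vLN = σ.word vLN := hF.1 _ (by decide)
  have f6 : υ.word vMax = σ.word vMax := hF.1 _ (by decide)
  have f7 : υ.word vSc = σ.word vSc := hF.1 _ (by decide)
  have f8 : υ.word aLA = σ.word aLA := hF.1 _ (by decide)
  have f9 : υ.word aLB = σ.word aLB := hF.1 _ (by decide)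
  have f10 : υ.word aTU = σ.word aTU := hF.1 _ (by decide)
  have f11 : υ.word aTV = σ.word aTV := hF.1 _ (by decide)
  set q := υ.word vSp 0 with hqd
  have hpq := S.pos_add_le (hq.trans hs) le_rfl
  have hxR : (x : ℝ) + 5 * υ.word vH 0 ≤ 5 * σ.word vH 0 +
      1002 * (⌈1 / ε⌉₊ * ((σ.word vCnt 0 : ℝ) - σ.word aPos q)) + 5 := by
    rw [← Nat.cast_sub (by omega)]
    exact_mod_cast hx
  simp only [wp_branch, Test.Holds, WExp.eval]
  refine ⟨fun hok => ?_, fun hok => ?_⟩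
  · rcases hcase with ⟨-, hacc⟩ | ⟨h, -⟩
    swap
    · omega
    refine wp_of (wp_accept hqd.symm (by omega) (by rw [f1]; omega) (by omega)) ?_
    rintro φ y ⟨rfl, h1, h2, h3, h4, h5, h6⟩ -
    rw [f2, f1] at h2
    rw [f3] at h3
    rw [f4, hLυ.wt, hacc.isIn.sum] at h4
    obtain ⟨k1, k2⟩ := Accepted.running K hW hε hE hG hLε hspL hcount hpos hdue hs hq hsh hLυ hInυ hHυ
      hacc h1 h2 h3 h4 (fun a ha => h5 a (by revert a; decide)) (fun a ha => h6 a (by revert a; decide))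
      (fun a ha => by
        rw [h5 a (by revert a; decide)]
        simp only [List.mem_cons, List.not_mem_nil, or_false] at ha
        rcases ha with rfl | rfl | rfl | rfl | rfl | rfl | rfl | rfl <;> assumption)
    refine ⟨k1, ?_, ?_⟩
    · rw [h5 vH (by decide)] at k2
      have h0 : (0 : ℝ) ≤ ⌈1 / ε⌉₊ * ((σ.word vCnt 0 : ℝ) - σ.word aPos q) := by
        have : (σ.word aPos q : ℝ) ≤ σ.word vCnt 0 := by
          exact_mod_cast (by omega : σ.word aPos q ≤ σ.word vCnt 0)
        exact mul_nonneg (Nat.cast_nonneg _) (by linarith)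
      push_cast
      linarith
    · rw [h5 vMax (by decide), f6]; exact le_max_left _ _
  · rcases hcase with ⟨h, -⟩ | ⟨-, hq0, hfail⟩
    · omega
    have hN : 0 < σ.word vMax 0 := by
      by_contra h
      have h0 : σ.word vMax 0 = 0 := by omega
      rw [h0] at hcount
      have : (0 : ℝ) ≤ σ.word vSc 0 := Nat.cast_nonneg _
      simp at hcount
      linarith
    have hin := S.isIn 0 (Nat.zero_le _)
    rw [S.mark_zero] at hin
    have hlen := K.length_le
    have hmax := K.max_le
    simp only [wp_block_cons, wp_block_one]
    refine wp_of (wp_rebuilt hE hin hLυ (by rw [f3]; exact S.mark_zero)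
      (K.listing.of_eq f5 f8 f9) hInυ (by omega) (by rw [f5]; omega) (by omega) (by omega)) ?_
    rintro φ y ⟨hR, hy⟩ hF2
    have g6 : φ.word vMax = σ.word vMax := by rw [hF2.1 _ (by decide), f6]
    have g7 : φ.word vSc = σ.word vSc := by rw [hF2.1 _ (by decide), f7]
    have hLN := hR.length
    obtain ⟨hμ, hn⟩ := hE.length_le
    refine wp_enlarge (by rw [hLN]; omega) (by omega) ?_
    intro ψ e1 e2 e3 z hz
    have hRψ : Rebuilt E ψ := hR.of_eq (fun a _ ha => e2 a ha) e3
    rw [g6, hLN] at e1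
    have e4 : ψ.word vSc = σ.word vSc := by rw [e2 _ (by decide), g7]
    have e5 := hRψ.length
    -- The maximum makes the size monotone within a phase, as `listPotential_add_le` requires.
    set N' := max (σ.word vMax 0) (E.A.edges E.s).length with hN'
    have hNN' : σ.word vMax 0 ≤ N' := le_max_left _ _
    have hNN'R : (σ.word vMax 0 : ℝ) ≤ N' := by exact_mod_cast hNN'
    have hlw := hE.length_le_weight
    have hwl := hE.weight_le_length hWp.le
    have hLN'R : ((E.A.edges E.s).length : ℝ) ≤ N' := by exact_mod_cast le_max_right _ _
    -- By `wide` there is a matching with almost `2 vMax` matched vertices; all weights are at least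
    -- `1` and the black box loses a fraction `ε ≤ 1/1000`, which leaves a doubled weight of at
    -- least `vMax`.
    have hbase : (N' : ℝ) ≤ E.G.mateWeight E.target := by
      obtain ⟨f, hf, hf2⟩ := K.wide
      rw [← hG] at hf
      have h1 := (hE.matchedCount_le hf hWp.le).resolve_right (by linarith)
      have h2 : 2 * (σ.word vMax 0 : ℝ) ≤ WGraph.matchedCount n f + 2 * σ.word vSc 0 := by
        exact_mod_cast hf2
      have h3 : ε * (σ.word vMax 0 : ℝ) ≤ 1 / 1000 * σ.word vMax 0 := by gcongr
      have h4 : (1 - 1 / 1000) * (WGraph.matchedCount n f : ℝ) ≤ (1 - ε) * WGraph.matchedCount n f := by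
        gcongr
      have hN0 : (0 : ℝ) < σ.word vMax 0 := by exact_mod_cast hN
      rw [hN', Nat.cast_max]
      refine max_le ?_ ?_
      · linarith
      · have : (0 : ℝ) ≤ (E.A.edges E.s).length := Nat.cast_nonneg _
        linarith
    have htopR : E.G.mateWeight E.target ≤ 5 * W * N' := by
      have h1 := mul_le_mul_of_nonneg_left hLN'R (by linarith : 0 ≤ 5 * W)
      have h2 : 0 ≤ W * ((E.A.edges E.s).length : ℝ) := by positivity
      linarith
    have hrun : Running W ε 𝒢 eu ev (fun _ => (ψ.word aM, ψ.real rWV)) i ψ := by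
      refine hRψ.running hE hWp.le hε (by linarith) hG ?_ ?_ ?_ ?_ ?_ ?_ ?_
      · rw [e1]; exact hbase
      · rw [e1, e5]; exact le_max_right _ _
      · rw [e1]; exact max_le hmax hn
      · rw [e4]; exact K.sc_le
      · rw [e1, e4]
        exact hcount.le.trans (by gcongr)
      · rw [e1, e4]
        rcases le_total (σ.word vMax 0) (E.A.edges E.s).length with h | h
        · rw [hN', max_eq_right h]
          refine ⟨_, hG ▸ hE.isMate, ?_⟩
          have := hE.count
          omega
        · rw [hN', max_eq_left h]; exact K.wide
      · rw [e1, e4]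
        have h1 := K.opt_le
        have h2 : 3 * W * (σ.word vMax 0 : ℝ) ≤ 3 * W * N' := by gcongr
        linarith
    refine ⟨⟨_, hrun⟩, ?_, ?_⟩
    · have hw1 := hE.weightsIn.mateWeight_le_opt hWp.le hE.isMate
      -- The weight of the rebuilt matching is the new bottom weight, at most `0.7` of the old one.
      have hpay := listPotential_add_le hW hN hNN' (hw1.trans hfail) hbase htopR
      have hpot := S.potential_le hW hε hN hposN.le
      have hmP := maxPotential_nonneg hW
      have hpc : (σ.word aPos (σ.word vSp 0) : ℝ) ≤ σ.word vCnt 0 := by exact_mod_cast hpos.le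
      -- The discarded potential is at most `maxPotential W` for each update of the stack. Resetting
      -- `vCnt` releases `maxPotential W + 1` for each, and the surplus pays for the rejected
      -- repairs.
      have hpot2 : potential W ε (σ.word vMax 0) (σ.word aPos) (σ.real rR) (σ.word vSp 0) ≤
          σ.word vCnt 0 * maxPotential W := by
        refine hpot.trans ?_
        exact mul_le_mul_of_nonneg_right hpc hmP
      have hr0 : (0 : ℝ) ≤ 1100 * (⌈1 / ε⌉₊ : ℝ) := by positivity
      have hpot3 := mul_le_mul_of_nonneg_left hpot2 hr0
      have hyR : (y : ℝ) ≤ 5 * υ.word vH 0 + 97 * ((σ.word vLN 0 : ℝ) + (E.A.edges E.s).length) + 30 := by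
        rw [f5, hLN] at hy
        exact_mod_cast hy
      have hzR : (z : ℝ) ≤ 2 := by exact_mod_cast hz
      rw [hq0, S.pos_zero] at hxR
      have hc0 : (0 : ℝ) ≤ ⌈1 / ε⌉₊ * (σ.word vCnt 0 : ℝ) := by positivity
      unfold credit
      rw [hRψ.cnt_zero, hRψ.sp_zero, hRψ.log_zero, hRψ.weight, e1, e4, e5, potential_zero]
      push_cast at hxR ⊢
      linarith
    · rw [e1, ← hG]; exact max_le_max le_rfl hμ

end Env

end

/-! ### Processing one update. -/

noncomputable section

namespace Prog

/-- Record an announced update, and remove its edge from the current matching. -/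
def record : Prog := block [
  setWord aTU (.var vCnt) (.get 1 (.const 1)),
  setWord aTV (.var vCnt) (.get 1 (.const 2)),
  assign vCnt (.add (.var vCnt) (.const 1)),
  assign vSc (.add (.var vSc) (.const 1)),
  assign vEu (.get 1 (.const 1)),
  assign vEv (.get 1 (.const 2)),
  touch]

/-- Process an announced update. -/
def main : Prog := block [
  record,
  branch (.realLe (.mul (.get 0 (.const 1)) (.ofWord (.var vMax))) (.ofWord (.var vSc)))
    refresh
    (branch (.realLe (.mul (.get 0 (.const 1)) (.get rR (.var vSp)))
        (.mul (.sub (.ofWord (.var vCnt)) (.ofWord (.get aPos (.var vSp)))) (.get 0 (.const 0))))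
      renew skip)]

end Prog

section

variable {n : ℕ} {hist : ℕ → MateState} {σ τ : Memory} {W ε : ℝ} {𝒢 : ℕ → WGraph n}
  {eu ev : ℕ → ℕ} {i : ℕ}

theorem MateState.In.removePair {G G' : WGraph n} {a b : ℕ} (hA : WGraph.AgreeOff G G' a b)
    {f g : ℕ → ℕ} {w w' : ℕ → ℝ} (h : MateState.In G (f, w))
    (hg : ∀ u < n, g u = WGraph.removePair a b f u)
    (hw : ∀ u < n, w' u = if g u = 0 then 0 else w u) : MateState.In G' (g, w') := by
  refine ⟨(hA.isMate h.isMate).congr hg, fun u hu => ?_⟩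
  have h1 := h.weight u hu
  have h2 := WGraph.vertexWeight_removeEdges (P := fun u v => u = a ∧ v = b ∨ u = b ∧ v = a) hA f u
  simp only at h1 ⊢
  rw [hw u hu, G'.vertexWeight_congr (hg u hu), WGraph.removePair, h2, h1, hg u hu]
  rfl

/-- The words that hold the state of the data structure. -/
def stateWords : List ℕ :=
  [vMax, vCnt, aPos, aMark, vSp, vH, aLC, aLV, aM, vSc, aTU, aTV, vLN, aLA, aLB, aIn]

theorem Running.of_eq (h : Running W ε 𝒢 eu ev hist i σ)
    (h1 : ∀ a ∈ stateWords, τ.word a = σ.word a)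
    (h2 : ∀ a ∈ [rR, rWV, rLR, rWt], τ.real a = σ.real a) : Running W ε 𝒢 eu ev hist i τ := by
  have a1 := h1 vMax (by decide)
  have a2 := h1 vCnt (by decide)
  have a3 := h1 aPos (by decide)
  have a4 := h1 aMark (by decide)
  have a5 := h1 vSp (by decide)
  have a6 := h1 vH (by decide)
  have a7 := h1 aLC (by decide)
  have a8 := h1 aLV (by decide)
  have a9 := h1 aM (by decide)
  have a10 := h1 vSc (by decide)
  have a11 := h1 aTU (by decide)
  have a12 := h1 aTV (by decide)
  have a13 := h1 vLN (by decide)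
  have a14 := h1 aLA (by decide)
  have a15 := h1 aLB (by decide)
  have a16 := h1 aIn (by decide)
  have b1 := h2 rR (by simp)
  have b2 := h2 rWV (by simp)
  have b3 := h2 rLR (by simp)
  have b4 := h2 rWt (by simp)
  obtain ⟨⟨c1, c2, c3, c4, c5, c6, c7, c8, c9, c10, c11, c12, c13, c14, c15, c16⟩, c17, c18⟩ := h
  refine ⟨⟨?_, ?_, ?_, ?_, ?_, ?_, ?_, ?_, ?_, ?_, ?_, ?_, ?_, ?_, ?_, ?_⟩, ?_, ?_⟩
  · rw [a1, a2, a3, a4, a5, b1]; exact c1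
  · rw [a4, a5]; exact c2.of_eq a9 a6 a7 a8 b2 b3 b4
  · rw [a6, a2]; exact c3
  · rw [a9, b2]; exact c4
  · rw [a2, a10]; exact c5
  · rw [a10]; exact c6
  · rw [a3, a5, a2]; exact c7
  · rw [a2, a11, a12]; exact c8
  · rw [a2, a11, a12]; exact c9
  · rw [a2, a3, a4, a5, a9]; exact c10
  · exact c11.of_eq a13 a14 a15
  · rw [a16]; exact c12
  · rw [a13, a1]; exact c13
  · rw [a1]; exact c14
  · rw [a1, a10]; exact c15
  · rw [a1, a10]; exact c16
  · rw [a2, a3, a5, b1]; exact c17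
  · rw [a10, a1]; exact c18

theorem Core.potential_le (K : Core W ε 𝒢 eu ev hist i σ) (hW : 2 ≤ W) (hε : 0 < ε)
    (hpos : (σ.word aPos (σ.word vSp 0) : ℝ) ≤ ε * σ.word vMax 0) :
    potential W ε (σ.word vMax 0) (σ.word aPos) (σ.real rR) (σ.word vSp 0) ≤
      σ.word vCnt 0 * maxPotential W := by
  have hmP := maxPotential_nonneg hW
  have hpc : (σ.word aPos (σ.word vSp 0) : ℝ) ≤ σ.word vCnt 0 := by exact_mod_cast K.pos_le
  rcases Nat.eq_zero_or_pos (σ.word vMax 0) with h0 | hN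
  · rw [h0] at hpos
    have h1 : σ.word aPos (σ.word vSp 0) = 0 := by
      have : (σ.word aPos (σ.word vSp 0) : ℝ) ≤ 0 := by simpa using hpos
      exact_mod_cast le_antisymm this (Nat.cast_nonneg _)
    have h2 := K.stack.pos_add_le (Nat.zero_le (σ.word vSp 0)) le_rfl
    have h3 : σ.word vSp 0 = 0 := by omega
    rw [h3, potential_zero]
    positivity
  · exact (K.stack.potential_le hW hε hN hpos).trans (mul_le_mul_of_nonneg_right hpc hmP)

theorem credit_congr (h1 : ∀ a ∈ stateWords, τ.word a = σ.word a)
    (h2 : τ.real rR = σ.real rR) : credit W ε i τ = credit W ε i σ := by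
  unfold credit
  rw [h1 vCnt (by decide), h1 vMax (by decide), h1 aPos (by decide), h1 vSp (by decide),
    h1 vSc (by decide), h1 vH (by decide), h1 vLN (by decide), h2]

end

namespace Env

variable {n : ℕ} {E : Env n} {hist : ℕ → MateState} {σ τ : Memory} {W ε : ℝ}
  {𝒢 : ℕ → WGraph n} {eu ev : ℕ → ℕ} {i : ℕ}

/-- An update changes doubled weights by at most `2W` and the number of matched vertices by at most
`2`; this is absorbed by the increments of `vCnt` and `vSc` in `weight`, `wide` and `opt_le`. -/
theorem wp_record (K : Running W ε 𝒢 eu ev hist i σ) (hW : 0 ≤ W) (hG : ∀ j, (𝒢 j).WeightsIn W)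
    (hA : WGraph.AgreeOff (𝒢 i) (𝒢 (i + 1)) (eu i) (ev i))
    (hu : σ.word 1 1 = eu i) (hv : σ.word 1 2 = ev i) (hun : eu i < n) (hvn : ev i < n)
    (hB : (3 * n + 2) * (σ.word vCnt 0 + 1) + 2 < E.B) (hB2 : σ.word vSc 0 + 1 < E.B) :
    E.wp .record (fun τ x => x ≤ 29 ∧ Core W ε 𝒢 eu ev hist (i + 1) τ ∧
      τ.word aPos (τ.word vSp 0) < τ.word vCnt 0 ∧ τ.word vCnt 0 = σ.word vCnt 0 + 1 ∧
      (τ.word aPos (τ.word vSp 0) : ℝ) ≤ ε * τ.word vMax 0 ∧ τ.word vMax 0 = σ.word vMax 0 ∧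
      credit W ε i σ ≤ credit W ε (i + 1) τ + 10) σ := by
  have h3n : 3 * n + 2 ≤ (3 * n + 2) * (σ.word vCnt 0 + 1) := Nat.le_mul_of_pos_right _ (by omega)
  have hcn : σ.word vCnt 0 + 1 ≤ (3 * n + 2) * (σ.word vCnt 0 + 1) :=
    Nat.le_mul_of_pos_left _ (by omega)
  have hmul : (3 * n + 2) * (σ.word vCnt 0 + 1) = (3 * n + 2) * σ.word vCnt 0 + (3 * n + 2) := by ring
  have hlog := K.log_le
  have hci : σ.word vCnt 0 ≤ i := K.cnt_le.trans K.sc_le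
  simp only [Prog.record, wp_block_cons, wp_block_one, wp_setWord, wp_setReal, wp_skip, WExp.eval, RExp.eval,
    Memory.word_setWord, Memory.real_setWord, Memory.real_setReal, Memory.word_setReal,
    Nat.reduceEqDiff, if_true, if_false, Function.update_self]
  refine ⟨by omega, by omega, by omega, by omega, by omega, by omega, by omega, by omega, by omega,
    by omega, by omega, by omega, ?_⟩
  refine wp_of (wp_touch (hist := hist) (m := σ.word aMark (σ.word vSp 0))
    (K.logged.of_eq ?_ ?_ ?_ ?_ ?_ ?_ ?_) ?_ ?_ ?_ ?_ (by omega) ?_) ?_ <;> try simp only [Memory.word_setWord, Memory.real_setWord, Memory.real_setReal, Memory.word_setReal,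
    Nat.reduceEqDiff, if_true, if_false, Function.update_self, hu, hv]
  · exact hun
  · exact hvn
  · exact K.isIn.isMate.pairing
  · exact K.isIn.zero
  · omega
  rintro τ x ⟨hx, hL, hM, hWV, hH⟩ hF
  have e1 : τ.word vCnt = Function.update (σ.word vCnt) 0 (σ.word vCnt 0 + 1) := by
    rw [hF.1 _ (by decide)]; simp only [Memory.word_setWord, Memory.real_setWord, Memory.real_setReal, Memory.word_setReal,
    Nat.reduceEqDiff, if_true, if_false, Function.update_self]
  have e2 : τ.word vSc = Function.update (σ.word vSc) 0 (σ.word vSc 0 + 1) := by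
    rw [hF.1 _ (by decide)]; simp only [Memory.word_setWord, Memory.real_setWord, Memory.real_setReal, Memory.word_setReal,
    Nat.reduceEqDiff, if_true, if_false, Function.update_self]
  have e3 : τ.word aTU = Function.update (σ.word aTU) (σ.word vCnt 0) (eu i) := by
    rw [hF.1 _ (by decide)]; simp only [Memory.word_setWord, Memory.real_setWord, Memory.real_setReal, Memory.word_setReal,
    Nat.reduceEqDiff, if_true, if_false, Function.update_self, hu]
  have e4 : τ.word aTV = Function.update (σ.word aTV) (σ.word vCnt 0) (ev i) := by
    rw [hF.1 _ (by decide)]; simp only [Memory.word_setWord, Memory.real_setWord, Memory.real_setReal, Memory.word_setReal,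
    Nat.reduceEqDiff, if_true, if_false, Function.update_self, hv]
  have e5 : τ.word vMax = σ.word vMax := by
    rw [hF.1 _ (by decide)]; simp only [Memory.word_setWord, Memory.real_setWord, Memory.real_setReal, Memory.word_setReal,
    Nat.reduceEqDiff, if_true, if_false, Function.update_self]
  have e6 : τ.word aPos = σ.word aPos := by
    rw [hF.1 _ (by decide)]; simp only [Memory.word_setWord, Memory.real_setWord, Memory.real_setReal, Memory.word_setReal,
    Nat.reduceEqDiff, if_true, if_false, Function.update_self]
  have e7 : τ.word aMark = σ.word aMark := by
    rw [hF.1 _ (by decide)]; simp only [Memory.word_setWord, Memory.real_setWord, Memory.real_setReal, Memory.word_setReal,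
    Nat.reduceEqDiff, if_true, if_false, Function.update_self]
  have e8 : τ.word vSp = σ.word vSp := by
    rw [hF.1 _ (by decide)]; simp only [Memory.word_setWord, Memory.real_setWord, Memory.real_setReal, Memory.word_setReal,
    Nat.reduceEqDiff, if_true, if_false, Function.update_self]
  have e9 : τ.word vLN = σ.word vLN := by
    rw [hF.1 _ (by decide)]; simp only [Memory.word_setWord, Memory.real_setWord, Memory.real_setReal, Memory.word_setReal,
    Nat.reduceEqDiff, if_true, if_false, Function.update_self]
  have e10 : τ.word aLA = σ.word aLA := by
    rw [hF.1 _ (by decide)]; simp only [Memory.word_setWord, Memory.real_setWord, Memory.real_setReal, Memory.word_setReal,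
    Nat.reduceEqDiff, if_true, if_false, Function.update_self]
  have e11 : τ.word aLB = σ.word aLB := by
    rw [hF.1 _ (by decide)]; simp only [Memory.word_setWord, Memory.real_setWord, Memory.real_setReal, Memory.word_setReal,
    Nat.reduceEqDiff, if_true, if_false, Function.update_self]
  have e12 : τ.word aIn = σ.word aIn := by
    rw [hF.1 _ (by decide)]; simp only [Memory.word_setWord, Memory.real_setWord, Memory.real_setReal, Memory.word_setReal,
    Nat.reduceEqDiff, if_true, if_false, Function.update_self]
  have e13 : τ.real rR = σ.real rR := by
    rw [hF.2 _ (by decide)]; simp only [Memory.word_setWord, Memory.real_setWord, Memory.real_setReal, Memory.word_setReal,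
    Nat.reduceEqDiff, if_true, if_false, Function.update_self]
  have hpos := K.pos_le
  have hcount := K.count
  have hcs : (σ.word vCnt 0 : ℝ) ≤ σ.word vSc 0 := by exact_mod_cast K.cnt_le
  have hpc : (σ.word aPos (σ.word vSp 0) : ℝ) ≤ σ.word vCnt 0 := by exact_mod_cast hpos
  have hin : MateState.In (𝒢 (i + 1)) (τ.word aM, τ.real rWV) := K.isIn.removePair hA hM hWV
  refine ⟨by omega, ⟨?_, ?_, ?_, hin, ?_, ?_, ?_, ?_, ?_, ?_, ?_, ?_, ?_, ?_, ?_, ?_⟩, ?_, ?_, ?_,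
    ?_, ?_⟩
  · rw [e1, e5, e6, e7, e8, e13, Function.update_self]
    -- Time and `vCnt` grow together, so `i - vCnt`, the time of the last rebuild, stays the same.
    simp only [Nat.add_sub_add_right]
    exact K.stack
  · rw [e7, e8]; exact hL
  · rw [e1, Function.update_self]; omega
  · rw [e1, e2, Function.update_self, Function.update_self]
    have := K.cnt_le
    omega
  · rw [e2, Function.update_self]
    have := K.sc_le
    omega
  · rw [e1, e6, e8, Function.update_self]; omega
  · rw [e1, e3, e4, Function.update_self, Nat.add_sub_add_right]
    intro j hj
    rcases Nat.lt_succ_iff_lt_or_eq.1 hj with hj | rfl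
    · rw [Function.update_of_ne (by omega), Function.update_of_ne (by omega)]
      exact K.touched j hj
    · rw [Function.update_self, Function.update_self, Nat.sub_add_cancel hci]
      exact ⟨rfl, rfl⟩
  · rw [e1, e3, e4, Function.update_self]
    intro j hj
    rcases Nat.lt_succ_iff_lt_or_eq.1 hj with hj | rfl
    · rw [Function.update_of_ne (by omega), Function.update_of_ne (by omega)]
      exact K.touched_lt j hj
    · rw [Function.update_self, Function.update_self]
      exact ⟨hun, hvn⟩
  · rw [e1, e6, e7, e8, Function.update_self, Nat.add_sub_add_right,
      (𝒢 (i + 1)).mateWeight_congr hM]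
    have h1 := hA.mateWeight_le (hG i) (hG (i + 1)) hW (σ.word aM)
    have h2 := K.weight
    push_cast
    linarith
  · exact K.listing.of_eq e9 e10 e11
  · rw [e12]; exact K.marks
  · rw [e9, e5]; exact K.length_le
  · rw [e5]; exact K.max_le
  · rw [e5, e2, Function.update_self]
    obtain ⟨f, hf, hf2⟩ := K.wide
    refine ⟨_, hA.isMate hf, ?_⟩
    have := WGraph.matchedCount_removePair n (eu i) (ev i) f
    omega
  · rw [e5, e2, Function.update_self]
    have h1 := hA.symm.opt_le (hG (i + 1)) (hG i) hW
    have h2 := K.opt_le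
    push_cast
    linarith
  · rw [e1, e6, e8, Function.update_self]; omega
  · rw [e1, Function.update_self]
  · rw [e6, e8, e5]; linarith
  · rw [e5]
  · have hHR : (τ.word vH 0 : ℝ) ≤ σ.word vH 0 + 2 := by exact_mod_cast hH
    unfold credit
    rw [e1, e2, e5, e6, e8, e9, e13, Function.update_self, Function.update_self]
    push_cast
    linarith

/-- The phase has had at least `ε vMax` updates, each of which releases `194 (1 + 3 log (5W)) / ε`
when `vSc` is reset; that covers the potential of the old list, whatever it is. -/
theorem wp_refresh (K : Core W ε 𝒢 eu ev hist i σ) (hW : 2 ≤ W) (hε : 0 < ε) (hε1 : ε ≤ 1 / 10)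
    (hE : E.Fits W ε) (hG : E.G = 𝒢 i)
    (hcount : ε * σ.word vMax 0 ≤ σ.word vSc 0)
    (hpos : (σ.word aPos (σ.word vSp 0) : ℝ) ≤ ε * σ.word vMax 0) (hB : 3 * n + 2 < E.B)
    (hB2 : σ.word vH 0 < E.B) :
    E.wp .refresh (fun τ x => (∃ hist', Running W ε 𝒢 eu ev hist' i τ) ∧
      (x : ℝ) + credit W ε i σ ≤ credit W ε i τ + 50 ∧
      τ.word vMax 0 ≤ (𝒢 i).matchingNumber) σ := by
  have hWp : 0 < W := by linarith
  have S := K.stack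
  have hin := S.isIn 0 (Nat.zero_le _)
  rw [S.mark_zero] at hin
  have hlen := K.length_le
  have hmax := K.max_le
  obtain ⟨hμ, hn⟩ := hE.length_le
  simp only [Prog.refresh, wp_block_cons, wp_block_one]
  refine wp_of (wp_rebuilt hE hin K.logged S.mark_zero K.listing K.marks (by omega) (by omega) hB2 hB) ?_
  rintro φ x ⟨hR, hx⟩ hF
  have g := hR.length
  simp only [wp_block_cons, wp_block_one, wp_setWord, wp_setReal, wp_skip, WExp.eval, RExp.eval,
    Memory.word_setWord, Memory.real_setWord, Memory.real_setReal, Memory.word_setReal,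
    Nat.reduceEqDiff, if_true, if_false, Function.update_self, g]
  refine ⟨by omega, by omega, by omega, by omega, ?_⟩
  set τ := (φ.setWord vSc 0 0).setWord vMax 0 (E.A.edges E.s).length with hτ
  have e1 : τ.word vMax 0 = (E.A.edges E.s).length := by rw [hτ]; simp only [Memory.word_setWord, Memory.real_setWord, Memory.real_setReal, Memory.word_setReal,
    Nat.reduceEqDiff, if_true, if_false, Function.update_self]
  have e2 : τ.word vSc 0 = 0 := by rw [hτ]; simp only [Memory.word_setWord, Memory.real_setWord, Memory.real_setReal, Memory.word_setReal,
    Nat.reduceEqDiff, if_true, if_false, Function.update_self]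
  have e3 : τ.real = φ.real := by rw [hτ]; simp only [Memory.word_setWord, Memory.real_setWord, Memory.real_setReal, Memory.word_setReal,
    Nat.reduceEqDiff, if_true, if_false, Function.update_self]
  have hRτ : Rebuilt E τ := hR.of_eq (fun a h1 h2 => by
    rw [hτ]; simp only [Memory.word_setWord, Memory.real_setWord, Memory.real_setReal, Memory.word_setReal,
    Nat.reduceEqDiff, if_true, if_false, Function.update_self, if_neg h1, if_neg h2]) e3
  have e5 := hRτ.length
  have hlw := hE.length_le_weight
  have hwl := hE.weight_le_length hWp.le
  have hl0 : (0 : ℝ) ≤ (E.A.edges E.s).length := Nat.cast_nonneg _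
  have hWl : 0 ≤ W * ((E.A.edges E.s).length : ℝ) := by positivity
  have hopt0 := hE.weightsIn.opt_nonneg hWp.le
  refine ⟨⟨_, hRτ.running hE hWp.le hε (by linarith) hG ?_ ?_ ?_ ?_ ?_ ?_ ?_⟩, ?_, ?_⟩
  · rw [e1]; linarith
  · rw [e1, e5]
  · rw [e1]; exact hn
  · rw [e2]; omega
  · rw [e1, e2]
    have : 0 ≤ ε * ((E.A.edges E.s).length : ℝ) := by positivity
    simpa using this
  · rw [e1, e2]
    refine ⟨_, hG ▸ hE.isMate, ?_⟩
    have := hE.count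
    omega
  · rw [e1, e2, ← hG]
    have h1 := hE.approx
    have h2 : ε * E.G.opt ≤ 1 / 10 * E.G.opt := by gcongr
    push_cast
    linarith
  · have hmP := maxPotential_nonneg hW
    have hpot := K.potential_le hW hε hpos
    have hr0 : (0 : ℝ) ≤ 1100 * (⌈1 / ε⌉₊ : ℝ) := by positivity
    have hpot3 := mul_le_mul_of_nonneg_left hpot hr0
    have hlp := listPotential_le hW S.base
    have hH : 0 ≤ 1 + 3 * Real.log (5 * W) := by
      have := Real.log_nonneg (by linarith : 1 ≤ 5 * W)
      linarith
    -- The test that started the new phase, `ε vMax ≤ vSc`, divided by `ε`.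
    have hlp2 : (σ.word vMax 0 : ℝ) * (1 + 3 * Real.log (5 * W)) ≤
        (1 + 3 * Real.log (5 * W)) / ε * σ.word vSc 0 := by
      rw [div_mul_eq_mul_div, le_div_iff₀ hε]
      have := mul_le_mul_of_nonneg_left hcount hH
      linarith
    have hlp3 : ((E.A.edges E.s).length : ℝ) ≤
        listPotential W (E.A.edges E.s).length (E.G.mateWeight E.target) := by
      refine le_listPotential ?_ ?_
      · linarith
      · linarith
    have hxR : (x : ℝ) ≤ 5 * σ.word vH 0 + 97 * ((σ.word vLN 0 : ℝ) + (E.A.edges E.s).length) + 30 := by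
      rw [g] at hx
      exact_mod_cast hx
    have hc0 : (0 : ℝ) ≤ ⌈1 / ε⌉₊ * (σ.word vCnt 0 : ℝ) := by positivity
    unfold credit
    rw [hRτ.cnt_zero, hRτ.sp_zero, hRτ.log_zero, hRτ.weight, e1, e2, e5, potential_zero]
    push_cast
    linarith
  · rw [← hG]; exact hμ

/-- When neither test succeeds, their negations are exactly the clauses `pending` and `count` of
`Running`. -/
theorem wp_main {L : ℕ} (K : Running W ε 𝒢 eu ev hist i σ) (hW : 2 ≤ W) (hε : 0 < ε)
    (hE : E.Fits W ε) (hEG : E.G = 𝒢 (i + 1)) (hG : ∀ j, (𝒢 j).WeightsIn W)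
    (hA : ∀ j, WGraph.AgreeOff (𝒢 j) (𝒢 (j + 1)) (eu j) (ev j)) (hL : W ≤ 2 ^ L)
    (hLε : 1000 * ε * (L + 10) ≤ 1) (hσW : σ.real 0 0 = W) (hσε : σ.real 0 1 = ε)
    (hu : σ.word 1 1 = eu i) (hv : σ.word 1 2 = ev i) (hun : eu i < n) (hvn : ev i < n)
    (hB : (3 * n + 2) * (n + 1) + 2 < E.B) (hB' : ⌈1 / ε⌉₊ + 1 < E.B) :
    E.wp .main (fun τ x => (∃ hist', Running W ε 𝒢 eu ev hist' (i + 1) τ) ∧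
      (x : ℝ) + credit W ε i σ ≤ credit W ε (i + 1) τ + 100 ∧
      τ.word vMax 0 ≤ max (σ.word vMax 0) (𝒢 (i + 1)).matchingNumber) σ := by
  have hWp : 0 < W := by linarith
  have hεb : ε ≤ 1 / 1000 := by
    have : (0 : ℝ) ≤ L := Nat.cast_nonneg _
    nlinarith
  -- A phase has at most `ε n` updates, so the log stays polynomial in `n` and its addresses fit
  -- into words.
  have hscn : σ.word vSc 0 ≤ n := by
    have h1 := K.count
    have h2 : (σ.word vMax 0 : ℝ) ≤ n := by exact_mod_cast K.max_le
    have h3 : ε * (σ.word vMax 0 : ℝ) ≤ 1 * n := by gcongr; linarith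
    have h4 : (σ.word vSc 0 : ℝ) ≤ n := by linarith
    exact_mod_cast h4
  have hcn := K.cnt_le
  have hmono : (3 * n + 2) * (σ.word vCnt 0 + 1) ≤ (3 * n + 2) * (n + 1) :=
    Nat.mul_le_mul_left _ (by omega)
  have hn1 : 3 * n + 2 ≤ (3 * n + 2) * (n + 1) := Nat.le_mul_of_pos_right _ (by omega)
  simp only [Prog.main, wp_block_cons, wp_block_one]
  refine wp_of (wp_record K hWp.le hG (hA i) hu hv hun hvn (by omega) (by omega)) ?_
  rintro τ x ⟨hx, K', hpos, hcnt, hposN, hmax, hcr⟩ hF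
  have hxR : (x : ℝ) ≤ 29 := by exact_mod_cast hx
  have f1 : τ.real 0 = σ.real 0 := hF.2 _ (by decide)
  have hlog := K'.log_le
  rw [hcnt] at hlog
  simp only [wp_branch, Test.Holds, RExp.eval, WExp.eval, f1, hσW, hσε, wp_skip]
  refine ⟨fun h => ?_, fun h => ⟨fun h' => ?_, fun h' => ?_⟩⟩
  · refine wp_of (wp_refresh K' hW hε (by linarith) hE hEG h hposN (by omega) (by omega)) ?_
    rintro υ y ⟨h1, h2, h3⟩ -
    refine ⟨h1, ?_, h3.trans (le_max_right _ _)⟩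
    push_cast
    linarith
  · refine wp_of (wp_renew K' hW hε hE hEG hG hA hL hLε (not_le.1 h) hpos h' (by rw [f1]; exact hσε)
      hB' (by rw [hcnt]; omega)) ?_
    rintro υ y ⟨h1, h2, h3⟩ -
    refine ⟨h1, ?_, by rw [← hmax]; exact h3⟩
    push_cast
    linarith
  · refine ⟨⟨hist, K', (not_le.1 h').le, (not_le.1 h).le⟩, ?_, ?_⟩
    · push_cast
      linarith
    · rw [hmax]; exact le_max_left _ _

end Env

end

/-! ### Initialization, and the case where the guarantee is void. -/

noncomputable section

namespace Prog

/-- Put the binary logarithm of the largest weight, rounded up, into `vL`. -/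
def levels : Prog := block [
  assign vL (.const 0),
  assignReal rD (.ofWord (.const 1)),
  loop (.neg (.realLe (.get 0 (.const 0)) (.var rD))) (block [
    assignReal rD (.add (.var rD) (.var rD)),
    assign vL (.add (.var vL) (.const 1))])]

/-- Process an announced update when no approximation is asked for. -/
def coarse : Prog := block [
  assign vEu (.get 1 (.const 1)),
  assign vEv (.get 1 (.const 2)),
  touch,
  assign vH (.const 0)]

/-- The program for an update. -/
def update : Prog := block [
  levels,
  branch (.realLe (.mul (.mul (.ofWord (.const 1000)) (.get 0 (.const 1)))
      (.ofWord (.add (.var vL) (.const 10)))) (.ofWord (.const 1)))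
    main coarse]

/-- The program for the initialization. -/
def init : Prog := block [rebuild, assign vMax (.var vLN)]

end Prog

/-- The state between two updates when no approximation is asked for. -/
structure Coarse {n : ℕ} (G : WGraph n) (σ : Memory) : Prop where
  isIn : MateState.In G (σ.word aM, σ.real rWV)
  logged : Logged n (fun _ => (σ.word aM, σ.real rWV)) 0 σ
  log_zero : σ.word vH 0 = 0

theorem Logged.clear {n : ℕ} {hist : ℕ → MateState} {m : ℕ} {σ τ : Memory} (h : Logged n hist m σ)
    (h1 : τ.word aM = σ.word aM) (h2 : τ.word vH 0 = 0) (h3 : τ.real rWV = σ.real rWV)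
    (h4 : τ.real rWt = σ.real rWt) : Logged n (fun _ => (τ.word aM, τ.real rWV)) 0 τ := by
  refine ⟨fun _ => (τ.word aM, τ.real rWV), ⟨rfl, ?_, ?_, ?_, ?_⟩, by omega, fun _ _ => rfl⟩
  · intro j hj; omega
  · intro j hj; omega
  · rw [h1]; exact h.val
  · rw [h3, h4]; exact h.wt

/-- The cost that the state accounts for. -/
def budget (W ε : ℝ) (L i : ℕ) (σ : Memory) : ℝ :=
  if 1000 * ε * (L + 10) ≤ 1 then credit W ε i σ else 0

/-- What holds between two updates, where `μ` bounds the size of the first matching. -/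
structure Sound {n : ℕ} (W ε : ℝ) (L : ℕ) (𝒢 : ℕ → WGraph n) (eu ev : ℕ → ℕ) (μ i : ℕ)
    (σ : Memory) : Prop where
  maxWeight : σ.real 0 0 = W
  precision : σ.real 0 1 = ε
  fine : 1000 * ε * (L + 10) ≤ 1 →
    (∃ hist, Running W ε 𝒢 eu ev hist i σ) ∧ σ.word vMax 0 ≤ μ + i
  coarse : ¬ 1000 * ε * (L + 10) ≤ 1 → Coarse (𝒢 i) σ

namespace Env

variable {n : ℕ} {E : Env n} {σ τ : Memory} {W ε : ℝ} {L : ℕ}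
  {𝒢 : ℕ → WGraph n} {eu ev : ℕ → ℕ} {i μ : ℕ}

/-- Repeated doubling finds the least `L` with `W ≤ 2 ^ L`; the machine has no logarithm. -/
theorem wp_levels (hW : σ.real 0 0 = W) (hL : W ≤ 2 ^ L) (hmin : ∀ j < L, (2 : ℝ) ^ j < W)
    (hB : L + 1 < E.B) :
    E.wp .levels (fun τ x => τ.word vL 0 = L ∧ x ≤ 3 * L + 3) σ := by
  simp only [Prog.levels, wp_block_cons, wp_block_one, wp_setWord, wp_setReal, wp_skip, WExp.eval, RExp.eval,
    Memory.word_setWord, Memory.real_setWord, Memory.real_setReal, Memory.word_setReal,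
    Nat.reduceEqDiff, if_true, if_false, Function.update_self]
  refine ⟨by omega, by omega, by omega, ?_⟩
  refine wp_loop (fun τ k => τ.word vL 0 ≤ L ∧ τ.real rD 0 = 2 ^ τ.word vL 0 ∧
    k ≤ 3 * τ.word vL 0 ∧ τ.real 0 0 = W) (fun τ => L - τ.word vL 0) ?_ ?_ ?_
  · simp only [Memory.word_setWord, Memory.real_setWord, Memory.real_setReal, Memory.word_setReal,
    Nat.reduceEqDiff, if_true, if_false, Function.update_self]
    exact ⟨Nat.zero_le _, by simp, le_rfl, hW⟩
  · rintro τ k ⟨h1, h2, h3, h4⟩ hb -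
    simp only [Test.Holds, RExp.eval, WExp.eval, h4, h2, not_le] at hb
    have hlt : τ.word vL 0 < L := by
      by_contra h
      have : τ.word vL 0 = L := by omega
      rw [this] at hb
      linarith
    simp only [wp_block_cons, wp_block_one, wp_setWord, wp_setReal, wp_skip, WExp.eval, RExp.eval,
    Memory.word_setWord, Memory.real_setWord, Memory.real_setReal, Memory.word_setReal,
    Nat.reduceEqDiff, if_true, if_false, Function.update_self]
    refine ⟨by omega, by omega, by omega, ⟨by omega, ?_, by omega, h4⟩, by omega⟩
    rw [h2, pow_succ]; ring
  · rintro τ k ⟨h1, h2, h3, h4⟩ hb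
    simp only [Test.Holds, RExp.eval, WExp.eval, h4, h2, not_not] at hb
    have h : τ.word vL 0 = L := by
      by_contra h
      have := hmin _ (lt_of_le_of_ne h1 h)
      linarith
    exact ⟨h, by omega⟩

/-- Deleting the updated edge keeps a valid matching. Resetting the log keeps it from growing;
nothing is ever undone in this mode. -/
theorem wp_coarse {G : WGraph n} (K : Coarse G σ)
    (hA : WGraph.AgreeOff G E.G (σ.word 1 1) (σ.word 1 2)) (hun : σ.word 1 1 < n)
    (hvn : σ.word 1 2 < n) (hB : n < E.B) (hB2 : 2 < E.B) :
    E.wp .coarse (fun τ x => Coarse E.G τ ∧ x ≤ 26) σ := by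
  have hH := K.log_zero
  simp only [Prog.coarse, wp_block_cons, wp_block_one, wp_setWord, wp_setReal, wp_skip, WExp.eval, RExp.eval,
    Memory.word_setWord, Memory.real_setWord, Memory.real_setReal, Memory.word_setReal,
    Nat.reduceEqDiff, if_true, if_false, Function.update_self]
  refine ⟨by omega, by omega, by omega, by omega, ?_⟩
  refine wp_of (wp_touch (K.logged.of_eq ?_ ?_ ?_ ?_ ?_ ?_ ?_) ?_ ?_ ?_ ?_ (by omega) ?_) ?_ <;>
    try simp only [Memory.word_setWord, Memory.real_setWord, Memory.real_setReal, Memory.word_setReal,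
    Nat.reduceEqDiff, if_true, if_false, Function.update_self]
  · exact hun
  · exact hvn
  · exact K.isIn.isMate.pairing
  · exact K.isIn.zero
  · omega
  rintro τ x ⟨hx, hL, hM, hWV, -⟩ -
  refine ⟨by omega, by omega, ⟨?_, ?_, ?_⟩, by omega⟩
  · simp only [Memory.word_setWord, Memory.real_setWord, Memory.real_setReal, Memory.word_setReal,
    Nat.reduceEqDiff, if_true, if_false, Function.update_self]
    exact K.isIn.removePair hA hM hWV
  · exact hL.clear (by simp only [Memory.word_setWord, Memory.real_setWord, Memory.real_setReal, Memory.word_setReal,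
    Nat.reduceEqDiff, if_true, if_false, Function.update_self]) (by simp only [Memory.word_setWord, Memory.real_setWord, Memory.real_setReal, Memory.word_setReal,
    Nat.reduceEqDiff, if_true, if_false, Function.update_self]) (by simp only [Memory.word_setWord, Memory.real_setWord, Memory.real_setReal, Memory.word_setReal,
    Nat.reduceEqDiff, if_true, if_false, Function.update_self])
      (by simp only [Memory.word_setWord, Memory.real_setWord, Memory.real_setReal, Memory.word_setReal,
    Nat.reduceEqDiff, if_true, if_false, Function.update_self])
  · simp only [Memory.word_setWord, Memory.real_setWord, Memory.real_setReal, Memory.word_setReal,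
    Nat.reduceEqDiff, if_true, if_false, Function.update_self]

/-- The invariant concerns the memory `ρ` before the announcement; announcing changes only the
arrays `1`, which hold no state. -/
theorem wp_update {ρ : Memory} (K : Sound W ε L 𝒢 eu ev μ i ρ) (h1 : ∀ a, a ≠ 1 → σ.word a = ρ.word a)
    (h2 : ∀ a, a ≠ 1 → σ.real a = ρ.real a) (hW : 2 ≤ W) (hε : 0 < ε)
    (hE : E.Fits W ε) (hEG : E.G = 𝒢 (i + 1)) (hG : ∀ j, (𝒢 j).WeightsIn W)
    (hA : ∀ j, WGraph.AgreeOff (𝒢 j) (𝒢 (j + 1)) (eu j) (ev j)) (hL : W ≤ 2 ^ L)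
    (hmin : ∀ j < L, (2 : ℝ) ^ j < W) (hμ : (𝒢 (i + 1)).matchingNumber ≤ μ + (i + 1))
    (hu : σ.word 1 1 = eu i) (hv : σ.word 1 2 = ev i) (hun : eu i < n) (hvn : ev i < n)
    (hB : (3 * n + 2) * (n + 1) + 2 < E.B) (hB' : ⌈1 / ε⌉₊ + 1 < E.B) (hBL : L + 1 < E.B) :
    E.wp .update (fun τ x => Sound W ε L 𝒢 eu ev μ (i + 1) τ ∧
      (x : ℝ) + budget W ε L i ρ ≤ budget W ε L (i + 1) τ + (3 * L + 110)) σ := by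
  have hn1 : 3 * n + 2 ≤ (3 * n + 2) * (n + 1) := Nat.le_mul_of_pos_right _ (by omega)
  simp only [Prog.update, wp_block_cons, wp_block_one]
  refine wp_of (wp_levels (by rw [h2 0 (by decide)]; exact K.maxWeight) hL hmin hBL) ?_
  rintro φ x ⟨hvL, hx⟩ hF
  have hxR : (x : ℝ) ≤ 3 * L + 3 := by exact_mod_cast hx
  have e0 : φ.real 0 = ρ.real 0 := by rw [hF.2 0 (by decide), h2 0 (by decide)]
  have e1 : φ.word 1 = σ.word 1 := hF.1 1 (by decide)
  have ew : ∀ a ∈ stateWords, φ.word a = ρ.word a := by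
    intro a ha
    rw [hF.1 a (by revert a; decide), h1 a (by revert a; decide)]
  have er : ∀ a ∈ [rR, rWV, rLR, rWt], φ.real a = ρ.real a := by
    intro a ha
    rw [hF.2 a (by revert a; decide), h2 a (by revert a; decide)]
  have hWφ : φ.real 0 0 = W := by rw [e0]; exact K.maxWeight
  have hεφ : φ.real 0 1 = ε := by rw [e0]; exact K.precision
  simp only [wp_branch, Test.Holds, RExp.eval, WExp.eval, hvL, hεφ]
  push_cast
  unfold budget
  refine ⟨fun h => ?_, fun h => ?_⟩
  · obtain ⟨⟨hist, hrun⟩, hmax⟩ := K.fine h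
    have hcr : credit W ε i φ = credit W ε i ρ := credit_congr ew (er _ (by simp))
    refine wp_of (wp_main (hrun.of_eq ew er) hW hε hE hEG hG hA hL h hWφ hεφ (by rw [e1]; exact hu)
      (by rw [e1]; exact hv) hun hvn hB hB') ?_
    rintro τ y ⟨k1, k2, k3⟩ hF2
    have f0 : τ.real 0 = φ.real 0 := hF2.2 0 (by decide)
    rw [ew vMax (by decide)] at k3
    refine ⟨⟨by rw [f0]; exact hWφ, by rw [f0]; exact hεφ, fun _ => ⟨k1, ?_⟩, fun h' => absurd h h'⟩, ?_⟩
    · refine k3.trans (max_le ?_ ?_) <;> omega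
    · rw [if_pos h, if_pos h]
      rw [hcr] at k2
      push_cast
      linarith
  · have hC := K.coarse h
    have m2 := ew aM (by decide)
    have r4 := er rWV (by simp)
    have hCφ : Coarse (𝒢 i) φ := by
      refine ⟨by rw [m2, r4]; exact hC.isIn, ?_, by rw [ew vH (by decide)]; exact hC.log_zero⟩
      rw [m2, r4]
      exact hC.logged.of_eq m2 (ew _ (by decide)) (ew _ (by decide)) (ew _ (by decide)) r4
        (er _ (by simp)) (er _ (by simp))
    refine wp_of (wp_coarse hCφ ?_ ?_ ?_ (by omega) (by omega)) ?_ <;>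
      try rw [e1]
    · rw [hEG, hu, hv]; exact hA i
    · rw [hu]; exact hun
    · rw [hv]; exact hvn
    rintro τ y ⟨k1, k2⟩ hF2
    have f0 : τ.real 0 = φ.real 0 := hF2.2 0 (by decide)
    have hyR : (y : ℝ) ≤ 26 := by exact_mod_cast k2
    refine ⟨⟨by rw [f0]; exact hWφ, by rw [f0]; exact hεφ, fun h' => absurd h' h,
      fun _ => hEG ▸ k1⟩, ?_⟩
    rw [if_neg h, if_neg h]
    push_cast
    linarith

/-- The blank memory is a valid state with the empty matching, an empty log and an empty list, so
the rebuild program also serves as initialization. Its cost is linear in the size of the first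
matching, and the credit left is not negative. -/
theorem wp_init (hW : 2 ≤ W) (hε : 0 < ε) (hE : E.Fits W ε) (hEG : E.G = 𝒢 0)
    (hB : (3 * n + 2) * (n + 1) + 2 < E.B) :
    E.wp .init (fun τ x => Sound W ε L 𝒢 eu ev (𝒢 0).matchingNumber 0 τ ∧
      x ≤ 97 * (𝒢 0).matchingNumber + 31 ∧ 0 ≤ budget W ε L 0 τ)
      (Transformation.startMemory n W ε) := by
  have hWp : 0 < W := by linarith
  have hn1 : 3 * n + 2 ≤ (3 * n + 2) * (n + 1) := Nat.le_mul_of_pos_right _ (by omega)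
  set σ := Transformation.startMemory n W ε with hσ
  have s1 : ∀ a, a ≠ 0 → ∀ u, σ.word a u = 0 := by
    intro a ha u
    simp only [hσ, Transformation.startMemory, Memory.word_setWord, Memory.real_setWord, Memory.real_setReal, Memory.word_setReal,
    Nat.reduceEqDiff, if_true, if_false, Function.update_self, if_neg ha]
  have s2 : ∀ a, a ≠ 0 → ∀ u, σ.real a u = 0 := by
    intro a ha u
    simp only [hσ, Transformation.startMemory, Memory.word_setWord, Memory.real_setWord, Memory.real_setReal, Memory.word_setReal,
    Nat.reduceEqDiff, if_true, if_false, Function.update_self, if_neg ha]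
  have s3 : σ.real 0 0 = W := by
    simp [hσ, Transformation.startMemory, Memory.setReal]
  have s4 : σ.real 0 1 = ε := by
    simp [hσ, Transformation.startMemory, Memory.setReal]
  have c1 := s1 vH (by decide) 0
  have c2 := s1 vLN (by decide) 0
  have hin : MateState.In E.G (σ.word aM, σ.real rWV) :=
    ⟨(E.G.isMate_zero).congr fun u _ => s1 aM (by decide) u, fun u _ => by
      rw [WGraph.vertexWeight, if_pos (s1 aM (by decide) u)]; exact s2 rWV (by decide) u⟩
  have hlog : Logged n (fun _ => (σ.word aM, σ.real rWV)) 0 σ := by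
    refine ⟨fun _ => (σ.word aM, σ.real rWV), ⟨rfl, ?_, ?_, ?_, ?_⟩, by omega, fun _ _ => rfl⟩
    · intro j hj; omega
    · intro j hj; omega
    · intro u _; rw [s1 aM (by decide)]; omega
    · rw [s2 rWt (by decide), Finset.sum_eq_zero fun u _ => s2 rWV (by decide) u]
  have hlst : Listing n (σ.word aM) σ :=
    ⟨fun j hj => by omega, fun u _ h => absurd (s1 aM (by decide) u) h⟩
  obtain ⟨hμ, hn⟩ := hE.length_le
  rw [hEG] at hμ
  simp only [Prog.init, wp_block_cons, wp_block_one]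
  refine wp_of (wp_rebuilt hE hin hlog (s1 aMark (by decide) 0) hlst
    (fun u _ => s1 aIn (by decide) u) (by omega) (by omega) (by omega) (by omega)) ?_
  rintro φ x ⟨hR, hx⟩ hF
  have g := hR.length
  have g0 : φ.word vSc 0 = 0 := by rw [hF.1 vSc (by decide)]; exact s1 vSc (by decide) 0
  have f0 : φ.real 0 = σ.real 0 := hF.2 0 (by decide)
  simp only [wp_block_cons, wp_block_one, wp_setWord, wp_setReal, wp_skip, WExp.eval, RExp.eval,
    Memory.word_setWord, Memory.real_setWord, Memory.real_setReal, Memory.word_setReal,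
    Nat.reduceEqDiff, if_true, if_false, Function.update_self, g]
  refine ⟨by omega, by omega, ?_⟩
  set τ := φ.setWord vMax 0 (E.A.edges E.s).length with hτ
  have e1 : τ.word vMax 0 = (E.A.edges E.s).length := by rw [hτ]; simp only [Memory.word_setWord, Memory.real_setWord, Memory.real_setReal, Memory.word_setReal,
    Nat.reduceEqDiff, if_true, if_false, Function.update_self]
  have e2 : τ.word vSc 0 = 0 := by rw [hτ]; simp only [Memory.word_setWord, Memory.real_setWord, Memory.real_setReal, Memory.word_setReal,
    Nat.reduceEqDiff, if_true, if_false, Function.update_self]; exact g0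
  have e3 : τ.real = φ.real := by rw [hτ]; simp only [Memory.word_setWord, Memory.real_setWord, Memory.real_setReal, Memory.word_setReal,
    Nat.reduceEqDiff, if_true, if_false, Function.update_self]
  have hRτ : Rebuilt E τ := hR.of_eq (fun a h1 h2 => by
    rw [hτ]; simp only [Memory.word_setWord, Memory.real_setWord, Memory.real_setReal, Memory.word_setReal,
    Nat.reduceEqDiff, if_true, if_false, Function.update_self, if_neg h2]) e3
  have e5 := hRτ.length
  have hlw := hE.length_le_weight
  have hwl := hE.weight_le_length hWp.le
  have hl0 : (0 : ℝ) ≤ (E.A.edges E.s).length := Nat.cast_nonneg _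
  have hWl : 0 ≤ W * ((E.A.edges E.s).length : ℝ) := by positivity
  have hopt0 := hE.weightsIn.opt_nonneg hWp.le
  refine ⟨⟨by rw [e3, f0]; exact s3, by rw [e3, f0]; exact s4, fun h =>
    ⟨⟨fun _ => (τ.word aM, τ.real rWV), ?_⟩, by omega⟩, fun _ => ?_⟩,
    by omega, ?_⟩
  · have hεb : ε ≤ 1 / 1000 := by
      have : (0 : ℝ) ≤ L := Nat.cast_nonneg _
      nlinarith
    refine hRτ.running hE hWp.le hε (by linarith) hEG ?_ ?_ ?_ ?_ ?_ ?_ ?_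
    · rw [e1]; linarith
    · rw [e1, e5]
    · rw [e1]; exact hn
    · rw [e2]
    · rw [e1, e2]
      have : 0 ≤ ε * ((E.A.edges E.s).length : ℝ) := by positivity
      simpa using this
    · rw [e1, e2]
      refine ⟨_, hEG ▸ hE.isMate, ?_⟩
      have := hE.count
      omega
    · rw [e1, e2, ← hEG]
      have h1 := hE.approx
      have h2 : ε * E.G.opt ≤ 1 / 1000 * E.G.opt := by gcongr
      push_cast
      linarith
  · refine ⟨?_, hRτ.logged, hRτ.log_zero⟩
    rw [← hEG]; exact hRτ.isIn
  · unfold budget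
    split_ifs
    · have hlp3 : ((E.A.edges E.s).length : ℝ) ≤
          listPotential W (E.A.edges E.s).length (E.G.mateWeight E.target) := by
        refine le_listPotential ?_ ?_ <;> linarith
      unfold credit
      rw [hRτ.cnt_zero, hRτ.sp_zero, hRτ.log_zero, hRτ.weight, e1, e2, e5, potential_zero]
      push_cast
      linarith
    · exact le_rfl

end Env

end

/-! ### Approximation guarantee and total credit in terms of `log W`. -/

noncomputable section

section

variable {n : ℕ} {W ε : ℝ} {L : ℕ} {𝒢 : ℕ → WGraph n} {eu ev : ℕ → ℕ} {hist : ℕ → MateState}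
  {i μ : ℕ} {σ : Memory}

theorem opt_add_le (hW : 0 ≤ W) (hG : ∀ j, (𝒢 j).WeightsIn W)
    (hA : ∀ j, WGraph.AgreeOff (𝒢 j) (𝒢 (j + 1)) (eu j) (ev j)) (t b : ℕ) :
    (𝒢 (t + b)).opt ≤ (𝒢 t).opt + 2 * W * b ∧ (𝒢 t).opt ≤ (𝒢 (t + b)).opt + 2 * W * b := by
  induction b with
  | zero => simp
  | succ b ih =>
    have h1 := (hA (t + b)).opt_le (hG _) (hG _) hW
    have h2 := (hA (t + b)).symm.opt_le (hG _) (hG _) hW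
    rw [← add_assoc]
    push_cast
    exact ⟨by linarith, by linarith⟩

/-- Three losses are added: the slack of the top entry, and the drift of the optimum and of the
weight during the pending updates. By `pending` each drift is at most `2 ε R`. -/
theorem Running.approx (h : Running W ε 𝒢 eu ev hist i σ) (hW : 0 < W) (hε : 0 < ε)
    (hG : ∀ j, (𝒢 j).WeightsIn W)
    (hA : ∀ j, WGraph.AgreeOff (𝒢 j) (𝒢 (j + 1)) (eu j) (ev j)) (hL : W ≤ 2 ^ L)
    (hLε : 1000 * ε * (L + 10) ≤ 1) :
    (1 - ε * (45 * L + 102)) * (𝒢 i).opt ≤ (𝒢 i).mateWeight (σ.word aM) := by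
  have S := h.stack
  have hposN : (σ.word aPos (σ.word vSp 0) : ℝ) ≤ ε * σ.word vMax 0 := by
    have h1 : σ.word aPos (σ.word vSp 0) ≤ σ.word vSc 0 := h.pos_le.trans h.cnt_le
    have h2 : (σ.word aPos (σ.word vSp 0) : ℝ) ≤ σ.word vSc 0 := by exact_mod_cast h1
    exact h2.trans h.count
  -- Here only `pos sp ≤ ε N` is known, so the strict bound in `size_le` is available for the entry
  -- below the top.
  have hspL : σ.word vSp 0 ≤ L + 1 := by
    rcases Nat.eq_zero_or_pos (σ.word vSp 0) with h0 | h0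
    · omega
    · have h1 := S.pos_lt (σ.word vSp 0 - 1) (by omega)
      rw [Nat.sub_add_cancel h0] at h1
      have h2 : (σ.word aPos (σ.word vSp 0 - 1) : ℝ) < σ.word aPos (σ.word vSp 0) := by
        exact_mod_cast h1
      have := (S.mono (q := σ.word vSp 0 - 1) (by omega)).size_le hL hW hε (by linarith)
      omega
  have hspR : (σ.word vSp 0 : ℝ) ≤ L + 1 := by exact_mod_cast hspL
  have hsl := S.slack _ le_rfl
  have hlow := S.low _ le_rfl
  have hin := S.isIn _ le_rfl
  have hR0 := S.R_nonneg le_rfl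
  obtain ⟨b, hb⟩ : ∃ b, σ.word aPos (σ.word vSp 0) + b = σ.word vCnt 0 :=
    ⟨_, Nat.add_sub_cancel' h.pos_le⟩
  have hbR : (σ.word vCnt 0 : ℝ) - σ.word aPos (σ.word vSp 0) = b := by
    rw [← hb]; push_cast; ring
  have hci : σ.word vCnt 0 ≤ i := h.cnt_le.trans h.sc_le
  have hi : i - σ.word vCnt 0 + σ.word aPos (σ.word vSp 0) + b = i := by omega
  obtain ⟨o1, o2⟩ := opt_add_le hW.le hG hA (i - σ.word vCnt 0 + σ.word aPos (σ.word vSp 0)) b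
  rw [hi] at o1 o2
  have hw := h.weight
  have hp := h.pending
  rw [hbR] at hw hp
  have hopt := (hG _).mateWeight_le_opt hW.le hin.isMate
  set R := σ.real rR (σ.word vSp 0) with hR
  have hL0 : (0 : ℝ) ≤ L := Nat.cast_nonneg _
  have hεb : ε * R ≤ 1 / 10000 * R := by
    gcongr
    nlinarith
  have hR3 : R ≤ 3 * (𝒢 i).opt := by linarith
  have h1 : 15 * ε * ((σ.word vSp 0 : ℝ) + 1) * R ≤ 15 * ε * (L + 2) * R := by
    have h3 : (σ.word vSp 0 : ℝ) + 1 ≤ L + 2 := by linarith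
    exact mul_le_mul_of_nonneg_right (mul_le_mul_of_nonneg_left h3 (by positivity)) hR0
  -- The slack contributes `15 (L + 2)` and the two drifts `4`; with `R` at most three times the
  -- optimum this is the factor `45 L + 102`.
  have h2 : ε * (15 * L + 34) * R ≤ ε * (15 * L + 34) * (3 * (𝒢 i).opt) := by gcongr
  linarith

/-- `W ≥ 2` keeps `log W` away from `0`, so that constants can be absorbed into it. -/
theorem two_thirds_le_log (hW : 2 ≤ W) : 2 / 3 ≤ Real.log W := by
  have h1 := Real.log_two_gt_d9
  have h2 := Real.log_le_log (by norm_num) hW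
  linarith

theorem log_five_mul_le (hW : 2 ≤ W) : Real.log (5 * W) ≤ 4 * Real.log W := by
  rw [Real.log_mul (by norm_num) (by linarith)]
  have h1 : Real.log 5 ≤ Real.log (2 ^ 3) := Real.log_le_log (by norm_num) (by norm_num)
  rw [Real.log_pow] at h1
  have h2 := Real.log_le_log (by norm_num) hW
  push_cast at h1
  linarith

theorem levels_le (hW : 2 ≤ W) (hmin : ∀ j < L, (2 : ℝ) ^ j < W) : (L : ℝ) ≤ 3 * Real.log W := by
  have h0 := two_thirds_le_log hW
  rcases Nat.eq_zero_or_pos L with rfl | hL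
  · push_cast; linarith
  · have h1 := Real.log_le_log (by positivity) (hmin (L - 1) (by omega)).le
    rw [Real.log_pow, Nat.cast_sub hL] at h1
    have h2 := Real.log_two_gt_d9
    have h3 : (1 : ℝ) ≤ L := by exact_mod_cast hL
    push_cast at h1
    nlinarith

theorem maxPotential_le (hW : 2 ≤ W) : maxPotential W + 1 ≤ 57 * Real.log W ^ 2 := by
  have h0 := two_thirds_le_log hW
  have h1 := log_five_mul_le hW
  have h2 : Real.log (5 * W) * Real.log W ≤ 4 * Real.log W * Real.log W := by gcongr
  unfold maxPotential
  nlinarith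

theorem one_add_log_le (hW : 2 ≤ W) : 1 + 3 * Real.log (5 * W) ≤ 21 * Real.log W ^ 2 := by
  have h0 := two_thirds_le_log hW
  have h1 := log_five_mul_le hW
  nlinarith

theorem ceil_inv_le (hε : 0 < ε) (hε1 : ε < 1) : (⌈1 / ε⌉₊ : ℝ) ≤ 2 / ε := by
  have h1 := Nat.ceil_lt_add_one (by positivity : 0 ≤ 1 / ε)
  have h2 : 1 ≤ 1 / ε := (one_le_div hε).2 hε1.le
  have h3 : 2 / ε = 1 / ε + 1 / ε := by ring
  linarith

/-- The updates in the stack have potential at most `maxPotential W` and the earlier ones are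
charged a little more, so `i` updates account for `O(i log² W / ε)`. The list has at most `μ + i`
edges and contributes `O((μ + i) log² W)`, which is the source of the term `ε μ` after factoring out
`log² W / ε`. -/
theorem Running.credit_le (h : Running W ε 𝒢 eu ev hist i σ) (hW : 2 ≤ W) (hε : 0 < ε)
    (hε1 : ε < 1) (hmax : σ.word vMax 0 ≤ μ + i) :
    credit W ε i σ ≤ Real.log W ^ 2 / ε * (133548 * i + 4074 * (ε * μ)) := by
  have hposN : (σ.word aPos (σ.word vSp 0) : ℝ) ≤ ε * σ.word vMax 0 := by
    have h1 : σ.word aPos (σ.word vSp 0) ≤ σ.word vSc 0 := h.pos_le.trans h.cnt_le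
    have h2 : (σ.word aPos (σ.word vSp 0) : ℝ) ≤ σ.word vSc 0 := by exact_mod_cast h1
    exact h2.trans h.count
  have hpot := h.potential_le hW hε hposN
  have hlp := listPotential_le hW h.stack.base
  have hmaxR : (σ.word vMax 0 : ℝ) ≤ μ + i := by exact_mod_cast hmax
  have hH0 : 0 ≤ 1 + 3 * Real.log (5 * W) := by
    have := Real.log_nonneg (by linarith : 1 ≤ 5 * W)
    linarith
  have hH := one_add_log_le hW
  have hmP := maxPotential_le hW
  have hmP0 := maxPotential_nonneg hW
  have hr := ceil_inv_le hε hε1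
  have hr0 : (0 : ℝ) ≤ 1100 * (⌈1 / ε⌉₊ : ℝ) := by positivity
  have hpot3 := mul_le_mul_of_nonneg_left hpot hr0
  have hc0 : (0 : ℝ) ≤ 1100 * (⌈1 / ε⌉₊ : ℝ) * σ.word vCnt 0 := by positivity
  have hi0 : (0 : ℝ) ≤ i := Nat.cast_nonneg _
  have hμ0 : (0 : ℝ) ≤ μ := Nat.cast_nonneg _
  set ℓ := Real.log W with hℓ
  set Z := ℓ ^ 2 / ε with hZ
  have hεZ : ε * Z = ℓ ^ 2 := by rw [hZ]; field_simp
  -- `125400 = 1100 * 2 * 57`; the term below contributes `194 * 21 = 4074` twice to the coefficient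
  -- of `i` and once to that of `ε μ`.
  have k1 : 1100 * (⌈1 / ε⌉₊ : ℝ) * (maxPotential W + 1) * i ≤ 125400 * Z * i := by
    calc 1100 * (⌈1 / ε⌉₊ : ℝ) * (maxPotential W + 1) * i
        ≤ 1100 * (2 / ε) * (57 * ℓ ^ 2) * i := by gcongr
      _ = 125400 * Z * i := by rw [hZ]; ring
  have hdiv : (1 + 3 * Real.log (5 * W)) / ε ≤ 21 * Z := by
    rw [hZ, ← mul_div_assoc]; gcongr
  have hdiv0 : 0 ≤ (1 + 3 * Real.log (5 * W)) / ε := by positivity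
  have k2 : (1 + 3 * Real.log (5 * W)) / ε * ((i : ℝ) - σ.word vSc 0) ≤ 21 * Z * i := by
    have : (0 : ℝ) ≤ σ.word vSc 0 := Nat.cast_nonneg _
    calc (1 + 3 * Real.log (5 * W)) / ε * ((i : ℝ) - σ.word vSc 0)
        ≤ (1 + 3 * Real.log (5 * W)) / ε * i := by gcongr; linarith
      _ ≤ 21 * Z * i := by gcongr
  have hZ0 : 0 ≤ Z := by positivity
  have k3 : (σ.word vMax 0 : ℝ) * (1 + 3 * Real.log (5 * W)) ≤ 21 * Z * (ε * μ) + 21 * Z * i := by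
    calc (σ.word vMax 0 : ℝ) * (1 + 3 * Real.log (5 * W)) ≤ (μ + i) * (21 * ℓ ^ 2) := by gcongr
      _ = 21 * Z * (ε * μ) + ε * (21 * Z * i) := by rw [← hεZ]; ring
      _ ≤ 21 * Z * (ε * μ) + 1 * (21 * Z * i) := by gcongr
      _ = _ := by ring
  have h5 : (0 : ℝ) ≤ σ.word vH 0 := Nat.cast_nonneg _
  have h6 : (0 : ℝ) ≤ σ.word vLN 0 := Nat.cast_nonneg _
  unfold credit
  linarith

theorem Sound.budget_le (h : Sound W ε L 𝒢 eu ev μ i σ) (hW : 2 ≤ W) (hε : 0 < ε) (hε1 : ε < 1) :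
    budget W ε L i σ ≤ Real.log W ^ 2 / ε * (133548 * i + 4074 * (ε * μ)) := by
  unfold budget
  split_ifs with hf
  · obtain ⟨⟨hist, hr⟩, hm⟩ := h.fine hf
    exact hr.credit_le hW hε hε1 hm
  · positivity

theorem Sound.isMate (h : Sound W ε L 𝒢 eu ev μ i σ) : (𝒢 i).IsMate (σ.word aM) := by
  by_cases hf : 1000 * ε * (L + 10) ≤ 1
  · obtain ⟨⟨hist, hr⟩, -⟩ := h.fine hf
    exact hr.isIn.isMate
  · exact (h.coarse hf).isIn.isMate

/-- If the test on `ε` fails, then `C ε log W ≥ 1` and there is nothing to prove. This case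
determines the constant: `L + 10 ≤ 18 log W`, hence `18000`. -/
theorem Sound.approx (h : Sound W ε L 𝒢 eu ev μ i σ) (hW : 2 ≤ W) (hε : 0 < ε)
    (hG : ∀ j, (𝒢 j).WeightsIn W)
    (hA : ∀ j, WGraph.AgreeOff (𝒢 j) (𝒢 (j + 1)) (eu j) (ev j)) (hL : W ≤ 2 ^ L)
    (hmin : ∀ j < L, (2 : ℝ) ^ j < W) {C : ℝ} (hC : 18000 ≤ C) :
    (1 - C * ε * Real.log W) * (𝒢 i).opt ≤ (𝒢 i).mateWeight (σ.word aM) := by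
  have hWp : 0 < W := by linarith
  have h0 := two_thirds_le_log hW
  have hLℓ := levels_le hW hmin
  have hopt0 := (hG i).opt_nonneg hWp.le
  have hεℓ : 0 ≤ ε * Real.log W := by positivity
  have hCε : 18000 * (ε * Real.log W) ≤ C * (ε * Real.log W) := by gcongr
  by_cases hf : 1000 * ε * (L + 10) ≤ 1
  · obtain ⟨⟨hist, hr⟩, -⟩ := h.fine hf
    refine le_trans ?_ (hr.approx hWp hε hG hA hL hf)
    refine mul_le_mul_of_nonneg_right ?_ hopt0
    have : ε * (45 * L + 102) ≤ ε * (288 * Real.log W) := by gcongr; linarith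
    linarith
  · have h1 : (1 - C * ε * Real.log W) ≤ 0 := by
      have : 1000 * ε * (L + 10) ≤ 1000 * ε * (18 * Real.log W) := by gcongr; linarith
      linarith
    exact (mul_nonpos_of_nonpos_of_nonneg h1 hopt0).trans ((hG i).mateWeight_nonneg _)

end

end

/-! ### Assembling the runs and the final constants. -/

noncomputable section

namespace UpdateSeq

variable {n : ℕ} (S : UpdateSeq n)

/-- The first endpoint of an update. -/
def endFst (i : ℕ) : ℕ := if h : i < S.updates.length then (S.updates[i]).fst else 0

/-- The second endpoint of an update. -/
def endSnd (i : ℕ) : ℕ := if h : i < S.updates.length then (S.updates[i]).snd else 0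

theorem graphAt_of_le {i : ℕ} (h : S.length ≤ i) : S.graphAt i = S.graphAt S.length := by
  unfold graphAt
  have h' : S.updates.take S.length = S.updates := List.take_of_length_le le_rfl
  rw [List.take_of_length_le h, h']

theorem agreeOff_graphAt (i : ℕ) :
    WGraph.AgreeOff (S.graphAt i) (S.graphAt (i + 1)) (S.endFst i) (S.endSnd i) := by
  by_cases h : i < S.updates.length
  · rw [S.graphAt_succ h, endFst, endSnd, dif_pos h, dif_pos h]
    exact Update.agreeOff_apply _ _
  · have h' : S.length ≤ i := not_lt.1 h
    rw [S.graphAt_of_le h', S.graphAt_of_le (h'.trans (Nat.le_succ i))]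
    exact fun u v _ => rfl

theorem weightsIn_graphAt {mdl : UpdateModel} {m : ℕ} {W : ℝ} (hS : S ∈ mdl.sequences n m W)
    (i : ℕ) : (S.graphAt i).WeightsIn W := by
  rcases le_total i S.length with h | h
  · exact weightsIn hS i h
  · rw [S.graphAt_of_le h]; exact weightsIn hS _ le_rfl

end UpdateSeq

theorem announce_spec {n : ℕ} (σ : Memory) (x : Update n) :
    (∀ a, a ≠ 1 → (Transformation.announce σ x).word a = σ.word a) ∧
      (∀ a, a ≠ 1 → (Transformation.announce σ x).real a = σ.real a) ∧
      (Transformation.announce σ x).word 1 1 = x.fst ∧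
      (Transformation.announce σ x).word 1 2 = x.snd := by
  cases x <;>
  · refine ⟨fun a ha => ?_, fun a ha => ?_, ?_, ?_⟩ <;>
    simp_all [Transformation.announce, Memory.setWord, Memory.setReal, Update.fst, Update.snd]

theorem Prog.listsApart_update : Prog.update.ListsApart := by
  repeat' first | constructor | decide

theorem exists_levels {W : ℝ} (hW : 2 ≤ W) :
    ∃ L : ℕ, W ≤ 2 ^ L ∧ (∀ j < L, (2 : ℝ) ^ j < W) ∧ L ≤ ⌈W⌉₊ := by
  classical
  have hex : ∃ L : ℕ, W ≤ 2 ^ L :=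
    (pow_unbounded_of_one_lt W (by norm_num : (1 : ℝ) < 2)).imp fun _ h => h.le
  refine ⟨Nat.find hex, Nat.find_spec hex, fun j hj => not_le.1 (Nat.find_min hex hj), ?_⟩
  refine Nat.find_min' hex ((Nat.le_ceil W).trans ?_)
  exact_mod_cast Nat.lt_two_pow_self.le

/-- The largest addresses are those of the log, quadratic in `n`, so the exponent `3` suffices; both
ceilings are at least `2`, so the base is at least `n + 6`. -/
theorem word_bounds {n : ℕ} {W ε : ℝ} (hW : 2 ≤ W) (hε : 0 < ε) (hε1 : ε < 1) :
    (3 * n + 2) * (n + 1) + 2 < (n + ⌈W⌉₊ + ⌈1 / ε⌉₊ + 2) ^ 3 ∧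
      ⌈1 / ε⌉₊ + 1 < (n + ⌈W⌉₊ + ⌈1 / ε⌉₊ + 2) ^ 3 ∧ ⌈W⌉₊ + 1 < (n + ⌈W⌉₊ + ⌈1 / ε⌉₊ + 2) ^ 3 := by
  have h1 : 1 < ⌈1 / ε⌉₊ := Nat.lt_ceil.2 (by simpa using (one_lt_div hε).2 hε1)
  have h2 : 1 < ⌈W⌉₊ := Nat.lt_ceil.2 (by push_cast; linarith)
  set b := n + ⌈W⌉₊ + ⌈1 / ε⌉₊ + 2 with hb
  have h3 : b ≤ b ^ 3 := Nat.le_self_pow (by norm_num) b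
  refine ⟨?_, by omega, by omega⟩
  have h4 : n + 6 ≤ b := by omega
  calc (3 * n + 2) * (n + 1) + 2 < (n + 6) ^ 3 := by nlinarith [Nat.zero_le n, Nat.zero_le (n ^ 3)]
    _ ≤ b ^ 3 := Nat.pow_le_pow_left h4 3

/-- The black-box transformation. -/
def lazyTransformation : Transformation := ⟨Prog.init, Prog.update⟩

/-- The runs of the transformation with the normalized costs. -/
theorem exists_runs {mdl : UpdateModel} {n m : ℕ} {W ε I U T : ℝ} {𝒞 : Set (UpdateSeq n)}
    {A : DynAlg n} (hW : 2 ≤ W) (hε : 0 < ε) (hε1 : ε < 1) (h𝒞 : 𝒞 ⊆ mdl.sequences n m W)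
    (hA : A.Solves 𝒞 ε I U T) {S : UpdateSeq n} (hS : S ∈ 𝒞) {L : ℕ} (hL : W ≤ 2 ^ L)
    (hmin : ∀ j < L, (2 : ℝ) ^ j < W) (hLW : L ≤ ⌈W⌉₊) {E : ℕ → Env n}
    (hE : E = fun i => ⟨S.graphAt i, A, A.stateAt S i, (n + ⌈W⌉₊ + ⌈1 / ε⌉₊ + 2) ^ 3⟩) :
    ∃ (σ : ℕ → Memory) (x : ℕ → ℕ),
      (E 0).Ex Prog.init (Transformation.startMemory n W ε) (x 0) (σ 0) ∧
      (∀ (i : ℕ) (h : i < S.updates.length),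
        (E (i + 1)).Ex Prog.update (Transformation.announce (σ i) S.updates[i]) (x (i + 1))
          (σ (i + 1))) ∧
      (∀ i ≤ S.length, Sound W ε L S.graphAt S.endFst S.endSnd S.start.matchingNumber i (σ i)) ∧
      x 0 ≤ 97 * S.start.matchingNumber + 31 ∧
      ∀ i ≤ S.length, (∑ j ∈ Finset.range i, x (j + 1) : ℝ) ≤
        budget W ε L i (σ i) + (3 * L + 110) * i := by
  have hseq := h𝒞 hS
  obtain ⟨b1, b2, b3⟩ := word_bounds (n := n) hW hε hε1
  have hG := S.weightsIn_graphAt hseq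
  have hfit : ∀ i ≤ S.length, (E i).Fits W ε := by
    intro i hi
    subst hE
    exact Env.Fits.of_vertexMatch (by linarith) hε1 (hG i) (hA.query S hS i hi) (hA.approx S hS i hi)
  obtain ⟨σ₀, x₀, hx₀, s₀, c₀, d₀⟩ := Env.wp_init (E := E 0) (𝒢 := S.graphAt) (eu := S.endFst)
    (ev := S.endSnd) (L := L) hW hε (hfit 0 (Nat.zero_le _)) (by rw [hE]) (by rw [hE]; exact b1)
  -- The outcome of a step is made total in `i` and `ρ`, with dummy values when there is no update
  -- or the state is not sound, so that the run can be defined by recursion.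
  have hstep : ∀ (i : ℕ) (ρ : Memory), ∃ p : Memory × ℕ, ∀ h : i < S.updates.length,
      Sound W ε L S.graphAt S.endFst S.endSnd S.start.matchingNumber i ρ →
      (E (i + 1)).Ex Prog.update (Transformation.announce ρ S.updates[i]) p.2 p.1 ∧
      Sound W ε L S.graphAt S.endFst S.endSnd S.start.matchingNumber (i + 1) p.1 ∧
      (p.2 : ℝ) + budget W ε L i ρ ≤ budget W ε L (i + 1) p.1 + (3 * L + 110) := by
    intro i ρ
    by_cases h : i < S.updates.length ∧
        Sound W ε L S.graphAt S.endFst S.endSnd S.start.matchingNumber i ρ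
    swap
    · exact ⟨(ρ, 0), fun h1 h2 => absurd ⟨h1, h2⟩ h⟩
    obtain ⟨hi, hs⟩ := h
    obtain ⟨a1, a2, a3, a4⟩ := announce_spec ρ S.updates[i]
    have e1 : S.endFst i = (S.updates[i]).fst := by rw [UpdateSeq.endFst, dif_pos hi]
    have e2 : S.endSnd i = (S.updates[i]).snd := by rw [UpdateSeq.endSnd, dif_pos hi]
    obtain ⟨τ, x, h1, h2, h3⟩ := Env.wp_update (E := E (i + 1)) hs a1 a2 hW hε (hfit (i + 1) hi)
      (by rw [hE]) hG S.agreeOff_graphAt hL hmin (S.matchingNumber_le (i + 1) hi)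
      (by rw [a3, e1]) (by rw [a4, e2]) (by rw [e1]; exact Fin.is_lt _)
      (by rw [e2]; exact Fin.is_lt _) (by rw [hE]; exact b1) (by rw [hE]; exact b2)
      (by rw [hE]; exact lt_of_le_of_lt (by omega) b3)
    exact ⟨(τ, x), fun _ _ => ⟨h1, h2, h3⟩⟩
  choose nxt hnxt using hstep
  set σ : ℕ → Memory := fun i => Nat.rec σ₀ (fun i ρ => (nxt i ρ).1) i with hσ
  have hsound : ∀ i ≤ S.length,
      Sound W ε L S.graphAt S.endFst S.endSnd S.start.matchingNumber i (σ i) := by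
    intro i
    induction i with
    | zero => exact fun _ => s₀
    | succ i ih => exact fun hi => (hnxt i (σ i) hi (ih (by omega))).2.1
  refine ⟨σ, fun i => Nat.casesOn i x₀ fun i => (nxt i (σ i)).2, hx₀, ?_, hsound, c₀, ?_⟩
  · exact fun i h => (hnxt i (σ i) h (hsound i h.le)).1
  · intro i
    induction i with
    | zero =>
      have h0 : 0 ≤ budget W ε L 0 (σ 0) := d₀
      intro _; simpa using h0
    | succ i ih =>
      intro hi
      have h1 := ih (by omega)
      have h2 : ((nxt i (σ i)).2 : ℝ) + budget W ε L i (σ i) ≤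
        budget W ε L (i + 1) (σ (i + 1)) + (3 * L + 110) := (hnxt i (σ i) hi (hsound i (by omega))).2.2
      rw [Finset.sum_range_succ]
      push_cast
      linarith

/-- All contributions are multiples of `log² W / ε * K`; the linear cost of the first matching is
one of them because `μ = (1/ε) (ε μ)` and `log² W ≥ 4/9`. -/
theorem total_cost_le {W ε : ℝ} {L k μ : ℕ} {x b K : ℝ} (hW : 2 ≤ W) (hε : 0 < ε) (hε1 : ε < 1)
    (hmin : ∀ j < L, (2 : ℝ) ^ j < W)
    (hb : b ≤ Real.log W ^ 2 / ε * (133548 * k + 4074 * (ε * μ)))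
    (hx : x ≤ b + (3 * L + 110) * k) (hK1 : 1 ≤ K) (hKk : (k : ℝ) ≤ K) (hKμ : ε * μ ≤ K) :
    97 * μ + 31 + x ≤ 140000 * (Real.log W ^ 2 / ε * K) := by
  have hL := levels_le hW hmin
  have h0 := two_thirds_le_log hW
  set ℓ := Real.log W with hℓ
  set Z := ℓ ^ 2 / ε with hZ
  have hZ2 : ℓ ^ 2 ≤ Z := by
    rw [hZ, le_div_iff₀ hε]
    nlinarith [sq_nonneg ℓ]
  have h1 : 4 / 9 ≤ ℓ ^ 2 := by nlinarith
  have hZ0 : 0 ≤ Z := by positivity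
  have hk0 : (0 : ℝ) ≤ k := Nat.cast_nonneg k
  have hμ0 : (0 : ℝ) ≤ μ := Nat.cast_nonneg μ
  have h2 : (4 / 9 : ℝ) * μ ≤ Z * (ε * μ) := by
    calc (4 / 9 : ℝ) * μ ≤ ℓ ^ 2 * μ := by gcongr
      _ = Z * (ε * μ) := by rw [hZ]; field_simp
  have h3 : (3 * (L : ℝ) + 110) * k ≤ 262 * Z * k := by
    gcongr
    nlinarith
  have h4 : Z * k ≤ Z * K := by gcongr
  have h5 : Z * (ε * μ) ≤ Z * K := by gcongr
  have h6 : Z * 1 ≤ Z * K := by gcongr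
  linarith

theorem mainTheorem7 :
    ∃ (P : Transformation) (c : ℕ) (C : ℝ), 0 < C ∧
      ∀ (mdl : UpdateModel) (n m : ℕ) (W ε I U T : ℝ) (𝒞 : Set (UpdateSeq n)) (A : DynAlg n),
        2 ≤ W → 0 < ε → ε < 1 → 1 ≤ T →
        𝒞 ⊆ mdl.sequences n m W → A.Solves 𝒞 ε I U T →
        ∀ S ∈ 𝒞, ∃ (σ : ℕ → Memory) (t : ℕ → ℕ) (M : ℕ → Finset (Sym2 (Fin n))),
          P.Runs A c W ε S σ t ∧
          -- a matching is stored explicitly after every update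
          (∀ i ≤ S.length, (σ i).Stores (M i)) ∧
          -- approximation
          (∀ i ≤ S.length, (S.graphAt i).IsApproxMWM (C * ε * Real.log W) (M i)) ∧
          -- initialization time, with the time for writing down the first matching
          ((A.initTime S.start + t 0 : ℕ) : ℝ) ≤ I + C * T * (1 + S.start.matchingNumber) ∧
          -- total time of the initialization and of all updates
          ((A.initTime S.start + t 0 + ∑ i, (A.stepTime S i + t (i + 1)) : ℕ) : ℝ) ≤
            I + S.length * U + C * (Real.log W ^ 2 / ε) * T *
              max (max 1 (S.length : ℝ)) (ε * S.start.matchingNumber) ∧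
          -- total recourse
          ((∑ i ∈ Finset.range S.length, (symmDiff (M i) (M (i + 1))).card : ℕ) : ℝ) ≤
            C * (Real.log W ^ 2 / ε) *
              max (max 1 (S.length : ℝ)) (ε * S.start.matchingNumber) := by
  -- `280000 = 2 * 140000`: the factor `2` is the one in the passage from normalized costs to time,
  -- and equally the two edges that may change with every changed vertex.
  refine ⟨lazyTransformation, 3, 280000, by norm_num, ?_⟩
  intro mdl n m W ε I U T 𝒞 A hW hε hε1 hT h𝒞 hA S hS
  obtain ⟨L, hL, hmin, hLW⟩ := exists_levels hW
  set E : ℕ → Env n := fun i =>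
    ⟨S.graphAt i, A, A.stateAt S i, (n + ⌈W⌉₊ + ⌈1 / ε⌉₊ + 2) ^ 3⟩ with hE
  obtain ⟨σ, x, hx0, hx, hs, hx0', hsum⟩ := exists_runs hW hε hε1 h𝒞 hA hS hL hmin hLW hE
  have hG := S.weightsIn_graphAt (h𝒞 hS)
  obtain ⟨t₀, ht₀, ht₀'⟩ := hx0.exec hT (hA.query S hS 0 (Nat.zero_le _))
  have hts : ∀ i : ℕ, ∃ t : ℕ, ∀ h : i < S.updates.length,
      Exec (S.graphAt (i + 1)) A (A.stateAt S (i + 1)) ((n + ⌈W⌉₊ + ⌈1 / ε⌉₊ + 2) ^ 3) Prog.update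
        (Transformation.announce (σ i) S.updates[i]) t (σ (i + 1)) ∧ (t : ℝ) ≤ 2 * T * x (i + 1) := by
    intro i
    by_cases h : i < S.updates.length
    · obtain ⟨t, h1, h2⟩ := (hx i h).exec hT (hA.query S hS (i + 1) h)
      exact ⟨t, fun _ => ⟨h1, h2⟩⟩
    · exact ⟨0, fun h' => absurd h' h⟩
  choose ts hts using hts
  obtain ⟨t, ht0, ht1⟩ : ∃ t : ℕ → ℕ, t 0 = t₀ ∧ ∀ i, t (i + 1) = ts i :=
    ⟨fun i => if i = 0 then t₀ else ts (i - 1), by simp, by simp⟩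
  set K := max (max 1 (S.length : ℝ)) (ε * S.start.matchingNumber) with hK
  have hK1 : 1 ≤ K := (le_max_left _ _).trans (le_max_left _ _)
  have hKk : (S.length : ℝ) ≤ K := (le_max_right _ _).trans (le_max_left _ _)
  have hKμ : ε * S.start.matchingNumber ≤ K := le_max_right _ _
  have htotal := total_cost_le hW hε hε1 hmin ((hs _ le_rfl).budget_le hW hε hε1)
    (hsum _ le_rfl) hK1 hKk hKμ
  have hμ0 : (0 : ℝ) ≤ S.start.matchingNumber := Nat.cast_nonneg _
  have hx0R : (x 0 : ℝ) ≤ 97 * S.start.matchingNumber + 31 := by exact_mod_cast hx0'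
  have hI := hA.init_time S hS
  refine ⟨σ, t, fun i => WGraph.edgesOf n ((σ i).word 2),
    ⟨ht0 ▸ ht₀, fun i h => ht1 i ▸ (hts i h).1⟩, fun i hi => (hs i hi).isMate.stores, fun i hi => ?_, ?_, ?_, ?_⟩
  · exact (hG i).isApproxMWM_of (by linarith) (hs i hi).isMate
      ((hs i hi).approx hW hε hG S.agreeOff_graphAt hL hmin (by norm_num))
  · have h1 : T * x 0 ≤ T * (97 * S.start.matchingNumber + 31) := by gcongr
    have h2 : 0 ≤ T * (S.start.matchingNumber : ℝ) := by positivity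
    rw [ht0]
    push_cast
    linarith
  · have hU := hA.update_time S hS
    have h1 : (∑ i : Fin S.updates.length, (ts i : ℝ)) ≤
        2 * T * ∑ j ∈ Finset.range S.length, (x (j + 1) : ℝ) := by
      rw [Finset.mul_sum, Finset.sum_range]
      exact Finset.sum_le_sum fun i _ => (hts i i.2).2
    have h2 : T * (x 0 + ∑ j ∈ Finset.range S.length, (x (j + 1) : ℝ)) ≤
        T * (140000 * (Real.log W ^ 2 / ε * K)) := by
      gcongr
      linarith
    rw [Finset.sum_add_distrib, ht0]
    simp only [ht1]
    push_cast at hU ⊢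
    linarith
  -- The cells of the stored matching that an update changes are at most its normalized cost; a
  -- query costs a constant here, so `T` does not enter the recourse.
  · have h1 : ∀ i ∈ Finset.range S.length,
        (symmDiff (WGraph.edgesOf n ((σ i).word 2)) (WGraph.edgesOf n ((σ (i + 1)).word 2))).card ≤
          2 * x (i + 1) := by
      intro i hi
      have hi : i < S.updates.length := Finset.mem_range.1 hi
      obtain ⟨D, hD, hD'⟩ := (hx i hi).changes Prog.listsApart_update
      refine (WGraph.card_symmDiff_edgesOf_le (hs i hi.le).isMate (hs (i + 1) hi).isMate D ?_).trans
        (by omega)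
      intro u hu
      rw [hD' u hu, (announce_spec (σ i) S.updates[i]).1 2 (by decide)]
    have h2 : (∑ i ∈ Finset.range S.length, (symmDiff (WGraph.edgesOf n ((σ i).word 2))
        (WGraph.edgesOf n ((σ (i + 1)).word 2))).card : ℝ) ≤
        2 * ∑ j ∈ Finset.range S.length, (x (j + 1) : ℝ) := by
      rw [Finset.mul_sum]
      exact Finset.sum_le_sum fun i hi => by exact_mod_cast h1 i hi
    push_cast
    linarith

end
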